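/- **Setting.** Let $g,m,\ell>0$ and $\sigma\ge 0$. For each of the two fluids (upper $+$, lower $-$) let the pressure $P_\pm\in C^\infty((0,\infty))$ be positive and strictly increasing with $1/P_\pm'$ locally bounded, and let the viscosities $\varepsilon_\pm,\delta_\pm\in C^\infty((0,\infty))$ satisfy $\varepsilon_\pm>0$, $\delta_\pm\ge0$. Let $\rho_0^\pm>0$ satisfy $P_+(\rho_0^+)=P_-(\rho_0^-)$ and $P_-(\rho_0^-)>P_+(\rho_0^-)$, so that $[\![\rho_0]\!]:=\rho_0^+-\rho_0^->0$. With $h_\pm(z)=\int_1^z P_\pm'(r)/r\,dr$, assume $h_-(\rho_0^-)+gm\in h_-((0,\infty))$ and $h_+(\rho_0^+)-g\ell\in h_+((0,\infty))$, and let $\rho_0(x_3)=h_\pm^{-1}(h_\pm(\rho_0^\pm)-gx_3)$ for $x_3\in(0,\ell)$, resp. $x_3\in(-m,0)$. Write $\varepsilon_0=\varepsilon_\pm(\rho_0)$, $\delta_0=\delta_\pm(\rho_0)$, $P'(\rho_0)=P_\pm'(\rho_0)$. Let $\Omega_+=\mathcal H\times(0,\ell)$, $\Omega_-=\mathcal H\times(-m,0)$,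 $\Omega=\Omega_+\cup\Omega_-$, where $\mathcal H=\mathbb R^2$ (non-periodic case) or $\mathcal H=(2\pi L\mathbb T)^2$ (periodic case), and let $[\![f]\!]=f_+|_{x_3=0}-f_-|_{x_3=0}$. $H^k(\Omega)$ denotes the functions whose restrictions to $\Omega_\pm$ lie in $H^k(\Omega_\pm)$. **Linearised equations.** On $\Omega$ and for $t\ge0$, with real-valued unknowns $\eta,v:\Omega\to\mathbb R^3$ and $q:\Omega\to\mathbb R$, $$\partial_t\eta=v,\qquad \partial_t q+\rho_0\operatorname{div}v=0,$$ $$\rho_0\partial_t v+\nabla(P'(\rho_0)q)+gqe_3+g\rho_0\nabla\eta_3=\operatorname{div}\!\big(\varepsilon_0(Dv+Dv^T-\tfrac23(\operatorname{div}v)I)+\delta_0(\operatorname{div}v)I\big),$$ with $[\![v]\!]=0$, $v=0$ on $\{x_3=-m\}$ and $\{x_3=\ell\}$, $[\![\eta(0)]\!]=0$, and $$[\![P'(\rho_0)qI-\varepsilon_0(Dv+Dv^T)-(\delta_0-\tfrac23\varepsilon_0)(\operatorname{div}v)I]\!]\,e_3=\sigma\,\Delta_{x_1,x_2}\eta_3\,e_3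 .$$ A *solution* is a strong solution: $v\in C([0,\infty);H^2(\Omega))$, $\eta(t)\in H^2(\Omega)$ and $q(t)\in H^1(\Omega)$ for all $t\ge0$; the time derivatives exist in $L^2(\Omega)$ (one-sided at $t=0$), the equations hold almost everywhere in $\Omega$ for every $t\ge0$, the jump and boundary conditions hold for every $t\ge 0$ in the sense of traces, and the horizontal Laplacian of the trace of $\eta_3$ is taken in the weak sense. **Growth rates.** For $k,s>0$ and $\varphi,\psi\in H^1_0((-m,\ell))$ let $$E(\varphi,\psi;k,s)=\tfrac{\sigma k^2}{2}\psi(0)^2+\tfrac12\int_{-m}^{\ell}(s\delta_0+P'(\rho_0)\rho_0)(\psi'+k\varphi)^2-2g\rho_0k\varphi\psi+\tfrac12\int_{-m}^{\ell}s\varepsilon_0\big((\varphi'-k\psi)^2+(\psi'-k\varphi)^2+\tfrac13(\psi'+k\varphi)^2\big),$$ $J(\varphi,\psi)=\frac12\int_{-m}^\ell\rho_0(\varphi^2+\psi^2)$, and $\mu(k,s)=\inf\{E(\varphi,\psi;k,s): J(\varphi,\psi)=1\}$. When $\sigma k^2<g[\![\rho_0]\!]$, the growth rate $\lambda(k)>0$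 is the unique $s>0$ with $\mu(k,s)<0$ and $s=\sqrt{-\mu(k,s)}$. Let $$\Lambda=\sup\{\lambda(|\xi|):\xi\in\mathbb R^2,\ \xi\ne0,\ \sigma|\xi|^2<g[\![\rho_0]\!]\},\qquad \Lambda_L=\sup\{\lambda(|\xi|):\xi\in(L^{-1}\mathbb Z)^2,\ \xi\neq0,\ \sigma|\xi|^2<g[\![\rho_0]\!]\}.$$ **Norms.** $\|w\|_1^2=\int_\Omega\rho_0|w|^2$ and $\|w\|_2^2=\int_\Omega\frac{\varepsilon_0}{2}|Dw+Dw^T-\frac23(\operatorname{div}w)I|^2+\delta_0|\operatorname{div}w|^2$. **Theorem.** $\Lambda$ is a finite positive number, and so is $\Lambda_L$ whenever $L>\sqrt{\sigma/(g[\![\rho_0]\!])}$; in each case the set of growth rates is non-empty and bounded above. There is a function $C:\mathbb R\to(0,\infty)$, depending only on $\rho_0^\pm,P_\pm,\varepsilon_\pm,\delta_\pm,\sigma,g,m,\ell$, such that every solution $(\eta,v,q)$ in the non-periodic case satisfies, for all $t\ge0$, $$\|v(t)\|_1^2+\|v(t)\|_2^2+\|\partial_tv(t)\|_1^2\le C(\Lambda)\,e^{2\Lambda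 t}\Big(\|\partial_tv(0)\|_1^2+\|v(0)\|_1^2+\|v(0)\|_2^2+\sigma\int_{\mathbb R^2}|\nabla_{x_1,x_2}v_3(0)|^2\Big),$$ the last integral being over the interface $\{x_3=0\}$. In the periodic case with $L>\sqrt{\sigma/(g[\![\rho_0]\!])}$, the same inequality holds for every solution with $\Lambda$ replaced by $\Lambda_L$ (also in $C$) and the integral over $\mathbb R^2$ replaced by one over $(2\pi L\mathbb T)^2$. -/

import Mathlib

open MeasureTheory Set
open scoped ContDiff

noncomputable section

namespace RayleighTaylor

/-- The horizontal plane `ℝ²`. -/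
abbrev Plane : Type := EuclideanSpace ℝ (Fin 2)

/-- Physical space: `x.1 = (x₁, x₂)` is the horizontal variable and `x.2 = x₃` the vertical one. -/
abbrev Space : Type := Plane × ℝ

/-- The unit vectors of the plane. -/
def planeVec (j : Fin 2) : Plane := EuclideanSpace.single j 1

/-- The unit vectors `e₁, e₂, e₃` of space. -/
def spaceVec : Fin 3 → Space :=
  ![(planeVec 0, 0), (planeVec 1, 0), (0, 1)]

/-- Classical partial derivative of a function on space. -/
def partialD (j : Fin 3) (φ : Space → ℝ) (x : Space) : ℝ := fderiv ℝ φ x (spaceVec j)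

/-- Classical partial derivative of a function on the plane. -/
def planeD (j : Fin 2) (χ : Plane → ℝ) (y : Plane) : ℝ := fderiv ℝ χ y (planeVec j)

/-- Kronecker's delta. -/
def kron (i j : Fin 3) : ℝ := if i = j then 1 else 0

/-! ### The horizontal setting -/

/-- The two settings: the whole plane, or the torus `(2πL𝕋)²`. -/
inductive Horizontal : Type
  | plane : Horizontal
  | torus (L : ℝ) : Horizontal

namespace Horizontal

/-- The domain of horizontal integration: `ℝ²`, or the period cell `[0, 2πL)²`. -/
def cell : Horizontal → Set Plane
  | plane => univ
  | torus L => {y | ∀ i, y i ∈ Ico (0 : ℝ) (2 * Real.pi * L)}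

/-- Smooth test functions on space: compactly supported in the non-periodic setting, horizontally
`2πL`-periodic in the periodic one. There is no condition at the planes bounding the layers. -/
def IsTest (H : Horizontal) (φ : Space → ℝ) : Prop :=
  ContDiff ℝ ∞ φ ∧
    match H with
    | plane => HasCompactSupport φ
    | torus L => ∀ x i, φ (x.1 + (2 * Real.pi * L) • planeVec i, x.2) = φ x

/-- Smooth test functions on the interface `{x₃ = 0}`. -/
def IsPlaneTest (H : Horizontal) (χ : Plane → ℝ) : Prop :=
  ContDiff ℝ ∞ χ ∧
    match H with
    | plane => HasCompactSupport χ
    | torus L => ∀ y i, χ (y + (2 * Real.pi * L) • planeVec i) = χ y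

/-- Lebesgue measure on the interface (on one period of it in the periodic setting). -/
def surf (H : Horizontal) : Measure Plane := volume.restrict H.cell

/-- The moduli `|ξ| > 0` of the horizontal frequencies: `ξ ∈ ℝ²`, or `ξ ∈ (L⁻¹ℤ)²`. -/
def freqs : Horizontal → Set ℝ
  | plane => {k | 0 < k}
  | torus L => {k | 0 < k ∧ ∃ a b : ℤ, k = Real.sqrt ((a / L) ^ 2 + (b / L) ^ 2)}

/-- `d` is the weak derivative `∂ⱼ h` in `L²` of the function `h` on the interface. -/
def HasPlaneWeakDeriv (H : Horizontal) (j : Fin 2) (h d : Plane → ℝ) : Prop :=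
  MemLp d 2 H.surf ∧ ∀ χ, H.IsPlaneTest χ →
    ∫ y, h y * planeD j χ y ∂H.surf = -∫ y, d y * χ y ∂H.surf

open Classical in
/-- The weak derivative `∂ⱼ h` on the interface (determined almost everywhere). -/
def planeWeakDeriv (H : Horizontal) (j : Fin 2) (h : Plane → ℝ) : Plane → ℝ :=
  if hd : ∃ d, H.HasPlaneWeakDeriv j h d then hd.choose else 0

end Horizontal

/-! ### The fluids and the steady state -/

/-- A compressible viscous barotropic fluid: its pressure law `P`, shear viscosity `ε` and bulk
viscosity `δ`, all functions of the density. For the smooth increasing `P`, positivity of `P'`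
is the requirement that `1 / P'` be locally bounded on `(0, ∞)`. -/
structure Phase where
  P : ℝ → ℝ
  ε : ℝ → ℝ
  δ : ℝ → ℝ
  P_smooth : ContDiffOn ℝ ∞ P (Ioi 0)
  P_pos : ∀ r, 0 < r → 0 < P r
  P_strictMono : StrictMonoOn P (Ioi 0)
  P_deriv_pos : ∀ r, 0 < r → 0 < deriv P r
  ε_smooth : ContDiffOn ℝ ∞ ε (Ioi 0)
  ε_pos : ∀ r, 0 < r → 0 < ε r
  δ_smooth : ContDiffOn ℝ ∞ δ (Ioi 0)
  δ_nonneg : ∀ r, 0 < r → 0 ≤ δ r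

/-- The enthalpy `h(z) = ∫₁ᶻ P'(r) / r dr`. -/
def Phase.enthalpy (A : Phase) (z : ℝ) : ℝ := ∫ r in (1 : ℝ)..z, deriv A.P r / r

/-- The parameters of the problem: the lower fluid fills the layer `-m < x₃ < 0`, the upper one the
layer `0 < x₃ < ℓ`; `g` is gravity, `σ` the surface tension, and `ρm`, `ρp` are the densities of the
steady state just below and just above the interface. -/
structure Setup where
  lower : Phase
  upper : Phase
  g : ℝ
  σ : ℝ
  m : ℝ
  ℓ : ℝ
  ρm : ℝ
  ρp : ℝ
  g_pos : 0 < g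
  σ_nonneg : 0 ≤ σ
  m_pos : 0 < m
  ℓ_pos : 0 < ℓ
  ρm_pos : 0 < ρm
  ρp_pos : 0 < ρp
  /-- The pressure is continuous across the interface. -/
  balance : upper.P ρp = lower.P ρm
  /-- The Rayleigh-Taylor condition, equivalent to `ρm < ρp`. -/
  unstable : upper.P ρm < lower.P ρm
  /-- The steady state exists down to `x₃ = -m`. -/
  lower_range : ∃ r, 0 < r ∧ lower.enthalpy r = lower.enthalpy ρm + g * m
  /-- The steady state exists up to `x₃ = ℓ`. -/
  upper_range : ∃ r, 0 < r ∧ upper.enthalpy r = upper.enthalpy ρp - g * ℓ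

namespace Setup

variable (F : Setup)

/-- The fluid that occupies the height `z`. -/
def phase (z : ℝ) : Phase := if z < 0 then F.lower else F.upper

/-- The steady density `ρ₀(x₃) = h⁻¹(h(ρ₀^±) - g x₃)`, with `h⁻¹` the inverse of the enthalpy
on `(0, ∞)`. -/
def ρ₀ (z : ℝ) : ℝ :=
  Function.invFunOn (F.phase z).enthalpy (Ioi 0)
    ((F.phase z).enthalpy (if z < 0 then F.ρm else F.ρp) - F.g * z)

/-- `P'(ρ₀)` as a function of height. -/
def dP (z : ℝ) : ℝ := deriv (F.phase z).P (F.ρ₀ z)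

/-- `ε₀ = ε(ρ₀)` as a function of height. -/
def ε₀ (z : ℝ) : ℝ := (F.phase z).ε (F.ρ₀ z)

/-- `δ₀ = δ(ρ₀)` as a function of height. -/
def δ₀ (z : ℝ) : ℝ := (F.phase z).δ (F.ρ₀ z)

/-- The jump of the steady density across the interface. -/
def jumpρ : ℝ := F.ρp - F.ρm

/-! ### The growth rates -/

/-- `φ` belongs to `H¹₀((-m, ℓ))` (as its continuous representative) with derivative `dφ`. -/
def IsH10 (φ dφ : ℝ → ℝ) : Prop :=
  MemLp dφ 2 (volume.restrict (Ioo (-F.m) F.ℓ)) ∧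
    (∀ z ∈ Icc (-F.m) F.ℓ, φ z = ∫ y in (-F.m)..z, dφ y) ∧ φ F.ℓ = 0

/-- The energy `E(φ, ψ; s)` at frequency `k = |ξ|`, with modified viscosities `s ε₀`, `s δ₀`. -/
def energy (k s : ℝ) (φ dφ ψ dψ : ℝ → ℝ) : ℝ :=
  F.σ * k ^ 2 / 2 * ψ 0 ^ 2
  + 1 / 2 * (∫ z in (-F.m)..F.ℓ,
      ((s * F.δ₀ z + F.dP z * F.ρ₀ z) * (dψ z + k * φ z) ^ 2
        - 2 * F.g * F.ρ₀ z * k * φ z * ψ z))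
  + 1 / 2 * (∫ z in (-F.m)..F.ℓ,
      s * F.ε₀ z * ((dφ z - k * ψ z) ^ 2 + (dψ z - k * φ z) ^ 2
        + 1 / 3 * (dψ z + k * φ z) ^ 2))

/-- The constraint `J(φ, ψ)`. -/
def mass (φ ψ : ℝ → ℝ) : ℝ :=
  1 / 2 * ∫ z in (-F.m)..F.ℓ, F.ρ₀ z * (φ z ^ 2 + ψ z ^ 2)

/-- `μ(s)` at frequency `k`: the infimum of `E(·, ·; s)` over pairs in `H¹₀` with `J = 1`. -/
def μ (k s : ℝ) : ℝ :=
  sInf {e | ∃ φ dφ ψ dψ : ℝ → ℝ, F.IsH10 φ dφ ∧ F.IsH10 ψ dψ ∧ F.mass φ ψ = 1 ∧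
    e = F.energy k s φ dφ ψ dψ}

/-- `s` is the growth rate `λ(k)` at frequency `k`: the (unique) fixed point `s = √(-μ(s)) > 0`. -/
def IsGrowthRate (k s : ℝ) : Prop := F.μ k s < 0 ∧ s = Real.sqrt (-F.μ k s)

/-- The set of all `λ(|ξ|)`, with `ξ` a frequency of the setting and
`0 < |ξ| < √(g ⟦ρ₀⟧ / σ)` (no upper bound if `σ = 0`). -/
def growthRates (H : Horizontal) : Set ℝ :=
  {s | ∃ k ∈ H.freqs, F.σ * k ^ 2 < F.g * F.jumpρ ∧ F.IsGrowthRate k s}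

/-- The largest growth rate: `Λ` in the plane, `Λ_L` on the torus. -/
def maxRate (H : Horizontal) : ℝ := sSup (F.growthRates H)

/-! ### Piecewise Sobolev spaces and traces -/

/-- The vertical extent `(-m, 0) ∪ (0, ℓ)` of the two fluids. -/
def heights : Set ℝ := Ioo (-F.m) 0 ∪ Ioo 0 F.ℓ

/-- Lebesgue measure on the fluid domain `Ω` (on one period of it in the periodic setting). -/
def vol (H : Horizontal) : Measure Space := volume.restrict (H.cell ×ˢ F.heights)

/-- `f ∈ L²(Ω)`. -/
def MemL2 (H : Horizontal) (f : Space → ℝ) : Prop := MemLp f 2 (F.vol H)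

open Classical in
/-- The class of `f` in `L²(Ω)`. -/
def toL2 (H : Horizontal) (f : Space → ℝ) : Lp ℝ 2 (F.vol H) :=
  if hf : MemLp f 2 (F.vol H) then hf.toLp f else 0

/-- `d ∈ L²` is the weak derivative `∂ⱼ f` in each of the two fluids separately: the test functions
vanish near the interface. -/
def HasWeakDeriv (H : Horizontal) (j : Fin 3) (f d : Space → ℝ) : Prop :=
  F.MemL2 H d ∧ ∀ φ, H.IsTest φ → tsupport φ ⊆ {x | x.2 ∈ F.heights} →
    ∫ x, f x * partialD j φ x ∂F.vol H = -∫ x, d x * φ x ∂F.vol H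

open Classical in
/-- The piecewise weak derivative `∂ⱼ f` (determined almost everywhere). -/
def weakDeriv (H : Horizontal) (j : Fin 3) (f : Space → ℝ) : Space → ℝ :=
  if hd : ∃ d, F.HasWeakDeriv H j f d then hd.choose else 0

/-- The piecewise Sobolev space `H¹(Ω)`. -/
def MemH1 (H : Horizontal) (f : Space → ℝ) : Prop :=
  F.MemL2 H f ∧ ∀ j, ∃ d, F.HasWeakDeriv H j f d

/-- The piecewise Sobolev space `H²(Ω)`. -/
def MemH2 (H : Horizontal) (f : Space → ℝ) : Prop :=
  F.MemH1 H f ∧ ∀ j, F.MemH1 H (F.weakDeriv H j f)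

/-- On the layer `a < x₃ < b`, the function `f` has the trace `bot` on `{x₃ = a}` and the trace
`top` on `{x₃ = b}`, both in `L²`: this is Green's formula in the vertical direction. -/
def HasTraces (H : Horizontal) (a b : ℝ) (f : Space → ℝ) (bot top : Plane → ℝ) : Prop :=
  MemLp bot 2 H.surf ∧ MemLp top 2 H.surf ∧ ∀ φ, H.IsTest φ →
    ∫ x, (f x * partialD 2 φ x + F.weakDeriv H 2 f x * φ x)
        ∂(volume.restrict (H.cell ×ˢ Ioo a b)) =
      ∫ y, (top y * φ (y, b) - bot y * φ (y, a)) ∂H.surf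

open Classical in
/-- The trace on the interface `{x₃ = 0}`, taken from the upper fluid. -/
def interfaceTrace (H : Horizontal) (f : Space → ℝ) : Plane → ℝ :=
  if h : ∃ bot top, F.HasTraces H 0 F.ℓ f bot top then h.choose else 0

/-! ### The linearised problem -/

/-- The divergence of a vector field. -/
def dvg (H : Horizontal) (w : Fin 3 → Space → ℝ) (x : Space) : ℝ :=
  ∑ i, F.weakDeriv H i (w i) x

/-- The trace-free tensor `Dw + Dwᵀ - (2/3) (div w) I`. -/
def dev (H : Horizontal) (w : Fin 3 → Space → ℝ) (i j : Fin 3) (x : Space) : ℝ :=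
  F.weakDeriv H j (w i) x + F.weakDeriv H i (w j) x - 2 / 3 * F.dvg H w x * kron i j

/-- The viscous part of the linearised stress,
`ε₀ (Dw + Dwᵀ - (2/3) (div w) I) + δ₀ (div w) I`. -/
def viscous (H : Horizontal) (w : Fin 3 → Space → ℝ) (i j : Fin 3) (x : Space) : ℝ :=
  F.ε₀ x.2 * F.dev H w i j x + F.δ₀ x.2 * F.dvg H w x * kron i j

/-- The linearised stress `P'(ρ₀) q I - ε₀ (Dv + Dvᵀ) - (δ₀ - 2ε₀/3) (div v) I`. -/
def stress (H : Horizontal) (q : Space → ℝ) (v : Fin 3 → Space → ℝ) (i j : Fin 3)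
    (x : Space) : ℝ :=
  F.dP x.2 * q x * kron i j - F.viscous H v i j x

/-- `f' = ∂ₜ f` on `[0, ∞)`, the derivative being taken in `L²(Ω)` (one-sided at `t = 0`). -/
def HasTimeDeriv (H : Horizontal) (f f' : ℝ → Space → ℝ) : Prop :=
  ∀ t, 0 ≤ t → F.MemL2 H (f t) ∧ F.MemL2 H (f' t) ∧
    HasDerivWithinAt (fun s => F.toL2 H (f s)) (F.toL2 H (f' t)) (Ici 0) t

/-- `f ∈ C([0, ∞); H²(Ω))`. -/
def ContinuousInH2 (H : Horizontal) (f : ℝ → Space → ℝ) : Prop :=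
  (∀ t, 0 ≤ t → F.MemH2 H (f t)) ∧
  ContinuousOn (fun t => F.toL2 H (f t)) (Ici 0) ∧
  (∀ j, ContinuousOn (fun t => F.toL2 H (F.weakDeriv H j (f t))) (Ici 0)) ∧
  (∀ j k, ContinuousOn (fun t => F.toL2 H (F.weakDeriv H k (F.weakDeriv H j (f t)))) (Ici 0))

/-- `(η, v, q)` is a strong solution on `[0, ∞)` of the linearised equations with their jump and
boundary conditions, and `vt` is `∂ₜ v`. -/
structure IsSolution (H : Horizontal) (η v vt : ℝ → Fin 3 → Space → ℝ) (q : ℝ → Space → ℝ) :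
    Prop where
  η_mem : ∀ t, 0 ≤ t → ∀ i, F.MemH2 H (η t i)
  v_mem : ∀ i, F.ContinuousInH2 H (fun t => v t i)
  q_mem : ∀ t, 0 ≤ t → F.MemH1 H (q t)
  /-- `∂ₜ v = vt`. -/
  v_deriv : ∀ i, F.HasTimeDeriv H (fun t => v t i) (fun t => vt t i)
  /-- `∂ₜ η = v`. -/
  η_eq : ∀ i, F.HasTimeDeriv H (fun t => η t i) (fun t => v t i)
  /-- `∂ₜ q + ρ₀ div v = 0`. -/
  q_eq : F.HasTimeDeriv H q (fun t x => -(F.ρ₀ x.2 * F.dvg H (v t) x))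
  /-- The momentum equation in each of the two fluids. -/
  v_eq : ∀ t, 0 ≤ t → ∀ i, ∀ᵐ x ∂F.vol H,
    F.ρ₀ x.2 * vt t i x + F.weakDeriv H i (fun y => F.dP y.2 * q t y) x
        + F.g * q t x * kron i 2 + F.g * F.ρ₀ x.2 * F.weakDeriv H i (η t 2) x =
      ∑ j, F.weakDeriv H j (F.viscous H (v t) i j) x
  /-- `v` is continuous across the interface and vanishes on the outer boundaries. -/
  v_jump : ∀ t, 0 ≤ t → ∀ i, ∃ h : Plane → ℝ,
    F.HasTraces H 0 F.ℓ (v t i) h 0 ∧ F.HasTraces H (-F.m) 0 (v t i) 0 h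
  /-- The initial flow map is continuous across the interface. -/
  η_jump : ∀ i, ∃ h bot top : Plane → ℝ,
    F.HasTraces H 0 F.ℓ (η 0 i) h top ∧ F.HasTraces H (-F.m) 0 (η 0 i) bot h
  /-- The jump of the normal stress is `σ (Δ_{x₁,x₂} η₃) e₃`; the horizontal Laplacian of the
  trace of `η₃` is taken in the weak sense. -/
  stress_jump : ∀ t, 0 ≤ t → ∀ i, ∃ bot₁ top₁ bot₂ top₂ : Plane → ℝ,
    F.HasTraces H 0 F.ℓ (F.stress H (q t) (v t) i 2) bot₁ top₁ ∧
    F.HasTraces H (-F.m) 0 (F.stress H (q t) (v t) i 2) bot₂ top₂ ∧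
    ∀ χ, H.IsPlaneTest χ →
      ∫ y, (bot₁ y - top₂ y) * χ y ∂H.surf =
        F.σ * kron i 2 *
          ∫ y, F.interfaceTrace H (η t 2) y * ∑ j, planeD j (planeD j χ) y ∂H.surf

/-! ### The quantities in the estimate -/

/-- `‖w‖₁² = ∫_Ω ρ₀ |w|²`. -/
def normSq₁ (H : Horizontal) (w : Fin 3 → Space → ℝ) : ℝ :=
  ∫ x, F.ρ₀ x.2 * ∑ i, w i x ^ 2 ∂F.vol H

/-- `‖w‖₂² = ∫_Ω (ε₀/2) |Dw + Dwᵀ - (2/3)(div w) I|² + δ₀ |div w|²`. -/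
def normSq₂ (H : Horizontal) (w : Fin 3 → Space → ℝ) : ℝ :=
  ∫ x, (F.ε₀ x.2 / 2 * ∑ i, ∑ j, F.dev H w i j x ^ 2 + F.δ₀ x.2 * F.dvg H w x ^ 2) ∂F.vol H

/-- `∫ |∇_{x₁,x₂} f|²` over the interface `{x₃ = 0}`. -/
def surfaceDirichlet (H : Horizontal) (f : Space → ℝ) : ℝ :=
  ∫ y, ∑ j, H.planeWeakDeriv j (F.interfaceTrace H f) y ^ 2 ∂H.surf

/-- The growth estimate with rate `r` and constant `C`, for all solutions and all times. -/
def GrowthBound (H : Horizontal) (r C : ℝ) : Prop :=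
  ∀ (η v vt : ℝ → Fin 3 → Space → ℝ) (q : ℝ → Space → ℝ), F.IsSolution H η v vt q →
    ∀ t, 0 ≤ t →
      F.normSq₁ H (v t) + F.normSq₂ H (v t) + F.normSq₁ H (vt t) ≤
        C * Real.exp (2 * r * t) *
          (F.normSq₁ H (vt 0) + F.normSq₁ H (v 0) + F.normSq₂ H (v 0)
            + F.σ * F.surfaceDirichlet H (v 0 2))

end Setup

end RayleighTaylor

end

/-! Differentiating the momentum equation in time, with `∂ₜη = v` and `∂ₜq = -ρ₀ div v`, removes `η`
and `q`. It leaves a second order equation for the velocity in weak form, `M v'' + B v' + A v = 0`.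
Here `M` is the density-weighted `L²` product, `B` is the viscous dissipation, and `A` is the
symmetric form of compressive, buoyancy and surface tension energy. The theorem rests on one
coercivity statement: for `r = Λ` (or `Λ_L`), `A + r² M + r B ≥ 0` on fields that vanish on the
outer planes and are continuous across the interface (`total_nonneg`). Everything else is an energy
argument.

For the lower bound, Parseval in the horizontal variables splits the quadratic form into modes. At
wave number `k > 0`, the components along the wave vector, paired with the vertical component in
opposite phase, give two pairs `(φ, ψ)`. Up to nonnegative transverse terms, the mode then
contributes twice the sum of `E(φ, ψ; k, r) + r² J(φ, ψ)` over the two pairs (`density_mode_ge`).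
This quantity is nonnegative (`energy_add_nonneg`). If `σk² < g⟦ρ₀⟧`, then `μ(k, ·)` is
nondecreasing, so `r² + μ(k, r) ≥ s² + μ(k, s) = 0` for the growth rate `s ≤ r`. If `σk² ≥ g⟦ρ₀⟧`,
completing the square with the hydrostatic law `ρ₀' = -gρ₀ / P'(ρ₀)` leaves only nonnegative terms
(`potential_eq`). At frequency zero the form is a sum of squares.

Growth rates exist below the critical frequency by the intermediate value theorem for `s² + μ(k,
s)`. They are bounded uniformly in `k`, because the only negative energy is `-g⟦ρ₀⟧ψ(0)²/2`; a trace
interpolation absorbs it into the dissipation at cost `O(1/s)` (`exists_growthRate_bound`).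

The energy argument (`IsDissipative.regular_bound`) starts from the conservation law for `M(v', v')
+ A(v, v) + 2∫B(v', v')`. Inserting the lower bound for `A` and using Young's inequality for the
derivative of `B(v, v)`, one finds that `G = M(v, v) + ∫B(v, v)` satisfies `G' ≤ 2rG + K`, with `K`
depending on the initial data. Grönwall's inequality gives the rate `e^{2rt}`. A strong solution is
not regular enough to be tested with `v'`, so the equation is used integrated in time and the
velocity is averaged over short time windows (`IsDissipative.weak_bound`).

Two analytic facts make this rigorous. First, smooth fields supported away from the outer planes are
dense among the admissible fields, in a norm that also controls the horizontal gradient of the trace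
on the interface (`jets_subset_closure`). By Hahn-Banach and Riesz it is enough that a functional
vanishing on those test fields vanishes on all admissible fields. After a horizontal cutoff this
becomes, mode by mode, the lemma of du Bois-Reymond on `(-m, ℓ)`. Second, Korn's inequality
(`exists_korn`) bounds `A(v(0), v(0))` by `M`, `B` and the surface Dirichlet integral, so the
right-hand side involves only the stated initial quantities. -/

noncomputable section
namespace RayleighTaylor
open Filter Topology

/-! ### Enthalpy and the hydrostatic profile of a single fluid -/

namespace Phase

variable (A : Phase)

lemma contDiffOn_deriv_P : ContDiffOn ℝ ∞ (deriv A.P) (Ioi 0) :=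
  A.P_smooth.deriv_of_isOpen isOpen_Ioi (by simp)

lemma contDiffOn_enthalpyDensity : ContDiffOn ℝ ∞ (fun r => deriv A.P r / r) (Ioi 0) :=
  A.contDiffOn_deriv_P.div contDiffOn_id fun _ hx => ne_of_gt hx

lemma hasDerivAt_enthalpy {r : ℝ} (hr : 0 < r) :
    HasDerivAt A.enthalpy (deriv A.P r / r) r := by
  have hc := A.contDiffOn_enthalpyDensity.continuousOn
  have hsub : uIcc 1 r ⊆ Ioi 0 := fun x hx =>
    lt_of_lt_of_le (lt_min one_pos hr) hx.1
  refine intervalIntegral.integral_hasDerivAt_right ?_ ?_ ?_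
  · exact (hc.mono hsub).intervalIntegrable
  · exact hc.stronglyMeasurableAtFilter isOpen_Ioi r hr
  · exact hc.continuousAt (Ioi_mem_nhds hr)

lemma contDiffOn_enthalpy : ContDiffOn ℝ ∞ A.enthalpy (Ioi 0) := by
  rw [contDiffOn_infty_iff_deriv_of_isOpen isOpen_Ioi]
  refine ⟨fun x hx => (A.hasDerivAt_enthalpy hx).differentiableAt.differentiableWithinAt, ?_⟩
  exact A.contDiffOn_enthalpyDensity.congr fun x hx => (A.hasDerivAt_enthalpy hx).deriv

lemma enthalpy_strictMonoOn : StrictMonoOn A.enthalpy (Ioi 0) := by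
  refine strictMonoOn_of_deriv_pos (convex_Ioi 0) A.contDiffOn_enthalpy.continuousOn ?_
  intro x hx
  rw [interior_Ioi] at hx
  rw [(A.hasDerivAt_enthalpy hx).deriv]
  exact div_pos (A.P_deriv_pos x hx) hx

/-- The steady density in a layer occupied by a single fluid, with density `r₀` at height `0`. -/
def layerDensity (r₀ g z : ℝ) : ℝ :=
  Function.invFunOn A.enthalpy (Ioi 0) (A.enthalpy r₀ - g * z)

variable {A} {r₀ g z : ℝ}

lemma layerDensity_pos (h : ∃ r, 0 < r ∧ A.enthalpy r = A.enthalpy r₀ - g * z) :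
    0 < A.layerDensity r₀ g z :=
  Function.invFunOn_mem h

lemma enthalpy_layerDensity (h : ∃ r, 0 < r ∧ A.enthalpy r = A.enthalpy r₀ - g * z) :
    A.enthalpy (A.layerDensity r₀ g z) = A.enthalpy r₀ - g * z :=
  Function.invFunOn_eq h

lemma layerDensity_zero (hr : 0 < r₀) : A.layerDensity r₀ g 0 = r₀ := by
  have h : ∃ r, 0 < r ∧ A.enthalpy r = A.enthalpy r₀ - g * 0 := ⟨r₀, hr, by simp⟩
  refine A.enthalpy_strictMonoOn.injOn (layerDensity_pos h) hr ?_
  simpa using enthalpy_layerDensity h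

/-- The enthalpy has the positive derivative `P'(r) / r`, so the inverse function theorem applies.
Differentiating `h(ρ(z)) = h(r₀) - g z` gives the hydrostatic law `P'(ρ) ρ' = -g ρ`, the identity
that later lets the inviscid energy be written as a square plus a jump. -/
lemma layerDensity_smooth (h : ∃ r, 0 < r ∧ A.enthalpy r = A.enthalpy r₀ - g * z) :
    ContDiffAt ℝ ∞ (A.layerDensity r₀ g) z ∧
      HasDerivAt (A.layerDensity r₀ g)
        (-(g * A.layerDensity r₀ g z / deriv A.P (A.layerDensity r₀ g z))) z := by
  set r := A.layerDensity r₀ g z with hr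
  have hr0 : 0 < r := layerDensity_pos h
  have hP := A.P_deriv_pos r hr0
  have hd := A.hasDerivAt_enthalpy hr0
  have hne : deriv A.P r / r ≠ 0 := (div_pos hP hr0).ne'
  have hs : ContDiffAt ℝ ∞ A.enthalpy r := A.contDiffOn_enthalpy.contDiffAt (Ioi_mem_nhds hr0)
  have hd' := hd.hasFDerivAt_equiv hne
  have hn : (∞ : ℕ∞ω) ≠ 0 := by simp
  have hstr := hs.hasStrictFDerivAt' hd' hn
  set G := hs.localInverse hd' hn with hG
  have hGs : ContDiffAt ℝ ∞ G (A.enthalpy r) := hs.to_localInverse hd' hn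
  have hE : A.enthalpy r = A.enthalpy r₀ - g * z := enthalpy_layerDensity h
  have haff : ContDiffAt ℝ ∞ (fun y : ℝ => A.enthalpy r₀ - g * y) z := by fun_prop
  have hGr : G (A.enthalpy r) = r := hs.localInverse_apply_image hd' hn
  have hright : ∀ᶠ y in 𝓝 (A.enthalpy r), A.enthalpy (G y) = y :=
    hstr.eventually_right_inverse
  have hpos : ∀ᶠ y in 𝓝 (A.enthalpy r), 0 < G y :=
    hGs.continuousAt.eventually (by rw [hGr]; exact Ioi_mem_nhds hr0)
  have htend : Tendsto (fun y : ℝ => A.enthalpy r₀ - g * y) (𝓝 z) (𝓝 (A.enthalpy r)) := by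
    have := haff.continuousAt.tendsto
    rwa [← hE] at this
  -- `Function.invFunOn` selects an arbitrary preimage; injectivity of the enthalpy on `(0, ∞)`
  -- forces it to agree near `z` with the smooth local inverse.
  have hev : A.layerDensity r₀ g =ᶠ[𝓝 z] fun y => G (A.enthalpy r₀ - g * y) := by
    filter_upwards [htend.eventually hright, htend.eventually hpos] with y h1 h2
    have hy : ∃ r, 0 < r ∧ A.enthalpy r = A.enthalpy r₀ - g * y := ⟨_, h2, h1⟩
    refine A.enthalpy_strictMonoOn.injOn (layerDensity_pos hy) h2 ?_
    rw [h1, enthalpy_layerDensity hy]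
  have hsm : ContDiffAt ℝ ∞ (A.layerDensity r₀ g) z := by
    refine ContDiffAt.congr_of_eventuallyEq ?_ hev
    exact ContDiffAt.comp z (by rw [← hE]; exact hGs) haff
  refine ⟨hsm, ?_⟩
  have hdiff : DifferentiableAt ℝ (A.layerDensity r₀ g) z := hsm.differentiableAt hn
  have h1 : HasDerivAt (fun y => A.enthalpy (A.layerDensity r₀ g y))
      (deriv A.P r / r * deriv (A.layerDensity r₀ g) z) z :=
    HasDerivAt.comp (h₂ := A.enthalpy) (h := A.layerDensity r₀ g) z hd hdiff.hasDerivAt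
  have h2 : HasDerivAt (fun y => A.enthalpy (A.layerDensity r₀ g y)) (-g) z := by
    have h3 : HasDerivAt (fun y : ℝ => A.enthalpy r₀ - g * y) (-g) z := by
      simpa using ((hasDerivAt_id z).const_mul g).const_sub (A.enthalpy r₀)
    refine h3.congr_of_eventuallyEq ?_
    filter_upwards [htend.eventually hright, htend.eventually hpos] with y h1 h2
    exact enthalpy_layerDensity ⟨_, h2, h1⟩
  have h4 := h1.unique h2
  have h5 : deriv (A.layerDensity r₀ g) z = -(g * r / deriv A.P r) := by
    field_simp at h4 ⊢
    linarith
  rw [← h5]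
  exact hdiff.hasDerivAt

/-- The steady state is assumed to exist only at the far end of a layer; the intermediate value
theorem supplies it at every height in between. -/
lemma exists_layerDensity {r₁ z₁ : ℝ} (h0 : 0 < r₀) (h1 : 0 < r₁)
    (h : A.enthalpy r₁ = A.enthalpy r₀ - g * z₁) (hz : z ∈ uIcc 0 z₁) :
    ∃ r, 0 < r ∧ A.enthalpy r = A.enthalpy r₀ - g * z := by
  have hsub : uIcc r₀ r₁ ⊆ Ioi 0 := fun x hx => lt_of_lt_of_le (lt_min h0 h1) hx.1
  have hmem : A.enthalpy r₀ - g * z ∈ uIcc (A.enthalpy r₀) (A.enthalpy r₁) := by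
    rw [h]
    have : Continuous fun y : ℝ => A.enthalpy r₀ - g * y := by fun_prop
    -- Neither the sign of `g` nor that of `z₁` is fixed here, hence four cases.
    rcases mem_uIcc.1 hz with hz | hz <;> rw [mem_uIcc] <;>
      rcases le_total 0 g with hg | hg
    · exact .inr ⟨by nlinarith, by nlinarith⟩
    · exact .inl ⟨by nlinarith, by nlinarith⟩
    · exact .inl ⟨by nlinarith, by nlinarith⟩
    · exact .inr ⟨by nlinarith, by nlinarith⟩
  obtain ⟨r, hr, hr'⟩ := intermediate_value_uIcc
    (A.contDiffOn_enthalpy.continuousOn.mono hsub) hmem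
  exact ⟨r, hsub hr, hr'⟩

end Phase

/-! ### The steady state and coefficients smooth in each closed layer -/

namespace Setup

variable (F : Setup)

/-- Pressure balance turns the instability condition into `P₊(ρm) < P₊(ρp)`, and `P₊` is increasing.
-/
lemma ρm_lt_ρp : F.ρm < F.ρp :=
  (F.upper.P_strictMono.lt_iff_lt F.ρm_pos F.ρp_pos).1 (by rw [F.balance]; exact F.unstable)

lemma jumpρ_pos : 0 < F.jumpρ := sub_pos.2 F.ρm_lt_ρp

/-- The smooth extension of the lower steady density up to the interface. -/
def ρlow (z : ℝ) : ℝ := F.lower.layerDensity F.ρm F.g z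

/-- The upper steady density. -/
def ρup (z : ℝ) : ℝ := F.upper.layerDensity F.ρp F.g z

lemma ρ₀_of_neg {z : ℝ} (hz : z < 0) : F.ρ₀ z = F.ρlow z := by
  simp [ρ₀, ρlow, phase, hz, Phase.layerDensity]

lemma ρ₀_of_nonneg {z : ℝ} (hz : 0 ≤ z) : F.ρ₀ z = F.ρup z := by
  simp [ρ₀, ρup, phase, not_lt.2 hz, Phase.layerDensity]

lemma exists_low {z : ℝ} (hz : z ∈ Icc (-F.m) 0) :
    ∃ r, 0 < r ∧ F.lower.enthalpy r = F.lower.enthalpy F.ρm - F.g * z := by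
  obtain ⟨r, hr, h⟩ := F.lower_range
  refine Phase.exists_layerDensity F.ρm_pos hr (z₁ := -F.m) (by rw [h]; ring) ?_
  rw [uIcc_of_ge (by linarith [F.m_pos])]; exact hz

lemma exists_up {z : ℝ} (hz : z ∈ Icc 0 F.ℓ) :
    ∃ r, 0 < r ∧ F.upper.enthalpy r = F.upper.enthalpy F.ρp - F.g * z := by
  obtain ⟨r, hr, h⟩ := F.upper_range
  refine Phase.exists_layerDensity F.ρp_pos hr (z₁ := F.ℓ) h ?_
  rw [uIcc_of_le F.ℓ_pos.le]; exact hz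

/-- A coefficient that is smooth in each of the two closed layers, with one-sided extensions
`cl` and `cu`. -/
structure IsCoef (c cl cu : ℝ → ℝ) : Prop where
  low_smooth : ∀ z ∈ Icc (-F.m) 0, ContDiffAt ℝ ∞ cl z
  up_smooth : ∀ z ∈ Icc 0 F.ℓ, ContDiffAt ℝ ∞ cu z
  low_eq : ∀ z, z < 0 → c z = cl z
  up_eq : ∀ z, 0 ≤ z → c z = cu z

/-- `c` is smooth in each of the two closed layers. -/
def Coef (c : ℝ → ℝ) : Prop := ∃ cl cu, F.IsCoef c cl cu

variable {F}

lemma isCoef_ρ₀ : F.IsCoef F.ρ₀ F.ρlow F.ρup where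
  low_smooth _ hz := (Phase.layerDensity_smooth (F.exists_low hz)).1
  up_smooth _ hz := (Phase.layerDensity_smooth (F.exists_up hz)).1
  low_eq _ hz := F.ρ₀_of_neg hz
  up_eq _ hz := F.ρ₀_of_nonneg hz

lemma coef_comp (f : Phase → ℝ → ℝ) (hf : ∀ A, ContDiffOn ℝ ∞ (f A) (Ioi 0)) :
    F.Coef (fun z => f (F.phase z) (F.ρ₀ z)) := by
  refine ⟨fun z => f F.lower (F.ρlow z), fun z => f F.upper (F.ρup z), ?_, ?_, ?_, ?_⟩
  · intro z hz
    exact ContDiffAt.comp z ((hf _).contDiffAt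
      (Ioi_mem_nhds (Phase.layerDensity_pos (F.exists_low hz)))) (isCoef_ρ₀.low_smooth z hz)
  · intro z hz
    exact ContDiffAt.comp z ((hf _).contDiffAt
      (Ioi_mem_nhds (Phase.layerDensity_pos (F.exists_up hz)))) (isCoef_ρ₀.up_smooth z hz)
  · intro z hz; simp [phase, hz, F.ρ₀_of_neg hz]
  · intro z hz; simp [phase, not_lt.2 hz, F.ρ₀_of_nonneg hz]

lemma coef_ρ₀ : F.Coef F.ρ₀ := ⟨_, _, isCoef_ρ₀⟩
lemma coef_dP : F.Coef F.dP := coef_comp (fun A => deriv A.P) fun A => A.contDiffOn_deriv_P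
lemma coef_ε₀ : F.Coef F.ε₀ := coef_comp (fun A => A.ε) fun A => A.ε_smooth
lemma coef_δ₀ : F.Coef F.δ₀ := coef_comp (fun A => A.δ) fun A => A.δ_smooth

lemma Coef.mul {c d : ℝ → ℝ} (hc : F.Coef c) (hd : F.Coef d) : F.Coef fun z => c z * d z := by
  obtain ⟨cl, cu, h1⟩ := hc
  obtain ⟨dl, du, h2⟩ := hd
  exact ⟨fun z => cl z * dl z, fun z => cu z * du z,
    fun z hz => (h1.low_smooth z hz).mul (h2.low_smooth z hz),
    fun z hz => (h1.up_smooth z hz).mul (h2.up_smooth z hz),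
    fun z hz => by simp only [h1.low_eq z hz, h2.low_eq z hz],
    fun z hz => by simp only [h1.up_eq z hz, h2.up_eq z hz]⟩

lemma Coef.add {c d : ℝ → ℝ} (hc : F.Coef c) (hd : F.Coef d) : F.Coef fun z => c z + d z := by
  obtain ⟨cl, cu, h1⟩ := hc
  obtain ⟨dl, du, h2⟩ := hd
  exact ⟨fun z => cl z + dl z, fun z => cu z + du z,
    fun z hz => (h1.low_smooth z hz).add (h2.low_smooth z hz),
    fun z hz => (h1.up_smooth z hz).add (h2.up_smooth z hz),
    fun z hz => by simp only [h1.low_eq z hz, h2.low_eq z hz],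
    fun z hz => by simp only [h1.up_eq z hz, h2.up_eq z hz]⟩

lemma coef_const (a : ℝ) : F.Coef fun _ => a :=
  ⟨fun _ => a, fun _ => a, fun _ _ => contDiffAt_const, fun _ _ => contDiffAt_const,
    fun _ _ => rfl, fun _ _ => rfl⟩

lemma Coef.const_mul {c : ℝ → ℝ} (hc : F.Coef c) (a : ℝ) : F.Coef fun z => a * c z :=
  (coef_const a).mul hc

lemma Coef.bounded {c : ℝ → ℝ} (hc : F.Coef c) :
    ∃ K, 0 < K ∧ ∀ z ∈ Icc (-F.m) F.ℓ, |c z| ≤ K := by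
  obtain ⟨cl, cu, h⟩ := hc
  have h1 : ContinuousOn cl (Icc (-F.m) 0) := fun z hz =>
    (h.low_smooth z hz).continuousAt.continuousWithinAt
  have h2 : ContinuousOn cu (Icc 0 F.ℓ) := fun z hz =>
    (h.up_smooth z hz).continuousAt.continuousWithinAt
  obtain ⟨K1, hK1⟩ := isCompact_Icc.exists_bound_of_continuousOn h1
  obtain ⟨K2, hK2⟩ := isCompact_Icc.exists_bound_of_continuousOn h2
  refine ⟨|K1| + |K2| + 1, by positivity, fun z hz => ?_⟩
  rcases lt_or_ge z 0 with h0 | h0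
  · rw [h.low_eq z h0]
    have := hK1 z ⟨hz.1, h0.le⟩
    rw [Real.norm_eq_abs] at this
    linarith [le_abs_self K1, abs_nonneg K2]
  · rw [h.up_eq z h0]
    have := hK2 z ⟨h0, hz.2⟩
    rw [Real.norm_eq_abs] at this
    linarith [le_abs_self K2, abs_nonneg K1]

lemma isOpen_heights : IsOpen F.heights := isOpen_Ioo.union isOpen_Ioo

lemma heights_subset : F.heights ⊆ Ioo (-F.m) F.ℓ := by
  rintro z (hz | hz)
  · exact ⟨hz.1, hz.2.trans F.ℓ_pos⟩
  · exact ⟨by linarith [hz.1, F.m_pos], hz.2⟩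

lemma heights_ae_eq : F.heights =ᵐ[volume] Ioo (-F.m) F.ℓ := by
  have : Ioo (-F.m) F.ℓ = F.heights ∪ {0} := by
    ext z
    simp only [heights, mem_union, mem_Ioo, mem_singleton_iff]
    constructor
    · intro h
      rcases lt_trichotomy z 0 with h0 | h0 | h0
      · exact .inl (.inl ⟨h.1, h0⟩)
      · exact .inr h0
      · exact .inl (.inr ⟨h0, h.2⟩)
    · rintro ((h | h) | rfl)
      · exact ⟨h.1, h.2.trans F.ℓ_pos⟩
      · exact ⟨by linarith [h.1, F.m_pos], h.2⟩
      · exact ⟨by linarith [F.m_pos], F.ℓ_pos⟩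
  rw [this]
  exact (union_ae_eq_left_of_ae_eq_empty (by simp)).symm

lemma restrict_heights : volume.restrict F.heights = volume.restrict (Ioo (-F.m) F.ℓ) :=
  Measure.restrict_congr_set heights_ae_eq

lemma Coef.contDiffAt {c : ℝ → ℝ} (hc : F.Coef c) {z : ℝ} (hz : z ∈ F.heights) :
    ContDiffAt ℝ ∞ c z := by
  obtain ⟨cl, cu, h⟩ := hc
  rcases hz with hz | hz
  · refine (h.low_smooth z ⟨hz.1.le, hz.2.le⟩).congr_of_eventuallyEq ?_
    filter_upwards [Iio_mem_nhds hz.2] with y hy using h.low_eq y hy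
  · refine (h.up_smooth z ⟨hz.1.le, hz.2.le⟩).congr_of_eventuallyEq ?_
    filter_upwards [Ioi_mem_nhds hz.1] with y hy using h.up_eq y hy.le

lemma Coef.aestronglyMeasurable {c : ℝ → ℝ} (hc : F.Coef c) :
    AEStronglyMeasurable c (volume.restrict F.heights) :=
  ContinuousOn.aestronglyMeasurable
    (fun _ hz => (hc.contDiffAt hz).continuousAt.continuousWithinAt)
    isOpen_heights.measurableSet

lemma Coef.exists_deriv {c : ℝ → ℝ} (hc : F.Coef c) :
    ∃ c', F.Coef c' ∧ ∀ z ∈ F.heights, HasDerivAt c (c' z) z := by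
  have hc0 := hc
  obtain ⟨cl, cu, h⟩ := hc
  refine ⟨fun z => if z < 0 then deriv cl z else deriv cu z, ⟨deriv cl, deriv cu, ?_, ?_, ?_, ?_⟩,
    ?_⟩
  · intro z hz; exact (h.low_smooth z hz).derivWithin (by simp)
  · intro z hz; exact (h.up_smooth z hz).derivWithin (by simp)
  · intro z hz; simp [hz]
  · intro z hz; simp [not_lt.2 hz]
  · intro z hz
    have hd := ((hc0.contDiffAt hz).differentiableAt (by simp)).hasDerivAt
    suffices he : (if z < 0 then deriv cl z else deriv cu z) = deriv c z by
      simpa only [he] using hd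
    rcases hz with hz | hz
    · rw [if_pos hz.2]
      refine Filter.EventuallyEq.deriv_eq ?_
      filter_upwards [Iio_mem_nhds hz.2] with y hy using (h.low_eq y hy).symm
    · rw [if_neg (not_lt.2 hz.1.le)]
      refine Filter.EventuallyEq.deriv_eq ?_
      filter_upwards [Ioi_mem_nhds hz.1] with y hy using (h.up_eq y hy.le).symm

/-- Compactness of each closed layer. Positivity is asked of the extensions, because at height `0`
the coefficient takes its upper value and says nothing about its limit from below. -/
lemma exists_lower_bound {c cl cu : ℝ → ℝ} (h : F.IsCoef c cl cu)
    (hl : ∀ z ∈ Icc (-F.m) 0, 0 < cl z) (hu : ∀ z ∈ Icc 0 F.ℓ, 0 < cu z) :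
    ∃ κ, 0 < κ ∧ ∀ z ∈ Icc (-F.m) F.ℓ, κ ≤ c z := by
  have h1 : ContinuousOn cl (Icc (-F.m) 0) := fun z hz =>
    (h.low_smooth z hz).continuousAt.continuousWithinAt
  have h2 : ContinuousOn cu (Icc 0 F.ℓ) := fun z hz =>
    (h.up_smooth z hz).continuousAt.continuousWithinAt
  obtain ⟨x, hx, hx'⟩ := isCompact_Icc.exists_isMinOn
    (nonempty_Icc.2 (by linarith [F.m_pos] : -F.m ≤ 0)) h1
  obtain ⟨y, hy, hy'⟩ := isCompact_Icc.exists_isMinOn (nonempty_Icc.2 F.ℓ_pos.le) h2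
  refine ⟨min (cl x) (cu y), lt_min (hl x hx) (hu y hy), fun z hz => ?_⟩
  rcases lt_or_ge z 0 with h0 | h0
  · rw [h.low_eq z h0]
    exact (min_le_left _ _).trans (hx' ⟨hz.1, h0.le⟩)
  · rw [h.up_eq z h0]
    exact (min_le_right _ _).trans (hy' ⟨h0, hz.2⟩)

lemma exists_ρ₀_lower : ∃ κ, 0 < κ ∧ ∀ z ∈ Icc (-F.m) F.ℓ, κ ≤ F.ρ₀ z :=
  exists_lower_bound isCoef_ρ₀ (fun _ hz => Phase.layerDensity_pos (F.exists_low hz))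
    (fun _ hz => Phase.layerDensity_pos (F.exists_up hz))

lemma ρ₀_pos {z : ℝ} (hz : z ∈ Icc (-F.m) F.ℓ) : 0 < F.ρ₀ z := by
  obtain ⟨κ, h, h'⟩ := F.exists_ρ₀_lower
  exact h.trans_le (h' z hz)

lemma dP_pos {z : ℝ} (hz : z ∈ Icc (-F.m) F.ℓ) : 0 < F.dP z :=
  (F.phase z).P_deriv_pos _ (ρ₀_pos hz)

lemma δ₀_nonneg {z : ℝ} (hz : z ∈ Icc (-F.m) F.ℓ) : 0 ≤ F.δ₀ z :=
  (F.phase z).δ_nonneg _ (ρ₀_pos hz)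

lemma exists_ε₀_lower : ∃ κ, 0 < κ ∧ ∀ z ∈ Icc (-F.m) F.ℓ, κ ≤ F.ε₀ z := by
  refine exists_lower_bound (cl := fun z => F.lower.ε (F.ρlow z))
    (cu := fun z => F.upper.ε (F.ρup z)) ⟨?_, ?_, ?_, ?_⟩ ?_ ?_
  · intro z hz
    exact ContDiffAt.comp z (F.lower.ε_smooth.contDiffAt
      (Ioi_mem_nhds (Phase.layerDensity_pos (F.exists_low hz)))) (isCoef_ρ₀.low_smooth z hz)
  · intro z hz
    exact ContDiffAt.comp z (F.upper.ε_smooth.contDiffAt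
      (Ioi_mem_nhds (Phase.layerDensity_pos (F.exists_up hz)))) (isCoef_ρ₀.up_smooth z hz)
  · intro z hz; simp [ε₀, phase, hz, F.ρ₀_of_neg hz]
  · intro z hz; simp [ε₀, phase, not_lt.2 hz, F.ρ₀_of_nonneg hz]
  · exact fun z hz => F.lower.ε_pos _ (Phase.layerDensity_pos (F.exists_low hz))
  · exact fun z hz => F.upper.ε_pos _ (Phase.layerDensity_pos (F.exists_up hz))

lemma ε₀_pos {z : ℝ} (hz : z ∈ Icc (-F.m) F.ℓ) : 0 < F.ε₀ z :=
  (F.phase z).ε_pos _ (ρ₀_pos hz)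

lemma hasDerivAt_ρlow {z : ℝ} (hz : z ∈ Icc (-F.m) 0) :
    HasDerivAt F.ρlow (-(F.g * F.ρlow z / deriv F.lower.P (F.ρlow z))) z :=
  (Phase.layerDensity_smooth (F.exists_low hz)).2

lemma hasDerivAt_ρup {z : ℝ} (hz : z ∈ Icc 0 F.ℓ) :
    HasDerivAt F.ρup (-(F.g * F.ρup z / deriv F.upper.P (F.ρup z))) z :=
  (Phase.layerDensity_smooth (F.exists_up hz)).2

lemma ρlow_zero : F.ρlow 0 = F.ρm := Phase.layerDensity_zero F.ρm_pos
lemma ρup_zero : F.ρup 0 = F.ρp := Phase.layerDensity_zero F.ρp_pos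

end Setup
end RayleighTaylor
end

/-! ### The space `H¹₀` on the interval `(-m, ℓ)` -/

noncomputable section
namespace RayleighTaylor
open Filter Topology

/-- Integration by parts for primitives of integrable functions. -/
lemma integral_mul_primitive {a b : ℝ} (hab : a ≤ b) {f g df dg : ℝ → ℝ}
    (hdf : IntervalIntegrable df volume a b) (hdg : IntervalIntegrable dg volume a b)
    (hf : ∀ z ∈ Icc a b, f z = f a + ∫ y in a..z, df y)
    (hg : ∀ z ∈ Icc a b, g z = g a + ∫ y in a..z, dg y) :
    ∫ z in a..b, (df z * g z + f z * dg z) = f b * g b - f a * g a := by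
  have key : ∀ {u du : ℝ → ℝ}, IntervalIntegrable du volume a b →
      AbsolutelyContinuousOnInterval (fun z => u a + ∫ y in a..z, du y) a b ∧
      ∀ᵐ z, z ∈ uIoc a b → deriv (fun z => u a + ∫ y in a..z, du y) z = du z := by
    intro u du hdu
    have h0 := hdu.absolutelyContinuousOnInterval_intervalIntegral (c := a) left_mem_uIcc
    refine ⟨?_, ?_⟩
    · have hc : AbsolutelyContinuousOnInterval (fun _ : ℝ => u a) a b :=
        (contDiffOn_const (c := u a) (n := 1)).absolutelyContinuousOnInterval
      exact hc.add h0
    · filter_upwards [hdu.ae_hasDerivAt_integral] with z hz hzm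
      have := (hz (uIoc_subset_uIcc hzm) a left_mem_uIcc).const_add (u a)
      exact this.deriv
  obtain ⟨hF, hF'⟩ := key (u := f) hdf
  obtain ⟨hG, hG'⟩ := key (u := g) hdg
  have h1 := AbsolutelyContinuousOnInterval.integral_deriv_mul_eq_sub hF hG
  have ha : a ∈ Icc a b := left_mem_Icc.2 hab
  have hb : b ∈ Icc a b := right_mem_Icc.2 hab
  simp only [← hf b hb, ← hg b hb, ← hf a ha, ← hg a ha] at h1
  rw [← h1]
  refine intervalIntegral.integral_congr_ae ?_
  filter_upwards [hF', hG'] with z h2 h3 hz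
  rw [h2 hz, h3 hz]
  have hz' : z ∈ Icc a b := by
    rw [uIoc_of_le hab] at hz; exact Ioc_subset_Icc_self hz
  rw [hf z hz', hg z hz']

namespace Setup

variable (F : Setup)

/-- Lebesgue measure on `(-m, ℓ)`. -/
def lin : Measure ℝ := volume.restrict (Ioo (-F.m) F.ℓ)

instance : IsFiniteMeasure F.lin := by
  unfold lin; infer_instance

variable {F}

lemma neg_m_lt_ℓ : -F.m < F.ℓ := by linarith [F.m_pos, F.ℓ_pos]

lemma zero_mem : (0 : ℝ) ∈ Icc (-F.m) F.ℓ := ⟨by linarith [F.m_pos], F.ℓ_pos.le⟩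

lemma integral_lin (f : ℝ → ℝ) : ∫ z in (-F.m)..F.ℓ, f z = ∫ z, f z ∂F.lin := by
  rw [intervalIntegral.integral_of_le neg_m_lt_ℓ.le, integral_Ioc_eq_integral_Ioo]; rfl

lemma ae_lin_of_forall {p : ℝ → Prop} (h : ∀ z ∈ Icc (-F.m) F.ℓ, p z) : ∀ᵐ z ∂F.lin, p z :=
  (ae_restrict_iff' measurableSet_Ioo).2 (.of_forall fun z hz => h z (Ioo_subset_Icc_self hz))

lemma Coef.aesm {c : ℝ → ℝ} (hc : F.Coef c) : AEStronglyMeasurable c F.lin := by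
  rw [lin, ← restrict_heights]; exact hc.aestronglyMeasurable

lemma Coef.memLp_mul {c f : ℝ → ℝ} (hc : F.Coef c) (hf : MemLp f 2 F.lin) :
    MemLp (fun z => c z * f z) 2 F.lin := by
  obtain ⟨K, -, hK⟩ := hc.bounded
  refine (hf.const_mul K).of_le (hc.aesm.mul hf.1) (ae_lin_of_forall fun z hz => ?_)
  simp only [norm_mul, Real.norm_eq_abs]
  exact mul_le_mul_of_nonneg_right ((hK z hz).trans (le_abs_self K)) (abs_nonneg _)

lemma integrable_mul_lin {f g : ℝ → ℝ} (hf : MemLp f 2 F.lin) (hg : MemLp g 2 F.lin) :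
    Integrable (fun z => f z * g z) F.lin :=
  MemLp.integrable_mul (p := 2) (q := 2) hf hg

lemma Coef.integrable_mul {c f g : ℝ → ℝ} (hc : F.Coef c) (hf : MemLp f 2 F.lin)
    (hg : MemLp g 2 F.lin) : Integrable (fun z => c z * (f z * g z)) F.lin := by
  simpa only [mul_assoc] using integrable_mul_lin (hc.memLp_mul hf) hg

lemma Coef.integrable_sq {c f : ℝ → ℝ} (hc : F.Coef c) (hf : MemLp f 2 F.lin) :
    Integrable (fun z => c z * f z ^ 2) F.lin := by
  simpa only [pow_two] using hc.integrable_mul hf hf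

namespace IsH10

variable {φ dφ ψ dψ : ℝ → ℝ}

lemma integrable_deriv (h : F.IsH10 φ dφ) : Integrable dφ F.lin :=
  MemLp.integrable (q := 2) (by norm_num) h.1

lemma intervalIntegrable (h : F.IsH10 φ dφ) {a b : ℝ} (ha : a ∈ Icc (-F.m) F.ℓ)
    (hb : b ∈ Icc (-F.m) F.ℓ) : IntervalIntegrable dφ volume a b := by
  have h1 : IntegrableOn dφ (Icc (-F.m) F.ℓ) := by
    rw [integrableOn_Icc_iff_integrableOn_Ioo]; exact h.integrable_deriv
  exact (h1.mono_set (uIcc_subset_Icc ha hb)).intervalIntegrable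

lemma left_eq (h : F.IsH10 φ dφ) : φ (-F.m) = 0 := by
  rw [h.2.1 _ (left_mem_Icc.2 neg_m_lt_ℓ.le)]; simp

lemma eq_add (h : F.IsH10 φ dφ) {a z : ℝ} (ha : a ∈ Icc (-F.m) F.ℓ) (hz : z ∈ Icc (-F.m) F.ℓ) :
    φ z = φ a + ∫ y in a..z, dφ y := by
  have hl := left_mem_Icc.2 (neg_m_lt_ℓ (F := F)).le
  rw [h.2.1 z hz, h.2.1 a ha, intervalIntegral.integral_add_adjacent_intervals
    (h.intervalIntegrable hl ha) (h.intervalIntegrable ha hz)]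

lemma continuousOn (h : F.IsH10 φ dφ) : ContinuousOn φ (Icc (-F.m) F.ℓ) := by
  have h1 : IntegrableOn dφ (uIcc (-F.m) F.ℓ) := by
    rw [uIcc_of_le neg_m_lt_ℓ.le, integrableOn_Icc_iff_integrableOn_Ioo]
    exact h.integrable_deriv
  have h2 := intervalIntegral.continuousOn_primitive_interval h1
  rw [uIcc_of_le neg_m_lt_ℓ.le] at h2
  exact h2.congr h.2.1

lemma memLp (h : F.IsH10 φ dφ) : MemLp φ 2 F.lin := by
  obtain ⟨K, hK⟩ := isCompact_Icc.exists_bound_of_continuousOn h.continuousOn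
  refine MemLp.of_bound ?_ K (ae_lin_of_forall hK)
  exact (h.continuousOn.mono Ioo_subset_Icc_self).aestronglyMeasurable measurableSet_Ioo

lemma const_mul (h : F.IsH10 φ dφ) (c : ℝ) : F.IsH10 (fun z => c * φ z) (fun z => c * dφ z) :=
  ⟨MemLp.const_mul h.1 c, fun z hz => by
    rw [intervalIntegral.integral_const_mul]
    exact congrArg (c * ·) (h.2.1 z hz), by simp [h.2.2]⟩

lemma integral_mul (h : F.IsH10 φ dφ) (h' : F.IsH10 ψ dψ) {a b : ℝ} (ha : a ∈ Icc (-F.m) F.ℓ)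
    (hb : b ∈ Icc (-F.m) F.ℓ) (hab : a ≤ b) :
    ∫ z in a..b, (dφ z * ψ z + φ z * dψ z) = φ b * ψ b - φ a * ψ a := by
  refine integral_mul_primitive hab (h.intervalIntegrable ha hb) (h'.intervalIntegrable ha hb) ?_ ?_
  · exact fun z hz => h.eq_add ha ⟨ha.1.trans hz.1, hz.2.trans hb.2⟩
  · exact fun z hz => h'.eq_add ha ⟨ha.1.trans hz.1, hz.2.trans hb.2⟩

/-- `∫ c ψ ψ' ` over a subinterval, with a smooth weight. -/
lemma integral_weight (h : F.IsH10 ψ dψ) {a b : ℝ} (ha : a ∈ Icc (-F.m) F.ℓ)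
    (hb : b ∈ Icc (-F.m) F.ℓ) (hab : a ≤ b) {c c' : ℝ → ℝ}
    (hc : ∀ z ∈ Icc a b, HasDerivAt c (c' z) z) (hc' : ContinuousOn c' (Icc a b)) :
    ∫ z in a..b, (c' z * ψ z ^ 2 + c z * (2 * (ψ z * dψ z))) = c b * ψ b ^ 2 - c a * ψ a ^ 2 := by
  have hci : ∀ z ∈ Icc a b, IntervalIntegrable c' volume a z := fun z hz =>
    (hc'.mono (Icc_subset_Icc_right hz.2)).intervalIntegrable_of_Icc hz.1
  have hsub : ∀ z ∈ Icc a b, z ∈ Icc (-F.m) F.ℓ := fun z hz =>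
    ⟨ha.1.trans hz.1, hz.2.trans hb.2⟩
  have hψc : ContinuousOn ψ (uIcc a b) := by
    rw [uIcc_of_le hab]; exact h.continuousOn.mono hsub
  have hi : IntervalIntegrable (fun z => 2 * (ψ z * dψ z)) volume a b :=
    ((h.intervalIntegrable ha hb).continuousOn_mul hψc).const_mul 2
  refine integral_mul_primitive (f := c) (g := fun z => ψ z ^ 2) hab
    (hci b (right_mem_Icc.2 hab)) hi ?_ ?_
  · intro z hz
    rw [intervalIntegral.integral_eq_sub_of_hasDerivAt (f := c) (f' := c') ?_ (hci z hz)]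
    · ring
    · intro x hx
      rw [uIcc_of_le hz.1] at hx
      exact hc x ⟨hx.1, hx.2.trans hz.2⟩
  · intro z hz
    have := h.integral_mul h ha (hsub z hz) hz.1
    have e : ∀ y, 2 * (ψ y * dψ y) = dψ y * ψ y + ψ y * dψ y := fun y => by ring
    simp only [e, this]
    ring

end IsH10

/-- A smooth function compactly supported in `(-m, ℓ)` lies in `H¹₀`. -/
lemma isH10_of_contDiff {φ : ℝ → ℝ} (hφ : ContDiff ℝ ∞ φ) (hs : tsupport φ ⊆ Ioo (-F.m) F.ℓ) :
    F.IsH10 φ (deriv φ) := by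
  have hd : Continuous (deriv φ) := hφ.continuous_deriv (by simp)
  have h0 : ∀ z, z ∉ Ioo (-F.m) F.ℓ → φ z = 0 := fun z hz =>
    image_eq_zero_of_notMem_tsupport fun h => hz (hs h)
  refine ⟨?_, ?_, h0 _ (by simp)⟩
  · obtain ⟨K, hK⟩ := isCompact_Icc.exists_bound_of_continuousOn
      (hd.continuousOn (s := Icc (-F.m) F.ℓ))
    exact MemLp.of_bound hd.aestronglyMeasurable K (ae_lin_of_forall hK)
  · intro z hz
    rw [intervalIntegral.integral_deriv_eq_sub (fun x _ => hφ.differentiable (by simp) x)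
      (hd.intervalIntegrable _ _), h0 (-F.m) (by simp), sub_zero]

/-- A vector of `L²` orthogonal to all smooth functions with compact support in the interval is
zero, so their span is dense. The derivative of the approximant is not controlled; this is harmless
where the lemma is applied, since the inviscid energy does not contain `φ'`. -/
lemma exists_isH10_approx {f : ℝ → ℝ} (hf : MemLp f 2 F.lin) {e : ℝ} (he : 0 < e) :
    ∃ φ dφ, F.IsH10 φ dφ ∧ ∫ z, (φ z - f z) ^ 2 ∂F.lin < e := by
  let K : Submodule ℝ (Lp ℝ 2 F.lin) :=
    Submodule.span ℝ {u | ∃ φ : ℝ → ℝ, ContDiff ℝ ∞ φ ∧ HasCompactSupport φ ∧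
      tsupport φ ⊆ Ioo (-F.m) F.ℓ ∧ u =ᵐ[F.lin] φ}
  have hK : K.topologicalClosure = ⊤ := by
    rw [Submodule.topologicalClosure_eq_top_iff, Submodule.eq_bot_iff]
    intro u hu
    have hui : Integrable u F.lin := MemLp.integrable (q := 2) (by norm_num) (Lp.memLp u)
    have hz : ∀ᵐ z ∂(volume : Measure ℝ), z ∈ Ioo (-F.m) F.ℓ → u z = 0 := by
      refine isOpen_Ioo.ae_eq_zero_of_integral_contDiff_smul_eq_zero
        (IntegrableOn.locallyIntegrableOn hui) fun φ h1 h2 h3 => ?_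
      have hφ := isH10_of_contDiff h1 h3
      have h4 := (Submodule.mem_orthogonal K u).1 hu (hφ.memLp.toLp φ)
        (Submodule.subset_span ⟨φ, h1, h2, h3, hφ.memLp.coeFn_toLp⟩)
      rw [L2.inner_def] at h4
      rw [← setIntegral_eq_integral_of_forall_compl_eq_zero (s := Ioo (-F.m) F.ℓ)]
      · refine Eq.trans (integral_congr_ae ?_) h4
        filter_upwards [hφ.memLp.coeFn_toLp] with z hz
        simp [hz, mul_comm]
      · intro z hz
        rw [image_eq_zero_of_notMem_tsupport fun h => hz (h3 h), zero_smul]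
    refine Lp.ext ?_
    filter_upwards [(ae_restrict_iff' measurableSet_Ioo).2 hz, Lp.coeFn_zero ℝ 2 F.lin] with z h1 h2
    rw [h1, h2]; rfl
  have hspan : ∀ u ∈ K, ∃ φ dφ, F.IsH10 φ dφ ∧ u =ᵐ[F.lin] φ := by
    intro u hu
    induction hu using Submodule.span_induction with
    | mem u h =>
      obtain ⟨φ, h1, h2, h3, h4⟩ := h
      exact ⟨φ, deriv φ, isH10_of_contDiff h1 h3, h4⟩
    | zero => exact ⟨fun _ => 0, fun _ => 0, ⟨by simp, by simp, rfl⟩, Lp.coeFn_zero ℝ 2 F.lin⟩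
    | add u v _ _ h1 h2 =>
      obtain ⟨φ, dφ, h, h'⟩ := h1
      obtain ⟨ψ, dψ, k, k'⟩ := h2
      refine ⟨fun z => φ z + ψ z, fun z => dφ z + dψ z, ⟨h.1.add k.1, fun z hz => ?_, ?_⟩, ?_⟩
      · have hl := left_mem_Icc.2 (neg_m_lt_ℓ (F := F)).le
        rw [intervalIntegral.integral_add (h.intervalIntegrable hl hz)
          (k.intervalIntegrable hl hz), ← h.2.1 z hz, ← k.2.1 z hz]
      · simp [h.2.2, k.2.2]
      · filter_upwards [Lp.coeFn_add u v, h', k'] with z h1 h2 h3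
        rw [h1, Pi.add_apply, h2, h3]
    | smul c u _ h1 =>
      obtain ⟨φ, dφ, h, h'⟩ := h1
      refine ⟨_, _, h.const_mul c, ?_⟩
      filter_upwards [Lp.coeFn_smul c u, h'] with z h1 h2
      rw [h1, Pi.smul_apply, h2, smul_eq_mul]
  have hmem : hf.toLp f ∈ closure (K : Set (Lp ℝ 2 F.lin)) := by
    rw [← Submodule.topologicalClosure_coe, hK]; trivial
  obtain ⟨u, hu, hdist⟩ := Metric.mem_closure_iff.1 hmem (Real.sqrt e) (Real.sqrt_pos.2 he)
  obtain ⟨φ, dφ, hφ, hu'⟩ := hspan u hu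
  refine ⟨φ, dφ, hφ, ?_⟩
  rw [dist_comm, dist_eq_norm] at hdist
  have h1 : ∫ z, (φ z - f z) ^ 2 ∂F.lin = ‖u - hf.toLp f‖ ^ 2 := by
    rw [← real_inner_self_eq_norm_sq, L2.inner_def]
    refine integral_congr_ae ?_
    filter_upwards [Lp.coeFn_sub u (hf.toLp f), hf.coeFn_toLp, hu'] with z h1 h2 h3
    rw [h1, Pi.sub_apply, h2, h3]
    simp [pow_two]
  rw [h1]
  calc ‖u - hf.toLp f‖ ^ 2 < Real.sqrt e ^ 2 := by gcongr
    _ = e := Real.sq_sqrt he.le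

end Setup
end RayleighTaylor
end

/-! ### The variational problem: existence, uniform bound and use of growth rates -/

noncomputable section
namespace RayleighTaylor
open Filter Topology

namespace Setup

variable {F : Setup} {k s : ℝ} {φ dφ ψ dψ : ℝ → ℝ}

variable (F) in
/-- The inviscid part of the energy. -/
def potential (k : ℝ) (φ ψ dψ : ℝ → ℝ) : ℝ :=
  F.σ * k ^ 2 / 2 * ψ 0 ^ 2 + 1 / 2 * ∫ z, (F.dP z * F.ρ₀ z * (dψ z + k * φ z) ^ 2
    - 2 * F.g * F.ρ₀ z * k * φ z * ψ z) ∂F.lin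

variable (F) in
/-- The viscous part of the energy. -/
def dissipation (k : ℝ) (φ dφ ψ dψ : ℝ → ℝ) : ℝ :=
  1 / 2 * ∫ z, (F.δ₀ z * (dψ z + k * φ z) ^ 2
    + F.ε₀ z * ((dφ z - k * ψ z) ^ 2 + (dψ z - k * φ z) ^ 2
        + 1 / 3 * (dψ z + k * φ z) ^ 2)) ∂F.lin

lemma coef_dPρ : F.Coef fun z => F.dP z * F.ρ₀ z := coef_dP.mul coef_ρ₀

lemma coef_inv_dP : F.Coef fun z => (F.dP z)⁻¹ := by
  refine ⟨fun z => (deriv F.lower.P (F.ρlow z))⁻¹, fun z => (deriv F.upper.P (F.ρup z))⁻¹,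
    ?_, ?_, ?_, ?_⟩
  · intro z hz
    have hp := Phase.layerDensity_pos (F.exists_low hz)
    exact (ContDiffAt.comp z (F.lower.contDiffOn_deriv_P.contDiffAt
      (Ioi_mem_nhds hp)) (isCoef_ρ₀.low_smooth z hz)).inv (F.lower.P_deriv_pos _ hp).ne'
  · intro z hz
    have hp := Phase.layerDensity_pos (F.exists_up hz)
    exact (ContDiffAt.comp z (F.upper.contDiffOn_deriv_P.contDiffAt
      (Ioi_mem_nhds hp)) (isCoef_ρ₀.up_smooth z hz)).inv (F.upper.P_deriv_pos _ hp).ne'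
  · intro z hz; simp [dP, phase, hz, F.ρ₀_of_neg hz]
  · intro z hz; simp [dP, phase, not_lt.2 hz, F.ρ₀_of_nonneg hz]

lemma memLp_lin (hφ : MemLp φ 2 F.lin) (hdψ : MemLp dψ 2 F.lin) (a : ℝ) :
    MemLp (fun z => dψ z + a * φ z) 2 F.lin := hdψ.add (hφ.const_mul a)

lemma integrable_potential (hφ : MemLp φ 2 F.lin) (hψ : MemLp ψ 2 F.lin)
    (hdψ : MemLp dψ 2 F.lin) :
    Integrable (fun z => F.dP z * F.ρ₀ z * (dψ z + k * φ z) ^ 2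
      - 2 * F.g * F.ρ₀ z * k * φ z * ψ z) F.lin := by
  refine (coef_dPρ.integrable_sq (memLp_lin hφ hdψ k)).sub ?_
  refine ((coef_ρ₀.integrable_mul hφ hψ).const_mul (2 * F.g * k)).congr (.of_forall fun z => ?_)
  ring

lemma integrable_dissipation (hφ : MemLp φ 2 F.lin) (hdφ : MemLp dφ 2 F.lin)
    (hψ : MemLp ψ 2 F.lin) (hdψ : MemLp dψ 2 F.lin) :
    Integrable (fun z => F.δ₀ z * (dψ z + k * φ z) ^ 2
      + F.ε₀ z * ((dφ z - k * ψ z) ^ 2 + (dψ z - k * φ z) ^ 2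
        + 1 / 3 * (dψ z + k * φ z) ^ 2)) F.lin := by
  refine (coef_δ₀.integrable_sq (memLp_lin hφ hdψ k)).add ?_
  have h1 := coef_ε₀.integrable_sq (memLp_lin hψ hdφ (-k))
  have h2 := coef_ε₀.integrable_sq (memLp_lin hφ hdψ (-k))
  have h3 := (coef_ε₀.integrable_sq (memLp_lin hφ hdψ k)).const_mul (1 / 3)
  refine ((h1.add h2).add h3).congr (.of_forall fun z => ?_)
  simp only [Pi.add_apply]
  ring

lemma energy_eq (hφ : F.IsH10 φ dφ) (hψ : F.IsH10 ψ dψ) :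
    F.energy k s φ dφ ψ dψ = F.potential k φ ψ dψ + s * F.dissipation k φ dφ ψ dψ := by
  have h1 := integrable_potential (k := k) hφ.memLp hψ.memLp hψ.1
  have h2 := coef_δ₀.integrable_sq (memLp_lin hφ.memLp hψ.1 k)
  have h3 := (integrable_dissipation (k := k) hφ.memLp hφ.1 hψ.memLp hψ.1).sub h2
  simp only [energy, potential, dissipation, integral_lin]
  have e1 : ∀ z, (s * F.δ₀ z + F.dP z * F.ρ₀ z) * (dψ z + k * φ z) ^ 2
        - 2 * F.g * F.ρ₀ z * k * φ z * ψ z = (F.dP z * F.ρ₀ z * (dψ z + k * φ z) ^ 2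
      - 2 * F.g * F.ρ₀ z * k * φ z * ψ z) + s * (F.δ₀ z * (dψ z + k * φ z) ^ 2) :=
    fun z => by ring
  have e2 : ∀ z, s * F.ε₀ z * ((dφ z - k * ψ z) ^ 2 + (dψ z - k * φ z) ^ 2
        + 1 / 3 * (dψ z + k * φ z) ^ 2) = s * ((F.δ₀ z * (dψ z + k * φ z) ^ 2
      + F.ε₀ z * ((dφ z - k * ψ z) ^ 2 + (dψ z - k * φ z) ^ 2
        + 1 / 3 * (dψ z + k * φ z) ^ 2)) - F.δ₀ z * (dψ z + k * φ z) ^ 2) := fun z => by ring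
  simp only [e1, e2]
  rw [integral_add h1 (h2.const_mul s), integral_const_mul, integral_const_mul, integral_sub
    (integrable_dissipation (k := k) hφ.memLp hφ.1 hψ.memLp hψ.1) h2]
  ring

lemma integrable_mass (hφ : MemLp φ 2 F.lin) (hψ : MemLp ψ 2 F.lin) :
    Integrable (fun z => F.ρ₀ z * (φ z ^ 2 + ψ z ^ 2)) F.lin := by
  simpa only [mul_add] using! (coef_ρ₀.integrable_sq hφ).add (coef_ρ₀.integrable_sq hψ)

lemma mass_eq : F.mass φ ψ = 1 / 2 * ∫ z, F.ρ₀ z * (φ z ^ 2 + ψ z ^ 2) ∂F.lin := by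
  rw [mass, integral_lin]

lemma mass_nonneg : 0 ≤ F.mass φ ψ := by
  rw [mass_eq]
  refine mul_nonneg (by norm_num) (integral_nonneg_of_ae (ae_lin_of_forall fun z hz => ?_))
  have := ρ₀_pos hz
  simp only [Pi.zero_apply]
  positivity

lemma dissipation_nonneg : 0 ≤ F.dissipation k φ dφ ψ dψ := by
  refine mul_nonneg (by norm_num) (integral_nonneg_of_ae (ae_lin_of_forall fun z hz => ?_))
  have h1 := ε₀_pos hz
  have h2 := δ₀_nonneg hz
  simp only [Pi.zero_apply]
  positivity

lemma potential_lower (hφ : MemLp φ 2 F.lin) (hψ : MemLp ψ 2 F.lin)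
    (hdψ : MemLp dψ 2 F.lin) (hk : 0 ≤ k) :
    -(F.g * k * F.mass φ ψ) ≤ F.potential k φ ψ dψ := by
  have h0 : 0 ≤ F.σ * k ^ 2 / 2 * ψ 0 ^ 2 := by have := F.σ_nonneg; positivity
  have h1 : ∫ z, -(F.g * k) * (F.ρ₀ z * (φ z ^ 2 + ψ z ^ 2)) ∂F.lin ≤
      ∫ z, (F.dP z * F.ρ₀ z * (dψ z + k * φ z) ^ 2
    - 2 * F.g * F.ρ₀ z * k * φ z * ψ z) ∂F.lin := by
    refine integral_mono_ae ((integrable_mass hφ hψ).const_mul _)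
      (integrable_potential hφ hψ hdψ) (ae_lin_of_forall fun z hz => ?_)
    have h1 := ρ₀_pos hz
    have h2 := dP_pos hz
    have h3 : 0 ≤ F.dP z * F.ρ₀ z * (dψ z + k * φ z) ^ 2 := by positivity
    have h4 : 0 ≤ F.g * k * F.ρ₀ z * (φ z - ψ z) ^ 2 := by have := F.g_pos; positivity
    nlinarith
  rw [integral_const_mul] at h1
  rw [potential, mass_eq]
  linarith

/-- Completing the square in the inviscid energy. -/
lemma potential_eq (hφ : MemLp φ 2 F.lin) (hψ : F.IsH10 ψ dψ) :
    F.potential k φ ψ dψ = 1 / 2 * (F.σ * k ^ 2 - F.g * F.jumpρ) * ψ 0 ^ 2 +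
      1 / 2 * ∫ z, F.dP z * F.ρ₀ z * (dψ z + k * φ z - F.g * ((F.dP z)⁻¹ * ψ z)) ^ 2 ∂F.lin := by
  have hψi := coef_inv_dP.memLp_mul hψ.memLp
  have hsq : Integrable (fun z => F.dP z * F.ρ₀ z *
      (dψ z + k * φ z - F.g * ((F.dP z)⁻¹ * ψ z)) ^ 2) F.lin :=
    coef_dPρ.integrable_sq ((memLp_lin hφ hψ.1 k).sub (hψi.const_mul F.g))
  have hpot := integrable_potential (k := k) hφ hψ.memLp hψ.1
  -- By the hydrostatic law, `q` is the derivative of `ρ₀ψ²` in each layer. Its integral is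
  -- therefore a pure interface term, `(ρm - ρp) ψ(0)²`, which produces the destabilising
  -- `-g⟦ρ₀⟧ψ(0)²`.
  set q : ℝ → ℝ := fun z => -(F.g * F.ρ₀ z / F.dP z) * ψ z ^ 2 + F.ρ₀ z * (2 * (ψ z * dψ z))
    with hq
  have hdecomp : ∀ᵐ z ∂F.lin, F.dP z * F.ρ₀ z * (dψ z + k * φ z) ^ 2
      - 2 * F.g * F.ρ₀ z * k * φ z * ψ z = F.dP z * F.ρ₀ z *
      (dψ z + k * φ z - F.g * ((F.dP z)⁻¹ * ψ z)) ^ 2 + F.g * q z := by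
    refine ae_lin_of_forall fun z hz => ?_
    have := (dP_pos hz).ne'
    simp only [hq]
    field_simp
    ring
  have hqi : Integrable q F.lin := by
    have h2 := ((coef_ρ₀.mul coef_inv_dP).integrable_sq hψ.memLp).const_mul (-F.g)
    have h3 := (coef_ρ₀.integrable_mul hψ.memLp hψ.1).const_mul 2
    refine (h2.add h3).congr (.of_forall fun z => ?_)
    simp only [Pi.add_apply, hq]
    ring
  have hqint : ∫ z, q z ∂F.lin = -F.jumpρ * ψ 0 ^ 2 := by
    rw [← integral_lin]
    have hii : ∀ a ∈ Icc (-F.m) F.ℓ, ∀ b ∈ Icc (-F.m) F.ℓ, IntervalIntegrable q volume a b := by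
      intro a ha b hb
      have h1 : IntegrableOn q (Icc (-F.m) F.ℓ) := by
        rw [integrableOn_Icc_iff_integrableOn_Ioo]; exact hqi
      exact (h1.mono_set (uIcc_subset_Icc ha hb)).intervalIntegrable
    have hl := left_mem_Icc.2 (neg_m_lt_ℓ (F := F)).le
    have hr := right_mem_Icc.2 (neg_m_lt_ℓ (F := F)).le
    have h0 := zero_mem (F := F)
    rw [← intervalIntegral.integral_add_adjacent_intervals (hii _ hl _ h0) (hii _ h0 _ hr)]
    have hlow := hψ.integral_weight hl h0 h0.1 (c := F.ρlow)
      (c' := fun z => -(F.g * F.ρlow z / deriv F.lower.P (F.ρlow z)))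
      (fun z hz => hasDerivAt_ρlow hz) (by
        intro z hz
        have hp := Phase.layerDensity_pos (F.exists_low hz)
        have hc : ContinuousAt F.ρlow z := (isCoef_ρ₀.low_smooth z hz).continuousAt
        have hd : ContinuousAt (deriv F.lower.P) (F.ρlow z) :=
          (F.lower.contDiffOn_deriv_P.contDiffAt (Ioi_mem_nhds hp)).continuousAt
        exact ((continuousAt_const.mul hc).div (ContinuousAt.comp (f := F.ρlow) hd hc)
          (F.lower.P_deriv_pos _ hp).ne').neg.continuousWithinAt)
    have hup := hψ.integral_weight h0 hr h0.2 (c := F.ρup)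
      (c' := fun z => -(F.g * F.ρup z / deriv F.upper.P (F.ρup z)))
      (fun z hz => hasDerivAt_ρup hz) (by
        intro z hz
        have hp := Phase.layerDensity_pos (F.exists_up hz)
        have hc : ContinuousAt F.ρup z := (isCoef_ρ₀.up_smooth z hz).continuousAt
        have hd : ContinuousAt (deriv F.upper.P) (F.ρup z) :=
          (F.upper.contDiffOn_deriv_P.contDiffAt (Ioi_mem_nhds hp)).continuousAt
        exact ((continuousAt_const.mul hc).div (ContinuousAt.comp (f := F.ρup) hd hc)
          (F.upper.P_deriv_pos _ hp).ne').neg.continuousWithinAt)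
    have e1 : ∫ z in (-F.m)..0, q z = ∫ z in (-F.m)..0,
        (-(F.g * F.ρlow z / deriv F.lower.P (F.ρlow z)) * ψ z ^ 2
          + F.ρlow z * (2 * (ψ z * dψ z))) := by
      refine intervalIntegral.integral_congr_ae ?_
      -- The height `0` belongs to the upper fluid by convention and must be discarded before the
      -- lower extension may be used.
      have : ∀ᵐ z : ℝ, z ≠ 0 := by simp [ae_iff]
      filter_upwards [this] with z hz0 hz
      rw [uIoc_of_le h0.1] at hz
      have hz' : z < 0 := lt_of_le_of_ne hz.2 hz0
      simp [hq, dP, phase, hz', F.ρ₀_of_neg hz']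
    have e2 : ∫ z in (0)..F.ℓ, q z = ∫ z in (0)..F.ℓ,
        (-(F.g * F.ρup z / deriv F.upper.P (F.ρup z)) * ψ z ^ 2
          + F.ρup z * (2 * (ψ z * dψ z))) := by
      refine intervalIntegral.integral_congr fun z hz => ?_
      rw [uIcc_of_le h0.2] at hz
      simp [hq, dP, phase, not_lt.2 hz.1, F.ρ₀_of_nonneg hz.1]
    rw [e1, e2, hlow, hup, ρlow_zero, ρup_zero, hψ.2.2, hψ.left_eq, jumpρ]
    ring
  rw [potential, integral_congr_ae hdecomp, integral_add hsq (hqi.const_mul _),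
    integral_const_mul, hqint]
  ring

variable (F) in
/-- The set whose infimum is `μ`. -/
def energySet (k s : ℝ) : Set ℝ :=
  {e | ∃ φ dφ ψ dψ : ℝ → ℝ, F.IsH10 φ dφ ∧ F.IsH10 ψ dψ ∧ F.mass φ ψ = 1 ∧
    e = F.energy k s φ dφ ψ dψ}

lemma energy_lower (hφ : F.IsH10 φ dφ) (hψ : F.IsH10 ψ dψ) (hk : 0 ≤ k) (hs : 0 ≤ s) :
    -(F.g * k * F.mass φ ψ) ≤ F.energy k s φ dφ ψ dψ := by
  rw [energy_eq hφ hψ]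
  have := potential_lower (k := k) hφ.memLp hψ.memLp hψ.1 hk
  have := mul_nonneg hs (dissipation_nonneg (F := F) (k := k) (φ := φ) (dφ := dφ) (ψ := ψ)
    (dψ := dψ))
  linarith

/-- Without a lower bound the real infimum defining `μ` would be a meaningless default value. -/
lemma bddBelow_energySet (hk : 0 ≤ k) (hs : 0 ≤ s) : BddBelow (F.energySet k s) := by
  refine ⟨-(F.g * k), ?_⟩
  rintro e ⟨φ, dφ, ψ, dψ, h1, h2, h3, rfl⟩
  have := energy_lower h1 h2 hk hs
  rwa [h3, mul_one] at this

lemma potential_const_mul (c : ℝ) :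
    F.potential k (fun z => c * φ z) (fun z => c * ψ z) (fun z => c * dψ z) =
      c ^ 2 * F.potential k φ ψ dψ := by
  have e : ∀ z, F.dP z * F.ρ₀ z * (c * dψ z + k * (c * φ z)) ^ 2
    - 2 * F.g * F.ρ₀ z * k * (c * φ z) * (c * ψ z) = c ^ 2 * (F.dP z * F.ρ₀ z *
      (dψ z + k * φ z) ^ 2 - 2 * F.g * F.ρ₀ z * k * φ z * ψ z) := fun z => by ring
  simp only [potential, e, integral_const_mul]
  ring

lemma dissipation_const_mul (c : ℝ) :
    F.dissipation k (fun z => c * φ z) (fun z => c * dφ z) (fun z => c * ψ z)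
      (fun z => c * dψ z) = c ^ 2 * F.dissipation k φ dφ ψ dψ := by
  have e : ∀ z, F.δ₀ z * (c * dψ z + k * (c * φ z)) ^ 2
      + F.ε₀ z * ((c * dφ z - k * (c * ψ z)) ^ 2 + (c * dψ z - k * (c * φ z)) ^ 2
        + 1 / 3 * (c * dψ z + k * (c * φ z)) ^ 2) = c ^ 2 * (F.δ₀ z * (dψ z + k * φ z) ^ 2
      + F.ε₀ z * ((dφ z - k * ψ z) ^ 2 + (dψ z - k * φ z) ^ 2
        + 1 / 3 * (dψ z + k * φ z) ^ 2)) := fun z => by ring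
  simp only [dissipation, e, integral_const_mul]
  ring

lemma mass_const_mul (c : ℝ) :
    F.mass (fun z => c * φ z) (fun z => c * ψ z) = c ^ 2 * F.mass φ ψ := by
  have e : ∀ z, F.ρ₀ z * ((c * φ z) ^ 2 + (c * ψ z) ^ 2) =
      c ^ 2 * (F.ρ₀ z * (φ z ^ 2 + ψ z ^ 2)) := fun z => by ring
  simp only [mass_eq, e, integral_const_mul]
  ring

lemma energy_const_mul (hφ : F.IsH10 φ dφ) (hψ : F.IsH10 ψ dψ) (c : ℝ) :
    F.energy k s (fun z => c * φ z) (fun z => c * dφ z) (fun z => c * ψ z)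
      (fun z => c * dψ z) = c ^ 2 * F.energy k s φ dφ ψ dψ := by
  rw [energy_eq (hφ.const_mul c) (hψ.const_mul c), energy_eq hφ hψ, potential_const_mul,
    dissipation_const_mul]
  ring

/-- The variational bound for arbitrary pairs. -/
lemma μ_mul_mass_le (hφ : F.IsH10 φ dφ) (hψ : F.IsH10 ψ dψ) (hk : 0 ≤ k) (hs : 0 ≤ s) :
    F.μ k s * F.mass φ ψ ≤ F.energy k s φ dφ ψ dψ := by
  rcases (mass_nonneg (F := F) (φ := φ) (ψ := ψ)).eq_or_lt with h | h
  -- A pair of zero mass cannot be normalised; here the elementary lower bound already gives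
  -- nonnegative energy.
  · have := energy_lower hφ hψ hk hs
    rw [← h] at this ⊢
    simpa using this
  · set c := (Real.sqrt (F.mass φ ψ))⁻¹ with hc
    have hc2 : c ^ 2 * F.mass φ ψ = 1 := by
      rw [hc, inv_pow, Real.sq_sqrt h.le, inv_mul_cancel₀ h.ne']
    have hle : F.μ k s ≤ c ^ 2 * F.energy k s φ dφ ψ dψ :=
      csInf_le (bddBelow_energySet hk hs) ⟨_, _, _, _, hφ.const_mul c, hψ.const_mul c,
        by rw [mass_const_mul, hc2], (energy_const_mul hφ hψ c).symm⟩
    calc F.μ k s * F.mass φ ψ ≤ c ^ 2 * F.energy k s φ dφ ψ dψ * F.mass φ ψ := by gcongr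
      _ = F.energy k s φ dφ ψ dψ * (c ^ 2 * F.mass φ ψ) := by ring
      _ = _ := by rw [hc2, mul_one]

variable (F) in
/-- The derivative of the piecewise linear hat function on `(-m, ℓ)` with peak at the interface. -/
def hatDeriv (z : ℝ) : ℝ := if z ≤ 0 then F.m⁻¹ else -F.ℓ⁻¹

variable (F) in
/-- The piecewise linear hat function on `(-m, ℓ)` with peak `1` at the interface. -/
def hat (z : ℝ) : ℝ := ∫ y in (-F.m)..z, F.hatDeriv y

lemma measurable_hatDeriv : Measurable F.hatDeriv :=
  Measurable.ite measurableSet_Iic measurable_const measurable_const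

lemma intervalIntegrable_hatDeriv (a b : ℝ) : IntervalIntegrable F.hatDeriv volume a b := by
  refine (intervalIntegrable_const (c := F.m⁻¹ + F.ℓ⁻¹)).mono_fun
    measurable_hatDeriv.aestronglyMeasurable (.of_forall fun z => ?_)
  have h1 := inv_pos.2 F.m_pos
  have h2 := inv_pos.2 F.ℓ_pos
  simp only [hatDeriv, Real.norm_eq_abs]
  rw [abs_of_pos (add_pos h1 h2)]
  split_ifs
  · rw [abs_of_pos h1]; linarith
  · rw [abs_neg, abs_of_pos h2]; linarith

lemma hat_zero : F.hat 0 = 1 := by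
  have : ∫ y in (-F.m)..0, F.hatDeriv y = ∫ y in (-F.m)..0, F.m⁻¹ := by
    refine intervalIntegral.integral_congr fun z hz => ?_
    rw [uIcc_of_le zero_mem.1] at hz
    simp [hatDeriv, hz.2]
  rw [hat, this, intervalIntegral.integral_const]
  simp [F.m_pos.ne']

lemma isH10_hat : F.IsH10 F.hat F.hatDeriv := by
  refine ⟨?_, fun z _ => rfl, ?_⟩
  · refine MemLp.of_bound measurable_hatDeriv.aestronglyMeasurable (F.m⁻¹ + F.ℓ⁻¹)
      (.of_forall fun z => ?_)
    have h1 := inv_pos.2 F.m_pos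
    have h2 := inv_pos.2 F.ℓ_pos
    simp only [hatDeriv, Real.norm_eq_abs]
    split_ifs
    · rw [abs_of_pos h1]; linarith
    · rw [abs_neg, abs_of_pos h2]; linarith
  · have h0 : F.hat F.ℓ = F.hat 0 + ∫ y in (0)..F.ℓ, F.hatDeriv y := by
      rw [hat, hat, intervalIntegral.integral_add_adjacent_intervals
        (intervalIntegrable_hatDeriv _ _) (intervalIntegrable_hatDeriv _ _)]
    have : ∫ y in (0)..F.ℓ, F.hatDeriv y = ∫ y in (0)..F.ℓ, -F.ℓ⁻¹ := by
      refine intervalIntegral.integral_congr_ae (.of_forall fun z hz => ?_)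
      rw [uIoc_of_le F.ℓ_pos.le] at hz
      simp [hatDeriv, not_le.2 hz.1]
    rw [h0, hat_zero, this, intervalIntegral.integral_const]
    simp [F.ℓ_pos.ne']

/-- Below the critical frequency the inviscid energy takes negative values. -/
lemma exists_potential_neg (hk : 0 < k) (hc : F.σ * k ^ 2 < F.g * F.jumpρ) :
    ∃ φ dφ ψ dψ, F.IsH10 φ dφ ∧ F.IsH10 ψ dψ ∧ F.potential k φ ψ dψ < 0 := by
  have hψ := isH10_hat (F := F)
  obtain ⟨K, hK0, hK⟩ := (coef_dPρ (F := F)).bounded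
  -- This choice of `φ` annihilates the completed square when `ψ` is the hat function. Its
  -- derivative term jumps at the interface, so it is only approximated by `H¹₀` functions in `L²`;
  -- the tolerance `d / (K k²)` keeps the square below the gain `d` from the trace `ψ(0) = 1`.
  have hf : MemLp (fun z => k⁻¹ * (F.g * ((F.dP z)⁻¹ * F.hat z) - F.hatDeriv z)) 2 F.lin :=
    (((coef_inv_dP.memLp_mul hψ.memLp).const_mul F.g).sub hψ.1).const_mul _
  set d := F.g * F.jumpρ - F.σ * k ^ 2 with hd
  have hd0 : 0 < d := sub_pos.2 hc
  obtain ⟨φ, dφ, hφ, hlt⟩ := exists_isH10_approx hf (e := d / (K * k ^ 2)) (by positivity)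
  refine ⟨φ, dφ, _, _, hφ, hψ, ?_⟩
  rw [potential_eq hφ.memLp hψ, hat_zero]
  have hint := (hφ.memLp.sub hf).integrable_sq
  have h1 : ∫ z, F.dP z * F.ρ₀ z *
      (F.hatDeriv z + k * φ z - F.g * ((F.dP z)⁻¹ * F.hat z)) ^ 2 ∂F.lin ≤
      ∫ z, (K * k ^ 2) *
        (φ z - k⁻¹ * (F.g * ((F.dP z)⁻¹ * F.hat z) - F.hatDeriv z)) ^ 2 ∂F.lin := by
    refine integral_mono_ae (coef_dPρ.integrable_sq ((memLp_lin hφ.memLp hψ.1 k).sub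
      ((coef_inv_dP.memLp_mul hψ.memLp).const_mul F.g))) (hint.const_mul _)
      (ae_lin_of_forall fun z hz => ?_)
    have e : F.hatDeriv z + k * φ z - F.g * ((F.dP z)⁻¹ * F.hat z) =
        k * (φ z - k⁻¹ * (F.g * ((F.dP z)⁻¹ * F.hat z) - F.hatDeriv z)) := by
      field_simp; ring
    simp only [e, mul_pow]
    rw [← mul_assoc]
    gcongr
    exact (le_abs_self _).trans (hK z hz)
  rw [integral_const_mul] at h1
  have h2 : (K * k ^ 2) * ∫ z, (φ z - k⁻¹ * (F.g * ((F.dP z)⁻¹ * F.hat z) - F.hatDeriv z)) ^ 2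
      ∂F.lin < d := by
    have := (mul_lt_mul_iff_right₀ (by positivity : 0 < K * k ^ 2)).2 hlt
    rwa [mul_div_cancel₀ _ (by positivity)] at this
  have : F.σ * k ^ 2 - F.g * F.jumpρ = -d := by rw [hd]; ring
  rw [this]
  linarith

/-- A nonzero pair can be rescaled to unit mass. The hat function qualifies: if its mass were zero
it would vanish identically by continuity, while its value at the interface is `1`. -/
lemma energySet_nonempty : (F.energySet k s).Nonempty := by
  have hψ := isH10_hat (F := F)
  have hpos : 0 < F.mass F.hat F.hat := by
    rcases (mass_nonneg (F := F) (φ := F.hat) (ψ := F.hat)).eq_or_lt with h | h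
    · exfalso
      have h1 := potential_lower (k := 0) hψ.memLp hψ.memLp hψ.1 le_rfl
      rw [mass_eq] at h
      have h2 : ∫ z, F.ρ₀ z * (F.hat z ^ 2 + F.hat z ^ 2) ∂F.lin = 0 := by linarith
      rw [integral_eq_zero_iff_of_nonneg_ae
        (ae_lin_of_forall fun z hz => by have := ρ₀_pos hz; simp only [Pi.zero_apply]; positivity)
        (integrable_mass hψ.memLp hψ.memLp)] at h2
      have h3 : ∀ᵐ z ∂F.lin, F.hat z = 0 := by
        filter_upwards [h2, ae_lin_of_forall fun z hz => (ρ₀_pos (F := F) hz).ne'] with z h h'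
        simp only [Pi.zero_apply, mul_eq_zero, h', false_or] at h
        nlinarith [sq_nonneg (F.hat z)]
      have h4 : EqOn F.hat (fun _ => 0) (Ioo (-F.m) F.ℓ) :=
        Measure.eqOn_open_of_ae_eq h3 isOpen_Ioo
          (hψ.continuousOn.mono Ioo_subset_Icc_self) continuousOn_const
      have h5 := h4 ⟨by linarith [F.m_pos], F.ℓ_pos⟩
      rw [hat_zero] at h5
      norm_num at h5
    · exact h
  set c := (Real.sqrt (F.mass F.hat F.hat))⁻¹ with hc
  refine ⟨_, _, _, _, _, hψ.const_mul c, hψ.const_mul c, ?_, rfl⟩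
  rw [mass_const_mul, hc, inv_pow, Real.sq_sqrt hpos.le, inv_mul_cancel₀ hpos.ne']

lemma neg_le_μ (hk : 0 ≤ k) (hs : 0 ≤ s) : -(F.g * k) ≤ F.μ k s := by
  refine le_csInf energySet_nonempty ?_
  rintro e ⟨φ, dφ, ψ, dψ, h1, h2, h3, rfl⟩
  have := energy_lower h1 h2 hk hs
  rwa [h3, mul_one] at this

/-- The parameter `s` multiplies the dissipation, which is nonnegative. -/
lemma μ_mono (hk : 0 ≤ k) {s t : ℝ} (hs : 0 ≤ s) (hst : s ≤ t) : F.μ k s ≤ F.μ k t := by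
  refine le_csInf energySet_nonempty ?_
  rintro e ⟨φ, dφ, ψ, dψ, h1, h2, h3, rfl⟩
  have := μ_mul_mass_le h1 h2 hk hs
  rw [h3, mul_one] at this
  refine this.trans ?_
  rw [energy_eq h1 h2, energy_eq h1 h2]
  have := dissipation_nonneg (F := F) (k := k) (φ := φ) (dφ := dφ) (ψ := ψ) (dψ := dψ)
  nlinarith

/-- For a normalised pair the potential plus `g k` is nonnegative, so `(E(·; s) + g k) / s` is
nonincreasing in `s`, and the infimum inherits this. Together with monotonicity it controls `μ` from
both sides. -/
lemma μ_scale (hk : 0 ≤ k) {s t : ℝ} (hs : 0 < s) (hst : s ≤ t) :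
    s * (F.μ k t + F.g * k) ≤ t * (F.μ k s + F.g * k) := by
  have ht : 0 < t := hs.trans_le hst
  suffices h : s / t * (F.μ k t + F.g * k) - F.g * k ≤ F.μ k s by
    have := mul_le_mul_of_nonneg_left h ht.le
    field_simp at this
    linarith
  refine le_csInf energySet_nonempty ?_
  rintro e ⟨φ, dφ, ψ, dψ, h1, h2, h3, rfl⟩
  have h4 := μ_mul_mass_le (k := k) h1 h2 hk ht.le
  have h5 := potential_lower (k := k) h1.memLp h2.memLp h2.1 hk
  rw [h3, mul_one] at h4 h5
  rw [energy_eq h1 h2] at h4 ⊢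
  have h6 : s / t * (F.μ k t + F.g * k) ≤ s / t *
      (F.potential k φ ψ dψ + t * F.dissipation k φ dφ ψ dψ + F.g * k) := by gcongr
  have h7 : s / t * (F.potential k φ ψ dψ + t * F.dissipation k φ dφ ψ dψ + F.g * k) =
      s / t * (F.potential k φ ψ dψ + F.g * k) + s * F.dissipation k φ dφ ψ dψ := by
    field_simp; ring
  have h8 : s / t * (F.potential k φ ψ dψ + F.g * k) ≤ 1 * (F.potential k φ ψ dψ + F.g * k) := by
    gcongr
    · linarith
    · exact (div_le_one ht).2 hst
  linarith

/-- Monotonicity and the scaling inequality squeeze `μ(k, t)` between the minimum and the maximum of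
`μ(k, s)` and `(t / s)(μ(k, s) + g k) - g k`, which coincide at `t = s`. No minimiser is needed. -/
lemma μ_continuousOn (hk : 0 ≤ k) : ContinuousOn (F.μ k) (Ioi 0) := by
  intro s hs
  have hs : 0 < s := hs
  refine ContinuousAt.continuousWithinAt ?_
  have hM : 0 ≤ F.μ k s + F.g * k := by linarith [neg_le_μ (F := F) hk hs.le]
  have hup : Tendsto (fun t => max (F.μ k s) (t / s * (F.μ k s + F.g * k) - F.g * k)) (𝓝 s)
      (𝓝 (F.μ k s)) := by
    have : Tendsto (fun t => max (F.μ k s) (t / s * (F.μ k s + F.g * k) - F.g * k)) (𝓝 s)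
      (𝓝 (max (F.μ k s) (s / s * (F.μ k s + F.g * k) - F.g * k))) :=
      Continuous.tendsto (by fun_prop) s
    rwa [div_self hs.ne', one_mul, add_sub_cancel_right, max_self] at this
  have hlo : Tendsto (fun t => min (F.μ k s) (t / s * (F.μ k s + F.g * k) - F.g * k)) (𝓝 s)
      (𝓝 (F.μ k s)) := by
    have : Tendsto (fun t => min (F.μ k s) (t / s * (F.μ k s + F.g * k) - F.g * k)) (𝓝 s)
      (𝓝 (min (F.μ k s) (s / s * (F.μ k s + F.g * k) - F.g * k))) :=
      Continuous.tendsto (by fun_prop) s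
    rwa [div_self hs.ne', one_mul, add_sub_cancel_right, min_self] at this
  refine tendsto_of_tendsto_of_tendsto_of_le_of_le' hlo hup ?_ ?_
  · filter_upwards [Ioi_mem_nhds hs] with t ht
    rcases le_total s t with h | h
    · exact (min_le_left _ _).trans (μ_mono hk hs.le h)
    · refine (min_le_right _ _).trans ?_
      have := μ_scale (F := F) hk ht h
      rw [div_mul_eq_mul_div, sub_le_iff_le_add, div_le_iff₀ hs]
      linarith
  · filter_upwards [Ioi_mem_nhds hs] with t ht
    rcases le_total s t with h | h
    · refine le_trans ?_ (le_max_right _ _)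
      have := μ_scale (F := F) hk hs h
      rw [div_mul_eq_mul_div, le_sub_iff_add_le, le_div_iff₀ hs]
      linarith
    · exact (μ_mono hk (le_of_lt ht) h).trans (le_max_left _ _)

lemma isGrowthRate_iff : F.IsGrowthRate k s ↔ 0 < s ∧ s ^ 2 + F.μ k s = 0 := by
  constructor
  · rintro ⟨h1, h2⟩
    have hs : 0 < s := by rw [h2]; exact Real.sqrt_pos.2 (by linarith)
    refine ⟨hs, ?_⟩
    have : s ^ 2 = -F.μ k s := by
      conv_lhs => rw [h2]
      exact Real.sq_sqrt (by linarith)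
    linarith
  · rintro ⟨h1, h2⟩
    refine ⟨by nlinarith, ?_⟩
    rw [show -F.μ k s = s ^ 2 by linarith, Real.sqrt_sq h1.le]

/-- The function `s² + μ(k, s)` is continuous. It is negative for small `s`, because a pair with
negative inviscid energy remains negative under a small amount of viscosity, and nonnegative for
large `s`, because `μ ≥ -g k`. A zero is a growth rate. -/
lemma exists_isGrowthRate (hk : 0 < k) (hc : F.σ * k ^ 2 < F.g * F.jumpρ) :
    ∃ s, F.IsGrowthRate k s := by
  obtain ⟨φ, dφ, ψ, dψ, h1, h2, h3⟩ := exists_potential_neg hk hc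
  set p := F.potential k φ ψ dψ
  set d := F.dissipation k φ dφ ψ dψ
  have hM := mass_nonneg (F := F) (φ := φ) (ψ := ψ)
  have hd : 0 ≤ d := dissipation_nonneg
  have htend : Tendsto (fun s : ℝ => s ^ 2 * F.mass φ ψ + (p + s * d)) (𝓝[>] 0) (𝓝 p) := by
    have : Tendsto (fun s : ℝ => s ^ 2 * F.mass φ ψ + (p + s * d)) (𝓝 0)
      (𝓝 (0 ^ 2 * F.mass φ ψ + (p + 0 * d))) := Continuous.tendsto (by fun_prop) 0
    simp only [ne_eq, OfNat.ofNat_ne_zero, not_false_eq_true, zero_pow, zero_mul, zero_add,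
      add_zero] at this
    exact this.mono_left nhdsWithin_le_nhds
  obtain ⟨a, ha, ha0⟩ := ((htend.eventually (Iio_mem_nhds h3)).and self_mem_nhdsWithin).exists
  have ha0 : 0 < a := ha0
  have hMpos : 0 < F.mass φ ψ := by
    rcases hM.eq_or_lt with h | h
    · exfalso
      have := potential_lower (k := k) h1.memLp h2.memLp h2.1 hk.le
      rw [← h] at this
      simp only [mul_zero, neg_zero] at this
      exact absurd h3 (not_lt.2 this)
    · exact h
  have hneg : a ^ 2 + F.μ k a < 0 := by
    have := μ_mul_mass_le (k := k) h1 h2 hk.le ha0.le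
    rw [energy_eq h1 h2] at this
    have h5 : (a ^ 2 + F.μ k a) * F.mass φ ψ < 0 := by
      have ha' : a ^ 2 * F.mass φ ψ + (p + a * d) < 0 := ha
      nlinarith
    by_contra hcon
    exact absurd h5 (not_lt.2 (mul_nonneg (not_lt.1 hcon) hM))
  -- Chosen so that `b ≥ 1` and `b ≥ g k`, hence `b² ≥ g k ≥ -μ(k, b)`.
  set b := a + F.g * k + 1 with hb
  have hgk : 0 < F.g * k := mul_pos F.g_pos hk
  have hpos : 0 ≤ b ^ 2 + F.μ k b := by
    have := neg_le_μ (F := F) hk.le (s := b) (by linarith)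
    nlinarith
  have hcont : ContinuousOn (fun s => s ^ 2 + F.μ k s) (Icc a b) :=
    (continuousOn_pow 2).add ((μ_continuousOn hk.le).mono fun x hx => ha0.trans_le hx.1)
  obtain ⟨s, hs, hs'⟩ := intermediate_value_Icc (by linarith) hcont ⟨hneg.le, hpos⟩
  exact ⟨s, (isGrowthRate_iff).2 ⟨ha0.trans_le hs.1, hs'⟩⟩

/-- An interpolation bound for the trace at the interface. -/
lemma sq_trace_le (hψ : F.IsH10 ψ dψ) {κ : ℝ} (hκ : 0 < κ) :
    ψ 0 ^ 2 ≤ κ * (∫ z, dψ z ^ 2 ∂F.lin) + κ⁻¹ * ∫ z, ψ z ^ 2 ∂F.lin := by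
  have hl := left_mem_Icc.2 (neg_m_lt_ℓ (F := F)).le
  have h0 := zero_mem (F := F)
  have h1 := hψ.integral_mul hψ hl h0 h0.1
  rw [hψ.left_eq] at h1
  have hi1 : Integrable (fun z => dψ z ^ 2) F.lin := MemLp.integrable_sq hψ.1
  have hi2 := hψ.memLp.integrable_sq
  have hI := (hi1.const_mul κ).add (hi2.const_mul κ⁻¹)
  have h2 : ψ 0 ^ 2 = ∫ z in Ioc (-F.m) 0, (dψ z * ψ z + ψ z * dψ z) := by
    rw [← intervalIntegral.integral_of_le h0.1, h1]; ring
  have hle : volume.restrict (Ioc (-F.m) 0) ≤ F.lin :=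
    Measure.restrict_mono (fun z (hz : z ∈ Ioc (-F.m) 0) =>
      (⟨hz.1, hz.2.trans_lt F.ℓ_pos⟩ : z ∈ Ioo (-F.m) F.ℓ)) le_rfl
  rw [h2]
  have hpt : ∀ z, dψ z * ψ z + ψ z * dψ z ≤ κ * dψ z ^ 2 + κ⁻¹ * ψ z ^ 2 := fun z => by
    have : 0 ≤ κ⁻¹ * (κ * dψ z - ψ z) ^ 2 := by positivity
    have e : κ⁻¹ * (κ * dψ z - ψ z) ^ 2 = κ * dψ z ^ 2 - 2 * (dψ z * ψ z) + κ⁻¹ * ψ z ^ 2 := by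
      field_simp
      ring
    linarith
  have hprod : Integrable (fun z => dψ z * ψ z + ψ z * dψ z) F.lin :=
    (integrable_mul_lin hψ.1 hψ.memLp).add (integrable_mul_lin hψ.memLp hψ.1)
  calc ∫ z in Ioc (-F.m) 0, (dψ z * ψ z + ψ z * dψ z)
      ≤ ∫ z in Ioc (-F.m) 0, (κ * dψ z ^ 2 + κ⁻¹ * ψ z ^ 2) :=
        integral_mono (hprod.mono_measure hle) (hI.mono_measure hle) hpt
    _ ≤ ∫ z, (κ * dψ z ^ 2 + κ⁻¹ * ψ z ^ 2) ∂F.lin :=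
        integral_mono_measure hle (.of_forall fun z => by simp only [Pi.zero_apply]; positivity) hI
    _ = _ := by rw [integral_add (hi1.const_mul _) (hi2.const_mul _), integral_const_mul,
        integral_const_mul]

/-- Growth rates are bounded uniformly in the frequency. -/
lemma exists_growthRate_bound :
    ∃ K, ∀ k s, 0 < k → F.IsGrowthRate k s → s ≤ K := by
  obtain ⟨κ, hκ, hκε⟩ := F.exists_ε₀_lower
  obtain ⟨r, hr, hrρ⟩ := F.exists_ρ₀_lower
  set a := F.g * F.jumpρ with ha
  have ha0 : 0 < a := mul_pos F.g_pos F.jumpρ_pos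
  set K := a ^ 2 / (κ * r) with hK
  have hK0 : 0 < K := by positivity
  refine ⟨K + 1, fun k s hk hgr => ?_⟩
  obtain ⟨hs, hfix⟩ := (isGrowthRate_iff).1 hgr
  -- The only negative term of the energy is `-(a / 2) ψ(0)²`. The trace inequality with parameter
  -- `s κ / a` makes its derivative part absorbable by `s` times the dissipation; the remainder
  -- costs `K / s`, independently of `k`.
  have hlow : -(K / s) ≤ F.μ k s := by
    refine le_csInf energySet_nonempty ?_
    rintro e ⟨φ, dφ, ψ, dψ, h1, h2, h3, rfl⟩
    rw [energy_eq h1 h2, potential_eq h1.memLp h2]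
    have hsq : 0 ≤ ∫ z, F.dP z * F.ρ₀ z *
        (dψ z + k * φ z - F.g * ((F.dP z)⁻¹ * ψ z)) ^ 2 ∂F.lin :=
      integral_nonneg_of_ae (ae_lin_of_forall fun z hz => by
        have := ρ₀_pos hz; have := dP_pos hz; simp only [Pi.zero_apply]; positivity)
    have hdis : κ * ∫ z, dψ z ^ 2 ∂F.lin ≤ 2 * F.dissipation k φ dφ ψ dψ := by
      rw [dissipation, ← integral_const_mul, ← mul_assoc]
      norm_num
      refine integral_mono_ae (h2.1.integrable_sq.const_mul κ)
        (by simpa using integrable_dissipation (k := k) h1.memLp h1.1 h2.memLp h2.1)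
        (ae_lin_of_forall fun z hz => ?_)
      have e1 := hκε z hz
      have e2 := δ₀_nonneg hz
      have e3 : 0 ≤ F.δ₀ z * (dψ z + k * φ z) ^ 2 := by positivity
      -- With `x = ψ'` and `y = kφ`, the last two terms exceed `x²` by exactly `(x - 2y)² / 3`.
      have e4 : dψ z ^ 2 ≤ (dφ z - k * ψ z) ^ 2 + (dψ z - k * φ z) ^ 2
        + 3⁻¹ * (dψ z + k * φ z) ^ 2 := by
        nlinarith [sq_nonneg (dφ z - k * ψ z), sq_nonneg (dψ z - 2 * (k * φ z))]
      calc κ * dψ z ^ 2 ≤ F.ε₀ z * ((dφ z - k * ψ z) ^ 2 + (dψ z - k * φ z) ^ 2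
        + 3⁻¹ * (dψ z + k * φ z) ^ 2) :=
          mul_le_mul e1 e4 (sq_nonneg _) (ε₀_pos hz).le
        _ ≤ _ := by norm_num at e3 ⊢; linarith
    have hmass : r * ∫ z, ψ z ^ 2 ∂F.lin ≤ 2 := by
      have : r * ∫ z, ψ z ^ 2 ∂F.lin ≤ ∫ z, F.ρ₀ z * (φ z ^ 2 + ψ z ^ 2) ∂F.lin := by
        rw [← integral_const_mul]
        refine integral_mono_ae (h2.memLp.integrable_sq.const_mul r)
          (integrable_mass h1.memLp h2.memLp) (ae_lin_of_forall fun z hz => ?_)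
        have e1 := hrρ z hz
        calc r * ψ z ^ 2 ≤ F.ρ₀ z * ψ z ^ 2 := by gcongr
          _ ≤ F.ρ₀ z * (φ z ^ 2 + ψ z ^ 2) := by
            have := ρ₀_pos hz
            gcongr
            linarith [sq_nonneg (φ z)]
      rw [mass_eq] at h3
      linarith
    have htr := sq_trace_le h2 (κ := s * κ / a) (by positivity)
    have hσ : 0 ≤ F.σ * k ^ 2 * ψ 0 ^ 2 := by have := F.σ_nonneg; positivity
    have ha1 : a * ψ 0 ^ 2 ≤ s * κ * (∫ z, dψ z ^ 2 ∂F.lin) + a ^ 2 / (s * κ) *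
        ∫ z, ψ z ^ 2 ∂F.lin := by
      calc a * ψ 0 ^ 2 ≤ a * (s * κ / a * (∫ z, dψ z ^ 2 ∂F.lin) + (s * κ / a)⁻¹ *
          ∫ z, ψ z ^ 2 ∂F.lin) := by gcongr
        _ = _ := by field_simp
    have ha2 : a ^ 2 / (s * κ) * ∫ z, ψ z ^ 2 ∂F.lin ≤ 2 * (K / s) := by
      have : a ^ 2 / (s * κ) * ∫ z, ψ z ^ 2 ∂F.lin =
          K / s * (r * ∫ z, ψ z ^ 2 ∂F.lin) := by rw [hK]; field_simp
      rw [this]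
      have : 0 < K / s := by positivity
      nlinarith
    have hsd : s * (κ * ∫ z, dψ z ^ 2 ∂F.lin) ≤ s * (2 * F.dissipation k φ dφ ψ dψ) := by gcongr
    linarith
  -- From `s² = -μ ≤ K / s`, a rate above `K + 1` would satisfy both `s > 1` and `s² ≤ 1`.
  by_contra hcon
  push Not at hcon
  have h1 : K / s ≤ 1 := (div_le_one hs).2 (by linarith)
  nlinarith

/-- The energy is bounded below by the square of any rate that dominates the growth rates. -/
theorem energy_add_nonneg (hk : 0 < k) {r : ℝ} (hr : 0 < r)
    (hmax : F.σ * k ^ 2 < F.g * F.jumpρ → ∀ s, F.IsGrowthRate k s → s ≤ r)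
    (hφ : F.IsH10 φ dφ) (hψ : F.IsH10 ψ dψ) :
    0 ≤ F.energy k r φ dφ ψ dψ + r ^ 2 * F.mass φ ψ := by
  have hM := mass_nonneg (F := F) (φ := φ) (ψ := ψ)
  rcases lt_or_ge (F.σ * k ^ 2) (F.g * F.jumpρ) with h | h
  · obtain ⟨s, hs⟩ := exists_isGrowthRate hk h
    have hsr := hmax h s hs
    obtain ⟨hs0, hfix⟩ := (isGrowthRate_iff).1 hs
    have h1 := μ_mono (F := F) hk.le hs0.le hsr
    have h2 := μ_mul_mass_le (k := k) hφ hψ hk.le hr.le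
    -- Both `s²` and `μ(k, s)` increase with `s`, and their sum vanishes at the growth rate.
    have h3 : 0 ≤ r ^ 2 + F.μ k r := by nlinarith
    nlinarith
  -- From the critical frequency on, surface tension outweighs the density jump and the completed
  -- square shows every term to be nonnegative.
  · rw [energy_eq hφ hψ, potential_eq hφ.memLp hψ]
    have hsq : 0 ≤ ∫ z, F.dP z * F.ρ₀ z *
        (dψ z + k * φ z - F.g * ((F.dP z)⁻¹ * ψ z)) ^ 2 ∂F.lin :=
      integral_nonneg_of_ae (ae_lin_of_forall fun z hz => by
        have := ρ₀_pos hz; have := dP_pos hz; simp only [Pi.zero_apply]; positivity)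
    have h1 : 0 ≤ (F.σ * k ^ 2 - F.g * F.jumpρ) * ψ 0 ^ 2 :=
      mul_nonneg (sub_nonneg.2 h) (sq_nonneg _)
    have h2 := mul_nonneg hr.le (dissipation_nonneg (F := F) (k := k) (φ := φ) (dφ := dφ) (ψ := ψ)
      (dψ := dψ))
    have h3 : 0 ≤ r ^ 2 * F.mass φ ψ := by positivity
    linarith

end Setup

/-- The settings of the theorem: the plane, or a torus of positive period. -/
def Horizontal.Proper : Horizontal → Prop
  | .plane => True
  | .torus L => 0 < L

namespace Setup
variable {F : Setup}

lemma growthRates_isLUB {H : Horizontal} (hfr : ∀ k ∈ H.freqs, 0 < k)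
    (hne : ∃ k ∈ H.freqs, F.σ * k ^ 2 < F.g * F.jumpρ) :
    0 < F.maxRate H ∧ IsLUB (F.growthRates H) (F.maxRate H) := by
  obtain ⟨k, hk, hc⟩ := hne
  obtain ⟨s, hs⟩ := exists_isGrowthRate (hfr k hk) hc
  obtain ⟨K, hK⟩ := F.exists_growthRate_bound
  have hmem : s ∈ F.growthRates H := ⟨k, hk, hc, hs⟩
  have hlub : IsLUB (F.growthRates H) (F.maxRate H) := by
    refine isLUB_csSup ⟨s, hmem⟩ ⟨K, ?_⟩
    rintro s ⟨k, hk, -, hs⟩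
    exact hK k s (hfr k hk) hs
  exact ⟨((isGrowthRate_iff).1 hs).1.trans_le (hlub.1 hmem), hlub⟩

lemma growthRates_plane :
    0 < F.maxRate .plane ∧ IsLUB (F.growthRates .plane) (F.maxRate .plane) := by
  refine growthRates_isLUB (fun k hk => hk) ?_
  have h0 : 0 < F.g * F.jumpρ := mul_pos F.g_pos F.jumpρ_pos
  have h1 : 0 < F.σ + F.g * F.jumpρ := by linarith [F.σ_nonneg]
  -- With `k² = g⟦ρ₀⟧ / (σ + g⟦ρ₀⟧)` the frequency is subcritical also when `σ = 0`.
  refine ⟨Real.sqrt (F.g * F.jumpρ / (F.σ + F.g * F.jumpρ)), Real.sqrt_pos.2 (by positivity), ?_⟩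
  rw [Real.sq_sqrt (by positivity), mul_div_assoc', div_lt_iff₀ h1]
  nlinarith

lemma growthRates_torus {L : ℝ} (hL : Real.sqrt (F.σ / (F.g * F.jumpρ)) < L) :
    0 < F.maxRate (.torus L) ∧ IsLUB (F.growthRates (.torus L)) (F.maxRate (.torus L)) := by
  have h0 : 0 < F.g * F.jumpρ := mul_pos F.g_pos F.jumpρ_pos
  have hL0 : 0 < L := (Real.sqrt_nonneg _).trans_lt hL
  -- The smallest nonzero frequency of the torus is `1 / L`, and the hypothesis on `L` says
  -- precisely that it is subcritical.
  refine growthRates_isLUB (fun k hk => hk.1) ⟨1 / L, ⟨by positivity, 1, 0, ?_⟩, ?_⟩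
  · simp [Real.sqrt_sq hL0.le]
  · rw [Real.sqrt_lt' hL0, div_lt_iff₀ h0] at hL
    rw [div_pow, one_pow, mul_one_div, div_lt_iff₀ (by positivity)]
    linarith

end Setup
end RayleighTaylor
end

/-! ### Abstract dissipative second order evolution equations -/

noncomputable section
namespace RayleighTaylor
open Filter Topology

section Energy

variable {X 𝓗 : Type*} [NormedAddCommGroup X] [NormedSpace ℝ X]
  [NormedAddCommGroup 𝓗] [NormedSpace ℝ 𝓗]

lemma hasDerivAt_bilin (B : X →L[ℝ] X →L[ℝ] ℝ) {Y : ℝ → X} {Y' : X} {t : ℝ}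
    (h : HasDerivAt Y Y' t) : HasDerivAt (fun s => B (Y s) (Y s)) (B Y' (Y t) + B (Y t) Y') t :=
  (B.hasFDerivAt.comp_hasDerivAt t h).clm_apply h

lemma continuousOn_bilin (B : X →L[ℝ] X →L[ℝ] ℝ) {Y Z : ℝ → X} {s : Set ℝ}
    (hY : ContinuousOn Y s) (hZ : ContinuousOn Z s) : ContinuousOn (fun t => B (Y t) (Z t)) s :=
  (B.continuous.comp_continuousOn hY).clm_apply hZ

lemma tendsto_bilin (Q : X →L[ℝ] X →L[ℝ] ℝ) {l : Filter ℝ} {f : ℝ → X} {z : X}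
    (hf : Tendsto f l (𝓝 z)) : Tendsto (fun e => Q (f e) (f e)) l (𝓝 (Q z z)) :=
  ((Q.continuous.clm_apply continuous_id).tendsto z).comp hf

/-- Grönwall's inequality for `G' ≤ 2 r G + K`. -/
lemma gronwall_bound {G G' : ℝ → ℝ} {r K : ℝ} (hr : 0 < r) (hG : ContinuousOn G (Ici 0))
    (hG' : ∀ t, 0 < t → HasDerivAt G (G' t) t) (h : ∀ t, 0 < t → G' t ≤ 2 * r * G t + K)
    {t : ℝ} (ht : 0 ≤ t) : G t + K / (2 * r) ≤ (G 0 + K / (2 * r)) * Real.exp (2 * r * t) := by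
  have hd : ∀ s, 0 < s → HasDerivAt (fun s => (G s + K / (2 * r)) * Real.exp (-(2 * r * s)))
      (G' s * Real.exp (-(2 * r * s)) +
        (G s + K / (2 * r)) * (Real.exp (-(2 * r * s)) * -(2 * r))) s := by
    intro s hs
    refine ((hG' s hs).add_const _).mul ?_
    have : HasDerivAt (fun s : ℝ => -(2 * r * s)) (-(2 * r)) s := by
      simpa only [neg_mul, mul_one] using (hasDerivAt_id' s).const_mul (-(2 * r))
    exact this.exp
  have hanti : AntitoneOn (fun s => (G s + K / (2 * r)) * Real.exp (-(2 * r * s))) (Ici 0) := by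
    refine antitoneOn_of_deriv_nonpos (convex_Ici 0) ?_ ?_ ?_
    · exact (hG.add continuousOn_const).mul (by fun_prop)
    · rw [interior_Ici]
      exact fun s hs => (hd s hs).differentiableAt.differentiableWithinAt
    · rw [interior_Ici]
      intro s hs
      rw [(hd s hs).deriv]
      have h1 := h s hs
      have h2 := Real.exp_pos (-(2 * r * s))
      have h3 : (G s + K / (2 * r)) * (2 * r) = 2 * r * G s + K := by field_simp
      have : G' s * Real.exp (-(2 * r * s)) +
        (G s + K / (2 * r)) * (Real.exp (-(2 * r * s)) * -(2 * r)) =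
        (G' s - (G s + K / (2 * r)) * (2 * r)) * Real.exp (-(2 * r * s)) := by ring
      rw [this, h3]
      exact mul_nonpos_of_nonpos_of_nonneg (by linarith) h2.le
  have h0 := hanti (mem_Ici.2 le_rfl) (mem_Ici.2 ht) ht
  simp only [mul_zero, neg_zero, Real.exp_zero, mul_one] at h0
  calc G t + K / (2 * r) = (G t + K / (2 * r)) * Real.exp (-(2 * r * t)) *
        Real.exp (2 * r * t) := by rw [mul_assoc, ← Real.exp_add]; simp
    _ ≤ _ := by gcongr

/-- The data of a second order evolution equation `M v'' + B v' + A v = 0` whose potential form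
`A` is bounded below by `-(r² M + r B)`. -/
structure IsDissipative (𝒦 : Submodule ℝ X) (π : X →L[ℝ] 𝓗) (M : 𝓗 →L[ℝ] 𝓗 →L[ℝ] ℝ)
    (A B : X →L[ℝ] X →L[ℝ] ℝ) (r : ℝ) : Prop where
  rate_pos : 0 < r
  M_symm : ∀ x y, M x y = M y x
  M_nonneg : ∀ x, 0 ≤ M x x
  A_symm : ∀ x ∈ 𝒦, ∀ y ∈ 𝒦, A x y = A y x
  B_symm : ∀ x y, B x y = B y x
  B_nonneg : ∀ x, 0 ≤ B x x
  lower : ∀ x ∈ 𝒦, 0 ≤ A x x + r ^ 2 * M (π x) (π x) + r * B x x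

variable {𝒦 : Submodule ℝ X} {π : X →L[ℝ] 𝓗} {M : 𝓗 →L[ℝ] 𝓗 →L[ℝ] ℝ}
  {A B : X →L[ℝ] X →L[ℝ] ℝ} {r : ℝ}

/-- Expand `B (r x - y) (r x - y) ≥ 0` and divide by `r`. -/
lemma form_young {B : X →L[ℝ] X →L[ℝ] ℝ} (hs : ∀ x y, B x y = B y x) (hp : ∀ x, 0 ≤ B x x)
    (hr : 0 < r) (x y : X) : 2 * B x y ≤ r * B x x + r⁻¹ * B y y := by
  have h := hp (r • x - y)
  simp only [map_sub, map_smul, _root_.sub_apply, _root_.smul_apply,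
    smul_eq_mul] at h
  rw [hs y x] at h
  have h2 : 0 ≤ r⁻¹ * (r * (r * B x x) - r * B x y - (r * B x y - B y y)) :=
    mul_nonneg (inv_nonneg.2 hr.le) (by linarith)
  have e : r⁻¹ * (r * (r * B x x) - r * B x y - (r * B x y - B y y)) =
      r * B x x - 2 * B x y + r⁻¹ * B y y := by field_simp; ring
  linarith

/-- The growth bound for regular solutions. -/
lemma IsDissipative.regular_bound (h : IsDissipative 𝒦 π M A B r) {Y Y' : ℝ → X} {Z : ℝ → 𝓗}
    (hY : ContinuousOn Y (Ici 0)) (hY' : ContinuousOn Y' (Ici 0))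
    (hYm : ∀ t, 0 ≤ t → Y t ∈ 𝒦) (hYm' : ∀ t, 0 ≤ t → Y' t ∈ 𝒦)
    (hd : ∀ t, 0 < t → HasDerivAt Y (Y' t) t)
    (hd' : ∀ t, 0 < t → HasDerivAt (fun s => π (Y' s)) (Z t) t)
    (heq : ∀ t, 0 < t → ∀ y ∈ 𝒦, M (Z t) (π y) + B (Y' t) y + A (Y t) y = 0)
    {K : ℝ} (hK : 2 * B (Y 0) (Y 0) + r⁻¹ * (M (π (Y' 0)) (π (Y' 0)) + A (Y 0) (Y 0)) ≤ K)
    {t : ℝ} (ht : 0 ≤ t) :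
    M (π (Y t)) (π (Y t)) + K / (2 * r) ≤
        (M (π (Y 0)) (π (Y 0)) + K / (2 * r)) * Real.exp (2 * r * t) ∧
      B (Y t) (Y t) + r⁻¹ * M (π (Y' t)) (π (Y' t)) ≤
        2 * r * ((M (π (Y 0)) (π (Y 0)) + K / (2 * r)) * Real.exp (2 * r * t)) := by
  have hr := h.rate_pos
  have hIcc : ∀ s : ℝ, Icc 0 s ⊆ Ici (0 : ℝ) := fun s x hx => hx.1
  have hcb := continuousOn_bilin B hY hY
  have hcb1 := continuousOn_bilin B hY' hY'
  have hint : ∀ {f : ℝ → ℝ}, ContinuousOn f (Ici 0) → ∀ s, 0 ≤ s →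
      IntervalIntegrable f volume 0 s := fun hf s hs =>
    (hf.mono (hIcc s)).intervalIntegrable_of_Icc hs
  have hπY : ContinuousOn (fun s => π (Y s)) (Ici 0) := π.continuous.comp_continuousOn hY
  have hπY' : ContinuousOn (fun s => π (Y' s)) (Ici 0) := π.continuous.comp_continuousOn hY'
  have hcm := continuousOn_bilin M hπY hπY
  -- the energy identity
  have henergy : ∀ s, 0 ≤ s → 2 * ∫ τ in (0)..s, B (Y' τ) (Y' τ) =
      M (π (Y' 0)) (π (Y' 0)) + A (Y 0) (Y 0) -
        (M (π (Y' s)) (π (Y' s)) + A (Y s) (Y s)) := by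
    intro s hs
    have h1 : ∫ τ in (0)..s, -2 * B (Y' τ) (Y' τ) =
        (M (π (Y' s)) (π (Y' s)) + A (Y s) (Y s)) -
          (M (π (Y' 0)) (π (Y' 0)) + A (Y 0) (Y 0)) := by
      refine intervalIntegral.integral_eq_sub_of_hasDerivAt_of_le hs
        (f := fun τ => M (π (Y' τ)) (π (Y' τ)) + A (Y τ) (Y τ)) ?_ ?_ ?_
      · exact ((continuousOn_bilin M hπY' hπY').add (continuousOn_bilin A hY hY)).mono (hIcc s)
      · intro τ hτ
        have e1 := hasDerivAt_bilin M (hd' τ hτ.1)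
        have e2 := hasDerivAt_bilin A (hd τ hτ.1)
        have e3 := heq τ hτ.1 (Y' τ) (hYm' τ hτ.1.le)
        have e4 := h.A_symm _ (hYm τ hτ.1.le) _ (hYm' τ hτ.1.le)
        have e5 := h.M_symm (Z τ) (π (Y' τ))
        exact (e1.add e2).congr_deriv (by linarith)
      · exact (hint hcb1 s hs).const_mul (-2)
    rw [intervalIntegral.integral_const_mul] at h1
    linarith
  -- Integrate `2 B(Y, Y')`, the derivative of `B(Y, Y)`, after Young's inequality with weight `r`;
  -- this weight is what produces the sharp rate.
  have hBint : ∀ s, 0 ≤ s → B (Y s) (Y s) - B (Y 0) (Y 0) ≤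
      r * (∫ τ in (0)..s, B (Y τ) (Y τ)) + r⁻¹ * ∫ τ in (0)..s, B (Y' τ) (Y' τ) := by
    intro s hs
    have h1 : ∫ τ in (0)..s, 2 * B (Y τ) (Y' τ) = B (Y s) (Y s) - B (Y 0) (Y 0) := by
      refine intervalIntegral.integral_eq_sub_of_hasDerivAt_of_le hs
        (f := fun τ => B (Y τ) (Y τ)) (hcb.mono (hIcc s)) ?_ ?_
      · intro τ hτ
        have e2 := hasDerivAt_bilin B (hd τ hτ.1)
        rw [h.B_symm (Y' τ)] at e2
        exact e2.congr_deriv (by ring)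
      · exact (hint (continuousOn_bilin B hY hY') s hs).const_mul 2
    rw [← h1, ← intervalIntegral.integral_const_mul, ← intervalIntegral.integral_const_mul,
      ← intervalIntegral.integral_add ((hint hcb s hs).const_mul r)
        ((hint hcb1 s hs).const_mul r⁻¹)]
    exact intervalIntegral.integral_mono_on hs ((hint (continuousOn_bilin B hY hY') s hs).const_mul 2)
      (((hint hcb s hs).const_mul r).add ((hint hcb1 s hs).const_mul r⁻¹))
      fun τ _ => form_young h.B_symm h.B_nonneg hr _ _
  -- Doubling the previous bound leaves `2 r⁻¹ ∫B(Y', Y')`, which the energy identity expresses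
  -- through `-A(Y, Y)`. The lower bound for `A` returns one copy of `B(Y, Y)`, and it is absorbed
  -- by one of the two copies on the left.
  have hmain : ∀ s, 0 ≤ s → B (Y s) (Y s) + r⁻¹ * M (π (Y' s)) (π (Y' s)) ≤
      K + 2 * r * (∫ τ in (0)..s, B (Y τ) (Y τ)) + r * M (π (Y s)) (π (Y s)) := by
    intro s hs
    have e1 := henergy s hs
    have e2 := hBint s hs
    have e3 := h.lower _ (hYm s hs)
    have e4 : r⁻¹ * (2 * ∫ τ in (0)..s, B (Y' τ) (Y' τ)) ≤
        r⁻¹ * (M (π (Y' 0)) (π (Y' 0)) + A (Y 0) (Y 0) - M (π (Y' s)) (π (Y' s)) +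
          r ^ 2 * M (π (Y s)) (π (Y s)) + r * B (Y s) (Y s)) := by
      refine mul_le_mul_of_nonneg_left (by linarith) (inv_nonneg.2 hr.le)
    have e5 : r⁻¹ * (M (π (Y' 0)) (π (Y' 0)) + A (Y 0) (Y 0) - M (π (Y' s)) (π (Y' s)) +
          r ^ 2 * M (π (Y s)) (π (Y s)) + r * B (Y s) (Y s)) =
        r⁻¹ * (M (π (Y' 0)) (π (Y' 0)) + A (Y 0) (Y 0)) - r⁻¹ * M (π (Y' s)) (π (Y' s)) +
          r * M (π (Y s)) (π (Y s)) + B (Y s) (Y s) := by field_simp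
    linarith
  -- the Grönwall argument
  have hGcont : ContinuousOn (fun s => ∫ τ in (0)..s, B (Y τ) (Y τ)) (Ici 0) := by
    intro s hs
    have hs : (0 : ℝ) ≤ s := hs
    have h1 : IntegrableOn (fun τ => B (Y τ) (Y τ)) (uIcc 0 (s + 1)) := by
      rw [uIcc_of_le (by linarith)]
      exact (hcb.mono (hIcc _)).integrableOn_Icc
    have h2 := intervalIntegral.continuousOn_primitive_interval h1
    rw [uIcc_of_le (by linarith)] at h2
    refine (h2 s ⟨hs, by linarith⟩).mono_of_mem_nhdsWithin ?_
    rw [← Ici_inter_Iic]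
    exact inter_mem_nhdsWithin _ (Iic_mem_nhds (by linarith))
  -- For `G = M(Y, Y) + ∫B(Y, Y)` the derivative is `2 M(Y, Y') + B(Y, Y)`. Young's inequality turns
  -- its first term into `r M(Y, Y) + r⁻¹ M(Y', Y')`, and the preceding bound then gives exactly `2
  -- r G + K`.
  have hgr := gronwall_bound (G := fun s => M (π (Y s)) (π (Y s)) + ∫ τ in (0)..s, B (Y τ) (Y τ))
    (G' := fun s => 2 * M (π (Y s)) (π (Y' s)) + B (Y s) (Y s)) (K := K) hr (hcm.add hGcont)
    (fun s hs => by
      have e1 := hasDerivAt_bilin M (π.hasFDerivAt.comp_hasDerivAt s (hd s hs))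
      simp only [Function.comp_apply] at e1
      rw [h.M_symm (π (Y' s))] at e1
      refine HasDerivAt.add (e1.congr_deriv (by ring)) ?_
      exact intervalIntegral.integral_hasDerivAt_right (hint hcb s hs.le)
        ((hcb.mono Ioi_subset_Ici_self).stronglyMeasurableAtFilter isOpen_Ioi s hs)
        ((hcb.mono Ioi_subset_Ici_self).continuousAt (Ioi_mem_nhds hs)))
    (fun s hs => by
      have e1 := form_young h.M_symm h.M_nonneg hr (π (Y s)) (π (Y' s))
      have e2 := hmain s hs.le
      linarith) ht
  have hB0 : ∀ s, 0 ≤ s → 0 ≤ ∫ τ in (0)..s, B (Y τ) (Y τ) := fun s hs =>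
    intervalIntegral.integral_nonneg hs fun τ _ => h.B_nonneg _
  simp only [intervalIntegral.integral_same, add_zero] at hgr
  refine ⟨by linarith [hB0 t ht], ?_⟩
  have e1 := hmain t ht
  have e2 := h.M_nonneg (π (Y t))
  have e3 : 2 * r * (M (π (Y t)) (π (Y t)) + (∫ τ in (0)..t, B (Y τ) (Y τ)) + K / (2 * r)) =
      2 * r * M (π (Y t)) (π (Y t)) + 2 * r * (∫ τ in (0)..t, B (Y τ) (Y τ)) + K := by
    field_simp
  have e4 := mul_le_mul_of_nonneg_left hgr (by positivity : 0 ≤ 2 * r)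
  rw [e3] at e4
  nlinarith

variable [CompleteSpace X]

/-- The integral of a function with values in a closed subspace lies in the subspace. -/
lemma intervalIntegral_mem (hcl : IsClosed (𝒦 : Set X)) {f : ℝ → X} {a b : ℝ} (hab : a ≤ b)
    (hf : ∀ s ∈ Ioc a b, f s ∈ 𝒦) (hi : IntegrableOn f (Ioc a b)) : ∫ s in a..b, f s ∈ 𝒦 := by
  rcases hab.eq_or_lt with rfl | hlt
  · simp
  rw [intervalIntegral.integral_of_le hab]
  have hne : (volume.restrict (Ioc a b)) univ ≠ 0 := by simp [hlt]
  have hne' : NeZero (volume.restrict (Ioc a b)) := ⟨fun h0 => hne (by rw [h0]; simp)⟩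
  have hav := (𝒦.convex).average_mem (μ := volume.restrict (Ioc a b)) hcl
    ((ae_restrict_iff' measurableSet_Ioc).2 (.of_forall hf)) hi
  have := 𝒦.smul_mem ((volume.restrict (Ioc a b)).real univ) hav
  rwa [measure_smul_average] at this

set_option maxHeartbeats 800000 in
/-- The growth bound for weak solutions, which are regularised by averaging in time. -/
theorem IsDissipative.weak_bound (h : IsDissipative 𝒦 π M A B r) (hcl : IsClosed (𝒦 : Set X))
    {U : ℝ → X} {V : ℝ → 𝓗} (hU : ContinuousOn U (Ici 0)) (hUm : ∀ t, 0 ≤ t → U t ∈ 𝒦)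
    (hV : ∀ t, 0 ≤ t → HasDerivWithinAt (fun s => π (U s)) (V t) (Ici 0) t)
    (hweak : ∀ t, 0 ≤ t → ∀ y ∈ 𝒦,
      M (V t - V 0) (π y) + B (U t - U 0) y + A (∫ s in (0)..t, U s) y = 0)
    {K : ℝ} (hK : 2 * B (U 0) (U 0) + r⁻¹ * (M (V 0) (V 0) + A (U 0) (U 0)) < K)
    {t : ℝ} (ht : 0 ≤ t) :
    M (π (U t)) (π (U t)) + K / (2 * r) ≤
        (M (π (U 0)) (π (U 0)) + K / (2 * r)) * Real.exp (2 * r * t) ∧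
      B (U t) (U t) + r⁻¹ * M (V t) (V t) ≤
        2 * r * ((M (π (U 0)) (π (U 0)) + K / (2 * r)) * Real.exp (2 * r * t)) := by
  -- The extension by `U 0` to negative times makes the function continuous on the whole line, so
  -- that its primitive is differentiable everywhere.
  set W : ℝ → X := fun t => U (max t 0) with hW
  have hWc : Continuous W := by
    refine hU.comp_continuous (by fun_prop) fun x => mem_Ici.2 (le_max_right _ _)
  have hWU : ∀ t, 0 ≤ t → W t = U t := fun t ht => by simp [hW, ht]
  have hWm : ∀ t, W t ∈ 𝒦 := fun t => hUm _ (le_max_right _ _)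
  have hii : ∀ a b, IntervalIntegrable W volume a b := fun a b => hWc.intervalIntegrable a b
  -- Averages over `[t, t + e]`. Their time derivative is a difference quotient of elements of `𝒦`,
  -- hence an admissible test vector, which `V` itself need not be.
  set Y : ℝ → ℝ → X := fun e t => e⁻¹ • ∫ s in t..(t + e), W s with hY
  set Y' : ℝ → ℝ → X := fun e t => e⁻¹ • (W (t + e) - W t) with hY'
  have hprim : ∀ t, HasDerivAt (fun t => ∫ s in (0)..t, W s) (W t) t := fun t =>
    intervalIntegral.integral_hasDerivAt_right (hii _ _)
      (hWc.stronglyMeasurableAtFilter _ _) hWc.continuousAt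
  have hYeq : ∀ e t, Y e t = e⁻¹ • ((∫ s in (0)..(t + e), W s) - ∫ s in (0)..t, W s) := by
    intro e t
    rw [intervalIntegral.integral_interval_sub_left (hii _ _) (hii _ _)]
  have hYd : ∀ e t, HasDerivAt (Y e) (Y' e t) t := by
    intro e t
    have : Y e = fun t => e⁻¹ • ((∫ s in (0)..(t + e), W s) - ∫ s in (0)..t, W s) :=
      funext (hYeq e)
    rw [this]
    refine HasDerivAt.const_smul _ (HasDerivAt.sub ?_ (hprim t))
    exact HasDerivAt.comp_add_const t e (hprim (t + e))
  have hYm : ∀ e, 0 < e → ∀ t, Y e t ∈ 𝒦 := by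
    intro e he t
    refine 𝒦.smul_mem _ ?_
    exact intervalIntegral_mem hcl (by linarith) (fun s _ => hWm s) (hii t (t + e)).1
  have hYm' : ∀ e t, Y' e t ∈ 𝒦 := fun e t => 𝒦.smul_mem _ (𝒦.sub_mem (hWm _) (hWm _))
  have hYc' : ∀ e, Continuous (Y' e) := fun e => by simp only [hY']; fun_prop
  have hVd : ∀ t, 0 < t → HasDerivAt (fun s => π (W s)) (V t) t := by
    intro t ht
    have := (hV t ht.le).hasDerivAt (Ici_mem_nhds ht)
    refine this.congr_of_eventuallyEq ?_
    filter_upwards [Ioi_mem_nhds ht] with s hs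
    rw [hWU s (le_of_lt hs)]
  have hd' : ∀ e, 0 < e → ∀ t, 0 < t →
      HasDerivAt (fun s => π (Y' e s)) (e⁻¹ • (V (t + e) - V t)) t := by
    intro e he t ht
    simp only [hY', map_smul, map_sub]
    exact HasDerivAt.const_smul _
      ((HasDerivAt.comp_add_const t e (hVd (t + e) (by linarith))).sub (hVd t ht))
  have hUW : ∀ t, 0 ≤ t → ∫ s in (0)..t, U s = ∫ s in (0)..t, W s := by
    intro t ht
    refine intervalIntegral.integral_congr fun s hs => ?_
    rw [uIcc_of_le ht] at hs
    exact (hWU s hs.1).symm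
  -- The difference of the integrated equations at times `t + e` and `t`, divided by `e`; the
  -- initial data drop out.
  have heq : ∀ e, 0 < e → ∀ t, 0 < t → ∀ y ∈ 𝒦,
      M (e⁻¹ • (V (t + e) - V t)) (π y) + B (Y' e t) y + A (Y e t) y = 0 := by
    intro e he t ht y hy
    have h1 := hweak (t + e) (by linarith) y hy
    have h2 := hweak t ht.le y hy
    rw [hUW _ (by linarith)] at h1
    rw [hUW _ ht.le] at h2
    have h3 : Y' e t = e⁻¹ • (U (t + e) - U t) := by
      simp only [hY', hWU t ht.le, hWU (t + e) (by linarith)]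
    rw [hYeq, h3]
    simp only [map_sub, map_smul, _root_.sub_apply, _root_.smul_apply,
      smul_eq_mul] at h1 h2 ⊢
    have : e⁻¹ * ((M (V (t + e)) (π y) - M (V 0) (π y) + (B (U (t + e)) y - B (U 0) y) +
        A (∫ s in (0)..(t + e), W s) y) - (M (V t) (π y) - M (V 0) (π y) +
        (B (U t) y - B (U 0) y) + A (∫ s in (0)..t, W s) y)) = 0 := by rw [h1, h2]; simp
    linarith
  -- limits as the length of the averaging window tends to zero
  have hlimY : ∀ t, 0 ≤ t → Tendsto (fun e => Y e t) (𝓝[>] 0) (𝓝 (U t)) := by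
    intro t ht
    have h1 := (hasDerivAt_iff_tendsto_slope_zero.1 (hprim t))
    have h2 := h1.mono_left (nhdsGT_le_nhdsNE 0)
    rw [hWU t ht] at h2
    refine h2.congr fun e => ?_
    rw [hYeq]
  have hlimπ : ∀ t, 0 ≤ t → Tendsto (fun e => π (Y' e t)) (𝓝[>] 0) (𝓝 (V t)) := by
    intro t ht
    have h1 : HasDerivWithinAt (fun s => π (U s)) (V t) (Ioi t) t :=
      (hV t ht).mono fun x (hx : t < x) => (ht.trans hx.le : (0 : ℝ) ≤ x)
    have h2 := hasDerivWithinAt_iff_tendsto_slope' (self_notMem_Ioi) |>.1 h1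
    have h3 : Tendsto (fun e : ℝ => t + e) (𝓝[>] 0) (𝓝[>] t) := by
      refine tendsto_nhdsWithin_iff.2 ⟨?_, ?_⟩
      · have : Tendsto (fun e : ℝ => t + e) (𝓝 0) (𝓝 (t + 0)) :=
          Continuous.tendsto (by fun_prop) 0
        rw [add_zero] at this
        exact this.mono_left nhdsWithin_le_nhds
      · filter_upwards [self_mem_nhdsWithin] with e (he : 0 < e)
        exact (lt_add_iff_pos_right t).2 he
    refine (h2.comp h3).congr' ?_
    filter_upwards [self_mem_nhdsWithin] with e (he : 0 < e)
    simp only [Function.comp_apply, slope, vsub_eq_sub, add_sub_cancel_left, hY', map_smul, map_sub,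
      hWU t ht, hWU (t + e) (by linarith)]
  -- The strict inequality for the initial data in `hK` is an open condition, so it survives for the
  -- averaged data when the window is short.
  have hKev : ∀ᶠ e in 𝓝[>] (0 : ℝ), 2 * B (Y e 0) (Y e 0) +
      r⁻¹ * (M (π (Y' e 0)) (π (Y' e 0)) + A (Y e 0) (Y e 0)) < K := by
    have hl := ((tendsto_bilin B (hlimY 0 le_rfl)).const_mul 2).add
      (((tendsto_bilin M (hlimπ 0 le_rfl)).add (tendsto_bilin A (hlimY 0 le_rfl))).const_mul r⁻¹)
    exact hl.eventually (Iio_mem_nhds hK)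
  have hYc : ∀ e, Continuous (Y e) := fun e =>
    continuous_iff_continuousAt.2 fun t => (hYd e t).continuousAt
  have hall : ∀ᶠ e in 𝓝[>] (0 : ℝ), M (π (Y e t)) (π (Y e t)) + K / (2 * r) ≤
        (M (π (Y e 0)) (π (Y e 0)) + K / (2 * r)) * Real.exp (2 * r * t) ∧
      B (Y e t) (Y e t) + r⁻¹ * M (π (Y' e t)) (π (Y' e t)) ≤
        2 * r * ((M (π (Y e 0)) (π (Y e 0)) + K / (2 * r)) * Real.exp (2 * r * t)) := by
    filter_upwards [hKev, self_mem_nhdsWithin] with e hKe (he : 0 < e)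
    exact h.regular_bound (hYc e).continuousOn (hYc' e).continuousOn (fun t _ => hYm e he t)
      (fun t _ => hYm' e t) (fun t _ => hYd e t) (hd' e he) (heq e he) hKe.le ht
  have hπ : ∀ t, 0 ≤ t → Tendsto (fun e => M (π (Y e t)) (π (Y e t))) (𝓝[>] 0)
      (𝓝 (M (π (U t)) (π (U t)))) := fun t ht =>
    tendsto_bilin M ((π.continuous.tendsto _).comp (hlimY t ht))
  refine ⟨le_of_tendsto_of_tendsto ((hπ t ht).add_const _)
      (((hπ 0 le_rfl).add_const _).mul_const _) (hall.mono fun _ h => h.1),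
    le_of_tendsto_of_tendsto ((tendsto_bilin B (hlimY t ht)).add ((tendsto_bilin M (hlimπ t ht)).const_mul _))
      ((((hπ 0 le_rfl).add_const _).mul_const _).const_mul _) (hall.mono fun _ h => h.2)⟩

end Energy
end RayleighTaylor
end

/-! ### Parseval's identity on a square for real functions -/

noncomputable section
namespace RayleighTaylor
open Filter Topology

/-- The half-open square `[a, a + T)²`. -/
def box (a T : ℝ) : Set Plane := {y | ∀ i, y i ∈ Ico a (a + T)}

/-- The components of the wave vector with index `n` for period `T`. -/
def wave (T : ℝ) (n : Fin 2 → ℤ) (j : Fin 2) : ℝ := 2 * Real.pi * n j / T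

/-- `cos (k · y)` for the wave vector with index `n`. -/
def cosWave (T : ℝ) (n : Fin 2 → ℤ) (y : Plane) : ℝ :=
  Real.cos (wave T n 0 * y 0 + wave T n 1 * y 1)

/-- `sin (k · y)` for the wave vector with index `n`. -/
def sinWave (T : ℝ) (n : Fin 2 → ℤ) (y : Plane) : ℝ :=
  Real.sin (wave T n 0 * y 0 + wave T n 1 * y 1)

lemma contDiff_cosWave (T : ℝ) (n : Fin 2 → ℤ) : ContDiff ℝ ∞ (cosWave T n) := by
  unfold cosWave; fun_prop

lemma contDiff_sinWave (T : ℝ) (n : Fin 2 → ℤ) : ContDiff ℝ ∞ (sinWave T n) := by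
  unfold sinWave; fun_prop

lemma abs_cosWave_le (T : ℝ) (n : Fin 2 → ℤ) (y : Plane) : |cosWave T n y| ≤ 1 :=
  Real.abs_cos_le_one _

lemma abs_sinWave_le (T : ℝ) (n : Fin 2 → ℤ) (y : Plane) : |sinWave T n y| ≤ 1 :=
  Real.abs_sin_le_one _

/-- The cosine coefficient on the square `[a, a + T)²`. -/
def cosCoef (a T : ℝ) (n : Fin 2 → ℤ) (f : Plane → ℝ) : ℝ := ∫ y in box a T, f y * cosWave T n y

/-- The sine coefficient on the square `[a, a + T)²`. -/
def sinCoef (a T : ℝ) (n : Fin 2 → ℤ) (f : Plane → ℝ) : ℝ := ∫ y in box a T, f y * sinWave T n y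

lemma measurableSet_box (a T : ℝ) : MeasurableSet (box a T) := by
  have : box a T = ⋂ i, (fun y : Plane => y i) ⁻¹' Ico a (a + T) := by
    ext; simp [box]
  rw [this]
  exact MeasurableSet.iInter fun i => (by fun_prop : Measurable fun y : Plane => y i) measurableSet_Ico

lemma isBounded_box (a T : ℝ) : Bornology.IsBounded (box a T) := by
  have hK : IsCompact ((WithLp.toLp 2 : (Fin 2 → ℝ) → Plane) '' (univ.pi fun _ => Icc a (a + T))) :=
    (isCompact_univ_pi fun _ => isCompact_Icc).image (PiLp.continuous_toLp 2 _)
  refine hK.isBounded.subset fun y hy => ⟨fun i => y i, fun i _ => Ico_subset_Icc_self (hy i), ?_⟩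
  rfl

instance (a T : ℝ) : IsFiniteMeasure (volume.restrict (box a T)) :=
  ⟨by rw [Measure.restrict_apply_univ]; exact (isBounded_box a T).measure_lt_top⟩

section Parseval

local instance : MeasureSpace UnitAddCircle := ⟨AddCircle.haarAddCircle⟩

/-- The parametrisation of the square by the unit torus. -/
def torusChart (a T : ℝ) (t : UnitAddTorus (Fin 2)) : Plane :=
  T • (WithLp.toLp 2 fun i => ((UnitAddTorus.measurableEquivPiIoc fun _ => a / T) t).1 i)

/-- The unit torus is parametrised by intervals open on the left and closed on the right, while the
period cell is the opposite; the faces on which they differ are null. -/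
lemma box_ae_eq {a T : ℝ} :
    box a T =ᵐ[volume] {y : Plane | ∀ i, y i ∈ Ioc a (a + T)} := by
  have h : ∀ c : ℝ, ∀ i : Fin 2, volume {y : Plane | y i = c} = 0 := by
    intro c i
    have h1 := (EuclideanSpace.volume_preserving_symm_measurableEquiv_toLp (Fin 2)).measure_preimage
      (s := {x : Fin 2 → ℝ | x i = c}) ((measurableSet_eq_fun (by fun_prop) (by fun_prop)).nullMeasurableSet)
    have h2 : volume {x : Fin 2 → ℝ | x i = c} = 0 := by
      have := Measure.pi_hyperplane (fun _ : Fin 2 => (volume : Measure ℝ)) i c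
      exact this
    rw [h2] at h1
    exact h1
  have hne : ∀ᵐ y : Plane, ∀ i, y i ≠ a ∧ y i ≠ a + T := by
    rw [ae_all_iff]
    intro i
    filter_upwards [measure_eq_zero_iff_ae_notMem.1 (h a i),
      measure_eq_zero_iff_ae_notMem.1 (h (a + T) i)] with y h1 h2
    exact ⟨h1, h2⟩
  filter_upwards [hne] with y hy
  refine propext ⟨fun h i => ⟨lt_of_le_of_ne (h i).1 (hy i).1.symm, (h i).2.le⟩,
    fun h i => ⟨(h i).1.le, lt_of_le_of_ne (h i).2 (hy i).2⟩⟩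

/-- The torus is identified with a unit square at `a / T`, which is then dilated by `T`. Haar
measure has total mass one, whence the factor `T⁻²`. -/
lemma measurePreserving_torusChart {a T : ℝ} (hT : 0 < T) :
    MeasurePreserving (torusChart a T) volume
      (ENNReal.ofReal ((T ^ 2)⁻¹) • volume.restrict (box a T)) := by
  have h1 := UnitAddTorus.measurePreserving_equivPiIoc (d := Fin 2) (fun _ => a / T)
  have hS : MeasurableSet {x : Fin 2 → ℝ | ∀ i, x i ∈ Ioc (a / T) (a / T + 1)} := by
    have : {x : Fin 2 → ℝ | ∀ i, x i ∈ Ioc (a / T) (a / T + 1)} =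
        univ.pi fun _ => Ioc (a / T) (a / T + 1) := by ext; simp
    rw [this]
    exact MeasurableSet.univ_pi fun _ => measurableSet_Ioc
  have h2 := measurePreserving_subtype_coe (μa := (volume : Measure (Fin 2 → ℝ))) hS
  have h3 : MeasurePreserving (WithLp.toLp 2 : (Fin 2 → ℝ) → Plane)
      (volume.restrict {x : Fin 2 → ℝ | ∀ i, x i ∈ Ioc (a / T) (a / T + 1)})
      (volume.restrict {y : Plane | ∀ i, y i ∈ Ioc (a / T) (a / T + 1)}) := by
    have hm : MeasurableSet {y : Plane | ∀ i, y i ∈ Ioc (a / T) (a / T + 1)} := by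
      have : {y : Plane | ∀ i, y i ∈ Ioc (a / T) (a / T + 1)} =
          ⋂ i, (fun y : Plane => y i) ⁻¹' Ioc (a / T) (a / T + 1) := by ext; simp
      rw [this]
      exact MeasurableSet.iInter fun i =>
        (by fun_prop : Measurable fun y : Plane => y i) measurableSet_Ioc
    exact (PiLp.volume_preserving_toLp (Fin 2)).restrict_preimage hm
  have h4 : MeasurePreserving (fun y : Plane => T • y)
      (volume.restrict {y : Plane | ∀ i, y i ∈ Ioc (a / T) (a / T + 1)})
      (ENNReal.ofReal ((T ^ 2)⁻¹) • volume.restrict (box a T)) := by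
    have h5 : MeasurePreserving (fun y : Plane => T • y) volume
        (ENNReal.ofReal ((T ^ 2)⁻¹) • volume) := by
      refine ⟨by fun_prop, ?_⟩
      rw [Measure.map_addHaar_smul volume hT.ne']
      simp
    rw [Measure.restrict_congr_set box_ae_eq, ← Measure.restrict_smul]
    have hm : MeasurableSet {y : Plane | ∀ i, y i ∈ Ioc a (a + T)} := by
      have : {y : Plane | ∀ i, y i ∈ Ioc a (a + T)} =
          ⋂ i, (fun y : Plane => y i) ⁻¹' Ioc a (a + T) := by ext; simp
      rw [this]
      exact MeasurableSet.iInter fun i =>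
        (by fun_prop : Measurable fun y : Plane => y i) measurableSet_Ioc
    have h6 := h5.restrict_preimage hm
    have : (fun y : Plane => T • y) ⁻¹' {y : Plane | ∀ i, y i ∈ Ioc a (a + T)} =
        {y : Plane | ∀ i, y i ∈ Ioc (a / T) (a / T + 1)} := by
      ext y
      simp only [mem_preimage, mem_ofPred_eq, PiLp.smul_apply, smul_eq_mul, mem_Ioc,
        div_lt_iff₀ hT, mul_comm T, ← sub_le_iff_le_add, le_div_iff₀ hT]
      refine forall_congr' fun i => and_congr_right fun _ => ?_
      rw [sub_le_iff_le_add, sub_mul, one_mul, sub_le_iff_le_add]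
    rwa [this] at h6
  exact h4.comp (h3.comp (h2.comp h1))

/-- Parseval's identity on a square, for real functions. -/
theorem hasSum_coef_mul {a T : ℝ} (hT : 0 < T) {f g : Plane → ℝ}
    (hf : MemLp f 2 (volume.restrict (box a T))) (hg : MemLp g 2 (volume.restrict (box a T))) :
    HasSum (fun n => cosCoef a T n f * cosCoef a T n g + sinCoef a T n f * sinCoef a T n g)
      (T ^ 2 * ∫ y in box a T, f y * g y) := by
  have hΨ := measurePreserving_torusChart (a := a) hT
  have hc0 : ENNReal.ofReal ((T ^ 2)⁻¹) ≠ ⊤ := ENNReal.ofReal_ne_top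
  have hlift : ∀ {f : Plane → ℝ}, MemLp f 2 (volume.restrict (box a T)) →
      MemLp (fun t => ((f (torusChart a T t) : ℝ) : ℂ)) 2 volume := by
    intro f hf
    have := (hf.smul_measure hc0).ofReal (K := ℂ)
    exact this.comp_measurePreserving hΨ
  have hint : ∀ h : Plane → ℂ, AEStronglyMeasurable h (volume.restrict (box a T)) →
      ∫ t, h (torusChart a T t) = ((T ^ 2)⁻¹ : ℝ) * ∫ y in box a T, h y := by
    intro h hh
    have := integral_map hΨ.measurable.aemeasurable (f := h) (by
      rw [hΨ.map_eq]; exact hh.smul_measure _)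
    rw [← this, hΨ.map_eq, integral_smul_measure, ENNReal.toReal_ofReal (by positivity)]
    simp
  -- For a real function the complex coefficient is `T⁻²` times the cosine coefficient minus `i`
  -- times the sine coefficient.
  have hcoef : ∀ {f : Plane → ℝ} (hf : MemLp f 2 (volume.restrict (box a T))) (n : Fin 2 → ℤ),
      UnitAddTorus.mFourierCoeff ((hlift hf).toLp _ : UnitAddTorus (Fin 2) → ℂ) n =
        ((T ^ 2)⁻¹ : ℝ) * (cosCoef a T n f - sinCoef a T n f * Complex.I) := by
    intro f hf n
    have hfi : Integrable f (volume.restrict (box a T)) :=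
      MemLp.integrable (q := 2) (by norm_num) hf
    have hcb : Integrable (fun y => f y * cosWave T n y) (volume.restrict (box a T)) :=
      hfi.mul_bdd (c := 1) (contDiff_cosWave T n).continuous.aestronglyMeasurable
        (.of_forall fun y => abs_cosWave_le T n y)
    have hsb : Integrable (fun y => f y * sinWave T n y) (volume.restrict (box a T)) :=
      hfi.mul_bdd (c := 1) (contDiff_sinWave T n).continuous.aestronglyMeasurable
        (.of_forall fun y => abs_sinWave_le T n y)
    have h1 : UnitAddTorus.mFourierCoeff ((hlift hf).toLp _ : UnitAddTorus (Fin 2) → ℂ) n =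
        ∫ t, (fun y : Plane => ((f y * cosWave T n y : ℝ) : ℂ) -
          ((f y * sinWave T n y : ℝ) : ℂ) * Complex.I) (torusChart a T t) := by
      refine integral_congr_ae ?_
      filter_upwards [(hlift hf).coeFn_toLp] with t ht
      rw [ht]
      have hexp : UnitAddTorus.mFourier (-n) t = (cosWave T n (torusChart a T t) : ℂ) -
          (sinWave T n (torusChart a T t) : ℂ) * Complex.I := by
        set x : Fin 2 → ℝ := ((UnitAddTorus.measurableEquivPiIoc fun _ => a / T) t).1 with hx
        have hxt : ∀ i, ((x i : ℝ) : UnitAddCircle) = t i := fun i => AddCircle.coe_equivIoc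
        have e1 : UnitAddTorus.mFourier (-n) t =
            Complex.exp ((-(wave T n 0 * (T * x 0) + wave T n 1 * (T * x 1)) : ℝ) * Complex.I) := by
          simp only [UnitAddTorus.mFourier, ContinuousMap.coe_mk, Fin.prod_univ_two]
          rw [← hxt 0, ← hxt 1, fourier_coe_apply, fourier_coe_apply, ← Complex.exp_add]
          congr 1
          simp only [wave, Pi.neg_apply]
          push_cast
          have : (T : ℂ) ≠ 0 := by exact_mod_cast hT.ne'
          field_simp
          ring
        rw [e1, Complex.exp_mul_I, ← Complex.ofReal_cos, ← Complex.ofReal_sin, Real.cos_neg,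
          Real.sin_neg]
        have e2 : ∀ i, torusChart a T t i = T * x i := fun i => rfl
        rw [cosWave, sinWave, e2, e2]
        push_cast
        ring
      rw [hexp, smul_eq_mul]
      push_cast
      ring
    have hm : AEStronglyMeasurable (fun y : Plane => ((f y * cosWave T n y : ℝ) : ℂ) -
          ((f y * sinWave T n y : ℝ) : ℂ) * Complex.I) (volume.restrict (box a T)) :=
      (hcb.ofReal.sub (hsb.ofReal.mul_const _)).aestronglyMeasurable
    refine h1.trans ((hint _ hm).trans ?_)
    congr 1
    rw [integral_sub hcb.ofReal (hsb.ofReal.mul_const _), integral_mul_const]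
    simp only [cosCoef, sinCoef]
    rw [integral_complex_ofReal, integral_complex_ofReal]
  have hP := UnitAddTorus.hasSum_prod_mFourierCoeff ((hlift hf).toLp _) ((hlift hg).toLp _)
  have hfun : (fun n => (starRingEnd ℂ) (UnitAddTorus.mFourierCoeff
      ((hlift hf).toLp _ : UnitAddTorus (Fin 2) → ℂ) n) * UnitAddTorus.mFourierCoeff
      ((hlift hg).toLp _ : UnitAddTorus (Fin 2) → ℂ) n) = fun n => (starRingEnd ℂ)
      (((T ^ 2)⁻¹ : ℝ) * (cosCoef a T n f - sinCoef a T n f * Complex.I)) *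
      (((T ^ 2)⁻¹ : ℝ) * (cosCoef a T n g - sinCoef a T n g * Complex.I)) :=
    funext fun n => by rw [hcoef hf n, hcoef hg n]
  have hprod : ∫ t, (starRingEnd ℂ) (((hlift hf).toLp _ : UnitAddTorus (Fin 2) → ℂ) t) *
      ((hlift hg).toLp _ : UnitAddTorus (Fin 2) → ℂ) t =
      (((T ^ 2)⁻¹ * ∫ y in box a T, f y * g y : ℝ) : ℂ) := by
    have h1 : ∫ t, (starRingEnd ℂ) (((hlift hf).toLp _ : UnitAddTorus (Fin 2) → ℂ) t) *
        ((hlift hg).toLp _ : UnitAddTorus (Fin 2) → ℂ) t =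
        ∫ t, (fun y : Plane => ((f y * g y : ℝ) : ℂ)) (torusChart a T t) := by
      refine integral_congr_ae ?_
      filter_upwards [(hlift hf).coeFn_toLp, (hlift hg).coeFn_toLp] with t h1 h2
      rw [h1, h2]
      simp
    refine h1.trans ((hint _ (Complex.continuous_ofReal.comp_aestronglyMeasurable
      (hf.1.mul hg.1))).trans ?_)
    rw [integral_complex_ofReal]
    push_cast
    rfl
  rw [hfun, hprod] at hP
  -- The real part of the product of conjugated and plain coefficients is the sum of the cosine and
  -- sine products, up to `T⁻⁴`, which is cleared here.
  have hre := (Complex.hasSum_re hP).mul_left ((T ^ 2) ^ 2)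
  have hT2 : (T ^ 2 : ℝ) ≠ 0 := by positivity
  have e1 : (fun n => cosCoef a T n f * cosCoef a T n g + sinCoef a T n f * sinCoef a T n g) =
      fun n => (T ^ 2) ^ 2 * ((starRingEnd ℂ)
      (((T ^ 2)⁻¹ : ℝ) * (cosCoef a T n f - sinCoef a T n f * Complex.I)) *
      (((T ^ 2)⁻¹ : ℝ) * (cosCoef a T n g - sinCoef a T n g * Complex.I))).re := by
    funext n
    simp only [map_mul, map_sub, Complex.conj_ofReal, Complex.conj_I, Complex.mul_re,
      Complex.ofReal_re, Complex.ofReal_im, Complex.sub_re, Complex.sub_im, Complex.mul_im,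
      Complex.neg_re, Complex.neg_im, Complex.I_re, Complex.I_im]
    field_simp
    ring
  have e2 : T ^ 2 * ∫ y in box a T, f y * g y =
      (T ^ 2) ^ 2 * (((T ^ 2)⁻¹ * ∫ y in box a T, f y * g y : ℝ) : ℂ).re := by
    rw [Complex.ofReal_re]
    field_simp
  rw [e1, e2]
  exact hre

end Parseval
end RayleighTaylor
end

/-! ### Weak derivatives and functionals in the vertical variable -/

noncomputable section
namespace RayleighTaylor
open Filter Topology

namespace Setup

variable {F : Setup}

lemma ae_eq_zero_of_test {u : ℝ → ℝ} {O : Set ℝ} (hO : IsOpen O)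
    (hOl : ∀ᵐ z ∂F.lin, z ∈ O) (hOs : O ⊆ Ioo (-F.m) F.ℓ) (hu : Integrable u F.lin)
    (h : ∀ τ : ℝ → ℝ, ContDiff ℝ ∞ τ → HasCompactSupport τ → tsupport τ ⊆ O →
      ∫ z, u z * τ z ∂F.lin = 0) : ∀ᵐ z ∂F.lin, u z = 0 := by
  have h1 : ∀ᵐ z ∂(volume : Measure ℝ), z ∈ O → u z = 0 := by
    refine hO.ae_eq_zero_of_integral_contDiff_smul_eq_zero
      ((IntegrableOn.mono_set hu hOs).locallyIntegrableOn) fun τ h1 h2 h3 => ?_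
    rw [← setIntegral_eq_integral_of_forall_compl_eq_zero (s := Ioo (-F.m) F.ℓ)]
    · simpa only [smul_eq_mul, mul_comm] using! h τ h1 h2 h3
    · intro z hz
      rw [image_eq_zero_of_notMem_tsupport fun h => hz (hOs (h3 h)), zero_smul]
  filter_upwards [hOl, ae_restrict_of_ae h1] with z h2 h3 using h3 h2

lemma memLp_of_continuous {τ : ℝ → ℝ} (h : Continuous τ) : MemLp τ 2 F.lin := by
  obtain ⟨K, hK⟩ := isCompact_Icc.exists_bound_of_continuousOn
    (h.continuousOn (s := Icc (-F.m) F.ℓ))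
  exact MemLp.of_bound h.aestronglyMeasurable K (ae_lin_of_forall hK)

lemma integrable_of_memLp {u : ℝ → ℝ} (hu : MemLp u 2 F.lin) : Integrable u F.lin :=
  MemLp.integrable (q := 2) (by norm_num) hu

lemma exists_Icc_of_tsupport {τ : ℝ → ℝ} (hc : HasCompactSupport τ)
    (hs : tsupport τ ⊆ Ioo (-F.m) F.ℓ) :
    ∃ a b, -F.m < a ∧ a ≤ b ∧ b < F.ℓ ∧ ∀ z, z ∉ Icc a b → τ z = 0 := by
  set K := tsupport τ ∪ {0} with hK
  have hKc : IsCompact K := hc.isCompact.union isCompact_singleton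
  have hKs : K ⊆ Ioo (-F.m) F.ℓ := union_subset hs (by
    rw [singleton_subset_iff]; exact ⟨by linarith [F.m_pos], F.ℓ_pos⟩)
  have hne : K.Nonempty := ⟨0, .inr rfl⟩
  refine ⟨sInf K, sSup K, (hKs (hKc.sInf_mem hne)).1,
    csInf_le_csSup hne hKc.bddBelow hKc.bddAbove, (hKs (hKc.sSup_mem hne)).2, fun z hz => ?_⟩
  by_contra h
  have hzK : z ∈ K := .inl (subset_tsupport τ h)
  exact hz ⟨csInf_le hKc.bddBelow hzK, le_csSup hKc.bddAbove hzK⟩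

/-- The lemma of du Bois-Reymond. -/
lemma ae_eq_const_of_test {w : ℝ → ℝ} (hw : MemLp w 2 F.lin)
    (h : ∀ τ : ℝ → ℝ, ContDiff ℝ ∞ τ → HasCompactSupport τ → tsupport τ ⊆ Ioo (-F.m) F.ℓ →
      ∫ z, w z * deriv τ z ∂F.lin = 0) : ∃ c, ∀ᵐ z ∂F.lin, w z = c := by
  have hz0 : (0 : ℝ) ∈ Ioo (-F.m) F.ℓ := ⟨by linarith [F.m_pos], F.ℓ_pos⟩
  -- a normalised bump function
  set R := min F.m F.ℓ with hR
  have hR0 : 0 < R := lt_min F.m_pos F.ℓ_pos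
  let β : ContDiffBump (0 : ℝ) := ⟨R / 4, R / 2, by linarith, by linarith⟩
  set κ₀ : ℝ → ℝ := β.normed volume with hκ₀
  have hκ₀s : ContDiff ℝ ∞ κ₀ := β.contDiff_normed
  have hκ₀c : HasCompactSupport κ₀ := β.hasCompactSupport_normed
  have hκ₀t : tsupport κ₀ ⊆ Ioo (-F.m) F.ℓ := by
    rw [hκ₀, β.tsupport_normed_eq]
    intro z hz
    have hz' : |z| ≤ R / 2 := by simpa [Real.dist_eq] using hz
    have h1 : R ≤ F.m := min_le_left _ _
    have h2 : R ≤ F.ℓ := min_le_right _ _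
    exact ⟨by linarith [neg_abs_le z], by linarith [le_abs_self z]⟩
  have hκ₀i : ∫ z, κ₀ z ∂F.lin = 1 := by
    rw [lin, setIntegral_eq_integral_of_forall_compl_eq_zero, hκ₀, β.integral_normed]
    exact fun z hz => image_eq_zero_of_notMem_tsupport fun h => hz (hκ₀t h)
  set c := ∫ z, w z * κ₀ z ∂F.lin with hc
  refine ⟨c, ?_⟩
  have hwi := integrable_of_memLp hw
  have hmain : ∀ᵐ z ∂F.lin, w z - c = 0 := by
    refine ae_eq_zero_of_test isOpen_Ioo (ae_restrict_mem measurableSet_Ioo) subset_rfl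
      (hwi.sub (integrable_const c)) fun κ h1 h2 h3 => ?_
    set I := ∫ z, κ z ∂F.lin with hI
    -- Subtracting the right multiple of the normalised bump makes the mean vanish, so the primitive
    -- is again compactly supported in the interval and may be used as a test function.
    set d : ℝ → ℝ := fun z => κ z - I * κ₀ z with hd
    have hds : ContDiff ℝ ∞ d := h1.sub (contDiff_const.mul hκ₀s)
    have hdc : Continuous d := hds.continuous
    set τ : ℝ → ℝ := fun z => ∫ y in (-F.m)..z, d y with hτ
    have hτd : ∀ z, HasDerivAt τ (d z) z := fun z =>
      intervalIntegral.integral_hasDerivAt_right (hdc.intervalIntegrable _ _)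
        (hdc.stronglyMeasurableAtFilter _ _) hdc.continuousAt
    have hτ' : deriv τ = d := funext fun z => (hτd z).deriv
    have hτs : ContDiff ℝ ∞ τ := by
      rw [contDiff_infty_iff_deriv, hτ']
      exact ⟨fun z => (hτd z).differentiableAt, hds⟩
    obtain ⟨a, b, ha, hab, hb, hκ0⟩ := exists_Icc_of_tsupport h2 h3
    obtain ⟨a', b', ha', hab', hb', hκ0'⟩ := exists_Icc_of_tsupport hκ₀c hκ₀t
    have hd0 : ∀ z, z ∉ Icc (min a a') (max b b') → d z = 0 := by
      intro z hz
      have e1 : z ∉ Icc a b := fun h => hz ⟨(min_le_left _ _).trans h.1, h.2.trans (le_max_left _ _)⟩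
      have e2 : z ∉ Icc a' b' := fun h =>
        hz ⟨(min_le_right _ _).trans h.1, h.2.trans (le_max_right _ _)⟩
      simp [hd, hκ0 z e1, hκ0' z e2]
    have hτl : ∀ z, z < min a a' → τ z = 0 := by
      intro z hz
      have : ∀ y ∈ uIcc (-F.m) z, d y = 0 := by
        intro y hy
        refine hd0 y fun h => ?_
        have := hy.2
        have h5 : max (-F.m) z < min a a' := max_lt (lt_min ha ha') hz
        linarith [h.1]
      simp only [hτ]
      rw [intervalIntegral.integral_congr this, intervalIntegral.integral_zero]
    have hdi : ∫ z in (-F.m)..F.ℓ, d z = 0 := by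
      rw [integral_lin, integral_sub (integrable_of_memLp (memLp_of_continuous h1.continuous))
        ((integrable_of_memLp (memLp_of_continuous hκ₀s.continuous)).const_mul I),
        integral_const_mul, hκ₀i, mul_one, sub_self]
    have hτr : ∀ z, max b b' < z → τ z = 0 := by
      intro z hz
      have h5 : τ z = (∫ y in (-F.m)..F.ℓ, d y) + ∫ y in F.ℓ..z, d y :=
        (intervalIntegral.integral_add_adjacent_intervals (hdc.intervalIntegrable _ _)
          (hdc.intervalIntegrable _ _)).symm
      have : ∀ y ∈ uIcc F.ℓ z, d y = 0 := by
        intro y hy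
        refine hd0 y fun h => ?_
        have h6 := hy.1
        have h7 : max b b' < min F.ℓ z := lt_min (max_lt hb hb') hz
        linarith [h.2]
      rw [h5, hdi, intervalIntegral.integral_congr this, intervalIntegral.integral_zero, add_zero]
    have hτsupp : tsupport τ ⊆ Icc (min a a') (max b b') := by
      refine closure_minimal (fun z hz => ?_) isClosed_Icc
      by_contra hcon
      rw [mem_Icc, not_and_or, not_le, not_le] at hcon
      rcases hcon with h | h
      · exact hz (hτl z h)
      · exact hz (hτr z h)
    have hkey := h τ hτs (isCompact_Icc.of_isClosed_subset (isClosed_tsupport _) hτsupp)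
      (hτsupp.trans fun z hz => ⟨lt_of_lt_of_le (lt_min ha ha') hz.1,
        hz.2.trans_lt (max_lt hb hb')⟩)
    rw [hτ'] at hkey
    have hwκ := integrable_mul_lin hw (memLp_of_continuous h1.continuous)
    have hwκ₀ := integrable_mul_lin hw (memLp_of_continuous hκ₀s.continuous)
    have e1 : ∀ z, w z * d z = w z * κ z - I * (w z * κ₀ z) := fun z => by simp only [hd]; ring
    simp only [e1] at hkey
    rw [integral_sub hwκ (hwκ₀.const_mul I), integral_const_mul, ← hc] at hkey
    have e2 : ∀ z, (w z - c) * κ z = w z * κ z - c * κ z := fun z => by ring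
    simp only [e2]
    rw [integral_sub hwκ ((integrable_of_memLp (memLp_of_continuous h1.continuous)).const_mul c),
      integral_const_mul, ← hI]
    linarith
  filter_upwards [hmain] with z hz using sub_eq_zero.1 hz

variable (F) in
/-- The primitive vanishing at the bottom. -/
def prim (d : ℝ → ℝ) (z : ℝ) : ℝ := ∫ y in (-F.m)..z, d y

lemma intervalIntegrable_of_memLp {d : ℝ → ℝ} (hd : MemLp d 2 F.lin) {a b : ℝ}
    (ha : a ∈ Icc (-F.m) F.ℓ) (hb : b ∈ Icc (-F.m) F.ℓ) : IntervalIntegrable d volume a b := by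
  have h1 : IntegrableOn d (Icc (-F.m) F.ℓ) := by
    rw [integrableOn_Icc_iff_integrableOn_Ioo]; exact integrable_of_memLp hd
  exact (h1.mono_set (uIcc_subset_Icc ha hb)).intervalIntegrable

lemma continuousOn_prim {d : ℝ → ℝ} (hd : MemLp d 2 F.lin) :
    ContinuousOn (F.prim d) (Icc (-F.m) F.ℓ) := by
  have h1 : IntegrableOn d (uIcc (-F.m) F.ℓ) := by
    rw [uIcc_of_le neg_m_lt_ℓ.le, integrableOn_Icc_iff_integrableOn_Ioo]
    exact integrable_of_memLp hd
  have h2 := intervalIntegral.continuousOn_primitive_interval h1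
  rwa [uIcc_of_le neg_m_lt_ℓ.le] at h2

lemma memLp_prim {d : ℝ → ℝ} (hd : MemLp d 2 F.lin) : MemLp (F.prim d) 2 F.lin := by
  obtain ⟨K, hK⟩ := isCompact_Icc.exists_bound_of_continuousOn (continuousOn_prim hd)
  exact MemLp.of_bound (((continuousOn_prim hd).mono Ioo_subset_Icc_self).aestronglyMeasurable
    measurableSet_Ioo) K (ae_lin_of_forall hK)

lemma prim_bot (d : ℝ → ℝ) : F.prim d (-F.m) = 0 := by simp [prim]

/-- Integration by parts between a primitive and a smooth function. -/
lemma integral_prim_mul {d τ : ℝ → ℝ} (hd : MemLp d 2 F.lin) (hτ : ContDiff ℝ ∞ τ) :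
    ∫ z, (F.prim d z * deriv τ z + d z * τ z) ∂F.lin = F.prim d F.ℓ * τ F.ℓ := by
  have hl := left_mem_Icc.2 (neg_m_lt_ℓ (F := F)).le
  have hr := right_mem_Icc.2 (neg_m_lt_ℓ (F := F)).le
  have hτc : Continuous (deriv τ) := hτ.continuous_deriv (by simp)
  have h := integral_mul_primitive (f := F.prim d) (df := d) (g := τ) (dg := deriv τ)
    (neg_m_lt_ℓ (F := F)).le
    (intervalIntegrable_of_memLp hd hl hr) (hτc.intervalIntegrable _ _)
    (fun z _ => by rw [prim_bot, zero_add]; rfl)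
    (fun z _ => by
      rw [intervalIntegral.integral_deriv_eq_sub (fun x _ => hτ.differentiable (by simp) x)
        (hτc.intervalIntegrable _ _)]
      ring)
  rw [prim_bot, zero_mul, sub_zero, integral_lin] at h
  rw [← h]
  exact integral_congr_ae (.of_forall fun z => add_comm _ _)

/-- A function on the interval with a weak derivative against all test functions, with no condition
at the end points, is in `H¹₀`. -/
lemma isH10_of_weak {u d : ℝ → ℝ} (hu : MemLp u 2 F.lin) (hd : MemLp d 2 F.lin)
    (h : ∀ τ : ℝ → ℝ, ContDiff ℝ ∞ τ → HasCompactSupport τ →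
      ∫ z, (u z * deriv τ z + d z * τ z) ∂F.lin = 0) :
    F.IsH10 (F.prim d) d ∧ ∀ᵐ z ∂F.lin, u z = F.prim d z := by
  have hp := memLp_prim hd
  have hsub : ∀ τ : ℝ → ℝ, ContDiff ℝ ∞ τ → HasCompactSupport τ →
      ∫ z, (u z - F.prim d z) * deriv τ z ∂F.lin = -(F.prim d F.ℓ * τ F.ℓ) := by
    intro τ h1 h2
    have hτc : Continuous (deriv τ) := h1.continuous_deriv (by simp)
    have e0 := h τ h1 h2
    have e1 := integral_prim_mul hd h1
    have i1 := (integrable_mul_lin hu (memLp_of_continuous hτc)).add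
      (integrable_mul_lin hd (memLp_of_continuous h1.continuous))
    have i2 := (integrable_mul_lin hp (memLp_of_continuous hτc)).add
      (integrable_mul_lin hd (memLp_of_continuous h1.continuous))
    have e2 : ∀ z, (u z - F.prim d z) * deriv τ z = (u z * deriv τ z + d z * τ z) -
        (F.prim d z * deriv τ z + d z * τ z) := fun z => by ring
    simp only [e2]
    refine (integral_sub i1 i2).trans ?_
    simp only [Pi.add_apply]
    rw [e0, e1]
    ring
  -- Interior tests show that `u` differs from the primitive of `d` by a constant; tests that do not
  -- vanish at the end points determine the boundary values.
  obtain ⟨c, hc⟩ := ae_eq_const_of_test (hu.sub hp) fun τ h1 h2 h3 => by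
    have := hsub τ h1 h2
    rw [image_eq_zero_of_notMem_tsupport (f := τ) (x := F.ℓ) fun h => by simpa using h3 h] at this
    simpa using this
  have hc' : ∀ τ : ℝ → ℝ, ContDiff ℝ ∞ τ → HasCompactSupport τ →
      c * (τ F.ℓ - τ (-F.m)) = -(F.prim d F.ℓ * τ F.ℓ) := by
    intro τ h1 h2
    rw [← hsub τ h1 h2]
    have hτc : Continuous (deriv τ) := h1.continuous_deriv (by simp)
    have : ∫ z, (u z - F.prim d z) * deriv τ z ∂F.lin = ∫ z, c * deriv τ z ∂F.lin := by
      refine integral_congr_ae ?_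
      filter_upwards [hc] with z hz
      simp only [Pi.sub_apply] at hz
      rw [hz]
    rw [this, integral_const_mul, ← integral_lin,
      intervalIntegral.integral_deriv_eq_sub (fun x _ => h1.differentiable (by simp) x)
        (hτc.intervalIntegrable _ _)]
  have hlen : 0 < F.ℓ + F.m := by linarith [neg_m_lt_ℓ (F := F)]
  -- The outer radius is half the length of the interval, so a bump centred at one end vanishes at
  -- the other. The bump at `-m` forces `c = 0`, and then the one at `ℓ` forces the primitive to
  -- vanish there.
  let β : ∀ x : ℝ, ContDiffBump x := fun x =>
    ⟨(F.ℓ + F.m) / 4, (F.ℓ + F.m) / 2, by linarith, by linarith⟩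
  have hβ1 : ∀ x, β x x = 1 := fun x => (β x).one_of_mem_closedBall (Metric.mem_closedBall_self (β x).rIn_pos.le)
  have hβ0 : ∀ x y : ℝ, (F.ℓ + F.m) / 2 ≤ |y - x| → β x y = 0 := fun x y h =>
    (β x).zero_of_le_dist (by simpa [Real.dist_eq] using h)
  have hc0 : c = 0 := by
    have := hc' (β (-F.m)) (β _).contDiff (β _).hasCompactSupport
    rw [hβ1, hβ0 (-F.m) F.ℓ (by rw [sub_neg_eq_add, abs_of_pos hlen]; linarith)] at this
    linarith
  have hℓ : F.prim d F.ℓ = 0 := by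
    have := hc' (β F.ℓ) (β _).contDiff (β _).hasCompactSupport
    rw [hβ1, hc0] at this
    linarith
  refine ⟨⟨hd, fun _ _ => rfl, hℓ⟩, ?_⟩
  filter_upwards [hc] with z hz
  simp only [Pi.sub_apply, hc0] at hz
  linarith

/-- A functional that vanishes on test functions vanishes on `H¹₀`. -/
lemma functional_H10 {r s : ℝ → ℝ} (hr : MemLp r 2 F.lin) (hs : MemLp s 2 F.lin) (j : ℝ)
    (h : ∀ τ : ℝ → ℝ, ContDiff ℝ ∞ τ → HasCompactSupport τ → tsupport τ ⊆ Ioo (-F.m) F.ℓ →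
      ∫ z, (r z * τ z + s z * deriv τ z) ∂F.lin + j * τ 0 = 0)
    {φ dφ : ℝ → ℝ} (hφ : F.IsH10 φ dφ) :
    ∫ z, (r z * φ z + s z * dφ z) ∂F.lin + j * φ 0 = 0 := by
  have hl := left_mem_Icc.2 (neg_m_lt_ℓ (F := F)).le
  have hrt := right_mem_Icc.2 (neg_m_lt_ℓ (F := F)).le
  -- Integration by parts writes the whole functional as `∫ w φ'`: the zeroth order part enters
  -- through its primitive, and the point mass at `0` through a step, because `φ(0) = -∫₀^ℓ φ'`. The
  -- hypothesis makes `w` constant, and `φ'` has mean zero.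
  set w : ℝ → ℝ := fun z => s z - F.prim r z - (Ioi 0).indicator (fun _ => j) z with hw
  have hind : MemLp ((Ioi (0 : ℝ)).indicator fun _ => j) 2 F.lin :=
    (memLp_const j).indicator measurableSet_Ioi
  have hwm : MemLp w 2 F.lin := (hs.sub (memLp_prim hr)).sub hind
  -- the functional in terms of the derivative only
  have key : ∀ φ dφ : ℝ → ℝ, F.IsH10 φ dφ →
      ∫ z, (r z * φ z + s z * dφ z) ∂F.lin + j * φ 0 = ∫ z, w z * dφ z ∂F.lin := by
    intro φ dφ hφ
    have hd : MemLp dφ 2 F.lin := hφ.1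
    have e1 : ∫ z, (r z * φ z + F.prim r z * dφ z) ∂F.lin = 0 := by
      rw [← integral_lin]
      have := integral_mul_primitive (f := F.prim r) (df := r) (g := φ) (dg := dφ)
        (neg_m_lt_ℓ (F := F)).le (intervalIntegrable_of_memLp hr hl hrt)
        (intervalIntegrable_of_memLp hd hl hrt)
        (fun z _ => by rw [prim_bot, zero_add]; rfl)
        (fun z hz => hφ.eq_add hl hz)
      rw [this, hφ.2.2, prim_bot]
      ring
    have e2 : ∫ z, (Ioi (0 : ℝ)).indicator (fun _ => j) z * dφ z ∂F.lin = -(j * φ 0) := by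
      have h1 : ∀ z, (Ioi (0 : ℝ)).indicator (fun _ => j) z * dφ z =
          (Ioi (0 : ℝ)).indicator (fun z => j * dφ z) z := fun z => by
        by_cases hz : z ∈ Ioi (0 : ℝ) <;> simp [hz]
      simp only [h1]
      rw [integral_indicator measurableSet_Ioi, lin, Measure.restrict_restrict measurableSet_Ioi]
      have h2 : Ioi (0 : ℝ) ∩ Ioo (-F.m) F.ℓ = Ioo 0 F.ℓ := by
        ext z
        simp only [mem_inter_iff, mem_Ioi, mem_Ioo]
        constructor
        · rintro ⟨h1, -, h2⟩; exact ⟨h1, h2⟩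
        · rintro ⟨h1, h2⟩; exact ⟨h1, by linarith [F.m_pos], h2⟩
      rw [h2, integral_const_mul, ← integral_Ioc_eq_integral_Ioo,
        ← intervalIntegral.integral_of_le F.ℓ_pos.le]
      have h3 := hφ.eq_add zero_mem hrt
      rw [hφ.2.2] at h3
      have h4 : ∫ y in (0)..F.ℓ, dφ y = -φ 0 := by linarith
      rw [h4]
      ring
    have i1 := integrable_mul_lin hr hφ.memLp
    have i2 := integrable_mul_lin hs hd
    have i3 := integrable_mul_lin (memLp_prim hr) hd
    have i4 := integrable_mul_lin hind hd
    have e3 : ∀ z, w z * dφ z = (r z * φ z + s z * dφ z) -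
        (r z * φ z + F.prim r z * dφ z) - (Ioi (0 : ℝ)).indicator (fun _ => j) z * dφ z :=
      fun z => by simp only [hw]; ring
    simp only [e3]
    have e4 := integral_sub ((i1.add i2).sub (i1.add i3)) i4
    have e5 := integral_sub (i1.add i2) (i1.add i3)
    simp only [Pi.add_apply, Pi.sub_apply] at e4 e5
    rw [e4, e5, e1, e2]
    ring
  obtain ⟨c, hc⟩ := ae_eq_const_of_test hwm fun τ h1 h2 h3 => by
    rw [← key τ (deriv τ) (isH10_of_contDiff h1 h3)]
    exact h τ h1 h2 h3
  rw [key φ dφ hφ]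
  have : ∫ z, w z * dφ z ∂F.lin = ∫ z, c * dφ z ∂F.lin := by
    refine integral_congr_ae ?_
    filter_upwards [hc] with z hz
    rw [hz]
  rw [this, integral_const_mul, ← integral_lin, ← hφ.2.1 _ hrt, hφ.2.2, mul_zero]

end Setup
end RayleighTaylor
end

/-! ### Horizontal Fourier modes on the interface and in the fluid -/

noncomputable section
namespace RayleighTaylor
open Filter Topology

namespace Horizontal

variable {H : Horizontal}

lemma measurableSet_cell (H : Horizontal) : MeasurableSet H.cell := by
  cases H with
  | plane => exact MeasurableSet.univ
  | torus L =>
    have : cell (torus L) = box 0 (2 * Real.pi * L) := by simp [cell, box]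
    rw [this]
    exact measurableSet_box _ _

instance (H : Horizontal) : SFinite H.surf := by unfold surf; infer_instance

end Horizontal

/-- A box contained in the horizontal domain whose Fourier modes are admissible. -/
structure Window (H : Horizontal) where
  a : ℝ
  T : ℝ
  T_pos : 0 < T
  subset : box a T ⊆ H.cell
  mul_cos : ∀ n χ, H.IsPlaneTest χ → H.IsPlaneTest (fun y => χ y * cosWave T n y)
  mul_sin : ∀ n χ, H.IsPlaneTest χ → H.IsPlaneTest (fun y => χ y * sinWave T n y)
  freq : ∀ n, n ≠ 0 → Real.sqrt (wave T n 0 ^ 2 + wave T n 1 ^ 2) ∈ H.freqs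

namespace Window

variable {H : Horizontal} (W : Window H)

/-- `f` vanishes outside the box. -/
def Off (f : Plane → ℝ) : Prop := ∀ y ∈ H.cell, y ∉ box W.a W.T → f y = 0

variable {W} {f g : Plane → ℝ}

lemma Off.integral_eq (hf : W.Off f) : ∫ y, f y ∂H.surf = ∫ y in box W.a W.T, f y :=
  setIntegral_eq_of_subset_of_forall_sdiff_eq_zero H.measurableSet_cell W.subset
    fun y hy => hf y hy.1 hy.2

lemma Off.mul (hf : W.Off f) (g : Plane → ℝ) : W.Off (fun y => f y * g y) := fun y h1 h2 => by
  simp [hf y h1 h2]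

lemma Off.mul_left (hf : W.Off f) (g : Plane → ℝ) : W.Off (fun y => g y * f y) := fun y h1 h2 => by
  simp [hf y h1 h2]

variable (W)

/-- The cosine coefficient of a function on the interface. -/
def cosI (n : Fin 2 → ℤ) (f : Plane → ℝ) : ℝ := ∫ y, f y * cosWave W.T n y ∂H.surf

/-- The sine coefficient of a function on the interface. -/
def sinI (n : Fin 2 → ℤ) (f : Plane → ℝ) : ℝ := ∫ y, f y * sinWave W.T n y ∂H.surf

/-- The cosine coefficient of a function on space, as a function of height. -/
def cosM (n : Fin 2 → ℤ) (f : Space → ℝ) (z : ℝ) : ℝ := W.cosI n fun y => f (y, z)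

/-- The sine coefficient of a function on space, as a function of height. -/
def sinM (n : Fin 2 → ℤ) (f : Space → ℝ) (z : ℝ) : ℝ := W.sinI n fun y => f (y, z)

variable {W}

lemma restrict_surf : H.surf.restrict (box W.a W.T) = volume.restrict (box W.a W.T) := by
  rw [Horizontal.surf, Measure.restrict_restrict (measurableSet_box _ _),
    inter_eq_self_of_subset_left W.subset]

lemma memLp_box {p : ENNReal} (hf : MemLp f p H.surf) :
    MemLp f p (volume.restrict (box W.a W.T)) := by
  rw [← W.restrict_surf]
  exact hf.restrict _

/-- Parseval's identity on the interface. -/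
theorem hasSum_surf (hf : MemLp f 2 H.surf) (hg : MemLp g 2 H.surf) (of : W.Off f) (og : W.Off g) :
    HasSum (fun n => W.cosI n f * W.cosI n g + W.sinI n f * W.sinI n g)
      (W.T ^ 2 * ∫ y, f y * g y ∂H.surf) := by
  have h := hasSum_coef_mul W.T_pos (memLp_box (W := W) hf) (memLp_box (W := W) hg)
  simp only [cosI, sinI, (of.mul _).integral_eq, (og.mul _).integral_eq]
  exact h

end Window

namespace Setup

variable {F : Setup} {H : Horizontal}

/-- The interface is a null set of heights, so the fluid measure is a product over the full interval
and Fubini's theorem applies without splitting the layers. -/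
lemma vol_eq : F.vol H = H.surf.prod F.lin := by
  rw [Horizontal.surf, lin, ← F.restrict_heights, Measure.prod_restrict]; rfl

lemma memLp_slice {f : Space → ℝ} (hf : MemLp f 2 (F.vol H)) :
    ∀ᵐ z ∂F.lin, MemLp (fun y => f (y, z)) 2 H.surf := by
  rw [vol_eq] at hf
  filter_upwards [hf.integrable_sq.prod_left_ae, hf.1.prodMk_right] with z h1 h2
  exact (memLp_two_iff_integrable_sq h2).2 h1

lemma integral_vol {f : Space → ℝ} (hf : Integrable f (F.vol H)) :
    ∫ x, f x ∂F.vol H = ∫ z, ∫ y, f (y, z) ∂H.surf ∂F.lin := by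
  rw [vol_eq] at hf ⊢
  exact integral_prod_symm f hf

lemma integrable_slices {f : Space → ℝ} (hf : Integrable f (F.vol H)) :
    Integrable (fun z => ∫ y, f (y, z) ∂H.surf) F.lin := by
  rw [vol_eq] at hf
  exact hf.integral_prod_right

lemma memLp_top_height {a : ℝ → ℝ} (ha : MemLp a ⊤ F.lin) :
    MemLp (fun x : Space => a x.2) ⊤ (F.vol H) := by
  have h := Measure.quasiMeasurePreserving_snd (μ := H.surf) (ν := F.lin)
  rw [vol_eq]
  refine memLp_top_of_bound (ha.1.comp_quasiMeasurePreserving h) (eLpNorm a ⊤ F.lin).toReal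
    (h.ae (p := fun z => ‖a z‖ ≤ (eLpNorm a ⊤ F.lin).toReal) ?_)
  filter_upwards [ae_le_eLpNormEssSup (f := a) (μ := F.lin)] with z hz
  have h2 := ENNReal.toReal_mono ha.2.ne (hz.trans (by rw [eLpNorm_exponent_top]))
  simpa using h2

lemma memLp_top_of_continuous {a : ℝ → ℝ} (ha : Continuous a) : MemLp a ⊤ F.lin := by
  obtain ⟨K, hK⟩ := (isCompact_Icc (a := -F.m) (b := F.ℓ)).exists_bound_of_continuousOn
    ha.continuousOn
  exact memLp_top_of_bound ha.aestronglyMeasurable K (ae_lin_of_forall hK)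

lemma Coef.memLp_top {c : ℝ → ℝ} (hc : F.Coef c) : MemLp c ⊤ F.lin := by
  obtain ⟨K, -, hK⟩ := hc.bounded
  exact memLp_top_of_bound hc.aesm K (ae_lin_of_forall hK)

lemma memL2_mul {a : ℝ → ℝ} (ha : MemLp a ⊤ F.lin) {f : Space → ℝ} (hf : MemLp f 2 (F.vol H)) :
    MemLp (fun x => a x.2 * f x) 2 (F.vol H) :=
  hf.mul (memLp_top_height (H := H) ha)

end Setup

namespace Window

open Setup

variable {F : Setup} {H : Horizontal} (W : Window H)

/-- `f` vanishes outside the box, at all heights. -/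
def OffS (f : Space → ℝ) : Prop := ∀ z, W.Off fun y => f (y, z)

variable {W} {f g : Space → ℝ} {n : Fin 2 → ℤ}

lemma OffS.mul (hf : W.OffS f) (g : Space → ℝ) : W.OffS (fun x => f x * g x) :=
  fun z => (hf z).mul _

lemma OffS.mul_left (hf : W.OffS f) (g : Space → ℝ) : W.OffS (fun x => g x * f x) :=
  fun z => (hf z).mul_left _

instance : IsFiniteMeasure ((volume.restrict (box W.a W.T)).prod F.lin) := inferInstance

/-- In the plane the domain has infinite measure; vanishing outside the box is what makes square
integrability imply integrability. -/
lemma integrable_of_offS (hf : MemLp f 2 (F.vol H)) (of : W.OffS f) : Integrable f (F.vol H) := by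
  have h1 : IntegrableOn f (box W.a W.T ×ˢ univ) (F.vol H) := by
    have : (F.vol H).restrict (box W.a W.T ×ˢ univ) = (volume.restrict (box W.a W.T)).prod F.lin := by
      rw [vol_eq, ← Measure.prod_restrict, restrict_surf, Measure.restrict_univ]
    have h2 := hf.restrict (box W.a W.T ×ˢ univ)
    rw [this] at h2
    rw [IntegrableOn, this]
    exact h2.integrable (by norm_num)
  have hm : MeasurableSet (box W.a W.T ×ˢ (univ : Set ℝ)) :=
    (measurableSet_box _ _).prod MeasurableSet.univ
  refine (h1.integrable_indicator hm).congr ?_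
  have hc : ∀ᵐ x ∂F.vol H, x.1 ∈ H.cell := by
    rw [vol]
    refine (ae_restrict_iff' ?_).2 (Eventually.of_forall fun x hx => hx.1)
    exact H.measurableSet_cell.prod F.isOpen_heights.measurableSet
  filter_upwards [hc] with x hx
  by_cases h : x.1 ∈ box W.a W.T
  · rw [indicator_of_mem]
    exact ⟨h, trivial⟩
  · rw [indicator_of_notMem (fun h' => h h'.1)]
    exact (of x.2 x.1 hx h).symm

lemma memLp_top_wave {w : Plane → ℝ} (hw : Continuous w) (hb : ∀ y, |w y| ≤ 1) :
    MemLp (fun x : Space => w x.1) ⊤ (F.vol H) :=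
  memLp_top_of_bound (hw.comp continuous_fst).aestronglyMeasurable 1
    (Eventually.of_forall fun x => hb x.1)

/-- Fubini: pairing with a product of a wave and a weight of height is a one-dimensional pairing of
the mode with that weight. Identities tested in space thereby become identities for single modes. -/
lemma integral_wave {w : Plane → ℝ} (hw : Continuous w) (hb : ∀ y, |w y| ≤ 1)
    (hf : MemLp f 2 (F.vol H)) (of : W.OffS f) {a : ℝ → ℝ} (ha : MemLp a ⊤ F.lin) :
    Integrable (fun x => f x * (a x.2 * w x.1)) (F.vol H) ∧
    ∫ x, f x * (a x.2 * w x.1) ∂F.vol H = ∫ z, (∫ y, f (y, z) * w y ∂H.surf) * a z ∂F.lin := by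
  have h1 : MemLp (fun x => f x * (a x.2 * w x.1)) 2 (F.vol H) := by
    have := (memL2_mul ha hf).mul (r := 2) (memLp_top_wave (F := F) (H := H) hw hb)
    refine this.congr_norm ?_ ?_
    · exact hf.1.mul ((memLp_top_height ha).1.mul (memLp_top_wave hw hb).1)
    · refine Eventually.of_forall fun x => ?_
      simp only [Pi.mul_apply]
      congr 1
      ring
  have h2 := integrable_of_offS h1 (of.mul _)
  refine ⟨h2, ?_⟩
  rw [integral_vol h2]
  refine integral_congr_ae (Eventually.of_forall fun z => ?_)
  simp only
  rw [← integral_mul_const]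
  refine integral_congr_ae (Eventually.of_forall fun y => ?_)
  simp only
  ring

lemma integral_cos (hf : MemLp f 2 (F.vol H)) (of : W.OffS f) {a : ℝ → ℝ} (ha : MemLp a ⊤ F.lin)
    (n : Fin 2 → ℤ) :
    Integrable (fun x => f x * (a x.2 * cosWave W.T n x.1)) (F.vol H) ∧
    ∫ x, f x * (a x.2 * cosWave W.T n x.1) ∂F.vol H = ∫ z, W.cosM n f z * a z ∂F.lin :=
  integral_wave (contDiff_cosWave _ _).continuous (abs_cosWave_le _ _) hf of ha

lemma integral_sin (hf : MemLp f 2 (F.vol H)) (of : W.OffS f) {a : ℝ → ℝ} (ha : MemLp a ⊤ F.lin)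
    (n : Fin 2 → ℤ) :
    Integrable (fun x => f x * (a x.2 * sinWave W.T n x.1)) (F.vol H) ∧
    ∫ x, f x * (a x.2 * sinWave W.T n x.1) ∂F.vol H = ∫ z, W.sinM n f z * a z ∂F.lin :=
  integral_wave (contDiff_sinWave _ _).continuous (abs_sinWave_le _ _) hf of ha

lemma aesm_integral_wave {w : Plane → ℝ} (hw : Continuous w) (hf : MemLp f 2 (F.vol H)) :
    AEStronglyMeasurable (fun z => ∫ y, f (y, z) * w y ∂H.surf) F.lin := by
  have h : AEStronglyMeasurable (fun x : Space => f x * w x.1) (H.surf.prod F.lin) := by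
    rw [← vol_eq]
    exact hf.1.mul (hw.comp continuous_fst).aestronglyMeasurable
  exact h.prod_swap.integral_prod_right'

lemma hasSum_slice (hf : MemLp f 2 (F.vol H)) (hg : MemLp g 2 (F.vol H)) (of : W.OffS f)
    (og : W.OffS g) : ∀ᵐ z ∂F.lin,
    HasSum (fun n => W.cosM n f z * W.cosM n g z + W.sinM n f z * W.sinM n g z)
      (W.T ^ 2 * ∫ y, f (y, z) * g (y, z) ∂H.surf) := by
  filter_upwards [memLp_slice hf, memLp_slice hg] with z h1 h2
  exact hasSum_surf h1 h2 (of z) (og z)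

/-- Bessel's inequality on almost every horizontal slice bounds the squares of the modes by an
integrable function of height. -/
lemma memLp_modes (hf : MemLp f 2 (F.vol H)) (of : W.OffS f) (n : Fin 2 → ℤ) :
    MemLp (W.cosM n f) 2 F.lin ∧ MemLp (W.sinM n f) 2 F.lin := by
  have hb : ∀ᵐ z ∂F.lin, W.cosM n f z ^ 2 + W.sinM n f z ^ 2 ≤
      W.T ^ 2 * ∫ y, f (y, z) * f (y, z) ∂H.surf := by
    filter_upwards [hasSum_slice hf hf of of] with z hz
    have := hz.summable.le_tsum n fun j _ => by nlinarith [mul_self_nonneg (W.cosM j f z), mul_self_nonneg (W.sinM j f z)]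
    rw [hz.tsum_eq] at this
    linarith
  have hi : Integrable (fun z => W.T ^ 2 * ∫ y, f (y, z) * f (y, z) ∂H.surf) F.lin :=
    (integrable_slices (hf.integrable_mul hf)).const_mul _
  have h1 : AEStronglyMeasurable (W.cosM n f) F.lin :=
    aesm_integral_wave (contDiff_cosWave _ _).continuous hf
  have h2 : AEStronglyMeasurable (W.sinM n f) F.lin :=
    aesm_integral_wave (contDiff_sinWave _ _).continuous hf
  rw [memLp_two_iff_integrable_sq h1, memLp_two_iff_integrable_sq h2]
  constructor
  · refine hi.mono' (h1.pow 2) ?_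
    filter_upwards [hb] with z hz
    rw [Real.norm_of_nonneg (by positivity)]
    nlinarith [sq_nonneg (W.sinM n f z)]
  · refine hi.mono' (h2.pow 2) ?_
    filter_upwards [hb] with z hz
    rw [Real.norm_of_nonneg (by positivity)]
    nlinarith [sq_nonneg (W.cosM n f z)]

/-- Parseval's identity in the fluid domain. -/
theorem hasSum_vol (hf : MemLp f 2 (F.vol H)) (hg : MemLp g 2 (F.vol H)) (of : W.OffS f)
    (og : W.OffS g) :
    HasSum (fun n => ∫ z, (W.cosM n f z * W.cosM n g z + W.sinM n f z * W.sinM n g z) ∂F.lin)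
      (W.T ^ 2 * ∫ x, f x * g x ∂F.vol H) := by
  rw [show ∫ x, f x * g x ∂F.vol H = _ from integral_vol (hf.integrable_mul hg), ← integral_const_mul]
  have hff := hasSum_slice hf hf of of
  have hgg := hasSum_slice hg hg og og
  -- The products in Parseval's series are dominated by half the sum of the series for `f, f` and
  -- `g, g`, which converge to integrable functions of height; dominated convergence then exchanges
  -- sum and vertical integral.
  have hb : ∀ᵐ z ∂F.lin, HasSum (fun n => (1 / 2 : ℝ) *
      ((W.cosM n f z * W.cosM n f z + W.sinM n f z * W.sinM n f z) +
        (W.cosM n g z * W.cosM n g z + W.sinM n g z * W.sinM n g z)))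
      (1 / 2 * (W.T ^ 2 * (∫ y, f (y, z) * f (y, z) ∂H.surf) +
        W.T ^ 2 * ∫ y, g (y, z) * g (y, z) ∂H.surf)) := by
    filter_upwards [hff, hgg] with z h1 h2
    exact (h1.add h2).mul_left _
  refine hasSum_integral_of_dominated_convergence _ (fun n => ?_) (fun n => ?_)
    (hb.mono fun z hz => hz.summable) ?_ (hasSum_slice hf hg of og)
  · have h1 := memLp_modes (F := F) hf of n
    have h2 := memLp_modes (F := F) hg og n
    exact (h1.1.1.mul h2.1.1).add (h1.2.1.mul h2.2.1)
  · refine Eventually.of_forall fun z => ?_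
    rw [Real.norm_eq_abs, abs_le]
    constructor <;> nlinarith [sq_nonneg (W.cosM n f z + W.cosM n g z),
      sq_nonneg (W.sinM n f z + W.sinM n g z), sq_nonneg (W.cosM n f z - W.cosM n g z),
      sq_nonneg (W.sinM n f z - W.sinM n g z)]
  · refine Integrable.congr (f := fun z => 1 / 2 * (W.T ^ 2 * (∫ y, f (y, z) * f (y, z) ∂H.surf) +
        W.T ^ 2 * ∫ y, g (y, z) * g (y, z) ∂H.surf)) ?_ ?_
    · exact (((integrable_slices (hf.integrable_mul hf)).const_mul _).add
        ((integrable_slices (hg.integrable_mul hg)).const_mul _)).const_mul _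
    · filter_upwards [hb] with z hz
      exact hz.tsum_eq.symm

end Window
end RayleighTaylor
end

/-! ### Integration over a period and classical derivatives of products and waves -/

noncomputable section
namespace RayleighTaylor
open Filter Topology

/-- The plane as a product, with the coordinate `j` first. -/
def splitPlane (j : Fin 2) : Plane ≃ᵐ ℝ × (Fin 1 → ℝ) :=
  (MeasurableEquiv.toLp 2 (Fin 2 → ℝ)).symm.trans (MeasurableEquiv.piFinSuccAbove (fun _ => ℝ) j)

lemma measurePreserving_splitPlane (j : Fin 2) : MeasurePreserving (splitPlane j) :=
  (EuclideanSpace.volume_preserving_symm_measurableEquiv_toLp (Fin 2)).trans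
    (volume_preserving_piFinSuccAbove (fun _ => ℝ) j)

lemma splitPlane_symm (j : Fin 2) (r : ℝ) (p : Fin 1 → ℝ) :
    (splitPlane j).symm (r, p) = (splitPlane j).symm (0, p) + r • planeVec j := by
  ext i
  have h : ∀ s : ℝ, (splitPlane j).symm (s, p) i = Fin.insertNth (α := fun _ => ℝ) j s p i :=
    fun s => rfl
  rw [PiLp.add_apply, PiLp.smul_apply, h, h]
  by_cases hi : i = j
  · subst hi; simp [planeVec]
  · obtain ⟨k, rfl⟩ := Fin.exists_succAbove_eq hi
    simp [planeVec]

lemma continuous_planeD {f : Plane → ℝ} (hf : ContDiff ℝ ∞ f) (j : Fin 2) :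
    Continuous (planeD j f) :=
  (hf.continuous_fderiv (by simp)).clm_apply continuous_const

/-- The integral of a derivative over a period vanishes. -/
lemma integral_box_planeD {a T : ℝ} (hT : 0 < T) {f : Plane → ℝ} (hf : ContDiff ℝ ∞ f) (j : Fin 2)
    (h : ∀ y : Plane, y j = a → f (y + T • planeVec j) = f y) :
    ∫ y in box a T, planeD j f y = 0 := by
  have hbox : box a T =
      splitPlane j ⁻¹' (Ico a (a + T) ×ˢ {p | ∀ i, p i ∈ Ico a (a + T)}) := by
    ext y
    have h1 : (splitPlane j y).1 = y j := rfl
    have h2 : ∀ i, (splitPlane j y).2 i = y (j.succAbove i) := fun i => rfl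
    simp only [mem_preimage, mem_prod, h1, mem_ofPred_eq, h2, box]
    exact Fin.forall_iff_succAbove j
  have hc := continuous_planeD hf j
  have hint : IntegrableOn (planeD j f) (box a T) := by
    have hK : IsCompact (closure (box a T)) := (isBounded_box a T).isCompact_closure
    exact (hc.continuousOn.integrableOn_compact hK).mono_set subset_closure
  have e1 : planeD j f = fun y => (fun q => planeD j f ((splitPlane j).symm q)) (splitPlane j y) := by
    ext y; simp
  have mp := measurePreserving_splitPlane j
  rw [hbox] at hint ⊢
  rw [e1] at hint ⊢
  rw [mp.setIntegral_preimage_emb (splitPlane j).measurableEmbedding]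
  have hint' := (mp.integrableOn_comp_preimage (splitPlane j).measurableEmbedding
    (f := fun q => planeD j f ((splitPlane j).symm q))).1 hint
  rw [IntegrableOn, Measure.volume_eq_prod, ← Measure.prod_restrict] at hint'
  rw [Measure.volume_eq_prod, ← Measure.prod_restrict, integral_prod_symm _ hint']
  refine integral_eq_zero_of_ae (Eventually.of_forall fun p => ?_)
  simp only [Pi.zero_apply]
  rw [integral_Ico_eq_integral_Ioc, ← intervalIntegral.integral_of_le (by linarith)]
  -- After Fubini, the integrand is a derivative along the `j`-th coordinate line, and the
  -- hypothesis equates the values on the two opposite faces.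
  have hd : ∀ r : ℝ, HasDerivAt (fun r => f ((splitPlane j).symm (r, p)))
      (planeD j f ((splitPlane j).symm (r, p))) r := by
    intro r
    have h1 : HasDerivAt (fun r : ℝ => (splitPlane j).symm (0, p) + r • planeVec j)
        (planeVec j) r := by
      simpa using ((hasDerivAt_id r).smul_const (planeVec j)).const_add ((splitPlane j).symm (0, p))
    have h2 := ((hf.differentiable (by simp)) ((splitPlane j).symm (0, p) + r • planeVec j)).hasFDerivAt
    have h3 := h2.comp_hasDerivAt r h1
    rw [← splitPlane_symm j r p] at h3
    refine h3.congr_of_eventuallyEq (Eventually.of_forall fun s => ?_)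
    simp only [Function.comp_apply]
    rw [← splitPlane_symm j s p]
  have hcont : Continuous fun r => planeD j f ((splitPlane j).symm (r, p)) := by
    have : (fun r => planeD j f ((splitPlane j).symm (r, p))) =
        fun r : ℝ => planeD j f ((splitPlane j).symm (0, p) + r • planeVec j) := by
      ext r; rw [splitPlane_symm]
    rw [this]
    exact hc.comp (by fun_prop)
  rw [intervalIntegral.integral_eq_sub_of_hasDerivAt (fun r _ => hd r) (hcont.intervalIntegrable _ _),
    splitPlane_symm j (a + T), add_smul, ← add_assoc, ← splitPlane_symm j a, h, sub_self]
  have : ∀ s : ℝ, (splitPlane j).symm (s, p) j = Fin.insertNth (α := fun _ => ℝ) j s p j :=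
    fun s => rfl
  rw [this]; simp

section Derivatives

lemma planeD_mul {f g : Plane → ℝ} (hf : ContDiff ℝ ∞ f) (hg : ContDiff ℝ ∞ g) (j : Fin 2)
    (y : Plane) : planeD j (fun y => f y * g y) y = planeD j f y * g y + f y * planeD j g y := by
  unfold planeD
  rw [fderiv_fun_mul (hf.differentiable (by simp) y) (hg.differentiable (by simp) y)]
  simp
  ring

lemma partialD_mul {f g : Space → ℝ} (hf : ContDiff ℝ ∞ f) (hg : ContDiff ℝ ∞ g) (j : Fin 3)
    (x : Space) :
    partialD j (fun x => f x * g x) x = partialD j f x * g x + f x * partialD j g x := by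
  unfold partialD
  rw [fderiv_fun_mul (hf.differentiable (by simp) x) (hg.differentiable (by simp) x)]
  simp
  ring

lemma hasFDerivAt_phase (T : ℝ) (n : Fin 2 → ℤ) (y : Plane) :
    HasFDerivAt (fun y : Plane => wave T n 0 * y 0 + wave T n 1 * y 1)
      (wave T n 0 • (EuclideanSpace.proj 0 : Plane →L[ℝ] ℝ) +
        wave T n 1 • (EuclideanSpace.proj 1 : Plane →L[ℝ] ℝ)) y :=
  ((EuclideanSpace.proj 0 : Plane →L[ℝ] ℝ).hasFDerivAt.const_mul _).add
    ((EuclideanSpace.proj 1 : Plane →L[ℝ] ℝ).hasFDerivAt.const_mul _)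

lemma planeD_cosWave (T : ℝ) (n : Fin 2 → ℤ) (j : Fin 2) (y : Plane) :
    planeD j (cosWave T n) y = -(wave T n j * sinWave T n y) := by
  have h := (hasFDerivAt_phase T n y).cos
  unfold planeD
  rw [show cosWave T n = fun y => Real.cos _ from rfl, h.fderiv]
  fin_cases j <;> simp [planeVec, sinWave] <;> ring

lemma planeD_sinWave (T : ℝ) (n : Fin 2 → ℤ) (j : Fin 2) (y : Plane) :
    planeD j (sinWave T n) y = wave T n j * cosWave T n y := by
  have h := (hasFDerivAt_phase T n y).sin
  unfold planeD
  rw [show sinWave T n = fun y => Real.sin _ from rfl, h.fderiv]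
  fin_cases j <;> simp [planeVec, cosWave] <;> ring

lemma contDiff_planeD {f : Plane → ℝ} (hf : ContDiff ℝ ∞ f) (j : Fin 2) :
    ContDiff ℝ ∞ (planeD j f) :=
  (hf.fderiv_right (m := ∞) (by simp)).clm_apply contDiff_const

lemma contDiff_partialD {f : Space → ℝ} (hf : ContDiff ℝ ∞ f) (j : Fin 3) :
    ContDiff ℝ ∞ (partialD j f) :=
  (hf.fderiv_right (m := ∞) (by simp)).clm_apply contDiff_const

/-- Mixed partial derivatives commute. -/
lemma partialD_comm {f : Space → ℝ} (hf : ContDiff ℝ ∞ f) (i j : Fin 3) (x : Space) :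
    partialD i (partialD j f) x = partialD j (partialD i f) x := by
  have h : ∀ i j, partialD i (partialD j f) x = fderiv ℝ (fderiv ℝ f) x (spaceVec i) (spaceVec j) := by
    intro i j
    have hd : DifferentiableAt ℝ (fderiv ℝ f) x :=
      (hf.fderiv_right (m := ∞) (by simp)).differentiable (by simp) x
    unfold partialD
    rw [fderiv_clm_apply hd (by fun_prop)]
    simp
  rw [h, h]
  exact (hf.contDiffAt.isSymmSndFDerivAt (by simpa using (WithTop.coe_le_coe.2 le_top : ((2 : ℕ∞) : WithTop ℕ∞) ≤ ((⊤ : ℕ∞) : WithTop ℕ∞)))).eq _ _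

/-- The index of a horizontal direction in space. -/
def horiz (j : Fin 2) : Fin 3 := j.castSucc

lemma spaceVec_horiz (j : Fin 2) : spaceVec (horiz j) = (planeVec j, 0) := by
  fin_cases j <;> rfl

lemma planeD_slice {f : Space → ℝ} (hf : ContDiff ℝ ∞ f) (j : Fin 2) (y : Plane) (z : ℝ) :
    planeD j (fun y => f (y, z)) y = partialD (horiz j) f (y, z) := by
  have h1 : HasFDerivAt (fun y : Plane => ((y, z) : Space)) (ContinuousLinearMap.inl ℝ Plane ℝ) y :=
    hasFDerivAt_prodMk_left y z
  have h2 := ((hf.differentiable (by simp)) (y, z)).hasFDerivAt.comp y h1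
  unfold planeD partialD
  rw [show (fun y => f (y, z)) = f ∘ fun y => (y, z) from rfl, h2.fderiv, spaceVec_horiz]
  simp

lemma hasDerivAt_slice {f : Space → ℝ} (hf : ContDiff ℝ ∞ f) (y : Plane) (z : ℝ) :
    HasDerivAt (fun z => f (y, z)) (partialD 2 f (y, z)) z := by
  have h1 : HasDerivAt (fun z : ℝ => ((y, z) : Space)) (0, 1) z :=
    (hasDerivAt_const z y).prodMk (hasDerivAt_id z)
  exact ((hf.differentiable (by simp)) (y, z)).hasFDerivAt.comp_hasDerivAt z h1

lemma partialD_horiz_prod {χ : Plane → ℝ} {τ : ℝ → ℝ} (hχ : ContDiff ℝ ∞ χ) (hτ : ContDiff ℝ ∞ τ)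
    (j : Fin 2) (x : Space) :
    partialD (horiz j) (fun x => χ x.1 * τ x.2) x = planeD j χ x.1 * τ x.2 := by
  have hf : ContDiff ℝ ∞ (fun x : Space => χ x.1 * τ x.2) := by fun_prop
  rw [show x = (x.1, x.2) from rfl, ← planeD_slice hf]
  simp only
  rw [planeD_mul hχ contDiff_const]
  simp [planeD]

lemma partialD_two_prod {χ : Plane → ℝ} {τ : ℝ → ℝ} (hχ : ContDiff ℝ ∞ χ) (hτ : ContDiff ℝ ∞ τ)
    (x : Space) :
    partialD 2 (fun x => χ x.1 * τ x.2) x = χ x.1 * deriv τ x.2 := by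
  have hf : ContDiff ℝ ∞ (fun x : Space => χ x.1 * τ x.2) := by fun_prop
  have h1 := hasDerivAt_slice hf x.1 x.2
  have h2 := ((hτ.differentiable (by simp)) x.2).hasDerivAt.const_mul (χ x.1)
  exact h1.unique h2

end Derivatives
end RayleighTaylor
end

/-! ### Test functions, windows and horizontal cutoffs -/

noncomputable section
namespace RayleighTaylor
open Filter Topology

lemma tsupport_planeD {f : Plane → ℝ} (j : Fin 2) : tsupport (planeD j f) ⊆ tsupport f :=
  closure_minimal (fun y hy => by
    by_contra h
    exact hy (by rw [planeD, fderiv_of_notMem_tsupport (𝕜 := ℝ) h]; rfl)) (isClosed_tsupport f)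

lemma tsupport_partialD {f : Space → ℝ} (j : Fin 3) : tsupport (partialD j f) ⊆ tsupport f :=
  closure_minimal (fun y hy => by
    by_contra h
    exact hy (by rw [partialD, fderiv_of_notMem_tsupport (𝕜 := ℝ) h]; rfl)) (isClosed_tsupport f)

lemma cosWave_add {T : ℝ} (hT : T ≠ 0) (n : Fin 2 → ℤ) (y : Plane) (i : Fin 2) :
    cosWave T n (y + T • planeVec i) = cosWave T n y := by
  have h : wave T n i * T = n i * (2 * Real.pi) := by unfold wave; field_simp
  unfold cosWave
  fin_cases i
  · change wave T n 0 * T = n 0 * (2 * Real.pi) at h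
    rw [← Real.cos_add_int_mul_two_pi (wave T n 0 * y 0 + wave T n 1 * y 1) (n 0), ← h]; simp [planeVec]; congr 1; ring
  · change wave T n 1 * T = n 1 * (2 * Real.pi) at h
    rw [← Real.cos_add_int_mul_two_pi (wave T n 0 * y 0 + wave T n 1 * y 1) (n 1), ← h]; simp [planeVec]; congr 1; ring

lemma sinWave_add {T : ℝ} (hT : T ≠ 0) (n : Fin 2 → ℤ) (y : Plane) (i : Fin 2) :
    sinWave T n (y + T • planeVec i) = sinWave T n y := by
  have h : wave T n i * T = n i * (2 * Real.pi) := by unfold wave; field_simp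
  unfold sinWave
  fin_cases i
  · change wave T n 0 * T = n 0 * (2 * Real.pi) at h
    rw [← Real.sin_add_int_mul_two_pi (wave T n 0 * y 0 + wave T n 1 * y 1) (n 0), ← h]; simp [planeVec]; congr 1; ring
  · change wave T n 1 * T = n 1 * (2 * Real.pi) at h
    rw [← Real.sin_add_int_mul_two_pi (wave T n 0 * y 0 + wave T n 1 * y 1) (n 1), ← h]; simp [planeVec]; congr 1; ring

lemma exists_radius {K : Set Plane} (hK : IsCompact K) :
    ∃ R : ℝ, 0 < R ∧ ∀ y i, R ≤ |y i| → y ∉ K := by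
  obtain ⟨R, hR⟩ := hK.isBounded.exists_norm_le
  refine ⟨|R| + 1, by positivity, fun y i hy hyK => ?_⟩
  have h1 := hR y hyK
  have h2 := PiLp.norm_apply_le y i
  rw [Real.norm_eq_abs] at h2
  linarith [le_abs_self R]

lemma exists_of_notMem_box {R : ℝ} {y : Plane} (h : y ∉ box (-R) (2 * R)) : ∃ i, R ≤ |y i| := by
  by_contra! hc
  refine h fun i => ?_
  have := abs_lt.1 (hc i)
  exact ⟨this.1.le, by linarith⟩

namespace Horizontal

variable {H : Horizontal} {φ ψ : Space → ℝ} {χ ζ : Plane → ℝ}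

lemma IsTest.add_period {L : ℝ} (h : IsTest (torus L) φ) (x : Space) (i : Fin 2) :
    φ (x + ((2 * Real.pi * L) • planeVec i, 0)) = φ x := by
  have := h.2 x i
  rwa [show x + ((2 * Real.pi * L) • planeVec i, 0) = (x.1 + (2 * Real.pi * L) • planeVec i, x.2) from
    Prod.ext rfl (add_zero _)]

lemma IsTest.mul (h : H.IsTest φ) (h' : H.IsTest ψ) : H.IsTest (fun x => φ x * ψ x) := by
  refine ⟨h.1.mul h'.1, ?_⟩
  cases H with
  | plane => exact HasCompactSupport.mul_right h.2
  | torus L => intro x i; simp only [h.2 x i, h'.2 x i]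

lemma IsTest.partialD (h : H.IsTest φ) (j : Fin 3) : H.IsTest (partialD j φ) := by
  refine ⟨contDiff_partialD h.1 j, ?_⟩
  cases H with
  | plane =>
    exact h.2.mono' ((subset_tsupport _).trans (tsupport_partialD j))
  | torus L =>
    intro x i
    have h1 : (fun x => φ (x + ((2 * Real.pi * L) • planeVec i, 0))) = φ :=
      funext fun x => h.add_period x i
    unfold RayleighTaylor.partialD
    rw [show (x.1 + (2 * Real.pi * L) • planeVec i, x.2) = x + ((2 * Real.pi * L) • planeVec i, 0) from
      Prod.ext rfl (add_zero _).symm, ← fderiv_comp_add_right, h1]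

lemma IsPlaneTest.planeD (h : H.IsPlaneTest χ) (j : Fin 2) : H.IsPlaneTest (planeD j χ) := by
  refine ⟨contDiff_planeD h.1 j, ?_⟩
  cases H with
  | plane => exact h.2.mono' ((subset_tsupport _).trans (tsupport_planeD j))
  | torus L =>
    intro y i
    have h1 : (fun y => χ (y + (2 * Real.pi * L) • planeVec i)) = χ := funext fun y => h.2 y i
    unfold RayleighTaylor.planeD
    rw [← fderiv_comp_add_right, h1]

lemma IsTest.slice (h : H.IsTest φ) (z : ℝ) : H.IsPlaneTest (fun y => φ (y, z)) := by
  refine ⟨h.1.comp (contDiff_id.prodMk contDiff_const), ?_⟩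
  cases H with
  | plane =>
    refine HasCompactSupport.intro (h.2.image continuous_fst) fun y hy => ?_
    by_contra hc
    exact hy ⟨(y, z), subset_tsupport _ hc, rfl⟩
  | torus L => intro y i; exact h.2 (y, z) i

lemma IsPlaneTest.prod (h : H.IsPlaneTest χ) {τ : ℝ → ℝ} (hτ : ContDiff ℝ ∞ τ)
    (hc : HasCompactSupport τ) : H.IsTest (fun x => χ x.1 * τ x.2) := by
  refine ⟨(h.1.comp contDiff_fst).mul (hτ.comp contDiff_snd), ?_⟩
  cases H with
  | plane =>
    refine HasCompactSupport.intro (h.2.prod hc) fun x hx => ?_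
    by_contra hn
    exact hx ⟨subset_tsupport _ (left_ne_zero_of_mul hn), subset_tsupport _ (right_ne_zero_of_mul hn)⟩
  | torus L => intro x i; simp only [h.2 x.1 i]

lemma tsupport_prod (χ : Plane → ℝ) (τ : ℝ → ℝ) {S : Set ℝ} (h : tsupport τ ⊆ S) :
    tsupport (fun x : Space => χ x.1 * τ x.2) ⊆ {x | x.2 ∈ S} := by
  have : tsupport (fun x : Space => χ x.1 * τ x.2) ⊆ Prod.snd ⁻¹' tsupport τ :=
    closure_minimal (fun x hx => subset_tsupport _ (right_ne_zero_of_mul hx))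
      ((isClosed_tsupport τ).preimage continuous_snd)
  exact fun x hx => h (this hx)

lemma cell_torus (L : ℝ) : cell (torus L) = box 0 (2 * Real.pi * L) := by simp [cell, box]

instance {L : ℝ} : IsFiniteMeasure (surf (torus L)) := by
  unfold surf; rw [cell_torus]; infer_instance

lemma IsPlaneTest.memLp (h : H.IsPlaneTest χ) (p : ENNReal) : MemLp χ p H.surf := by
  cases H with
  | plane =>
    unfold surf
    exact h.1.continuous.memLp_of_hasCompactSupport h.2
  | torus L =>
    have h1 : MemLp χ ⊤ (surf (torus L)) := by
      obtain ⟨K, hK⟩ := (isBounded_box 0 (2 * Real.pi * L)).isCompact_closure.exists_bound_of_continuousOn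
        h.1.continuous.continuousOn
      refine memLp_top_of_bound h.1.continuous.aestronglyMeasurable K ?_
      rw [surf, cell_torus]
      exact (ae_restrict_iff' (measurableSet_box _ _)).2
        (Eventually.of_forall fun y hy => hK y (subset_closure hy))
    exact h1.mono_exponent le_top

lemma IsTest.memLp (F : Setup) (h : H.IsTest φ) (p : ENNReal) :
    MemLp φ p (F.vol H) := by
  cases H with
  | plane =>
    unfold Setup.vol
    exact h.1.continuous.memLp_of_hasCompactSupport h.2
  | torus L =>
    have h1 : MemLp φ ⊤ (F.vol (torus L)) := by
      obtain ⟨K, hK⟩ := ((isBounded_box 0 (2 * Real.pi * L)).isCompact_closure.prod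
        (isCompact_Icc (a := -F.m) (b := F.ℓ))).exists_bound_of_continuousOn
        h.1.continuous.continuousOn
      refine memLp_top_of_bound h.1.continuous.aestronglyMeasurable K ?_
      rw [Setup.vol, cell_torus]
      refine (ae_restrict_iff' ((measurableSet_box _ _).prod F.isOpen_heights.measurableSet)).2
        (Eventually.of_forall fun x hx => hK x ⟨subset_closure hx.1, ?_⟩)
      exact Ioo_subset_Icc_self (F.heights_subset hx.2)
    have : IsFiniteMeasure (F.vol (torus L)) := by rw [Setup.vol_eq]; infer_instance
    exact h1.mono_exponent le_top

/-- Horizontal integration by parts: the integral of a derivative vanishes. -/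
theorem IsPlaneTest.integral_planeD (hH : H.Proper) (h : H.IsPlaneTest χ) (j : Fin 2) :
    ∫ y, RayleighTaylor.planeD j χ y ∂H.surf = 0 := by
  cases H with
  | plane =>
    obtain ⟨R, hR, hK⟩ := exists_radius h.2
    have h0 : ∀ y i, R ≤ |y i| → χ y = 0 := fun y i hy => image_eq_zero_of_notMem_tsupport (hK y i hy)
    have h1 := integral_box_planeD (a := -R) (T := 2 * R) (by linarith) h.1 j fun y hy => by
      have hv : (y + (2 * R) • planeVec j) j = R := by simp [planeVec, hy]; ring
      rw [h0 y j (by rw [hy, abs_neg, abs_of_pos hR]), h0 _ j (by rw [hv, abs_of_pos hR])]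
    rw [← h1]
    refine setIntegral_eq_of_subset_of_forall_sdiff_eq_zero MeasurableSet.univ (subset_univ _)
      fun y hy => ?_
    obtain ⟨i, hi⟩ := exists_of_notMem_box hy.2
    exact image_eq_zero_of_notMem_tsupport fun hc => hK y i hi (tsupport_planeD j hc)
  | torus L =>
    rw [surf, cell_torus]
    exact integral_box_planeD (by have := Real.pi_pos; have : 0 < L := hH; positivity) h.1 j
      fun y _ => h.2 y j

end Horizontal

namespace Window

variable {H : Horizontal} {χ : Plane → ℝ}

/-- The square of side `2R` in the plane. -/
def planeBox {R : ℝ} (hR : 0 < R) : Window .plane where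
  a := -R
  T := 2 * R
  T_pos := by linarith
  subset := subset_univ _
  mul_cos n χ h := ⟨h.1.mul (contDiff_cosWave _ _), HasCompactSupport.mul_right h.2⟩
  mul_sin n χ h := ⟨h.1.mul (contDiff_sinWave _ _), HasCompactSupport.mul_right h.2⟩
  freq n hn := by
    refine Real.sqrt_pos.2 ?_
    have h2 : ∀ j, n j ≠ 0 → wave (2 * R) n j ≠ 0 := fun j hj => by
      unfold wave
      have := Real.pi_pos
      have : (n j : ℝ) ≠ 0 := by exact_mod_cast hj
      positivity
    obtain ⟨j, hj⟩ := Function.ne_iff.1 hn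
    have h3 := h2 j hj
    fin_cases j
    · have : 0 < wave (2 * R) n 0 ^ 2 := by positivity
      positivity
    · have : 0 < wave (2 * R) n 1 ^ 2 := by positivity
      positivity

/-- The period cell of the torus. -/
def torusCell {L : ℝ} (hL : 0 < L) : Window (.torus L) where
  a := 0
  T := 2 * Real.pi * L
  T_pos := by positivity
  subset := by rw [Horizontal.cell_torus]
  mul_cos n χ h := ⟨h.1.mul (contDiff_cosWave _ _), fun y i => by
    have : 2 * Real.pi * L ≠ 0 := by positivity
    simp only [h.2 y i, cosWave_add this]⟩
  mul_sin n χ h := ⟨h.1.mul (contDiff_sinWave _ _), fun y i => by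
    have : 2 * Real.pi * L ≠ 0 := by positivity
    simp only [h.2 y i, sinWave_add this]⟩
  freq n hn := by
    have h1 : ∀ j, wave (2 * Real.pi * L) n j = n j / L := fun j => by
      unfold wave; have := Real.pi_pos; field_simp
    have h2 : ∀ j, n j ≠ 0 → (n j : ℝ) / L ≠ 0 := fun j hj => by
      have : (n j : ℝ) ≠ 0 := by exact_mod_cast hj
      positivity
    rw [h1, h1]
    refine ⟨Real.sqrt_pos.2 ?_, n 0, n 1, rfl⟩
    obtain ⟨j, hj⟩ := Function.ne_iff.1 hn
    have h3 := h2 j hj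
    fin_cases j
    · have : 0 < ((n 0 : ℝ) / L) ^ 2 := by positivity
      positivity
    · have : 0 < ((n 1 : ℝ) / L) ^ 2 := by positivity
      positivity

/-- The derivative of `χ cos` integrates to zero, since this product is itself a test function; the
product rule exchanges cosine and sine coefficients. -/
lemma cosI_planeD (W : Window H) (hH : H.Proper) (h : H.IsPlaneTest χ) (n : Fin 2 → ℤ) (j : Fin 2) :
    W.cosI n (planeD j χ) = wave W.T n j * W.sinI n χ := by
  have h1 := (W.mul_cos n χ h).integral_planeD hH j
  have i1 := memLp_one_iff_integrable.1 ((W.mul_cos n _ (h.planeD j)).memLp 1)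
  have i2 := memLp_one_iff_integrable.1 ((W.mul_sin n _ h).memLp 1)
  have e : ∀ y, planeD j (fun y => χ y * cosWave W.T n y) y =
      planeD j χ y * cosWave W.T n y - wave W.T n j * (χ y * sinWave W.T n y) := fun y => by
    rw [planeD_mul h.1 (contDiff_cosWave _ _), planeD_cosWave]; ring
  simp only [e] at h1
  rw [integral_sub i1 (i2.const_mul _), integral_const_mul] at h1
  exact sub_eq_zero.1 h1

lemma sinI_planeD (W : Window H) (hH : H.Proper) (h : H.IsPlaneTest χ) (n : Fin 2 → ℤ) (j : Fin 2) :
    W.sinI n (planeD j χ) = -(wave W.T n j * W.cosI n χ) := by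
  have h1 := (W.mul_sin n χ h).integral_planeD hH j
  have i1 := memLp_one_iff_integrable.1 ((W.mul_sin n _ (h.planeD j)).memLp 1)
  have i2 := memLp_one_iff_integrable.1 ((W.mul_cos n _ h).memLp 1)
  have e : ∀ y, planeD j (fun y => χ y * sinWave W.T n y) y =
      planeD j χ y * sinWave W.T n y + wave W.T n j * (χ y * cosWave W.T n y) := fun y => by
    rw [planeD_mul h.1 (contDiff_sinWave _ _), planeD_sinWave]; ring
  simp only [e] at h1
  rw [integral_add i1 (i2.const_mul _), integral_const_mul] at h1
  exact eq_neg_of_add_eq_zero_left h1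

/-- Finitely many test functions fit into one box. -/
theorem exists_window (hH : H.Proper) (φ : Fin 3 → Space → ℝ) (h : ∀ i, H.IsTest (φ i)) :
    ∃ W : Window H, ∀ i, W.OffS (φ i) ∧ ∀ j, W.OffS (partialD j (φ i)) := by
  cases H with
  | plane =>
    obtain ⟨R, hR, hK⟩ := exists_radius
      ((isCompact_iUnion fun i => (h i).2 : IsCompact (⋃ i, tsupport (φ i))).image continuous_fst)
    have h0 : ∀ i z y, y ∉ box (-R) (2 * R) → (y, z) ∉ tsupport (φ i) := fun i z y hy hc => by
      obtain ⟨k, hk⟩ := exists_of_notMem_box hy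
      exact hK y k hk ⟨(y, z), mem_iUnion_of_mem i hc, rfl⟩
    refine ⟨planeBox hR, fun i => ⟨fun z y _ hy => ?_, fun j z y _ hy => ?_⟩⟩
    · exact image_eq_zero_of_notMem_tsupport (h0 i z y hy)
    · exact image_eq_zero_of_notMem_tsupport fun hc => h0 i z y hy (tsupport_partialD j hc)
  | torus L =>
    refine ⟨torusCell hH, fun i => ⟨fun z y h1 hy => ?_, fun j z y h1 hy => ?_⟩⟩ <;>
    · rw [Horizontal.cell_torus] at h1
      exact absurd h1 hy

end Window

/-- A horizontal cutoff function with a box outside which it vanishes. -/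
structure Cutoff (H : Horizontal) extends Window H where
  θ : Plane → ℝ
  test : H.IsPlaneTest θ
  off : toWindow.Off θ
  offD : ∀ j, toWindow.Off (planeD j θ)

/-- On the torus the constant `1` serves. In the plane a fixed bump is dilated by `N + 1`, so its
gradient is bounded uniformly in `N` and tends to zero; that decay removes the commutator terms
which truncation produces. -/
lemma exists_cutoffs {H : Horizontal} (hH : H.Proper) : ∃ (c : ℕ → Cutoff H) (K : ℝ),
    (∀ N y, |(c N).θ y| ≤ 1) ∧ (∀ N j y, |planeD j (c N).θ y| ≤ K) ∧
    (∀ y, Tendsto (fun N => (c N).θ y) atTop (𝓝 1)) ∧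
    ∀ j y, Tendsto (fun N => planeD j (c N).θ y) atTop (𝓝 0) := by
  cases H with
  | torus L =>
    have hL : 0 < L := hH
    have hD : ∀ j y, planeD j (fun _ => (1 : ℝ)) y = 0 := fun j y => by simp [planeD]
    refine ⟨fun _ => ⟨Window.torusCell hL, fun _ => 1, ⟨contDiff_const, fun _ _ => rfl⟩,
      fun y h1 hy => absurd (by rwa [Horizontal.cell_torus] at h1) hy, fun j y _ _ => hD j y⟩, 0,
      fun _ _ => by simp, fun _ j y => by simp [hD], fun _ => tendsto_const_nhds,
      fun j y => by simp only [hD]; exact tendsto_const_nhds⟩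
  | plane =>
    let β : ContDiffBump (0 : Plane) := ⟨1, 2, one_pos, by norm_num⟩
    have hpos : ∀ N : ℕ, (0 : ℝ) < N + 1 := fun N => by positivity
    let θ : ℕ → Plane → ℝ := fun N y => β (((N : ℝ) + 1)⁻¹ • y)
    have hθ : ∀ N, ContDiff ℝ ∞ (θ N) := fun N => β.contDiff.comp (contDiff_const_smul _)
    have hD : ∀ N j y, planeD j (θ N) y = ((N : ℝ) + 1)⁻¹ * planeD j β (((N : ℝ) + 1)⁻¹ • y) := by
      intro N j y
      have hβ : ContDiff ℝ ∞ β := β.contDiff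
      have h1 := hβ.differentiable (by simp) (((N : ℝ) + 1)⁻¹ • y)
      have h2 := h1.hasFDerivAt.comp y ((ContinuousLinearMap.id ℝ Plane).hasFDerivAt.const_smul
        ((N : ℝ) + 1)⁻¹)
      unfold planeD
      rw [show fderiv ℝ (θ N) y = _ from h2.fderiv]
      simp
    have hts : tsupport β = Metric.closedBall 0 2 := β.tsupport_eq
    have hfar : ∀ (N : ℕ) (y : Plane), y ∉ box (-(3 * ((N : ℝ) + 1))) (2 * (3 * ((N : ℝ) + 1))) →
        ((N : ℝ) + 1)⁻¹ • y ∉ tsupport β := by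
      intro N y hy hc
      obtain ⟨i, hi⟩ := exists_of_notMem_box hy
      rw [hts, mem_closedBall_zero_iff, norm_smul, Real.norm_of_nonneg (by positivity)] at hc
      have h2 := PiLp.norm_apply_le y i
      rw [Real.norm_eq_abs] at h2
      rw [inv_mul_le_iff₀ (hpos N)] at hc
      linarith [hpos N]
    have hK : ∀ j, ∃ K, ∀ y, ‖planeD j β y‖ ≤ K := fun j =>
      (continuous_planeD β.contDiff j).bounded_above_of_compact_support
        (β.hasCompactSupport.mono' ((subset_tsupport _).trans (tsupport_planeD j)))
    choose K hK using hK
    have hK0 : ∀ j y, |planeD j β y| ≤ |K 0| + |K 1| := by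
      intro j y
      have := hK j y
      rw [Real.norm_eq_abs] at this
      fin_cases j
      · exact this.trans ((le_abs_self _).trans (by simp))
      · exact this.trans ((le_abs_self _).trans (by simp))
    have hDb : ∀ N j y, |planeD j (θ N) y| ≤ ((N : ℝ) + 1)⁻¹ * (|K 0| + |K 1|) := by
      intro N j y
      rw [hD, abs_mul, abs_of_pos (inv_pos.2 (hpos N))]
      have := hpos N
      gcongr
      exact hK0 _ _
    -- The dilated bump is supported in the ball of radius `2(N + 1)`, which the half side `3(N +
    -- 1)` of the box exceeds.
    refine ⟨fun N => ⟨Window.planeBox (R := 3 * ((N : ℝ) + 1)) (by positivity), θ N, ⟨hθ N, ?_⟩,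
      fun y _ hy => ?_, fun j y _ hy => ?_⟩, |K 0| + |K 1|, fun N y => ?_, fun N j y => ?_,
      fun y => ?_, fun j y => ?_⟩
    · exact β.hasCompactSupport.comp_smul (inv_ne_zero (hpos N).ne')
    · exact image_eq_zero_of_notMem_tsupport (f := β) (hfar N y hy)
    · rw [hD, image_eq_zero_of_notMem_tsupport fun hc => hfar N y hy (tsupport_planeD j hc), mul_zero]
    · rw [abs_of_nonneg β.nonneg]
      exact β.le_one
    · refine (hDb N j y).trans (mul_le_of_le_one_left (by positivity) (inv_le_one_of_one_le₀ ?_))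
      linarith [(Nat.cast_nonneg N : (0 : ℝ) ≤ N)]
    · refine tendsto_const_nhds.congr' ?_
      filter_upwards [eventually_ge_atTop ⌈‖y‖⌉₊] with N hN
      refine (β.one_of_mem_closedBall ?_).symm
      rw [mem_closedBall_zero_iff, norm_smul, Real.norm_of_nonneg (by positivity),
        inv_mul_le_iff₀ (hpos N)]
      have := (Nat.ceil_le.1 hN)
      change ‖y‖ ≤ ((N : ℝ) + 1) * 1
      linarith
    · refine squeeze_zero_norm (fun N => hDb N j y) ?_
      simpa using (tendsto_one_div_add_atTop_nhds_zero_nat (𝕜 := ℝ)).mul_const (|K 0| + |K 1|)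

end RayleighTaylor
end

/-! ### Uniqueness and calculus of weak derivatives -/

noncomputable section
namespace RayleighTaylor
open Filter Topology

namespace Setup

variable {F : Setup} {H : Horizontal}

lemma memLp_top_horiz {w : Plane → ℝ} (hw : Continuous w) {K : ℝ} (hb : ∀ y, |w y| ≤ K) :
    MemLp (fun x : Space => w x.1) ⊤ (F.vol H) :=
  memLp_top_of_bound (hw.comp continuous_fst).aestronglyMeasurable K
    (Eventually.of_forall fun x => hb x.1)

lemma memL2_horiz_mul {w : Plane → ℝ} (hw : Continuous w) {K : ℝ} (hb : ∀ y, |w y| ≤ K)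
    {f : Space → ℝ} (hf : MemLp f 2 (F.vol H)) : MemLp (fun x => w x.1 * f x) 2 (F.vol H) :=
  hf.mul (memLp_top_horiz (F := F) (H := H) hw hb)

lemma memLp_surf_mul {w : Plane → ℝ} (hw : Continuous w) {K : ℝ} (hb : ∀ y, |w y| ≤ K)
    {f : Plane → ℝ} (hf : MemLp f 2 H.surf) : MemLp (fun y => w y * f y) 2 H.surf :=
  hf.mul (memLp_top_of_bound hw.aestronglyMeasurable K (Eventually.of_forall hb))

lemma ae_heights : ∀ᵐ z ∂F.lin, z ∈ F.heights := by
  rw [lin, ← F.restrict_heights]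
  exact ae_restrict_mem F.isOpen_heights.measurableSet

/-- A function on the interface that is orthogonal to the test functions vanishes. -/
theorem ae_eq_zero_of_planeTests (hH : H.Proper) {f : Plane → ℝ} (hf : MemLp f 2 H.surf)
    (h : ∀ χ, H.IsPlaneTest χ → ∫ y, f y * χ y ∂H.surf = 0) : f =ᵐ[H.surf] 0 := by
  obtain ⟨c, K, h1, -, h3, -⟩ := exists_cutoffs hH
  -- A cutoff times a wave is a test function, so all Fourier coefficients of the truncated function
  -- vanish and Parseval's identity kills its norm.
  have key : ∀ N, ∀ᵐ y ∂H.surf, (c N).θ y * f y = 0 := by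
    intro N
    have hg := memLp_surf_mul (c N).test.1.continuous (h1 N) hf
    have og := (c N).off.mul f
    have hs := Window.hasSum_surf hg hg og og
    have hz : ∀ n, (c N).cosI n (fun y => (c N).θ y * f y) = 0 ∧
        (c N).sinI n (fun y => (c N).θ y * f y) = 0 := fun n => by
      constructor
      · rw [← h _ ((c N).mul_cos n _ (c N).test)]
        exact integral_congr_ae (Eventually.of_forall fun y => by simp only; ring)
      · rw [← h _ ((c N).mul_sin n _ (c N).test)]
        exact integral_congr_ae (Eventually.of_forall fun y => by simp only; ring)
    simp only [(hz _).1, (hz _).2, mul_zero, add_zero] at hs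
    have h0 := hs.unique hasSum_zero
    have h5 : ∫ y, (c N).θ y * f y * ((c N).θ y * f y) ∂H.surf = 0 :=
      (mul_eq_zero.1 h0).resolve_left (pow_ne_zero 2 (c N).T_pos.ne')
    rw [integral_eq_zero_iff_of_nonneg (fun y => mul_self_nonneg _) (hg.integrable_mul hg)] at h5
    filter_upwards [h5] with y hy
    exact mul_self_eq_zero.1 hy
  filter_upwards [ae_all_iff.2 key] with y hy
  have := (h3 y).mul_const (f y)
  simp only [hy, one_mul] at this
  exact tendsto_nhds_unique this tendsto_const_nhds

/-- A function on the fluid domain that is orthogonal to the test functions vanishes. -/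
theorem ae_eq_zero_of_tests (hH : H.Proper) {f : Space → ℝ} (hf : MemLp f 2 (F.vol H))
    (h : ∀ φ, H.IsTest φ → tsupport φ ⊆ {x | x.2 ∈ F.heights} → ∫ x, f x * φ x ∂F.vol H = 0) :
    f =ᵐ[F.vol H] 0 := by
  obtain ⟨c, K, h1, -, h3, -⟩ := exists_cutoffs hH
  have key : ∀ N, ∀ᵐ x ∂F.vol H, (c N).θ x.1 * f x = 0 := by
    intro N
    set g : Space → ℝ := fun x => (c N).θ x.1 * f x with hgdef
    have hg : MemLp g 2 (F.vol H) := memL2_horiz_mul (c N).test.1.continuous (h1 N) hf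
    have og : (c N).OffS g := fun z => (c N).off.mul fun y => f (y, z)
    have hs := Window.hasSum_vol hg hg og og
    -- Each mode is orthogonal to every vertical test function supported in the open layers, hence
    -- vanishes as a function of height.
    have hz : ∀ n, (∀ᵐ z ∂F.lin, (c N).cosM n g z = 0) ∧ ∀ᵐ z ∂F.lin, (c N).sinM n g z = 0 := by
      intro n
      have hm := Window.memLp_modes (F := F) hg og n
      constructor
      · refine ae_eq_zero_of_test F.isOpen_heights ae_heights F.heights_subset
          (integrable_of_memLp hm.1) fun τ t1 t2 t3 => ?_
        rw [← (Window.integral_cos hg og (memLp_top_of_continuous t1.continuous) n).2,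
          ← h _ (((c N).mul_cos n _ (c N).test).prod t1 t2)
            (Horizontal.tsupport_prod (fun y => (c N).θ y * cosWave (c N).T n y) τ t3)]
        exact integral_congr_ae (Eventually.of_forall fun y => by simp only [hgdef]; ring)
      · refine ae_eq_zero_of_test F.isOpen_heights ae_heights F.heights_subset
          (integrable_of_memLp hm.2) fun τ t1 t2 t3 => ?_
        rw [← (Window.integral_sin hg og (memLp_top_of_continuous t1.continuous) n).2,
          ← h _ (((c N).mul_sin n _ (c N).test).prod t1 t2)
            (Horizontal.tsupport_prod (fun y => (c N).θ y * sinWave (c N).T n y) τ t3)]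
        exact integral_congr_ae (Eventually.of_forall fun y => by simp only [hgdef]; ring)
    have hz' : ∀ n, ∫ z, ((c N).cosM n g z * (c N).cosM n g z +
        (c N).sinM n g z * (c N).sinM n g z) ∂F.lin = 0 := fun n => by
      refine integral_eq_zero_of_ae ?_
      filter_upwards [(hz n).1, (hz n).2] with z a b
      simp [a, b]
    simp only [hz'] at hs
    have h0 := hs.unique hasSum_zero
    have h5 : ∫ x, g x * g x ∂F.vol H = 0 :=
      (mul_eq_zero.1 h0).resolve_left (pow_ne_zero 2 (c N).T_pos.ne')
    rw [integral_eq_zero_iff_of_nonneg (fun y => mul_self_nonneg _) (hg.integrable_mul hg)] at h5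
    filter_upwards [h5] with y hy
    exact mul_self_eq_zero.1 hy
  filter_upwards [ae_all_iff.2 key] with x hx
  have := (h3 x.1).mul_const (f x)
  simp only [hx, one_mul] at this
  exact tendsto_nhds_unique this tendsto_const_nhds

lemma _root_.RayleighTaylor.Horizontal.IsTest.mul_height {φ : Space → ℝ} (h : H.IsTest φ)
    {τ : ℝ → ℝ} (hτ : ContDiff ℝ ∞ τ) : H.IsTest (fun x => φ x * τ x.2) := by
  refine ⟨h.1.mul (hτ.comp contDiff_snd), ?_⟩
  cases H with
  | plane => exact HasCompactSupport.mul_right h.2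
  | torus L => intro x i; simp only [h.2 x i]

lemma partialD_height {τ : ℝ → ℝ} {x : Space} {τ' : ℝ} (h : HasDerivAt τ τ' x.2) (j : Fin 3) :
    partialD j (fun x => τ x.2) x = τ' * kron j 2 := by
  have h1 : HasFDerivAt (fun x : Space => τ x.2) _ x :=
    h.comp_hasFDerivAt x (hasFDerivAt_snd (𝕜 := ℝ) (E := Plane) (F := ℝ) (p := x))
  unfold partialD
  rw [h1.fderiv]
  fin_cases j <;> simp [spaceVec, kron]

lemma horiz_ne_two (j : Fin 2) : horiz j ≠ 2 := by fin_cases j <;> decide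

lemma kron_horiz (j : Fin 2) : kron (horiz j) 2 = 0 := if_neg (horiz_ne_two j)

lemma partialD_horiz_mul_height {φ : Space → ℝ} (h : ContDiff ℝ ∞ φ)
    {τ : ℝ → ℝ} (hτ : ContDiff ℝ ∞ τ) (j : Fin 2) (x : Space) :
    partialD (horiz j) (fun x => φ x * τ x.2) x = partialD (horiz j) φ x * τ x.2 := by
  rw [partialD_mul h (g := fun x => τ x.2) (hτ.comp contDiff_snd),
    partialD_height ((hτ.differentiable (by simp)) x.2).hasDerivAt, kron_horiz]
  simp

/-- Weak horizontal derivatives may be tested with functions that do not vanish near the planes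
bounding the layers, with a weight depending on height. -/
theorem HasWeakDeriv.integral_horiz {f d : Space → ℝ} {j : Fin 2} (hf : MemLp f 2 (F.vol H))
    (h : F.HasWeakDeriv H (horiz j) f d) {φ : Space → ℝ} (hφ : H.IsTest φ) {a : ℝ → ℝ}
    (ha : MemLp a ⊤ F.lin) :
    ∫ x, a x.2 * f x * partialD (horiz j) φ x ∂F.vol H = -∫ x, a x.2 * d x * φ x ∂F.vol H := by
  have i1 : ∀ {b : ℝ → ℝ}, MemLp b ⊤ F.lin →
      Integrable (fun x => b x.2 * f x * partialD (horiz j) φ x) (F.vol H) := fun hb =>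
    (memL2_mul hb hf).integrable_mul ((hφ.partialD _).memLp F 2)
  have i2 : ∀ {b : ℝ → ℝ}, MemLp b ⊤ F.lin →
      Integrable (fun x => b x.2 * d x * φ x) (F.vol H) := fun hb =>
    (memL2_mul hb h.1).integrable_mul (hφ.memLp F 2)
  -- The defect of the integration by parts on each slice. Multiplying `φ` by vertical test
  -- functions supported in the layers shows that it vanishes at almost every height; a horizontal
  -- derivative does not touch the vertical factor, so any bounded weight can then be inserted.
  let G : ℝ → ℝ := fun z => ∫ y, (f (y, z) * partialD (horiz j) φ (y, z) + d (y, z) * φ (y, z)) ∂H.surf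
  have hI : Integrable (fun x => f x * partialD (horiz j) φ x + d x * φ x) (F.vol H) :=
    (hf.integrable_mul ((hφ.partialD _).memLp F 2)).add (h.1.integrable_mul (hφ.memLp F 2))
  have hint : ∀ {b : ℝ → ℝ}, MemLp b ⊤ F.lin →
      ∫ x, (b x.2 * f x * partialD (horiz j) φ x + b x.2 * d x * φ x) ∂F.vol H =
        ∫ z, G z * b z ∂F.lin := fun {b} hb => by
    refine (integral_vol ((i1 hb).add (i2 hb))).trans ?_
    refine integral_congr_ae (Eventually.of_forall fun z => ?_)
    simp only [G]
    rw [← integral_mul_const]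
    exact integral_congr_ae (Eventually.of_forall fun y => by simp only [Pi.add_apply]; ring)
  have hG : ∀ᵐ z ∂F.lin, G z = 0 := by
    refine ae_eq_zero_of_test F.isOpen_heights ae_heights F.heights_subset (integrable_slices hI)
      fun τ t1 t2 t3 => ?_
    have ht := memLp_top_of_continuous (F := F) t1.continuous
    rw [← hint ht, integral_add (i1 ht) (i2 ht)]
    have h2 := h.2 _ (hφ.mul_height t1) (by
      have : tsupport (fun x : Space => φ x * τ x.2) ⊆ Prod.snd ⁻¹' tsupport τ :=
        closure_minimal (fun x hx => subset_tsupport _ (right_ne_zero_of_mul hx))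
          ((isClosed_tsupport τ).preimage continuous_snd)
      exact fun x hx => t3 (this hx))
    simp only [partialD_horiz_mul_height hφ.1 t1] at h2
    rw [add_eq_zero_iff_eq_neg]
    refine Eq.trans ?_ (h2.trans ?_)
    · exact integral_congr_ae (Eventually.of_forall fun y => by simp only; ring)
    · congr 1
      exact integral_congr_ae (Eventually.of_forall fun y => by simp only; ring)
  have := hint ha
  rw [integral_add (i1 ha) (i2 ha)] at this
  rw [← add_eq_zero_iff_eq_neg, this]
  refine integral_eq_zero_of_ae ?_
  filter_upwards [hG] with z hz
  simp [hz]

section Calculus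

variable {f g d e : Space → ℝ} {j : Fin 3}

lemma HasWeakDeriv.ae_eq (hH : H.Proper) (h : F.HasWeakDeriv H j f d) (h' : F.HasWeakDeriv H j g e)
    (hfg : f =ᵐ[F.vol H] g) : d =ᵐ[F.vol H] e := by
  have := ae_eq_zero_of_tests hH (h.1.sub h'.1) fun φ h1 h2 => by
    have i1 : Integrable (fun x => d x * φ x) (F.vol H) := h.1.integrable_mul (h1.memLp F 2)
    have i2 : Integrable (fun x => e x * φ x) (F.vol H) := h'.1.integrable_mul (h1.memLp F 2)
    simp only [Pi.sub_apply, sub_mul]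
    rw [integral_sub i1 i2]
    have a := h.2 φ h1 h2
    have b := h'.2 φ h1 h2
    have c : ∫ x, f x * partialD j φ x ∂F.vol H = ∫ x, g x * partialD j φ x ∂F.vol H :=
      integral_congr_ae (hfg.mono fun x hx => by simp only [hx])
    linarith
  exact sub_ae_eq_zero _ _ |>.1 this

lemma hasWeakDeriv_weakDeriv (h : ∃ d, F.HasWeakDeriv H j f d) :
    F.HasWeakDeriv H j f (F.weakDeriv H j f) := by
  unfold weakDeriv
  rw [dif_pos h]
  exact h.choose_spec

lemma HasWeakDeriv.weakDeriv_ae (hH : H.Proper) (h : F.HasWeakDeriv H j f d) :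
    F.weakDeriv H j f =ᵐ[F.vol H] d :=
  (hasWeakDeriv_weakDeriv ⟨d, h⟩).ae_eq hH h (ae_eq_refl f)

lemma MemH1.hasWeakDeriv (h : F.MemH1 H f) (j : Fin 3) : F.HasWeakDeriv H j f (F.weakDeriv H j f) :=
  hasWeakDeriv_weakDeriv (h.2 j)

lemma HasWeakDeriv.add (hf : F.MemL2 H f) (hg : F.MemL2 H g) (h : F.HasWeakDeriv H j f d)
    (h' : F.HasWeakDeriv H j g e) :
    F.HasWeakDeriv H j (fun x => f x + g x) (fun x => d x + e x) := by
  refine ⟨h.1.add h'.1, fun φ h1 h2 => ?_⟩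
  have hm := h1.memLp F 2
  have hm' := (h1.partialD j).memLp F 2
  have i1 : Integrable (fun x => d x * φ x) (F.vol H) := h.1.integrable_mul hm
  have i2 : Integrable (fun x => e x * φ x) (F.vol H) := h'.1.integrable_mul hm
  have i3 : Integrable (fun x => f x * partialD j φ x) (F.vol H) := hf.integrable_mul hm'
  have i4 : Integrable (fun x => g x * partialD j φ x) (F.vol H) := hg.integrable_mul hm'
  simp only [add_mul]
  rw [integral_add i1 i2, integral_add i3 i4, h.2 φ h1 h2, h'.2 φ h1 h2]
  ring

lemma HasWeakDeriv.const_mul (h : F.HasWeakDeriv H j f d) (c : ℝ) :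
    F.HasWeakDeriv H j (fun x => c * f x) (fun x => c * d x) := by
  refine ⟨h.1.const_mul c, fun φ h1 h2 => ?_⟩
  simp only [mul_assoc]
  rw [integral_const_mul, integral_const_mul, h.2 φ h1 h2]
  ring

/-- The product of a weakly differentiable function with a function of height that is smooth in each
layer. -/
lemma HasWeakDeriv.coef_mul (hf : F.MemL2 H f) (h : F.HasWeakDeriv H j f d) {c c' : ℝ → ℝ}
    (hc : F.Coef c) (hc' : F.Coef c') (hd : ∀ z ∈ F.heights, HasDerivAt c (c' z) z) :
    F.HasWeakDeriv H j (fun x => c x.2 * f x)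
      (fun x => c x.2 * d x + c' x.2 * kron j 2 * f x) := by
  have m1 := memL2_mul hc.memLp_top h.1
  have m2 := (memL2_mul hc'.memLp_top hf).const_mul (kron j 2)
  refine ⟨(m1.add m2).ae_eq (Eventually.of_forall fun x => by simp only [Pi.add_apply]; ring),
    fun φ h1 h2 => ?_⟩
  have hts : tsupport (fun x : Space => c x.2 * φ x) ⊆ tsupport φ :=
    closure_mono fun x hx => right_ne_zero_of_mul hx
  -- The coefficient is not smooth across the interface or beyond the outer planes, but `φ` vanishes
  -- near all of these, so the product is a smooth test function and the derivative can be moved by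
  -- the weak definition for `f`.
  have hψ : H.IsTest (fun x => c x.2 * φ x) := by
    refine ⟨contDiff_iff_contDiffAt.2 fun x => ?_, ?_⟩
    · by_cases hx : x ∈ tsupport φ
      · exact ((hc.contDiffAt (h2 hx)).comp x contDiffAt_snd).mul h1.1.contDiffAt
      · have : (fun x : Space => c x.2 * φ x) =ᶠ[𝓝 x] fun _ => 0 := by
          filter_upwards [(isClosed_tsupport φ).isOpen_compl.mem_nhds hx] with y hy
          rw [image_eq_zero_of_notMem_tsupport hy, mul_zero]
        exact contDiffAt_const.congr_of_eventuallyEq this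
    · cases H with
      | plane => exact HasCompactSupport.mul_left h1.2
      | torus L => intro x i; simp only [h1.2 x i]
  have hD : ∀ x, x.2 ∈ F.heights →
      partialD j (fun x : Space => c x.2 * φ x) x = c' x.2 * kron j 2 * φ x + c x.2 * partialD j φ x := by
    intro x hx
    have hcd : DifferentiableAt ℝ (fun x : Space => c x.2) x :=
      (hd _ hx).differentiableAt.comp x differentiableAt_snd
    have := partialD_height (hd _ hx) j
    unfold partialD at this ⊢
    rw [fderiv_fun_mul hcd (h1.1.differentiable (by simp) x)]
    simp [this]
    ring
  have hae : ∀ᵐ x ∂F.vol H, x.2 ∈ F.heights :=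
    (ae_restrict_iff' (H.measurableSet_cell.prod F.isOpen_heights.measurableSet)).2
      (Eventually.of_forall fun x hx => hx.2)
  have key := h.2 _ hψ (hts.trans h2)
  have hm := h1.memLp F 2
  have hm' := (h1.partialD j).memLp F 2
  have i1 : Integrable (fun x => c x.2 * f x * partialD j φ x) (F.vol H) :=
    (memL2_mul hc.memLp_top hf).integrable_mul hm'
  have i2 : Integrable (fun x => kron j 2 * (c' x.2 * f x) * φ x) (F.vol H) := m2.integrable_mul hm
  have i3 : Integrable (fun x => c x.2 * d x * φ x) (F.vol H) := m1.integrable_mul hm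
  have e1 : ∫ x, f x * partialD j (fun x : Space => c x.2 * φ x) x ∂F.vol H =
      ∫ x, c x.2 * f x * partialD j φ x ∂F.vol H + ∫ x, kron j 2 * (c' x.2 * f x) * φ x ∂F.vol H := by
    rw [← integral_add i1 i2]
    refine integral_congr_ae (hae.mono fun x hx => ?_)
    simp only [hD x hx]
    ring
  have e2 : ∫ x, (c x.2 * d x + c' x.2 * kron j 2 * f x) * φ x ∂F.vol H =
      ∫ x, c x.2 * d x * φ x ∂F.vol H + ∫ x, kron j 2 * (c' x.2 * f x) * φ x ∂F.vol H := by
    rw [← integral_add i3 i2]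
    exact integral_congr_ae (Eventually.of_forall fun x => by simp only; ring)
  have e3 : ∫ x, d x * (c x.2 * φ x) ∂F.vol H = ∫ x, c x.2 * d x * φ x ∂F.vol H :=
    integral_congr_ae (Eventually.of_forall fun x => by simp only; ring)
  rw [e1, e3] at key
  rw [e2]
  linarith

end Calculus
end Setup
end RayleighTaylor
end

/-! ### Annihilating functionals, one horizontal mode at a time -/

noncomputable section
namespace RayleighTaylor
open Filter Topology

/-- The coefficient of a function on space at the wave `u`, as a function of height. -/
def coefAt (H : Horizontal) (u : Plane → ℝ) (f : Space → ℝ) (z : ℝ) : ℝ :=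
  ∫ y, f (y, z) * u y ∂H.surf

/-- The coefficient of a function on the interface at the wave `u`. -/
def coefAtI (H : Horizontal) (u : Plane → ℝ) (f : Plane → ℝ) : ℝ := ∫ y, f y * u y ∂H.surf

/-- A horizontal wave `u` compatible with a cutoff: `∂ⱼ u = κⱼ u'`. -/
structure WavePair {H : Horizontal} (c : Cutoff H) (u u' : Plane → ℝ) (κ : Fin 2 → ℝ) : Prop where
  cont : Continuous u
  cont' : Continuous u'
  bound : ∀ y, |u y| ≤ 1
  bound' : ∀ y, |u' y| ≤ 1
  test : H.IsPlaneTest fun y => c.θ y * u y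
  deriv : ∀ j y, planeD j (fun y => c.θ y * u y) y = planeD j c.θ y * u y + κ j * (c.θ y * u' y)
  memLp : ∀ (F : Setup) f, MemLp f 2 (F.vol H) → c.OffS f → MemLp (coefAt H u f) 2 F.lin
  memLp' : ∀ (F : Setup) f, MemLp f 2 (F.vol H) → c.OffS f → MemLp (coefAt H u' f) 2 F.lin

lemma Cutoff.cosPair {H : Horizontal} (c : Cutoff H) (n : Fin 2 → ℤ) :
    WavePair c (cosWave c.T n) (sinWave c.T n) (fun j => -wave c.T n j) where
  cont := (contDiff_cosWave _ _).continuous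
  cont' := (contDiff_sinWave _ _).continuous
  bound := abs_cosWave_le _ _
  bound' := abs_sinWave_le _ _
  test := c.mul_cos n _ c.test
  deriv j y := by rw [planeD_mul c.test.1 (contDiff_cosWave _ _), planeD_cosWave]; ring
  memLp _ _ hf of := (Window.memLp_modes hf of n).1
  memLp' _ _ hf of := (Window.memLp_modes hf of n).2

lemma Cutoff.sinPair {H : Horizontal} (c : Cutoff H) (n : Fin 2 → ℤ) :
    WavePair c (sinWave c.T n) (cosWave c.T n) (wave c.T n) where
  cont := (contDiff_sinWave _ _).continuous
  cont' := (contDiff_cosWave _ _).continuous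
  bound := abs_sinWave_le _ _
  bound' := abs_cosWave_le _ _
  test := c.mul_sin n _ c.test
  deriv j y := by rw [planeD_mul c.test.1 (contDiff_sinWave _ _), planeD_sinWave]; ring
  memLp _ _ hf of := (Window.memLp_modes hf of n).2
  memLp' _ _ hf of := (Window.memLp_modes hf of n).1

/-- A test function on space that vanishes near the outer boundaries. -/
def Setup.IsInner (F : Setup) (H : Horizontal) (φ : Space → ℝ) : Prop :=
  H.IsTest φ ∧ tsupport φ ⊆ {x | x.2 ∈ Ioo (-F.m) F.ℓ}

namespace Setup

variable {F : Setup} {H : Horizontal}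

/-- The indicator function of the upper fluid. -/
def above (z : ℝ) : ℝ := (Ioi (0 : ℝ)).indicator 1 z

lemma memLp_above : MemLp above ⊤ F.lin :=
  memLp_top_of_bound
    (measurable_one.indicator measurableSet_Ioi).aestronglyMeasurable 1
    (Eventually.of_forall fun z => by
      unfold above; rw [indicator]; split_ifs <;> simp)

/-- `(w, D, h, G)` are a function that vanishes on the outer boundaries, its derivatives, its trace
on the interface, and the derivatives of the trace. -/
structure IsTuple (F : Setup) (H : Horizontal) (w : Space → ℝ) (D : Fin 3 → Space → ℝ)
    (h : Plane → ℝ) (h' : Fin 2 → Plane → ℝ) : Prop where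
  mem : MemLp w 2 (F.vol H)
  memD : ∀ j, MemLp (D j) 2 (F.vol H)
  memh : MemLp h 2 H.surf
  memh' : ∀ j, MemLp (h' j) 2 H.surf
  green : ∀ φ, H.IsTest φ → ∀ j,
    ∫ x, w x * partialD j φ x ∂F.vol H = -∫ x, D j x * φ x ∂F.vol H
  trace : ∀ χ, H.IsPlaneTest χ →
    ∫ y, h y * χ y ∂H.surf = -∫ x, D 2 x * (above x.2 * χ x.1) ∂F.vol H
  green' : ∀ χ, H.IsPlaneTest χ → ∀ j,
    ∫ y, h y * planeD j χ y ∂H.surf = -∫ y, h' j y * χ y ∂H.surf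

/-- `(R, S, G)` represents a functional that vanishes on the inner test functions. -/
structure IsAnnihilator (F : Setup) (H : Horizontal) (R : Space → ℝ) (S : Fin 3 → Space → ℝ)
    (G : Fin 2 → Plane → ℝ) : Prop where
  mem : MemLp R 2 (F.vol H)
  memS : ∀ j, MemLp (S j) 2 (F.vol H)
  memG : ∀ j, MemLp (G j) 2 H.surf
  eq_zero : ∀ φ, F.IsInner H φ →
    ∫ x, (R x * φ x + ∑ j, S j x * partialD j φ x) ∂F.vol H +
      ∫ y, ∑ j, G j y * partialD (horiz j) φ (y, 0) ∂H.surf = 0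

section Truncation

variable (c : Cutoff H)

/-- Truncation of a function on space. -/
def cut (f : Space → ℝ) (x : Space) : ℝ := c.θ x.1 * f x

/-- Truncation of a function on the interface. -/
def cutI (f : Plane → ℝ) (y : Plane) : ℝ := c.θ y * f y

/-- The gradient of the cutoff contracted with a vector field. -/
def slope (f : Fin 2 → Space → ℝ) (x : Space) : ℝ := ∑ j, planeD j c.θ x.1 * f j x

/-- The gradient of the cutoff contracted with a vector field on the interface. -/
def slopeI (f : Fin 2 → Plane → ℝ) (y : Plane) : ℝ := ∑ j, planeD j c.θ y * f j y

variable {c}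

lemma exists_bound_plane {χ : Plane → ℝ} (h : H.IsPlaneTest χ) : ∃ K, ∀ᵐ y ∂H.surf, |χ y| ≤ K := by
  refine ⟨(eLpNorm χ ⊤ H.surf).toReal, ?_⟩
  filter_upwards [ae_le_eLpNormEssSup (f := χ) (μ := H.surf)] with z hz
  have h2 := ENNReal.toReal_mono (h.memLp ⊤).2.ne (hz.trans (by rw [eLpNorm_exponent_top]))
  simpa using h2

lemma memLp_top_fst {χ : Plane → ℝ} (h : H.IsPlaneTest χ) :
    MemLp (fun x : Space => χ x.1) ⊤ (F.vol H) := by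
  obtain ⟨K, hK⟩ := exists_bound_plane h
  have hq := Measure.quasiMeasurePreserving_fst (μ := H.surf) (ν := F.lin)
  refine memLp_top_of_bound (h.1.continuous.comp continuous_fst).aestronglyMeasurable K ?_
  rw [vol_eq]
  exact hq.ae (p := fun y => ‖χ y‖ ≤ K) hK

lemma memLp_test_mul {χ : Plane → ℝ} (h : H.IsPlaneTest χ) {f : Space → ℝ}
    (hf : MemLp f 2 (F.vol H)) : MemLp (fun x => χ x.1 * f x) 2 (F.vol H) :=
  hf.mul (memLp_top_fst (F := F) h)

lemma memLp_test_mulI {χ : Plane → ℝ} (h : H.IsPlaneTest χ) {f : Plane → ℝ}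
    (hf : MemLp f 2 H.surf) : MemLp (fun x => χ x * f x) 2 H.surf :=
  hf.mul (h.memLp ⊤)

lemma memLp_cut {f : Space → ℝ} (hf : MemLp f 2 (F.vol H)) : MemLp (cut c f) 2 (F.vol H) :=
  memLp_test_mul c.test hf

lemma memLp_cutI {f : Plane → ℝ} (hf : MemLp f 2 H.surf) : MemLp (cutI c f) 2 H.surf :=
  memLp_test_mulI c.test hf

lemma memLp_slope {f : Fin 2 → Space → ℝ} (hf : ∀ j, MemLp (f j) 2 (F.vol H)) :
    MemLp (slope c f) 2 (F.vol H) :=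
  memLp_finsetSum _ fun j _ => memLp_test_mul (c.test.planeD j) (hf j)

lemma memLp_slopeI {f : Fin 2 → Plane → ℝ} (hf : ∀ j, MemLp (f j) 2 H.surf) :
    MemLp (slopeI c f) 2 H.surf :=
  memLp_finsetSum _ fun j _ => memLp_test_mulI (c.test.planeD j) (hf j)

lemma off_cut (f : Space → ℝ) : c.OffS (cut c f) := fun _ => c.off.mul _

lemma off_cutI (f : Plane → ℝ) : c.Off (cutI c f) := c.off.mul _

lemma off_slope (f : Fin 2 → Space → ℝ) : c.OffS (slope c f) := fun z y h1 h2 => by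
  simp [slope, c.offD _ y h1 h2]

lemma off_slopeI (f : Fin 2 → Plane → ℝ) : c.Off (slopeI c f) := fun y h1 h2 => by
  simp [slopeI, c.offD _ y h1 h2]

end Truncation

lemma _root_.RayleighTaylor.sum_three (f : Fin 3 → ℝ) : ∑ j, f j = ∑ j : Fin 2, f (horiz j) + f 2 :=
  Fin.sum_univ_castSucc f

section Modes

variable {c : Cutoff H} {u u' : Plane → ℝ} {κ : Fin 2 → ℝ} {R w : Space → ℝ}
  {S D : Fin 3 → Space → ℝ} {G h' : Fin 2 → Plane → ℝ} {h : Plane → ℝ}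

lemma integrable_surf_wave {f : Plane → ℝ} (hf : MemLp f 2 H.surf) (of : c.Off f)
    {u : Plane → ℝ} (hu : Continuous u) (hb : ∀ y, |u y| ≤ 1) :
    Integrable (fun y => f y * u y) H.surf := by
  have h1 : Integrable (fun y => f y * u y) (volume.restrict (box c.a c.T)) := by
    have := Window.memLp_box (W := c.toWindow) hf
    exact (this.integrable (by norm_num)).mul_bdd (c := 1) hu.aestronglyMeasurable
      (Eventually.of_forall hb)
  rw [← c.restrict_surf] at h1
  refine IntegrableOn.integrable_of_ae_notMem_eq_zero h1 ?_
  filter_upwards [ae_restrict_mem H.measurableSet_cell] with y h1 h2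
  rw [of y h1 h2, zero_mul]

variable (c R S w D) in
/-- The zeroth order part of the truncated functional. -/
def cutR (x : Space) : ℝ := cut c R x + slope c (fun j => S (horiz j)) x

variable (c w D) in
/-- The derivatives of the truncated function. -/
def cutD (j : Fin 2) (x : Space) : ℝ := cut c (D (horiz j)) x + planeD j c.θ x.1 * w x

variable (c h h') in
/-- The derivatives of the truncated trace. -/
def cutH (j : Fin 2) (y : Plane) : ℝ := cutI c (h' j) y + planeD j c.θ y * h y

lemma integral_sum_split {α : Type*} [MeasurableSpace α] {μ : Measure α} {a d : α → ℝ}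
    {b : Fin 2 → α → ℝ} (κ : Fin 2 → ℝ) (ha : Integrable a μ) (hb : ∀ j, Integrable (b j) μ)
    (hd : Integrable d μ) :
    ∫ x, (a x + ∑ j, κ j * b j x + d x) ∂μ =
      ∫ x, a x ∂μ + ∑ j, κ j * ∫ x, b j x ∂μ + ∫ x, d x ∂μ := by
  have h1 : Integrable (fun x => ∑ j, κ j * b j x) μ :=
    integrable_finsetSum _ fun j _ => (hb j).const_mul _
  have h2 : Integrable (fun x => a x + ∑ j, κ j * b j x) μ := ha.add h1
  rw [integral_add h2 hd, integral_add ha h1, integral_finsetSum _ fun j _ => (hb j).const_mul _]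
  simp only [integral_const_mul]

lemma memLp_cutR (hA : F.IsAnnihilator H R S G) : MemLp (cutR c R S) 2 (F.vol H) :=
  (memLp_cut hA.mem).add (memLp_slope fun _ => hA.memS _)

lemma off_cutR : c.OffS (cutR c R S) := fun z y h1 h2 => by
  have := off_cut (c := c) R z y h1 h2
  have := off_slope (c := c) (fun j => S (horiz j)) z y h1 h2
  simp_all [cutR]

lemma memLp_cutD (hT : F.IsTuple H w D h h') (j : Fin 2) :
    MemLp (cutD c w D j) 2 (F.vol H) :=
  (memLp_cut (hT.memD _)).add (memLp_test_mul (c.test.planeD j) hT.mem)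

lemma off_cutD (j : Fin 2) : c.OffS (cutD c w D j) := fun z y h1 h2 => by
  have := off_cut (c := c) (D (horiz j)) z y h1 h2
  have := c.offD j y h1 h2
  simp_all [cutD]

lemma memLp_cutH (hT : F.IsTuple H w D h h') (j : Fin 2) : MemLp (cutH c h' h j) 2 H.surf :=
  (memLp_cutI (hT.memh' _)).add (memLp_test_mulI (c.test.planeD j) hT.memh)

lemma off_cutH (j : Fin 2) : c.Off (cutH c h' h j) := fun y h1 h2 => by
  have := off_cutI (c := c) (h' j) y h1 h2
  have := c.offD j y h1 h2
  simp_all [cutH]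

/-- Test with cutoff times wave times a vertical function. Horizontal derivatives falling on the
wave give the factors `κ j`, those falling on the cutoff are collected in `cutR` and `slopeI`, and
the interface integral becomes a point mass at height `0`. -/
lemma IsAnnihilator.mode (hA : F.IsAnnihilator H R S G) (P : WavePair c u u' κ) {τ : ℝ → ℝ}
    (t1 : ContDiff ℝ ∞ τ) (t2 : HasCompactSupport τ) (t3 : tsupport τ ⊆ Ioo (-F.m) F.ℓ) :
    ∫ z, ((coefAt H u (cutR c R S) z + ∑ j, κ j * coefAt H u' (cut c (S (horiz j))) z) * τ z +
      coefAt H u (cut c (S 2)) z * deriv τ z) ∂F.lin +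
    (coefAtI H u (slopeI c G) + ∑ j, κ j * coefAtI H u' (cutI c (G j))) * τ 0 = 0 := by
  have hφ : F.IsInner H fun x => c.θ x.1 * u x.1 * τ x.2 :=
    ⟨P.test.prod t1 t2, Horizontal.tsupport_prod (fun y => c.θ y * u y) τ t3⟩
  have hDj : ∀ j x, partialD (horiz j) (fun x : Space => c.θ x.1 * u x.1 * τ x.2) x =
      (planeD j c.θ x.1 * u x.1 + κ j * (c.θ x.1 * u' x.1)) * τ x.2 := fun j x => by
    rw [partialD_horiz_prod (χ := fun y => c.θ y * u y) P.test.1 t1, P.deriv]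
  have hD2 : ∀ x, partialD 2 (fun x : Space => c.θ x.1 * u x.1 * τ x.2) x =
      c.θ x.1 * u x.1 * deriv τ x.2 := fun x =>
    partialD_two_prod (χ := fun y => c.θ y * u y) P.test.1 t1 x
  have key := hA.eq_zero _ hφ
  have hτ := memLp_top_of_continuous (F := F) t1.continuous
  have hτ' := memLp_top_of_continuous (F := F) (t1.continuous_deriv (by simp))
  obtain ⟨i1, e1⟩ := Window.integral_wave P.cont P.bound (memLp_cutR (c := c) hA) off_cutR hτ
  have h2 := fun j : Fin 2 =>
    Window.integral_wave P.cont' P.bound' (memLp_cut (c := c) (hA.memS (horiz j))) (off_cut _) hτ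
  obtain ⟨i3, e3⟩ := Window.integral_wave P.cont P.bound (memLp_cut (c := c) (hA.memS 2)) (off_cut _) hτ'
  have e : ∫ x, (R x * (c.θ x.1 * u x.1 * τ x.2) +
      ∑ j, S j x * partialD j (fun x : Space => c.θ x.1 * u x.1 * τ x.2) x) ∂F.vol H =
      ∫ x, (cutR c R S x * (τ x.2 * u x.1) + ∑ j, κ j * (cut c (S (horiz j)) x * (τ x.2 * u' x.1)) +
        cut c (S 2) x * (deriv τ x.2 * u x.1)) ∂F.vol H := by
    refine integral_congr_ae (Eventually.of_forall fun x => ?_)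
    simp only [sum_three, hDj, hD2, cutR, cut, slope, Fin.sum_univ_two]
    ring
  rw [e, integral_sum_split κ i1 (fun j => (h2 j).1) i3, e1, e3] at key
  simp only [(h2 _).2] at key
  have n1 : Integrable (fun z => coefAt H u (cutR c R S) z * τ z) F.lin :=
    (P.memLp F _ (memLp_cutR (c := c) hA) off_cutR).integrable_mul (memLp_of_continuous t1.continuous)
  have n2 : ∀ j, Integrable (fun z => coefAt H u' (cut c (S (horiz j))) z * τ z) F.lin := fun j =>
    (P.memLp' F _ (memLp_cut (c := c) (hA.memS _)) (off_cut _)).integrable_mul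
      (memLp_of_continuous t1.continuous)
  have n3 : Integrable (fun z => coefAt H u (cut c (S 2)) z * deriv τ z) F.lin :=
    (P.memLp F _ (memLp_cut (c := c) (hA.memS _)) (off_cut _)).integrable_mul
      (memLp_of_continuous (t1.continuous_deriv (by simp)))
  have e4 : ∫ z, ((coefAt H u (cutR c R S) z + ∑ j, κ j * coefAt H u' (cut c (S (horiz j))) z) * τ z +
      coefAt H u (cut c (S 2)) z * deriv τ z) ∂F.lin =
      ∫ z, coefAt H u (cutR c R S) z * τ z ∂F.lin +
      ∑ j, κ j * ∫ z, coefAt H u' (cut c (S (horiz j))) z * τ z ∂F.lin +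
      ∫ z, coefAt H u (cut c (S 2)) z * deriv τ z ∂F.lin := by
    rw [← integral_sum_split κ n1 n2 n3]
    refine integral_congr_ae (Eventually.of_forall fun z => ?_)
    simp only [Fin.sum_univ_two]
    ring
  have e5 : ∫ y, ∑ j, G j y * partialD (horiz j) (fun x : Space => c.θ x.1 * u x.1 * τ x.2) (y, 0)
      ∂H.surf = (coefAtI H u (slopeI c G) + ∑ j, κ j * coefAtI H u' (cutI c (G j))) * τ 0 := by
    have j1 := integrable_surf_wave (memLp_slopeI (c := c) hA.memG) (off_slopeI _) P.cont P.bound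
    have j2 := fun j => integrable_surf_wave (memLp_cutI (c := c) (hA.memG j)) (off_cutI _)
      P.cont' P.bound'
    simp only [coefAtI, ← integral_const_mul]
    rw [← integral_finsetSum _ fun j _ => (j2 j).const_mul _, ← integral_add j1
      (integrable_finsetSum _ fun j _ => (j2 j).const_mul _), ← integral_mul_const]
    refine integral_congr_ae (Eventually.of_forall fun y => ?_)
    simp only [hDj, slopeI, cutI, Fin.sum_univ_two]
    ring
  rw [e4, ← e5]
  exact key

lemma ae_Ioo : ∀ᵐ z ∂F.lin, z ∈ Ioo (-F.m) F.ℓ := ae_restrict_mem measurableSet_Ioo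

/-- In Fourier variables a horizontal derivative is multiplication by the frequency. Including the
derivative of the cutoff in `cutD` makes this exact for the truncated function. -/
lemma IsTuple.coef_cutD (hT : F.IsTuple H w D h h') (P : WavePair c u u' κ) (j : Fin 2) :
    ∀ᵐ z ∂F.lin, coefAt H u (cutD c w D j) z = -(κ j * coefAt H u' (cut c w) z) := by
  have m1 := P.memLp F _ (memLp_cutD (c := c) hT j) (off_cutD j)
  have m2 := P.memLp' F _ (memLp_cut (c := c) hT.mem) (off_cut _)
  have := ae_eq_zero_of_test isOpen_Ioo ae_Ioo subset_rfl
    (integrable_of_memLp (m1.add (m2.const_mul (κ j)))) fun τ t1 t2 t3 => by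
      have hφ : H.IsTest fun x => c.θ x.1 * u x.1 * τ x.2 := P.test.prod t1 t2
      have hDj : ∀ x, partialD (horiz j) (fun x : Space => c.θ x.1 * u x.1 * τ x.2) x =
          (planeD j c.θ x.1 * u x.1 + κ j * (c.θ x.1 * u' x.1)) * τ x.2 := fun x => by
        rw [partialD_horiz_prod (χ := fun y => c.θ y * u y) P.test.1 t1, P.deriv]
      have key := hT.green _ hφ (horiz j)
      simp only [hDj] at key
      have hτ := memLp_top_of_continuous (F := F) t1.continuous
      obtain ⟨i1, e1⟩ := Window.integral_wave P.cont P.bound (memLp_cutD (c := c) hT j) (off_cutD j) hτ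
      obtain ⟨i2, e2⟩ := Window.integral_wave P.cont' P.bound' (memLp_cut (c := c) hT.mem) (off_cut _) hτ
      have n1 : Integrable (fun z => coefAt H u (cutD c w D j) z * τ z) F.lin :=
        m1.integrable_mul (memLp_of_continuous t1.continuous)
      have n2 : Integrable (fun z => coefAt H u' (cut c w) z * τ z) F.lin :=
        m2.integrable_mul (memLp_of_continuous t1.continuous)
      have e3 : ∫ z, ((coefAt H u (cutD c w D j) + fun z => κ j * coefAt H u' (cut c w) z) z) * τ z ∂F.lin =
          ∫ z, coefAt H u (cutD c w D j) z * τ z ∂F.lin +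
            κ j * ∫ z, coefAt H u' (cut c w) z * τ z ∂F.lin := by
        rw [← integral_const_mul, ← integral_add n1 (n2.const_mul _)]
        refine integral_congr_ae (Eventually.of_forall fun z => ?_)
        simp only [Pi.add_apply]
        ring
      have q1 : Integrable (fun x => w x * ((planeD j c.θ x.1 * u x.1 + κ j * (c.θ x.1 * u' x.1)) * τ x.2))
          (F.vol H) := by
        simp only [← hDj]
        exact hT.mem.integrable_mul ((hφ.partialD _).memLp F 2)
      have q2 : Integrable (fun x => D (horiz j) x * (c.θ x.1 * u x.1 * τ x.2)) (F.vol H) :=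
        (hT.memD _).integrable_mul (hφ.memLp F 2)
      rw [e3]
      unfold coefAt
      rw [← e1, ← e2, ← integral_const_mul, ← integral_add i1 (i2.const_mul _)]
      rw [← add_eq_zero_iff_eq_neg, ← integral_add q1 q2] at key
      rw [← key]
      refine integral_congr_ae (Eventually.of_forall fun x => ?_)
      simp only [cutD, cut]
      ring
  filter_upwards [this] with z hz
  simp only [Pi.add_apply] at hz
  linarith

/-- The vertical function need not vanish at the end points. This freedom encodes zero values on the
outer planes and makes the mode an element of `H¹₀`. -/
lemma IsTuple.weak (hT : F.IsTuple H w D h h') (P : WavePair c u u' κ) {τ : ℝ → ℝ}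
    (t1 : ContDiff ℝ ∞ τ) (t2 : HasCompactSupport τ) :
    ∫ z, (coefAt H u (cut c w) z * deriv τ z + coefAt H u (cut c (D 2)) z * τ z) ∂F.lin = 0 := by
  have hφ : H.IsTest fun x => c.θ x.1 * u x.1 * τ x.2 := P.test.prod t1 t2
  have hD2 : ∀ x, partialD 2 (fun x : Space => c.θ x.1 * u x.1 * τ x.2) x =
      c.θ x.1 * u x.1 * deriv τ x.2 := fun x =>
    partialD_two_prod (χ := fun y => c.θ y * u y) P.test.1 t1 x
  have key := hT.green _ hφ 2
  have hτ := memLp_top_of_continuous (F := F) t1.continuous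
  have hτ' := memLp_top_of_continuous (F := F) (t1.continuous_deriv (by simp))
  have e1 := (Window.integral_wave P.cont P.bound (memLp_cut (c := c) hT.mem) (off_cut _) hτ').2
  have e2 := (Window.integral_wave P.cont P.bound (memLp_cut (c := c) (hT.memD 2)) (off_cut _) hτ).2
  have n1 : Integrable (fun z => coefAt H u (cut c w) z * deriv τ z) F.lin :=
    (P.memLp F _ (memLp_cut (c := c) hT.mem) (off_cut _)).integrable_mul
      (memLp_of_continuous (t1.continuous_deriv (by simp)))
  have n2 : Integrable (fun z => coefAt H u (cut c (D 2)) z * τ z) F.lin :=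
    (P.memLp F _ (memLp_cut (c := c) (hT.memD 2)) (off_cut _)).integrable_mul
      (memLp_of_continuous t1.continuous)
  rw [integral_add n1 n2]
  unfold coefAt
  rw [← e1, ← e2, add_eq_zero_iff_eq_neg]
  refine Eq.trans ?_ (key.trans ?_)
  · refine integral_congr_ae (Eventually.of_forall fun x => ?_)
    simp only [hD2, cut]; ring
  · congr 1
    refine integral_congr_ae (Eventually.of_forall fun x => ?_)
    simp only [cut]; ring

lemma IsTuple.coef_trace (hT : F.IsTuple H w D h h') (P : WavePair c u u' κ) :
    coefAtI H u (cutI c h) = -∫ z, coefAt H u (cut c (D 2)) z * above z ∂F.lin := by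
  have key := hT.trace _ P.test
  unfold coefAt
  rw [← (Window.integral_wave P.cont P.bound (memLp_cut (c := c) (hT.memD 2)) (off_cut _)
    (memLp_above (F := F))).2]
  refine Eq.trans ?_ (key.trans ?_)
  · refine integral_congr_ae (Eventually.of_forall fun x => ?_)
    simp only [cutI]; ring
  · congr 1
    refine integral_congr_ae (Eventually.of_forall fun x => ?_)
    simp only [cut]; ring

lemma IsTuple.coef_cutH (hT : F.IsTuple H w D h h') (P : WavePair c u u' κ) (j : Fin 2) :
    coefAtI H u (cutH c h' h j) = -(κ j * coefAtI H u' (cutI c h)) := by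
  have key := hT.green' _ P.test j
  simp only [P.deriv] at key
  have j1 := integrable_surf_wave (memLp_cutH (c := c) hT j) (off_cutH _) P.cont P.bound
  have j2 := integrable_surf_wave (memLp_cutI (c := c) hT.memh) (off_cutI _) P.cont' P.bound'
  have q1 : Integrable (fun y => h y * (planeD j c.θ y * u y + κ j * (c.θ y * u' y))) H.surf := by
    simp only [← P.deriv]
    exact hT.memh.integrable_mul ((P.test.planeD j).memLp 2)
  have q2 : Integrable (fun y => h' j y * (c.θ y * u y)) H.surf :=
    (hT.memh' j).integrable_mul (P.test.memLp 2)
  unfold coefAtI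
  rw [← add_eq_zero_iff_eq_neg, ← integral_const_mul, ← integral_add j1 (j2.const_mul _)]
  rw [← add_eq_zero_iff_eq_neg, ← integral_add q1 q2] at key
  rw [← key]
  refine integral_congr_ae (Eventually.of_forall fun x => ?_)
  simp only [cutH, cutI]
  ring

/-- The coefficient of the function at the wave `u` is an `H¹₀` function of height. -/
lemma IsTuple.isH10 (hT : F.IsTuple H w D h h') (P : WavePair c u u' κ) :
    ∃ φ, F.IsH10 φ (coefAt H u (cut c (D 2))) ∧ (∀ᵐ z ∂F.lin, coefAt H u (cut c w) z = φ z) ∧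
      φ 0 = coefAtI H u (cutI c h) := by
  obtain ⟨h1, h2⟩ := isH10_of_weak (P.memLp F _ (memLp_cut (c := c) hT.mem) (off_cut _))
    (P.memLp F _ (memLp_cut (c := c) (hT.memD 2)) (off_cut _)) fun τ t1 t2 => hT.weak P t1 t2
  refine ⟨_, h1, h2, ?_⟩
  rw [hT.coef_trace P]
  have h3 := h1.eq_add F.zero_mem ⟨neg_m_lt_ℓ.le, le_rfl⟩
  rw [h1.2.2] at h3
  -- The trace is given as minus the integral of the vertical derivative over the upper layer, which
  -- is the value at `0` because the mode vanishes at `ℓ`.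
  have h4 : ∫ z, coefAt H u (cut c (D 2)) z * above z ∂F.lin =
      ∫ z in (0 : ℝ)..F.ℓ, coefAt H u (cut c (D 2)) z := by
    rw [intervalIntegral.integral_of_le F.ℓ_pos.le, integral_Ioc_eq_integral_Ioo, lin]
    have : ∀ z, coefAt H u (cut c (D 2)) z * above z =
        (Ioi (0 : ℝ)).indicator (coefAt H u (cut c (D 2))) z := fun z => by
      unfold above
      by_cases hz : z ∈ Ioi (0 : ℝ) <;> simp [hz]
    simp only [this]
    rw [integral_indicator measurableSet_Ioi, Measure.restrict_restrict measurableSet_Ioi]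
    congr 2
    ext z
    simp only [mem_inter_iff, mem_Ioi, mem_Ioo]
    constructor
    · rintro ⟨a, -, b⟩; exact ⟨a, b⟩
    · rintro ⟨a, b⟩; exact ⟨a, by linarith [F.m_pos], b⟩
  rw [h4]
  linarith

/-- The contribution of the wave `u` to the pairing of an annihilator with a tuple vanishes. -/
lemma IsAnnihilator.pairing (hA : F.IsAnnihilator H R S G) (hT : F.IsTuple H w D h h')
    (P : WavePair c u u' κ) :
    ∫ z, coefAt H u (cutR c R S) z * coefAt H u (cut c w) z ∂F.lin +
      ∑ j, κ j * ∫ z, coefAt H u' (cut c (S (horiz j))) z * coefAt H u (cut c w) z ∂F.lin +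
      ∫ z, coefAt H u (cut c (S 2)) z * coefAt H u (cut c (D 2)) z ∂F.lin +
      (coefAtI H u (slopeI c G) + ∑ j, κ j * coefAtI H u' (cutI c (G j))) * coefAtI H u (cutI c h) =
        0 := by
  obtain ⟨φ, h1, h2, h3⟩ := hT.isH10 P
  have mR := P.memLp F _ (memLp_cutR (c := c) hA) off_cutR
  have mS := fun j : Fin 2 => P.memLp' F _ (memLp_cut (c := c) (hA.memS (horiz j))) (off_cut _)
  have mS2 := P.memLp F _ (memLp_cut (c := c) (hA.memS 2)) (off_cut _)
  have mw := P.memLp F _ (memLp_cut (c := c) hT.mem) (off_cut _)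
  -- The mode of the annihilator vanishes on vertical test functions, hence on `H¹₀`, in particular
  -- on the corresponding mode of the tuple.
  have key := functional_H10 (mR.add (memLp_finsetSum _ fun j _ => (mS j).const_mul (κ j))) mS2 _
    (fun τ t1 t2 t3 => hA.mode P t1 t2 t3) h1
  rw [← h3]
  refine Eq.trans ?_ key
  congr 1
  have n1 : Integrable (fun z => coefAt H u (cutR c R S) z * coefAt H u (cut c w) z) F.lin :=
    mR.integrable_mul mw
  have n2 : ∀ j, Integrable (fun z => coefAt H u' (cut c (S (horiz j))) z * coefAt H u (cut c w) z)
    F.lin := fun j => (mS j).integrable_mul mw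
  have n3 : Integrable (fun z => coefAt H u (cut c (S 2)) z * coefAt H u (cut c (D 2)) z) F.lin :=
    mS2.integrable_mul h1.1
  rw [← integral_sum_split κ n1 n2 n3]
  refine integral_congr_ae ?_
  filter_upwards [h2] with z hz
  simp only [Pi.add_apply, ← hz, Fin.sum_univ_two]
  ring

end Modes
end Setup
end RayleighTaylor
end

/-! ### Summation over the modes and removal of the cutoff -/

noncomputable section
namespace RayleighTaylor
open Filter Topology

namespace Setup

variable {F : Setup} {H : Horizontal} {R w : Space → ℝ}
  {S D : Fin 3 → Space → ℝ} {G h' : Fin 2 → Plane → ℝ} {h : Plane → ℝ}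

lemma hasSum_coefAt {W : Window H} {f g : Space → ℝ} (hf : MemLp f 2 (F.vol H))
    (hg : MemLp g 2 (F.vol H)) (of : W.OffS f) (og : W.OffS g) :
    HasSum (fun n => ∫ z, coefAt H (cosWave W.T n) f z * coefAt H (cosWave W.T n) g z ∂F.lin +
      ∫ z, coefAt H (sinWave W.T n) f z * coefAt H (sinWave W.T n) g z ∂F.lin)
      (W.T ^ 2 * ∫ x, f x * g x ∂F.vol H) := by
  have h := Window.hasSum_vol hf hg of og
  have e : ∀ n, ∫ z, (W.cosM n f z * W.cosM n g z + W.sinM n f z * W.sinM n g z) ∂F.lin = _ :=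
    fun n => integral_add ((Window.memLp_modes hf of n).1.integrable_mul (Window.memLp_modes hg og n).1)
      ((Window.memLp_modes hf of n).2.integrable_mul (Window.memLp_modes hg og n).2)
  simp only [e] at h
  exact h

/-- The pairing of a truncated annihilator with a truncated tuple vanishes. -/
lemma IsAnnihilator.pairing_cut (hA : F.IsAnnihilator H R S G) (hT : F.IsTuple H w D h h')
    (c : Cutoff H) :
    ∫ x, cutR c R S x * cut c w x ∂F.vol H +
      (∑ j, ∫ x, cut c (S (horiz j)) x * cutD c w D j x ∂F.vol H +
      ∫ x, cut c (S 2) x * cut c (D 2) x ∂F.vol H) +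
      (∫ y, slopeI c G y * cutI c h y ∂H.surf +
      ∑ j, ∫ y, cutI c (G j) y * cutH c h' h j y ∂H.surf) = 0 := by
  have s1 := hasSum_coefAt (memLp_cutR (c := c) hA) (memLp_cut hT.mem) off_cutR (off_cut w)
  have s2 := fun j : Fin 2 => hasSum_coefAt (memLp_cut (c := c) (hA.memS (horiz j)))
    (memLp_cutD hT j) (off_cut _) (off_cutD j)
  have s3 := hasSum_coefAt (memLp_cut (c := c) (hA.memS 2)) (memLp_cut (hT.memD 2)) (off_cut _)
    (off_cut _)
  have s4 := Window.hasSum_surf (memLp_slopeI (c := c) hA.memG) (memLp_cutI hT.memh) (off_slopeI _)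
    (off_cutI _)
  have s5 := fun j : Fin 2 => Window.hasSum_surf (memLp_cutI (c := c) (hA.memG j))
    (memLp_cutH hT j) (off_cutI _) (off_cutH j)
  -- Parseval's identity for all five pairings at once. The term of index `n` in the combined series
  -- is the sum of the cosine and the sine contributions, each of which vanishes.
  have s := (s1.add (((s2 0).add (s2 1)).add s3)).add (s4.add ((s5 0).add (s5 1)))
  rw [← mul_add, ← mul_add, ← mul_add, ← mul_add, ← mul_add, ← mul_add] at s
  rw [Fin.sum_univ_two, Fin.sum_univ_two]
  refine (mul_eq_zero.1 (s.unique ?_)).resolve_left (pow_ne_zero 2 c.T_pos.ne')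
  rw [show (fun n => _) = fun _ : Fin 2 → ℤ => (0 : ℝ) from funext fun n => ?_]
  · exact hasSum_zero
  have p1 := hA.pairing hT (c.cosPair n)
  have p2 := hA.pairing hT (c.sinPair n)
  have d1 := fun j (f : ℝ → ℝ) => integral_congr_ae (μ := F.lin)
    ((hT.coef_cutD (c.cosPair n) j).mono fun z hz => congrArg (f z * ·) hz)
  have d2 := fun j (f : ℝ → ℝ) => integral_congr_ae (μ := F.lin)
    ((hT.coef_cutD (c.sinPair n) j).mono fun z hz => congrArg (f z * ·) hz)
  have d3 : ∀ j, c.cosI n (cutH c h' h j) = _ := fun j => hT.coef_cutH (c.cosPair n) j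
  have d4 : ∀ j, c.sinI n (cutH c h' h j) = _ := fun j => hT.coef_cutH (c.sinPair n) j
  rw [d1, d2, d1, d2, d3, d4, d3, d4]
  have e : ∀ (k : ℝ) (f g : ℝ → ℝ), ∫ z, f z * (-(k * g z)) ∂F.lin = -(k * ∫ z, f z * g z ∂F.lin) := by
    intro k f g
    rw [← integral_const_mul, ← integral_neg]
    exact integral_congr_ae (Eventually.of_forall fun z => by simp only; ring)
  simp only [e]
  simp only [Fin.sum_univ_two] at p1 p2
  have q1 : ∀ f, c.cosI n f = coefAtI H (cosWave c.T n) f := fun _ => rfl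
  have q2 : ∀ f, c.sinI n f = coefAtI H (sinWave c.T n) f := fun _ => rfl
  simp only [q1, q2]
  linear_combination p1 + p2

/-- Dominated convergence: the squared cutoff tends to one, while every term containing its gradient
tends to zero under a uniform bound. -/
lemma tendsto_integral_cut {X : Type*} [MeasurableSpace X] [TopologicalSpace X]
    [OpensMeasurableSpace X] {μ : Measure X} {p : X → Plane} (hp : Continuous p)
    {c : ℕ → Cutoff H} {K : ℝ} (h1 : ∀ N y, |(c N).θ y| ≤ 1)
    (h2 : ∀ N j y, |planeD j (c N).θ y| ≤ K)
    (h3 : ∀ y, Tendsto (fun N => (c N).θ y) atTop (𝓝 1))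
    (h4 : ∀ j y, Tendsto (fun N => planeD j (c N).θ y) atTop (𝓝 0))
    {P : X → ℝ} {Q : Fin 2 → X → ℝ} (hP : Integrable P μ) (hQ : ∀ j, Integrable (Q j) μ) :
    Tendsto (fun N => ∫ x, ((c N).θ (p x) ^ 2 * P x +
      (c N).θ (p x) * ∑ j, planeD j (c N).θ (p x) * Q j x) ∂μ) atTop (𝓝 (∫ x, P x ∂μ)) := by
  have hK : 0 ≤ K := (abs_nonneg _).trans (h2 0 0 0)
  refine tendsto_integral_of_dominated_convergence
    (fun x => |P x| + (K * |Q 0 x| + K * |Q 1 x|)) (fun N => ?_) ?_ (fun N => ?_) ?_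
  · have a1 : AEStronglyMeasurable (fun x => (c N).θ (p x)) μ :=
      ((c N).test.1.continuous.comp hp).aestronglyMeasurable
    have a2 : ∀ j, AEStronglyMeasurable (fun x => planeD j (c N).θ (p x)) μ := fun j =>
      ((continuous_planeD (c N).test.1 j).comp hp).aestronglyMeasurable
    simp only [Fin.sum_univ_two]
    exact ((a1.pow 2).mul hP.1).add (a1.mul (((a2 0).mul (hQ 0).1).add ((a2 1).mul (hQ 1).1)))
  · exact hP.abs.add (((hQ 0).abs.const_mul K).add ((hQ 1).abs.const_mul K))
  · refine Eventually.of_forall fun x => ?_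
    rw [Fin.sum_univ_two, Real.norm_eq_abs]
    have a := h1 N (p x)
    have hq : ∀ j, |planeD j (c N).θ (p x) * Q j x| ≤ K * |Q j x| := fun j => by
      rw [abs_mul]; gcongr; exact h2 _ _ _
    have h5 : |(c N).θ (p x) ^ 2 * P x| ≤ |P x| := by
      rw [abs_mul, abs_pow]
      exact mul_le_of_le_one_left (abs_nonneg _) (pow_le_one₀ (abs_nonneg _) a)
    refine (abs_add_le _ _).trans (add_le_add h5 ?_)
    rw [abs_mul]
    refine (mul_le_of_le_one_left (abs_nonneg _) a).trans ((abs_add_le _ _).trans ?_)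
    exact add_le_add (hq 0) (hq 1)
  · refine Eventually.of_forall fun x => ?_
    have := (((h3 (p x)).pow 2).mul_const (P x)).add ((h3 (p x)).mul (tendsto_finsetSum Finset.univ
      fun j _ => (h4 j (p x)).mul_const (Q j x)))
    simpa using this

/-- An annihilator of the inner test functions annihilates all tuples. -/
theorem IsAnnihilator.eq_zero_tuple (hH : H.Proper) (hA : F.IsAnnihilator H R S G)
    (hT : F.IsTuple H w D h h') :
    ∫ x, (R x * w x + ∑ j, S j x * D j x) ∂F.vol H + ∫ y, ∑ j, G j y * h' j y ∂H.surf = 0 := by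
  obtain ⟨c, K, h1, h2, h3, h4⟩ := exists_cutoffs hH
  have iR : Integrable (fun x => R x * w x) (F.vol H) := hA.mem.integrable_mul hT.mem
  have iS : ∀ j, Integrable (fun x => S j x * D j x) (F.vol H) := fun j =>
    (hA.memS j).integrable_mul (hT.memD j)
  -- The factor two arises because both members of the pairing are truncated: the gradient of the
  -- cutoff appears once beside the flux and once beside the derivative of `w`.
  have iSw : ∀ j : Fin 2, Integrable (fun x => 2 * (S (horiz j) x * w x)) (F.vol H) := fun j =>
    ((hA.memS _).integrable_mul hT.mem).const_mul 2
  have iG : ∀ j, Integrable (fun y => G j y * h' j y) H.surf := fun j =>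
    (hA.memG j).integrable_mul (hT.memh' j)
  have iGh : ∀ j, Integrable (fun y => 2 * (G j y * h y)) H.surf := fun j =>
    ((hA.memG _).integrable_mul hT.memh).const_mul 2
  have t1 := tendsto_integral_cut (μ := F.vol H) continuous_fst h1 h2 h3 h4
    (iR.add (integrable_finsetSum Finset.univ fun j _ => iS j)) iSw
  have t2 := tendsto_integral_cut (μ := H.surf) continuous_id h1 h2 h3 h4
    (integrable_finsetSum Finset.univ fun j _ => iG j) iGh
  refine tendsto_nhds_unique (t1.add t2) ?_
  refine tendsto_const_nhds.congr fun N => ?_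
  rw [← hA.pairing_cut hT (c N)]
  have j1 : Integrable (fun x => cutR (c N) R S x * cut (c N) w x) (F.vol H) :=
    (memLp_cutR hA).integrable_mul (memLp_cut hT.mem)
  have j2 : ∀ j, Integrable (fun x => cut (c N) (S (horiz j)) x * cutD (c N) w D j x) (F.vol H) :=
    fun j => (memLp_cut (hA.memS _)).integrable_mul (memLp_cutD hT j)
  have j3 : Integrable (fun x => cut (c N) (S 2) x * cut (c N) (D 2) x) (F.vol H) :=
    (memLp_cut (hA.memS _)).integrable_mul (memLp_cut (hT.memD _))
  have j4 : Integrable (fun y => slopeI (c N) G y * cutI (c N) h y) H.surf :=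
    (memLp_slopeI hA.memG).integrable_mul (memLp_cutI hT.memh)
  have j5 : ∀ j, Integrable (fun y => cutI (c N) (G j) y * cutH (c N) h' h j y) H.surf :=
    fun j => (memLp_cutI (hA.memG _)).integrable_mul (memLp_cutH hT j)
  congr 1
  · have := integral_sum_split (fun _ => 1) j1 j2 j3
    simp only [one_mul] at this
    rw [← add_assoc, ← this]
    refine integral_congr_ae (Eventually.of_forall fun x => ?_)
    simp only [sum_three, Fin.sum_univ_two, cut, cutR, cutD, slope, Pi.add_apply]
    ring
  · rw [← integral_finsetSum _ fun j _ => j5 j, ← integral_add j4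
      (integrable_finsetSum _ fun j _ => j5 j)]
    refine integral_congr_ae (Eventually.of_forall fun x => ?_)
    simp only [Fin.sum_univ_two, cutI, cutH, slopeI, id_eq]
    ring

end Setup
end RayleighTaylor
end

/-! ### Jets, traces as column integrals, and density of test functions -/

noncomputable section
namespace RayleighTaylor
open Filter Topology

section Pairing

variable {α : Type*} [MeasurableSpace α] {μ : Measure α}

lemma inner_toLp {f g : α → ℝ} (hf : MemLp f 2 μ) (hg : MemLp g 2 μ) :
    inner ℝ (hf.toLp f) (hg.toLp g) = ∫ x, f x * g x ∂μ := by
  rw [L2.inner_def]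
  refine integral_congr_ae ?_
  filter_upwards [hf.coeFn_toLp, hg.coeFn_toLp] with x h1 h2
  rw [h1, h2]
  exact mul_comm _ _

lemma inner_toLp_right (f : Lp ℝ 2 μ) {g : α → ℝ} (hg : MemLp g 2 μ) :
    inner ℝ f (hg.toLp g) = ∫ x, f x * g x ∂μ := by
  rw [← inner_toLp (Lp.memLp f) hg, Lp.toLp_coeFn]

lemma inner_eq_integral (f g : Lp ℝ 2 μ) : inner ℝ f g = ∫ x, f x * g x ∂μ := by
  rw [← inner_toLp (Lp.memLp f) (Lp.memLp g), Lp.toLp_coeFn, Lp.toLp_coeFn]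

end Pairing

/-- A submodule whose annihilating functionals annihilate a vector is dense at that vector. -/
lemma mem_closure_of_dual {X : Type*} [NormedAddCommGroup X] [NormedSpace ℝ X] (K : Submodule ℝ X)
    {x : X} (h : ∀ l : X →L[ℝ] ℝ, (∀ y ∈ K, l y = 0) → l x = 0) : x ∈ closure (K : Set X) := by
  by_contra hx
  obtain ⟨l, u, h1, h2⟩ := geometric_hahn_banach_closed_point K.convex.closure isClosed_closure hx
  have h0 : ∀ y ∈ K, l y = 0 := by
    intro y hy
    by_contra hne
    have h3 := h1 ((u / l y) • y) (subset_closure (K.smul_mem _ hy))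
    rw [map_smul, smul_eq_mul, div_mul_cancel₀ _ hne] at h3
    exact lt_irrefl _ h3
  have h4 := h1 0 (subset_closure K.zero_mem)
  rw [map_zero] at h4
  rw [h l h0] at h2
  linarith

open Classical in
/-- The class of a function in `L²` of the interface. -/
def Horizontal.toL2 (H : Horizontal) (f : Plane → ℝ) : Lp ℝ 2 H.surf :=
  if hf : MemLp f 2 H.surf then hf.toLp f else 0

namespace Setup

variable {F : Setup} {H : Horizontal}

lemma toL2_eq {f : Space → ℝ} (hf : MemLp f 2 (F.vol H)) : F.toL2 H f = hf.toLp f := dif_pos hf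

lemma toL2_surf_eq {f : Plane → ℝ} (hf : MemLp f 2 H.surf) : H.toL2 f = hf.toLp f := dif_pos hf

lemma toL2_add {f g : Space → ℝ} (hf : MemLp f 2 (F.vol H)) (hg : MemLp g 2 (F.vol H)) :
    F.toL2 H (fun x => f x + g x) = F.toL2 H f + F.toL2 H g := by
  rw [toL2_eq hf, toL2_eq hg]; exact (toL2_eq (hf.add hg)).trans (MemLp.toLp_add hf hg)

lemma toL2_const_mul {f : Space → ℝ} (c : ℝ) (hf : MemLp f 2 (F.vol H)) :
    F.toL2 H (fun x => c * f x) = c • F.toL2 H f := by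
  rw [toL2_eq hf, toL2_eq (hf.const_mul c)]; exact MemLp.toLp_const_smul c hf

lemma toL2_congr {f g : Space → ℝ} (hf : MemLp f 2 (F.vol H)) (hfg : f =ᵐ[F.vol H] g) :
    F.toL2 H f = F.toL2 H g := by
  rw [toL2_eq hf, toL2_eq (hf.ae_eq hfg)]
  exact MemLp.toLp_congr hf (hf.ae_eq hfg) hfg

lemma coeFn_toL2 {f : Space → ℝ} (hf : MemLp f 2 (F.vol H)) : F.toL2 H f =ᵐ[F.vol H] f := by
  rw [toL2_eq hf]; exact hf.coeFn_toLp

lemma toL2_surf_add {f g : Plane → ℝ} (hf : MemLp f 2 H.surf) (hg : MemLp g 2 H.surf) :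
    H.toL2 (fun x => f x + g x) = H.toL2 f + H.toL2 g := by
  rw [toL2_surf_eq hf, toL2_surf_eq hg]
  exact (toL2_surf_eq (hf.add hg)).trans (MemLp.toLp_add hf hg)

lemma toL2_surf_const_mul {f : Plane → ℝ} (c : ℝ) (hf : MemLp f 2 H.surf) :
    H.toL2 (fun x => c * f x) = c • H.toL2 f := by
  rw [toL2_surf_eq hf, toL2_surf_eq (hf.const_mul c)]; exact MemLp.toLp_const_smul c hf

variable (F H)

/-- Square integrable functions, candidates for their derivatives, and candidates for the
derivatives of their traces on the interface. -/
abbrev Jet : Type := Lp ℝ 2 (F.vol H) × (Fin 3 → Lp ℝ 2 (F.vol H)) × (Fin 2 → Lp ℝ 2 H.surf)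

/-- The jet of a test function. -/
def jet (φ : Space → ℝ) : F.Jet H :=
  (F.toL2 H φ, fun j => F.toL2 H (partialD j φ), fun j => H.toL2 fun y => partialD (horiz j) φ (y, 0))

variable {F H}

lemma IsInner.zero : F.IsInner H fun _ => 0 := by
  refine ⟨⟨contDiff_const, ?_⟩, ?_⟩
  · cases H with
    | plane => exact HasCompactSupport.zero
    | torus L => exact fun _ _ => rfl
  · rw [show (fun _ : Space => (0 : ℝ)) = 0 from rfl, tsupport_zero]; exact empty_subset _

lemma IsInner.add {φ ψ : Space → ℝ} (h : F.IsInner H φ) (h' : F.IsInner H ψ) :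
    F.IsInner H fun x => φ x + ψ x := by
  refine ⟨⟨h.1.1.add h'.1.1, ?_⟩, (tsupport_add φ ψ).trans (union_subset h.2 h'.2)⟩
  cases H with
  | plane => exact HasCompactSupport.add h.1.2 h'.1.2
  | torus L => intro x i; simp only [h.1.2 x i, h'.1.2 x i]

lemma IsInner.const_mul {φ : Space → ℝ} (h : F.IsInner H φ) (c : ℝ) :
    F.IsInner H fun x => c * φ x := by
  refine ⟨⟨contDiff_const.mul h.1.1, ?_⟩,
    (closure_mono fun x hx => right_ne_zero_of_mul hx).trans h.2⟩
  cases H with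
  | plane => exact HasCompactSupport.mul_left h.1.2
  | torus L => intro x i; simp only [h.1.2 x i]

lemma _root_.RayleighTaylor.partialD_add {φ ψ : Space → ℝ} (h : ContDiff ℝ ∞ φ)
    (h' : ContDiff ℝ ∞ ψ) (j : Fin 3) :
    partialD j (fun x => φ x + ψ x) = fun x => partialD j φ x + partialD j ψ x := by
  ext x
  unfold partialD
  rw [fderiv_fun_add (h.differentiable (by simp) x) (h'.differentiable (by simp) x)]; rfl

lemma _root_.RayleighTaylor.partialD_const_mul {φ : Space → ℝ} (h : ContDiff ℝ ∞ φ) (c : ℝ)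
    (j : Fin 3) : partialD j (fun x => c * φ x) = fun x => c * partialD j φ x := by
  ext x
  unfold partialD
  rw [fderiv_const_mul (h.differentiable (by simp) x)]; rfl

variable (F H) in
/-- The jets of the inner test functions. -/
def innerJets : Submodule ℝ (F.Jet H) where
  carrier := {x | ∃ φ, F.IsInner H φ ∧ F.jet H φ = x}
  zero_mem' := by
    refine ⟨_, IsInner.zero, ?_⟩
    have h0 : ∀ j, partialD j (fun _ => (0 : ℝ)) = fun _ => 0 := fun j => by
      ext x; simp [partialD]
    have h1 : F.toL2 H (fun _ => 0) = 0 := by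
      rw [toL2_eq (MemLp.zero' : MemLp (fun _ => (0 : ℝ)) 2 _)]; exact MemLp.toLp_zero _
    have h2 : H.toL2 (fun _ => 0) = 0 := by
      rw [toL2_surf_eq (MemLp.zero' : MemLp (fun _ => (0 : ℝ)) 2 _)]; exact MemLp.toLp_zero _
    simp only [jet, h0, h1, h2]; rfl
  add_mem' := by
    rintro _ _ ⟨φ, h, rfl⟩ ⟨ψ, h', rfl⟩
    refine ⟨_, h.add h', ?_⟩
    unfold jet
    simp only [partialD_add h.1.1 h'.1.1]
    rw [toL2_add (h.1.memLp F 2) (h'.1.memLp F 2)]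
    simp only [toL2_add ((h.1.partialD _).memLp F 2) ((h'.1.partialD _).memLp F 2),
      toL2_surf_add (((h.1.partialD _).slice 0).memLp 2) (((h'.1.partialD _).slice 0).memLp 2)]
    rfl
  smul_mem' := by
    rintro c _ ⟨φ, h, rfl⟩
    refine ⟨_, h.const_mul c, ?_⟩
    unfold jet
    simp only [partialD_const_mul h.1.1]
    rw [toL2_const_mul c (h.1.memLp F 2)]
    simp only [toL2_const_mul c ((h.1.partialD _).memLp F 2),
      toL2_surf_const_mul c (((h.1.partialD _).slice 0).memLp 2)]
    rfl

lemma memLp_above_mul {χ : Plane → ℝ} (h : MemLp χ 2 H.surf) :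
    MemLp (fun x : Space => above x.2 * χ x.1) 2 (F.vol H) := by
  refine memL2_mul memLp_above ?_
  rw [vol_eq]
  exact h.comp_fst F.lin

variable (F H) in
/-- The jets of functions that vanish on the outer boundaries. -/
def jets : Submodule ℝ (F.Jet H) :=
  (⨅ φ : {φ // H.IsTest φ}, ⨅ j : Fin 3, LinearMap.ker
    ((innerSL ℝ (F.toL2 H (partialD j φ)) ∘L ContinuousLinearMap.fst ℝ _ _ +
      innerSL ℝ (F.toL2 H φ) ∘L ContinuousLinearMap.proj j ∘L
        ContinuousLinearMap.fst ℝ _ _ ∘L ContinuousLinearMap.snd ℝ _ _ :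
        F.Jet H →L[ℝ] ℝ) : F.Jet H →ₗ[ℝ] ℝ)) ⊓
  ⨅ χ : {χ // H.IsPlaneTest χ}, ⨅ j : Fin 2, LinearMap.ker
    ((innerSL ℝ (H.toL2 χ) ∘L ContinuousLinearMap.proj j ∘L
        ContinuousLinearMap.snd ℝ _ _ ∘L ContinuousLinearMap.snd ℝ _ _ -
      innerSL ℝ (F.toL2 H fun x => above x.2 * planeD j χ x.1) ∘L ContinuousLinearMap.proj 2 ∘L
        ContinuousLinearMap.fst ℝ _ _ ∘L ContinuousLinearMap.snd ℝ _ _ :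
        F.Jet H →L[ℝ] ℝ) : F.Jet H →ₗ[ℝ] ℝ)

lemma isClosed_jets : IsClosed (F.jets H : Set (F.Jet H)) := by
  unfold jets
  simp only [Submodule.coe_inf, Submodule.coe_iInf]
  refine IsClosed.inter ?_ ?_ <;>
  · refine isClosed_iInter fun φ => isClosed_iInter fun j => ?_
    exact ContinuousLinearMap.isClosed_ker _

/-- The first condition is tested up to the outer planes and across the interface, so it expresses
the derivatives together with the vanishing outer traces and the continuity at height `0`. The
second identifies the last slot with the horizontal gradient of the trace, the latter being minus
the vertical integral of the third derivative over the upper fluid. -/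
lemma mem_jets {x : F.Jet H} : x ∈ F.jets H ↔
    (∀ φ, H.IsTest φ → ∀ j,
      ∫ p, x.1 p * partialD j φ p ∂F.vol H = -∫ p, x.2.1 j p * φ p ∂F.vol H) ∧
    ∀ χ, H.IsPlaneTest χ → ∀ j,
      ∫ y, x.2.2 j y * χ y ∂H.surf = ∫ p, x.2.1 2 p * (above p.2 * planeD j χ p.1) ∂F.vol H := by
  unfold jets
  simp only [Submodule.mem_inf, Submodule.mem_iInf, LinearMap.mem_ker, Subtype.forall]
  refine and_congr (forall₂_congr fun φ h => forall_congr' fun j => ?_)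
    (forall₂_congr fun χ h => forall_congr' fun j => ?_)
  · rw [toL2_eq (h.memLp F 2), toL2_eq ((h.partialD j).memLp F 2), 
      ← inner_toLp_right _ ((h.partialD j).memLp F 2), ← inner_toLp_right _ (h.memLp F 2), ← add_eq_zero_iff_eq_neg, real_inner_comm,
      real_inner_comm _ (x.2.1 j)]
    rfl
  · have m := memLp_above_mul (F := F) ((h.planeD j).memLp 2)
    rw [toL2_surf_eq (h.memLp 2), toL2_eq m, ← inner_toLp_right _ (h.memLp 2),
      ← inner_toLp_right _ m, real_inner_comm, real_inner_comm _ (x.2.1 2), ← sub_eq_zero (b := inner ℝ _ (x.2.1 2))]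
    rfl

lemma ae_fst {p : Plane → Prop} (h : ∀ᵐ y ∂H.surf, p y) : ∀ᵐ x ∂F.vol H, p x.1 := by
  rw [vol_eq]
  exact Measure.quasiMeasurePreserving_fst.ae h

variable (F H) in
/-- Functions on the interface extended to the upper fluid, independently of height. -/
def lift : Lp ℝ 2 H.surf →L[ℝ] Lp ℝ 2 (F.vol H) :=
  LinearMap.mkContinuous
    { toFun := fun g => F.toL2 H fun x => above x.2 * g x.1
      map_add' := fun f g => by
        rw [← toL2_add (memLp_above_mul (Lp.memLp f)) (memLp_above_mul (Lp.memLp g))]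
        refine toL2_congr (memLp_above_mul (Lp.memLp _)) ?_
        filter_upwards [ae_fst (F := F) (Lp.coeFn_add f g)] with x hx
        rw [hx, Pi.add_apply]; ring
      map_smul' := fun r f => by
        rw [RingHom.id_apply, ← toL2_const_mul r (memLp_above_mul (Lp.memLp f))]
        refine toL2_congr (memLp_above_mul (Lp.memLp _)) ?_
        filter_upwards [ae_fst (F := F) (Lp.coeFn_smul r f)] with x hx
        rw [hx, Pi.smul_apply, smul_eq_mul]; ring }
    (Real.sqrt (∫ z, above z * above z ∂F.lin)) fun g => by
      have h0 : 0 ≤ ∫ z, above z * above z ∂F.lin := integral_nonneg fun z => mul_self_nonneg _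
      refine le_of_sq_le_sq ?_ (by positivity)
      rw [mul_pow, Real.sq_sqrt h0, ← real_inner_self_eq_norm_sq, ← real_inner_self_eq_norm_sq]
      simp only [LinearMap.coe_mk, AddHom.coe_mk]
      rw [toL2_eq (memLp_above_mul (Lp.memLp g)), inner_toLp, inner_eq_integral, mul_comm,
        ← integral_prod_mul, ← vol_eq]
      refine le_of_eq (integral_congr_ae (Eventually.of_forall fun x => ?_))
      simp only
      ring

lemma lift_toL2 {χ : Plane → ℝ} (h : MemLp χ 2 H.surf) :
    F.lift H (H.toL2 χ) = F.toL2 H fun x => above x.2 * χ x.1 := by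
  refine toL2_congr (memLp_above_mul (Lp.memLp _)) ?_
  rw [toL2_surf_eq h]
  filter_upwards [ae_fst (F := F) h.coeFn_toLp] with x hx
  rw [hx]

variable (F H) in
/-- The vertical integral over the upper fluid. -/
def column : Lp ℝ 2 (F.vol H) →L[ℝ] Lp ℝ 2 H.surf := ContinuousLinearMap.adjoint (F.lift H)

lemma integral_column (f : Lp ℝ 2 (F.vol H)) {χ : Plane → ℝ} (h : MemLp χ 2 H.surf) :
    ∫ y, F.column H f y * χ y ∂H.surf = ∫ x, f x * (above x.2 * χ x.1) ∂F.vol H := by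
  rw [← inner_toLp_right _ h, ← inner_toLp_right _ (memLp_above_mul h), ← toL2_surf_eq h,
    ← toL2_eq (memLp_above_mul h), ← lift_toL2 h]
  exact ContinuousLinearMap.adjoint_inner_left _ _ _

lemma isTuple_of_mem_jets {x : F.Jet H} (hx : x ∈ F.jets H) :
    F.IsTuple H x.1 (fun j => x.2.1 j) (fun y => -F.column H (x.2.1 2) y) (fun j => x.2.2 j) where
  mem := Lp.memLp _
  memD j := Lp.memLp _
  memh := (Lp.memLp _).neg
  memh' j := Lp.memLp _
  green := (mem_jets.1 hx).1
  trace χ h := by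
    simp only [neg_mul]
    rw [integral_neg, integral_column _ (h.memLp 2)]
  green' χ h j := by
    simp only [neg_mul]
    rw [integral_neg, integral_column _ ((h.planeD j).memLp 2), (mem_jets.1 hx).2 χ h j]

/-- The jet space carries a product norm, not a Hilbert norm, so the representation theorem is
applied to each factor separately. -/
lemma exists_riesz (l : F.Jet H →L[ℝ] ℝ) : ∃ (R : Lp ℝ 2 (F.vol H)) (S : Fin 3 → Lp ℝ 2 (F.vol H))
    (G : Fin 2 → Lp ℝ 2 H.surf), ∀ x : F.Jet H,
      l x = inner ℝ R x.1 + ∑ j, inner ℝ (S j) (x.2.1 j) + ∑ j, inner ℝ (G j) (x.2.2 j) := by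
  have rep : ∀ {E : Type} [NormedAddCommGroup E] [InnerProductSpace ℝ E] [CompleteSpace E]
      (k : E →L[ℝ] ℝ), ∃ R : E, ∀ x, k x = inner ℝ R x := fun k =>
    ⟨(InnerProductSpace.toDual ℝ _).symm k, fun x => (InnerProductSpace.toDual_symm_apply).symm⟩
  obtain ⟨R, hR⟩ := rep (l ∘L ContinuousLinearMap.inl ℝ _ _)
  choose S hS using fun j => rep (l ∘L ContinuousLinearMap.inr ℝ _ _ ∘L
    ContinuousLinearMap.inl ℝ _ _ ∘L ContinuousLinearMap.single ℝ (fun _ => Lp ℝ 2 (F.vol H)) j)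
  choose G hG using fun j => rep (l ∘L ContinuousLinearMap.inr ℝ _ _ ∘L
    ContinuousLinearMap.inr ℝ _ _ ∘L ContinuousLinearMap.single ℝ (fun _ => Lp ℝ 2 H.surf) j)
  refine ⟨R, S, G, fun x => ?_⟩
  have e : x = (x.1, 0, 0) + ∑ j, ((0, Pi.single j (x.2.1 j), 0) : F.Jet H) +
      ∑ j, ((0, 0, Pi.single j (x.2.2 j)) : F.Jet H) := by
    refine Prod.ext ?_ (Prod.ext ?_ ?_)
    · simp [Prod.fst_sum]
    · simp [Prod.snd_sum, Prod.fst_sum, Finset.univ_sum_single]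
    · simp [Prod.snd_sum]
      ext1 j
      fin_cases j <;> simp
  conv_lhs => rw [e]
  rw [map_add, map_add, map_sum, map_sum, ← hR]
  simp only [← hS, ← hG]
  rfl

/-- Inner test functions are dense. -/
theorem jets_subset_closure (hH : H.Proper) :
    (F.jets H : Set (F.Jet H)) ⊆ closure (F.innerJets H : Set (F.Jet H)) := by
  intro x hx
  refine mem_closure_of_dual _ fun l hl => ?_
  obtain ⟨R, S, G, hR⟩ := exists_riesz l
  -- A functional vanishing on the jets of inner test functions is, through its representatives, an
  -- annihilator, so it also vanishes on the tuple attached to any jet.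
  have hA : F.IsAnnihilator H R (fun j => S j) (fun j => G j) := by
    refine ⟨Lp.memLp _, fun _ => Lp.memLp _, fun _ => Lp.memLp _, fun φ h => ?_⟩
    have h1 := hl _ ⟨φ, h, rfl⟩
    have m := h.1.memLp F 2
    have mD := fun j => (h.1.partialD j).memLp F 2
    have mG := fun j : Fin 2 => ((h.1.partialD (horiz j)).slice 0).memLp 2
    have i1 : Integrable (fun x => R x * φ x) (F.vol H) := (Lp.memLp _).integrable_mul m
    have i2 : ∀ j, Integrable (fun x => S j x * partialD j φ x) (F.vol H) := fun j =>
      (Lp.memLp _).integrable_mul (mD j)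
    have i3 : ∀ j, Integrable (fun y => G j y * partialD (horiz j) φ (y, 0)) H.surf := fun j =>
      (Lp.memLp _).integrable_mul (mG j)
    rw [integral_add i1 (integrable_finsetSum _ fun j _ => i2 j), integral_finsetSum _ fun j _ => i2 j,
      integral_finsetSum _ fun j _ => i3 j]
    refine Eq.trans ?_ h1
    rw [hR]
    simp only [jet, toL2_eq m, toL2_eq (mD _), toL2_surf_eq (mG _), inner_toLp_right]
  have h2 := hA.eq_zero_tuple hH (isTuple_of_mem_jets hx)
  have i1 : Integrable (fun p => R p * x.1 p) (F.vol H) := (Lp.memLp _).integrable_mul (Lp.memLp _)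
  have i2 : ∀ j, Integrable (fun p => S j p * x.2.1 j p) (F.vol H) := fun j =>
    (Lp.memLp _).integrable_mul (Lp.memLp _)
  have i3 : ∀ j, Integrable (fun y => G j y * x.2.2 j y) H.surf := fun j =>
    (Lp.memLp _).integrable_mul (Lp.memLp _)
  rw [integral_add i1 (integrable_finsetSum _ fun j _ => i2 j), integral_finsetSum _ fun j _ => i2 j,
    integral_finsetSum _ fun j _ => i3 j] at h2
  rw [hR]
  simp only [inner_eq_integral]
  exact h2

end Setup
end RayleighTaylor
end

/-! ### The mass, dissipation and potential forms on velocity fields -/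

noncomputable section
namespace RayleighTaylor
open Filter Topology

/-- The trace of a velocity gradient. -/
def mdiv (D : Fin 3 → Fin 3 → ℝ) : ℝ := ∑ i, D i i

/-- The trace-free symmetric part (times two) of a velocity gradient. -/
def mdev (D : Fin 3 → Fin 3 → ℝ) (i j : Fin 3) : ℝ := D i j + D j i - 2 / 3 * mdiv D * kron i j

namespace Setup

variable {F : Setup} {H : Horizontal}

open Classical in
variable (F H) in
/-- A bounded function of height as an element of `L^∞`. -/
def heightClass (a : ℝ → ℝ) : Lp ℝ ⊤ (F.vol H) :=
  if h : MemLp (fun x : Space => a x.2) ⊤ (F.vol H) then h.toLp _ else 0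

variable (F H) in
/-- The bilinear form `(f, g) ↦ ∫ a f g`. -/
def mulForm (a : ℝ → ℝ) : Lp ℝ 2 (F.vol H) →L[ℝ] Lp ℝ 2 (F.vol H) →L[ℝ] ℝ :=
  innerSL ℝ ∘L (ContinuousLinearMap.mul ℝ ℝ).holderL (F.vol H) ⊤ 2 2 (F.heightClass H a)

lemma mulForm_apply {a : ℝ → ℝ} (ha : MemLp a ⊤ F.lin) (f g : Lp ℝ 2 (F.vol H)) :
    F.mulForm H a f g = ∫ x, a x.2 * (f x * g x) ∂F.vol H := by
  have h := memLp_top_height (H := H) ha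
  change inner ℝ ((ContinuousLinearMap.mul ℝ ℝ).holder 2 (F.heightClass H a) f) g = _
  rw [inner_eq_integral, heightClass, dif_pos h]
  refine integral_congr_ae ?_
  filter_upwards [(ContinuousLinearMap.mul ℝ ℝ).coeFn_holder (r := 2) (h.toLp _) f, h.coeFn_toLp]
    with x h1 h2
  rw [h1, h2]
  simp [mul_assoc]

lemma integrable_weight {a : ℝ → ℝ} (ha : MemLp a ⊤ F.lin) {f g : Space → ℝ}
    (hf : MemLp f 2 (F.vol H)) (hg : MemLp g 2 (F.vol H)) :
    Integrable (fun x => a x.2 * (f x * g x)) (F.vol H) := by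
  have : Integrable (fun x => a x.2 * f x * g x) (F.vol H) := (memL2_mul ha hf).integrable_mul hg
  simpa only [mul_assoc] using this

/-- The inner product of `L²` of the interface. -/
def surfForm (H : Horizontal) : Lp ℝ 2 H.surf →L[ℝ] Lp ℝ 2 H.surf →L[ℝ] ℝ := innerSL ℝ

lemma surfForm_apply (f g : Lp ℝ 2 H.surf) : surfForm H f g = ∫ y, f y * g y ∂H.surf := by
  change inner ℝ f g = _
  exact inner_eq_integral f g

variable (F H)

/-- Velocity fields together with their derivatives. -/
abbrev Flow : Type := Fin 3 → F.Jet H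

/-- The components of a velocity field. -/
def velocity : F.Flow H →L[ℝ] (Fin 3 → Lp ℝ 2 (F.vol H)) :=
  ContinuousLinearMap.pi fun i => ContinuousLinearMap.fst ℝ _ _ ∘L ContinuousLinearMap.proj i

/-- The derivative `∂ⱼ wᵢ` of a velocity field. -/
def gradL (i j : Fin 3) : F.Flow H →L[ℝ] Lp ℝ 2 (F.vol H) :=
  ContinuousLinearMap.proj j ∘L ContinuousLinearMap.fst ℝ _ _ ∘L ContinuousLinearMap.snd ℝ _ _ ∘L
    ContinuousLinearMap.proj i

/-- The horizontal derivatives of the trace of the vertical velocity. -/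
def surfL (j : Fin 2) : F.Flow H →L[ℝ] Lp ℝ 2 H.surf :=
  ContinuousLinearMap.proj j ∘L ContinuousLinearMap.snd ℝ _ _ ∘L ContinuousLinearMap.snd ℝ _ _ ∘L
    ContinuousLinearMap.proj 2

/-- The divergence of a velocity field. -/
def divL : F.Flow H →L[ℝ] Lp ℝ 2 (F.vol H) :=
  F.gradL H 0 0 + F.gradL H 1 1 + F.gradL H 2 2

/-- The trace-free symmetric gradient of a velocity field. -/
def devL (i j : Fin 3) : F.Flow H →L[ℝ] Lp ℝ 2 (F.vol H) :=
  F.gradL H i j + F.gradL H j i - (2 / 3 * kron i j) • F.divL H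

/-- The form `∫ ρ₀ v · w`. -/
def massForm : (Fin 3 → Lp ℝ 2 (F.vol H)) →L[ℝ] (Fin 3 → Lp ℝ 2 (F.vol H)) →L[ℝ] ℝ :=
  ∑ i, (F.mulForm H F.ρ₀).bilinearComp (ContinuousLinearMap.proj i) (ContinuousLinearMap.proj i)

/-- The form of viscous dissipation. -/
def viscForm : F.Flow H →L[ℝ] F.Flow H →L[ℝ] ℝ :=
  ∑ i, ∑ j, (F.mulForm H fun z => F.ε₀ z / 2).bilinearComp (F.devL H i j) (F.devL H i j) +
    (F.mulForm H F.δ₀).bilinearComp (F.divL H) (F.divL H)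

/-- The form of potential energy. -/
def potForm : F.Flow H →L[ℝ] F.Flow H →L[ℝ] ℝ :=
  (F.mulForm H fun z => F.dP z * F.ρ₀ z).bilinearComp (F.divL H) (F.divL H) +
  ∑ j : Fin 2, ((F.mulForm H fun z => F.g * F.ρ₀ z).bilinearComp
      (ContinuousLinearMap.proj (horiz j) ∘L F.velocity H) (F.gradL H 2 (horiz j)) +
    ((F.mulForm H fun z => F.g * F.ρ₀ z).bilinearComp
      (ContinuousLinearMap.proj (horiz j) ∘L F.velocity H) (F.gradL H 2 (horiz j))).flip) +
  F.σ • ∑ j, (surfForm H).bilinearComp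
    (F.surfL H j) (F.surfL H j)

variable {F H}

/-- The values of the components of a velocity field. -/
def Flow.val (x : F.Flow H) (p : Space) (i : Fin 3) : ℝ := (x i).1 p

/-- The values of the gradient of a velocity field. -/
def Flow.grad (x : F.Flow H) (p : Space) (i j : Fin 3) : ℝ := (x i).2.1 j p

lemma coeFn_divL (x : F.Flow H) : F.divL H x =ᵐ[F.vol H] fun p => mdiv (Flow.grad x p) := by
  filter_upwards [Lp.coeFn_add (F.gradL H 0 0 x + F.gradL H 1 1 x) (F.gradL H 2 2 x),
    Lp.coeFn_add (F.gradL H 0 0 x) (F.gradL H 1 1 x)] with p h1 h2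
  rw [mdiv, Fin.sum_univ_three]
  refine h1.trans ?_
  rw [Pi.add_apply, h2]; rfl

lemma coeFn_devL (x : F.Flow H) (i j : Fin 3) :
    F.devL H i j x =ᵐ[F.vol H] fun p => mdev (Flow.grad x p) i j := by
  filter_upwards [Lp.coeFn_sub (F.gradL H i j x + F.gradL H j i x) ((2 / 3 * kron i j) • F.divL H x),
    Lp.coeFn_add (F.gradL H i j x) (F.gradL H j i x), Lp.coeFn_smul (2 / 3 * kron i j) (F.divL H x),
    coeFn_divL x] with p h1 h2 h3 h4
  refine h1.trans ?_
  rw [Pi.sub_apply, h2, h3, Pi.smul_apply, h4, mdev, smul_eq_mul, Pi.add_apply]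
  change Flow.grad x p i j + Flow.grad x p j i - _ = _
  ring

lemma memLp_val (x : F.Flow H) (i : Fin 3) : MemLp (fun p => Flow.val x p i) 2 (F.vol H) :=
  Lp.memLp _

lemma memLp_grad (x : F.Flow H) (i j : Fin 3) : MemLp (fun p => Flow.grad x p i j) 2 (F.vol H) :=
  Lp.memLp _

lemma memLp_mdiv (x : F.Flow H) : MemLp (fun p => mdiv (Flow.grad x p)) 2 (F.vol H) :=
  (Lp.memLp _).ae_eq (coeFn_divL x)

lemma memLp_mdev (x : F.Flow H) (i j : Fin 3) :
    MemLp (fun p => mdev (Flow.grad x p) i j) 2 (F.vol H) :=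
  (Lp.memLp _).ae_eq (coeFn_devL x i j)

lemma memLp_ε : MemLp (fun z => F.ε₀ z / 2) ⊤ F.lin := by
  have := (F.coef_ε₀.const_mul (1 / 2)).memLp_top
  exact this.ae_eq (Eventually.of_forall fun z => by simp only; ring)

lemma memLp_dPρ : MemLp (fun z => F.dP z * F.ρ₀ z) ⊤ F.lin := (F.coef_dP.mul F.coef_ρ₀).memLp_top

lemma memLp_gρ : MemLp (fun z => F.g * F.ρ₀ z) ⊤ F.lin := (F.coef_ρ₀.const_mul F.g).memLp_top

lemma mulForm_congr {a : ℝ → ℝ} (ha : MemLp a ⊤ F.lin) {f g : Lp ℝ 2 (F.vol H)} {f' g' : Space → ℝ}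
    (hf : f =ᵐ[F.vol H] f') (hg : g =ᵐ[F.vol H] g') :
    F.mulForm H a f g = ∫ p, a p.2 * (f' p * g' p) ∂F.vol H := by
  rw [mulForm_apply ha]
  refine integral_congr_ae ?_
  filter_upwards [hf, hg] with p h1 h2
  rw [h1, h2]

lemma massForm_apply (x y : F.Flow H) : F.massForm H (F.velocity H x) (F.velocity H y) =
    ∫ p, F.ρ₀ p.2 * ∑ i, Flow.val x p i * Flow.val y p i ∂F.vol H := by
  simp only [massForm, FunLike.coe_sum, Finset.sum_apply,
    ContinuousLinearMap.bilinearComp_apply, ContinuousLinearMap.proj_apply,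
    mulForm_apply F.coef_ρ₀.memLp_top, Finset.mul_sum]
  rw [integral_finsetSum _ fun i _ => integrable_weight F.coef_ρ₀.memLp_top (memLp_val x i) (memLp_val y i)]
  rfl

lemma viscForm_apply (x y : F.Flow H) : F.viscForm H x y =
    ∫ p, (F.ε₀ p.2 / 2 * ∑ i, ∑ j, mdev (Flow.grad x p) i j * mdev (Flow.grad y p) i j +
      F.δ₀ p.2 * (mdiv (Flow.grad x p) * mdiv (Flow.grad y p))) ∂F.vol H := by
  have i1 := fun i j => integrable_weight memLp_ε (memLp_mdev x i j) (memLp_mdev y i j)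
  have i2 := integrable_weight F.coef_δ₀.memLp_top (memLp_mdiv x) (memLp_mdiv y)
  simp only [viscForm, FunLike.coe_sum, Finset.sum_apply, _root_.add_apply,
    ContinuousLinearMap.bilinearComp_apply, Finset.mul_sum,
    mulForm_congr memLp_ε (coeFn_devL x _ _) (coeFn_devL y _ _),
    mulForm_congr F.coef_δ₀.memLp_top (coeFn_divL x) (coeFn_divL y)]
  rw [integral_add (integrable_finsetSum _ fun i _ => integrable_finsetSum _ fun j _ => i1 i j) i2,
    integral_finsetSum _ fun i _ => integrable_finsetSum _ fun j _ => i1 i j]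
  simp only [integral_finsetSum _ fun j _ => i1 _ j]

lemma potForm_apply (x y : F.Flow H) : F.potForm H x y =
    ∫ p, (F.dP p.2 * F.ρ₀ p.2 * (mdiv (Flow.grad x p) * mdiv (Flow.grad y p)) +
      ∑ j : Fin 2, (F.g * F.ρ₀ p.2 * (Flow.val x p (horiz j) * Flow.grad y p 2 (horiz j)) +
        F.g * F.ρ₀ p.2 * (Flow.val y p (horiz j) * Flow.grad x p 2 (horiz j)))) ∂F.vol H +
    F.σ * ∑ j, ∫ q, (x 2).2.2 j q * (y 2).2.2 j q ∂H.surf := by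
  have i1 := integrable_weight memLp_dPρ (memLp_mdiv x) (memLp_mdiv y)
  have i2 := fun j : Fin 2 => integrable_weight memLp_gρ (memLp_val x (horiz j))
    (memLp_grad y 2 (horiz j))
  have i3 := fun j : Fin 2 => integrable_weight memLp_gρ (memLp_val y (horiz j))
    (memLp_grad x 2 (horiz j))
  have i4 : ∀ j : Fin 2, Integrable (fun p => F.g * F.ρ₀ p.2 * (Flow.val x p (horiz j) *
      Flow.grad y p 2 (horiz j)) + F.g * F.ρ₀ p.2 * (Flow.val y p (horiz j) *
      Flow.grad x p 2 (horiz j))) (F.vol H) := fun j => (i2 j).add (i3 j)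
  rw [integral_add i1 (integrable_finsetSum _ fun j _ => i4 j), integral_finsetSum _ fun j _ => i4 j]
  simp only [integral_add (i2 _) (i3 _)]
  simp only [potForm, FunLike.coe_sum, Finset.sum_apply, _root_.add_apply,
    ContinuousLinearMap.bilinearComp_apply, ContinuousLinearMap.flip_apply,
    ContinuousLinearMap.coe_comp, Function.comp_apply, ContinuousLinearMap.proj_apply,
    _root_.smul_apply, smul_eq_mul, mulForm_congr memLp_dPρ (coeFn_divL x) (coeFn_divL y),
    mulForm_apply memLp_gρ, surfForm_apply]
  rfl

lemma massForm_symm (x y : Fin 3 → Lp ℝ 2 (F.vol H)) : F.massForm H x y = F.massForm H y x := by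
  simp only [massForm, FunLike.coe_sum, Finset.sum_apply,
    ContinuousLinearMap.bilinearComp_apply, ContinuousLinearMap.proj_apply,
    mulForm_apply F.coef_ρ₀.memLp_top]
  exact Finset.sum_congr rfl fun i _ => integral_congr_ae
    (Eventually.of_forall fun p => by simp only; ring)

lemma viscForm_symm (x y : F.Flow H) : F.viscForm H x y = F.viscForm H y x := by
  rw [viscForm_apply, viscForm_apply]
  refine integral_congr_ae (Eventually.of_forall fun p => ?_)
  simp only [mul_comm (mdev (Flow.grad x p) _ _), mul_comm (mdiv (Flow.grad x p))]

lemma potForm_symm (x y : F.Flow H) : F.potForm H x y = F.potForm H y x := by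
  rw [potForm_apply, potForm_apply]
  congr 1
  · refine integral_congr_ae (Eventually.of_forall fun p => ?_)
    simp only [Fin.sum_univ_two]; ring
  · simp only [mul_comm]

lemma ae_mem_Icc : ∀ᵐ p ∂F.vol H, p.2 ∈ Icc (-F.m) F.ℓ :=
  (ae_restrict_iff' (H.measurableSet_cell.prod F.isOpen_heights.measurableSet)).2
    (Eventually.of_forall fun _ hx => Ioo_subset_Icc_self (F.heights_subset hx.2))

lemma massForm_nonneg (x : Fin 3 → Lp ℝ 2 (F.vol H)) : 0 ≤ F.massForm H x x := by
  simp only [massForm, FunLike.coe_sum, Finset.sum_apply,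
    ContinuousLinearMap.bilinearComp_apply, ContinuousLinearMap.proj_apply,
    mulForm_apply F.coef_ρ₀.memLp_top]
  refine Finset.sum_nonneg fun i _ => integral_nonneg_of_ae ?_
  filter_upwards [ae_mem_Icc] with p hp
  exact mul_nonneg (F.ρ₀_pos hp).le (mul_self_nonneg _)

lemma viscForm_nonneg (x : F.Flow H) : 0 ≤ F.viscForm H x x := by
  rw [viscForm_apply]
  refine integral_nonneg_of_ae ?_
  filter_upwards [ae_mem_Icc] with p hp
  have h1 := F.ε₀_pos hp
  have h2 := F.δ₀_nonneg hp
  have h3 : 0 ≤ ∑ i, ∑ j, mdev (Flow.grad x p) i j * mdev (Flow.grad x p) i j :=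
    Finset.sum_nonneg fun i _ => Finset.sum_nonneg fun j _ => mul_self_nonneg _
  have := mul_self_nonneg (mdiv (Flow.grad x p))
  simp only [Pi.zero_apply]
  positivity

variable (F H) in
/-- Velocity fields that vanish on the outer boundaries. -/
def flows : Submodule ℝ (F.Flow H) := Submodule.pi univ fun _ => F.jets H

lemma isClosed_flows : IsClosed (F.flows H : Set (F.Flow H)) := by
  unfold flows
  rw [Submodule.coe_pi]
  exact isClosed_set_pi fun _ _ => isClosed_jets

variable (F H) in
/-- The flow given by test functions. -/
def testFlow (φ : Fin 3 → Space → ℝ) : F.Flow H := fun i => F.jet H (φ i)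

/-- A closed property of velocity fields may be checked on test functions. -/
theorem flows_induction (hH : H.Proper) {p : F.Flow H → Prop} (hp : IsClosed {x | p x})
    (h : ∀ φ, (∀ i, F.IsInner H (φ i)) → p (F.testFlow H φ)) {x : F.Flow H} (hx : x ∈ F.flows H) :
    p x := by
  have h1 : x ∈ closure (univ.pi fun _ : Fin 3 => (F.innerJets H : Set (F.Jet H))) := by
    rw [closure_pi_set]
    exact fun i hi => jets_subset_closure hH (hx i hi)
  refine closure_minimal ?_ hp h1
  intro y hy
  choose φ hφ using fun i => hy i (mem_univ i)
  have : y = F.testFlow H φ := funext fun i => (hφ i).2.symm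
  rw [this]
  exact h φ fun i => (hφ i).1

end Setup
end RayleighTaylor
end

/-! ### Decomposition of the quadratic form into horizontal modes -/

noncomputable section
namespace RayleighTaylor
open Filter Topology

namespace Setup

variable {F : Setup} {H : Horizontal} {φ : Space → ℝ}

section Modes

lemma IsInner.eq_zero_of_le (h : F.IsInner H φ) (y : Plane) {z : ℝ} :
    z ∉ Ioo (-F.m) F.ℓ → φ (y, z) = 0 := fun hz =>
  image_eq_zero_of_notMem_tsupport fun hc => hz (h.2 hc)

lemma IsInner.integral_vertical (h : F.IsInner H φ) (y : Plane) (z : ℝ) :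
    ∫ t in (-F.m)..z, partialD 2 φ (y, t) = φ (y, z) := by
  have hc : Continuous fun t => partialD 2 φ (y, t) :=
    (contDiff_partialD h.1.1 2).continuous.comp (by fun_prop)
  rw [intervalIntegral.integral_eq_sub_of_hasDerivAt (fun t _ => hasDerivAt_slice h.1.1 y t)
    (hc.intervalIntegrable _ _), h.eq_zero_of_le y (z := -F.m) (by simp), sub_zero]

lemma integral_indicator_Iic {f : ℝ → ℝ} {z : ℝ} (hz : z ∈ Icc (-F.m) F.ℓ) :
    ∫ t, f t * (Iic z).indicator 1 t ∂F.lin = ∫ t in (-F.m)..z, f t := by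
  have h1 : ∀ t, f t * (Iic z).indicator 1 t = (Iic z).indicator f t := fun t => by
    by_cases h : t ∈ Iic z <;> simp [h]
  simp only [h1]
  rw [integral_indicator measurableSet_Iic, lin, Measure.restrict_restrict measurableSet_Iic,
    intervalIntegral.integral_of_le hz.1]
  refine setIntegral_congr_set ?_
  have h2 : (Ioc (-F.m) z : Set ℝ) =ᵐ[volume] (Ioo (-F.m) z : Set ℝ) := Ioo_ae_eq_Ioc.symm
  refine EventuallyEq.trans ?_ h2.symm
  have h3 : ∀ᵐ t ∂(volume : Measure ℝ), t ≠ z := by simp [ae_iff, measure_singleton]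
  filter_upwards [h3] with t ht
  refine propext ⟨fun h => ⟨h.2.1, lt_of_le_of_ne h.1 ht⟩, fun h => ⟨h.2.le, h.1, h.2.trans_le hz.2⟩⟩

/-- The fundamental theorem of calculus along vertical lines and Fubini. The primitive formula holds
at every height, not just almost every one, so the interface value of the mode is the coefficient of
the actual trace. -/
lemma isH10_wave (h : F.IsInner H φ) {W : Window H} (of : W.OffS (partialD 2 φ)) {w : Plane → ℝ}
    (hw : Continuous w) (hb : ∀ y, |w y| ≤ 1)
    (hm : MemLp (fun z => ∫ y, partialD 2 φ (y, z) * w y ∂H.surf) 2 F.lin) :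
    F.IsH10 (fun z => ∫ y, φ (y, z) * w y ∂H.surf)
      (fun z => ∫ y, partialD 2 φ (y, z) * w y ∂H.surf) := by
  refine ⟨hm, fun z hz => ?_, by simp [h.eq_zero_of_le]⟩
  have ha : MemLp ((Iic z).indicator (1 : ℝ → ℝ)) ⊤ F.lin :=
    memLp_top_of_bound (measurable_one.indicator measurableSet_Iic).aestronglyMeasurable 1
      (Eventually.of_forall fun t => by rw [indicator]; split_ifs <;> simp)
  obtain ⟨i, e⟩ := W.integral_wave hw hb ((h.1.partialD 2).memLp F 2) of ha
  rw [← integral_indicator_Iic hz, ← e, vol_eq, integral_prod _ (by rwa [← vol_eq])]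
  refine integral_congr_ae (Eventually.of_forall fun y => ?_)
  simp only
  rw [← h.integral_vertical y z, ← integral_indicator_Iic hz, ← integral_mul_const]
  refine integral_congr_ae (Eventually.of_forall fun t => ?_)
  simp only
  ring

lemma isH10_cosM (h : F.IsInner H φ) {W : Window H} (of : W.OffS (partialD 2 φ)) (n : Fin 2 → ℤ) :
    F.IsH10 (W.cosM n φ) (W.cosM n (partialD 2 φ)) :=
  isH10_wave h of (contDiff_cosWave _ _).continuous (abs_cosWave_le _ _)
    (W.memLp_modes ((h.1.partialD 2).memLp F 2) of n).1

lemma isH10_sinM (h : F.IsInner H φ) {W : Window H} (of : W.OffS (partialD 2 φ)) (n : Fin 2 → ℤ) :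
    F.IsH10 (W.sinM n φ) (W.sinM n (partialD 2 φ)) :=
  isH10_wave h of (contDiff_sinWave _ _).continuous (abs_sinWave_le _ _)
    (W.memLp_modes ((h.1.partialD 2).memLp F 2) of n).2

lemma cosM_horiz (hH : H.Proper) (W : Window H) (h : H.IsTest φ) (n : Fin 2 → ℤ) (j : Fin 2) (z : ℝ) :
    W.cosM n (partialD (horiz j) φ) z = wave W.T n j * W.sinM n φ z := by
  have := W.cosI_planeD hH (h.slice z) n j
  simp only [show planeD j (fun y => φ (y, z)) = fun y => partialD (horiz j) φ (y, z) from
    funext fun y => planeD_slice h.1 j y z] at this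
  exact this

lemma sinM_horiz (hH : H.Proper) (W : Window H) (h : H.IsTest φ) (n : Fin 2 → ℤ) (j : Fin 2) (z : ℝ) :
    W.sinM n (partialD (horiz j) φ) z = -(wave W.T n j * W.cosM n φ z) := by
  have := W.sinI_planeD hH (h.slice z) n j
  simp only [show planeD j (fun y => φ (y, z)) = fun y => partialD (horiz j) φ (y, z) from
    funext fun y => planeD_slice h.1 j y z] at this
  exact this

end Modes

/-- The quadratic density `q` decomposes into the modes `m`. -/
structure Decomposes (F : Setup) {H : Horizontal} (W : Window H) (q : Space → ℝ)
    (m : (Fin 2 → ℤ) → ℝ → ℝ) : Prop where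
  int : Integrable q (F.vol H)
  int_mode : ∀ n, Integrable (m n) F.lin
  sum : HasSum (fun n => ∫ z, m n z ∂F.lin) (W.T ^ 2 * ∫ x, q x ∂F.vol H)

namespace Decomposes

variable {W : Window H} {q q' : Space → ℝ} {m m' : (Fin 2 → ℤ) → ℝ → ℝ}

lemma add (h : F.Decomposes W q m) (h' : F.Decomposes W q' m') :
    F.Decomposes W (fun x => q x + q' x) (fun n z => m n z + m' n z) := by
  refine ⟨h.int.add h'.int, fun n => (h.int_mode n).add (h'.int_mode n), ?_⟩
  rw [integral_add h.int h'.int, mul_add]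
  have : ∀ n, ∫ z, (m n z + m' n z) ∂F.lin = _ := fun n => integral_add (h.int_mode n) (h'.int_mode n)
  simp only [this]
  exact h.sum.add h'.sum

lemma congr (h : F.Decomposes W q m) (e : ∀ n z, m' n z = m n z) : F.Decomposes W q m' := by
  rwa [show m' = m from funext fun n => funext fun z => e n z]

lemma zero : F.Decomposes W (fun _ => 0) (fun _ _ => 0) :=
  ⟨integrable_zero _ _ _, fun _ => integrable_zero _ _ _, by simp [hasSum_zero]⟩

lemma finsetSum {ι : Type*} (s : Finset ι) {q : ι → Space → ℝ} {m : ι → (Fin 2 → ℤ) → ℝ → ℝ}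
    (h : ∀ i, F.Decomposes W (q i) (m i)) :
    F.Decomposes W (fun x => ∑ i ∈ s, q i x) (fun n z => ∑ i ∈ s, m i n z) := by
  classical
  induction s using Finset.induction_on with
  | empty => simpa using zero
  | insert i s hi ih =>
    simp only [Finset.sum_insert hi]
    exact (h i).add ih

/-- A weight depending only on height commutes with the horizontal Fourier transform, so Parseval's
identity applies to weighted products. -/
lemma mul {a : ℝ → ℝ} (ha : MemLp a ⊤ F.lin) {f g : Space → ℝ} (hf : MemLp f 2 (F.vol H))
    (hg : MemLp g 2 (F.vol H)) (of : W.OffS f) (og : W.OffS g) :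
    F.Decomposes W (fun x => a x.2 * (f x * g x))
      (fun n z => a z * (W.cosM n f z * W.cosM n g z + W.sinM n f z * W.sinM n g z)) := by
  have h := W.hasSum_vol (memL2_mul ha hf) hg (of.mul_left fun x => a x.2) og
  have ec : ∀ n z, W.cosM n (fun x => a x.2 * f x) z = a z * W.cosM n f z := fun n z => by
    simp only [Window.cosM, Window.cosI, mul_assoc]
    exact integral_const_mul _ _
  have es : ∀ n z, W.sinM n (fun x => a x.2 * f x) z = a z * W.sinM n f z := fun n z => by
    simp only [Window.sinM, Window.sinI, mul_assoc]
    exact integral_const_mul _ _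
  simp only [ec, es, mul_assoc, ← mul_add] at h
  refine ⟨integrable_weight ha hf hg, fun n => ?_, h⟩
  have hm := W.memLp_modes hf of n
  have hm' := W.memLp_modes hg og n
  have i : Integrable (fun z => W.cosM n f z * W.cosM n g z + W.sinM n f z * W.sinM n g z) F.lin :=
    (hm.1.integrable_mul hm'.1).add (hm.2.integrable_mul hm'.2)
  exact i.mul_of_top_right ha

end Decomposes

variable (F) in
/-- The density of `A + r² M + r B`. -/
def density (r z : ℝ) (w : Fin 3 → ℝ) (D : Fin 3 → Fin 3 → ℝ) : ℝ :=
  ∑ i, ∑ j, (r * F.ε₀ z * (D i j * D i j) + r * F.ε₀ z * (D i j * D j i) +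
      (F.dP z * F.ρ₀ z + (r * F.δ₀ z + -(2 / 3 * r) * F.ε₀ z)) * (D i i * D j j)) +
    (∑ j : Fin 2, 2 * F.g * F.ρ₀ z * (w (horiz j) * D 2 (horiz j)) +
    ∑ i, r ^ 2 * F.ρ₀ z * (w i * w i))

lemma decomposes_density {W : Window H} (r : ℝ) {w : Fin 3 → Space → ℝ} {D : Fin 3 → Fin 3 → Space → ℝ}
    (hw : ∀ i, MemLp (w i) 2 (F.vol H)) (hD : ∀ i j, MemLp (D i j) 2 (F.vol H))
    (ow : ∀ i, W.OffS (w i)) (oD : ∀ i j, W.OffS (D i j)) :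
    F.Decomposes W (fun x => F.density r x.2 (fun i => w i x) (fun i j => D i j x))
      (fun n z => F.density r z (fun i => W.cosM n (w i) z) (fun i j => W.cosM n (D i j) z) +
        F.density r z (fun i => W.sinM n (w i) z) (fun i j => W.sinM n (D i j) z)) := by
  have c1 := (F.coef_ε₀.const_mul r).memLp_top
  have c2 := (coef_dPρ.add ((F.coef_δ₀.const_mul r).add
    (F.coef_ε₀.const_mul (-(2 / 3 * r))))).memLp_top (F := F)
  have c3 := (F.coef_ρ₀.const_mul (2 * F.g)).memLp_top
  have c4 := (F.coef_ρ₀.const_mul (r ^ 2)).memLp_top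
  have h := (Decomposes.finsetSum (W := W) Finset.univ fun i => Decomposes.finsetSum Finset.univ fun j =>
    ((Decomposes.mul c1 (hD i j) (hD i j) (oD i j) (oD i j)).add
      (Decomposes.mul c1 (hD i j) (hD j i) (oD i j) (oD j i))).add
      (Decomposes.mul c2 (hD i i) (hD j j) (oD i i) (oD j j))).add
    ((Decomposes.finsetSum Finset.univ fun j : Fin 2 =>
      Decomposes.mul c3 (hw (horiz j)) (hD 2 (horiz j)) (ow (horiz j)) (oD 2 (horiz j))).add
    (Decomposes.finsetSum Finset.univ fun i => Decomposes.mul c4 (hw i) (hw i) (ow i) (ow i)))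
  refine h.congr fun n z => ?_
  simp only [density, mul_add, Finset.sum_add_distrib]
  ring

lemma _root_.RayleighTaylor.integral_lincomb {α : Type*} [MeasurableSpace α] {μ : Measure α}
    {a b c d : α → ℝ} (ha : Integrable a μ) (hb : Integrable b μ) (hc : Integrable c μ) (s t : ℝ)
    (h : ∀ p, d p = a p + s * b p + t * c p) :
    ∫ p, d p ∂μ = ∫ p, a p ∂μ + s * ∫ p, b p ∂μ + t * ∫ p, c p ∂μ := by
  simp only [h]
  rw [← integral_const_mul, ← integral_const_mul, ← integral_add ha (hb.const_mul s)]
  exact integral_add (ha.add (hb.const_mul s)) (hc.const_mul t)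

/-- The form `A + r² M + r B` in terms of its density. -/
lemma total_apply (r : ℝ) (x : F.Flow H) :
    F.potForm H x x + r ^ 2 * F.massForm H (F.velocity H x) (F.velocity H x) + r * F.viscForm H x x =
      ∫ p, F.density r p.2 (Flow.val x p) (Flow.grad x p) ∂F.vol H +
        F.σ * ∑ j, ∫ q, (x 2).2.2 j q * (x 2).2.2 j q ∂H.surf := by
  have i1 := integrable_weight memLp_dPρ (memLp_mdiv x) (memLp_mdiv x)
  have i2 := fun j : Fin 2 => integrable_weight memLp_gρ (memLp_val x (horiz j))
    (memLp_grad x 2 (horiz j))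
  have i3 := fun i j => integrable_weight memLp_ε (memLp_mdev x i j) (memLp_mdev x i j)
  have i4 := integrable_weight F.coef_δ₀.memLp_top (memLp_mdiv x) (memLp_mdiv x)
  have i5 := fun i => integrable_weight F.coef_ρ₀.memLp_top (memLp_val x i) (memLp_val x i)
  have j1 : Integrable (fun p => F.dP p.2 * F.ρ₀ p.2 * (mdiv (Flow.grad x p) * mdiv (Flow.grad x p)) +
      ∑ j : Fin 2, (F.g * F.ρ₀ p.2 * (Flow.val x p (horiz j) * Flow.grad x p 2 (horiz j)) +
        F.g * F.ρ₀ p.2 * (Flow.val x p (horiz j) * Flow.grad x p 2 (horiz j)))) (F.vol H) :=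
    i1.add (integrable_finsetSum _ fun j _ => (i2 j).add (i2 j))
  have j2 : Integrable (fun p => F.ρ₀ p.2 * ∑ i, Flow.val x p i * Flow.val x p i) (F.vol H) := by
    simp only [Finset.mul_sum]
    exact integrable_finsetSum _ fun i _ => i5 i
  have j3 : Integrable (fun p => F.ε₀ p.2 / 2 * ∑ i, ∑ j, mdev (Flow.grad x p) i j * mdev (Flow.grad x p) i j +
      F.δ₀ p.2 * (mdiv (Flow.grad x p) * mdiv (Flow.grad x p))) (F.vol H) := by
    simp only [Finset.mul_sum]
    exact (integrable_finsetSum _ fun i _ => integrable_finsetSum _ fun j _ => i3 i j).add i4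
  rw [potForm_apply, massForm_apply, viscForm_apply,
    integral_lincomb (d := fun p => F.density r p.2 (Flow.val x p) (Flow.grad x p)) j1 j2 j3 (r ^ 2) r fun p => ?_]
  · ring
  · simp only [density, Fin.sum_univ_three, Fin.sum_univ_two, mdev, mdiv, kron]
    simp
    ring

end Setup
end RayleighTaylor
end

/-! ### The lower bound `A + r² M + r B ≥ 0` -/

noncomputable section
namespace RayleighTaylor
open Filter Topology

/-- The gradient of a mode with wave vector `κ`. -/
def modeGrad (κ : Fin 2 → ℝ) (a b : Fin 3 → ℝ) (i : Fin 3) : Fin 3 → ℝ := ![κ 0 * b i, κ 1 * b i, a i]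

namespace Setup

variable {F : Setup} {H : Horizontal}

variable (F) in
/-- The density of `2 (E + r² J)`. -/
def pairDensity (k r z φ dφ ψ dψ : ℝ) : ℝ :=
  (F.dP z * F.ρ₀ z * (dψ + k * φ) ^ 2 - 2 * F.g * F.ρ₀ z * k * φ * ψ) +
    r ^ 2 * (F.ρ₀ z * (φ ^ 2 + ψ ^ 2)) +
    r * (F.δ₀ z * (dψ + k * φ) ^ 2 + F.ε₀ z * ((dφ - k * ψ) ^ 2 + (dψ - k * φ) ^ 2
        + 1 / 3 * (dψ + k * φ) ^ 2))

lemma integrable_pairDensity {φ dφ ψ dψ : ℝ → ℝ} (hφ : F.IsH10 φ dφ) (hψ : F.IsH10 ψ dψ) (k r : ℝ) :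
    Integrable (fun z => F.pairDensity k r z (φ z) (dφ z) (ψ z) (dψ z)) F.lin :=
  ((integrable_potential hφ.memLp hψ.memLp hψ.1).add
    ((integrable_mass hφ.memLp hψ.memLp).const_mul _)).add
    ((integrable_dissipation hφ.memLp hφ.1 hψ.memLp hψ.1).const_mul r)

lemma integral_pairDensity {φ dφ ψ dψ : ℝ → ℝ} (hφ : F.IsH10 φ dφ) (hψ : F.IsH10 ψ dψ) (k r : ℝ) :
    ∫ z, F.pairDensity k r z (φ z) (dφ z) (ψ z) (dψ z) ∂F.lin + F.σ * k ^ 2 * ψ 0 ^ 2 =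
      2 * (F.energy k r φ dφ ψ dψ + r ^ 2 * F.mass φ ψ) := by
  rw [integral_lincomb (d := fun z => F.pairDensity k r z (φ z) (dφ z) (ψ z) (dψ z))
    (integrable_potential (k := k) hφ.memLp hψ.memLp hψ.1)
    (integrable_mass hφ.memLp hψ.memLp) (integrable_dissipation (k := k) hφ.memLp hφ.1 hψ.memLp hψ.1)
    (r ^ 2) r fun z => rfl, energy_eq hφ hψ, mass_eq, potential, dissipation]
  ring

/-- Rotate the horizontal components so that one axis is the wave direction `(n₀, n₁)`.
Differentiation shifts the phase by a quarter period, so the longitudinal sine part pairs with the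
vertical cosine part and, with a sign, conversely; these are the two pairs. The transverse component
decouples from pressure and buoyancy and contributes only nonnegative shear and mass terms, which
are dropped. -/
lemma density_mode_ge {r z k n₀ n₁ : ℝ} (hr : 0 ≤ r) (hz : z ∈ Icc (-F.m) F.ℓ)
    (hn : n₀ ^ 2 + n₁ ^ 2 = 1) (c dc s ds : Fin 3 → ℝ) :
    F.pairDensity k r z (n₀ * s 0 + n₁ * s 1) (n₀ * ds 0 + n₁ * ds 1) (c 2) (dc 2) +
      F.pairDensity k r z (-n₀ * c 0 + -n₁ * c 1) (-n₀ * dc 0 + -n₁ * dc 1) (s 2) (ds 2) ≤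
    F.density r z c (modeGrad ![k * n₀, k * n₁] dc s) +
      F.density r z s (modeGrad ![-(k * n₀), -(k * n₁)] ds c) := by
  have h1 := mul_nonneg hr (F.ε₀_pos hz).le
  have h2 := mul_nonneg (sq_nonneg r) (F.ρ₀_pos hz).le
  have h3 : 0 ≤ r * F.ε₀ z * (k ^ 2 * (n₀ * s 1 - n₁ * s 0) ^ 2 + k ^ 2 * (n₀ * c 1 - n₁ * c 0) ^ 2 +
      (n₀ * ds 1 - n₁ * ds 0) ^ 2 + (n₀ * dc 1 - n₁ * dc 0) ^ 2) +
      r ^ 2 * F.ρ₀ z * ((n₀ * s 1 - n₁ * s 0) ^ 2 + (n₀ * c 1 - n₁ * c 0) ^ 2) := by positivity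
  rw [← sub_nonneg]
  refine h3.trans_eq ?_
  simp only [density, pairDensity, modeGrad, Fin.sum_univ_three, Fin.sum_univ_two]
  simp only [show horiz 0 = 0 from rfl, show horiz 1 = 1 from rfl, Matrix.cons_val]
  linear_combination (r * F.ε₀ z * ((dc 0 ^ 2 + dc 1 ^ 2 + ds 0 ^ 2 + ds 1 ^ 2) -
    k ^ 2 * (s 2 ^ 2 + c 2 ^ 2)) + r ^ 2 * F.ρ₀ z * (s 0 ^ 2 + s 1 ^ 2 + c 0 ^ 2 + c 1 ^ 2)) * hn

/-- At frequency zero only vertical derivatives survive. The buoyancy term contains a horizontal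
derivative and disappears, leaving a sum of squares. -/
lemma density_zero_ge {r z : ℝ} (hr : 0 ≤ r) (hz : z ∈ Icc (-F.m) F.ℓ) (w a b : Fin 3 → ℝ) :
    0 ≤ F.density r z w (modeGrad 0 a b) := by
  have h1 := mul_nonneg hr (F.ε₀_pos hz).le
  have h2 := mul_nonneg (sq_nonneg r) (F.ρ₀_pos hz).le
  have h3 := mul_nonneg hr (F.δ₀_nonneg hz)
  have h4 := mul_nonneg (F.dP_pos hz).le (F.ρ₀_pos hz).le
  have h5 : 0 ≤ r * F.ε₀ z * (a 0 ^ 2 + a 1 ^ 2 + 4 / 3 * a 2 ^ 2) + r * F.δ₀ z * a 2 ^ 2 +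
      F.dP z * F.ρ₀ z * a 2 ^ 2 + r ^ 2 * F.ρ₀ z * (w 0 ^ 2 + w 1 ^ 2 + w 2 ^ 2) := by positivity
  refine h5.trans_eq ?_
  simp only [density, modeGrad, Fin.sum_univ_three, Fin.sum_univ_two]
  simp only [show horiz 0 = 0 from rfl, show horiz 1 = 1 from rfl, Matrix.cons_val, Pi.zero_apply]
  ring

/-- `r` is at least every growth rate of the setting. -/
def Dominates (F : Setup) (H : Horizontal) (r : ℝ) : Prop := 0 < r ∧ ∀ s ∈ F.growthRates H, s ≤ r

lemma IsH10.add {φ dφ ψ dψ : ℝ → ℝ} (hφ : F.IsH10 φ dφ) (hψ : F.IsH10 ψ dψ) :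
    F.IsH10 (fun z => φ z + ψ z) (fun z => dφ z + dψ z) := by
  refine ⟨hφ.1.add hψ.1, fun z hz => ?_, by simp only [hφ.2.2, hψ.2.2, add_zero]⟩
  have hl := left_mem_Icc.2 (neg_m_lt_ℓ (F := F)).le
  rw [intervalIntegral.integral_add (hφ.intervalIntegrable hl hz) (hψ.intervalIntegrable hl hz),
    ← hφ.2.1 z hz, ← hψ.2.1 z hz]

/-- Every mode contributes a nonnegative amount to `A + r² M + r B`. -/
lemma mode_nonneg {r : ℝ} (hr : F.Dominates H r) {W : Window H} {n : Fin 2 → ℤ}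
    {c dc s ds : Fin 3 → ℝ → ℝ} (hc : ∀ i, F.IsH10 (c i) (dc i)) (hs : ∀ i, F.IsH10 (s i) (ds i))
    {D : ℝ → ℝ} (hD : ∀ z, D z = F.density r z (fun i => c i z)
        (modeGrad (wave W.T n) (fun i => dc i z) (fun i => s i z)) +
      F.density r z (fun i => s i z)
        (modeGrad (-wave W.T n) (fun i => ds i z) (fun i => c i z))) (iD : Integrable D F.lin) :
    0 ≤ ∫ z, D z ∂F.lin + F.σ * ((wave W.T n 0 ^ 2 + wave W.T n 1 ^ 2) * (c 2 0 ^ 2 + s 2 0 ^ 2)) := by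
  by_cases hn : n = 0
  · have h0 : wave W.T n = 0 := by subst hn; ext j; simp [wave]
    have h1 : 0 ≤ ∫ z, D z ∂F.lin := by
      refine integral_nonneg_of_ae (ae_lin_of_forall fun z hz => ?_)
      rw [hD, h0, neg_zero]
      exact add_nonneg (density_zero_ge hr.1.le hz _ _ _) (density_zero_ge hr.1.le hz _ _ _)
    simpa [h0] using h1
  have hf := W.freq n hn
  set k := Real.sqrt (wave W.T n 0 ^ 2 + wave W.T n 1 ^ 2) with hk
  have hk0 : 0 < k := by
    cases H with
    | plane => exact hf
    | torus L => exact hf.1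
  have hk2 : k ^ 2 = wave W.T n 0 ^ 2 + wave W.T n 1 ^ 2 := Real.sq_sqrt (by positivity)
  -- The unit vector in the direction of the wave; `k > 0` because the frequency is admissible and
  -- nonzero.
  set n₀ := wave W.T n 0 / k with hn0
  set n₁ := wave W.T n 1 / k with hn1
  have hnn : n₀ ^ 2 + n₁ ^ 2 = 1 := by rw [hn0, hn1, div_pow, div_pow, ← add_div, ← hk2]; field_simp
  have hw : wave W.T n = ![k * n₀, k * n₁] := by
    ext j; fin_cases j <;> simp [hn0, hn1] <;> field_simp
  have hw' : -wave W.T n = ![-(k * n₀), -(k * n₁)] := by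
    rw [hw]; ext j; fin_cases j <;> simp
  have hmax : F.σ * k ^ 2 < F.g * F.jumpρ → ∀ s, F.IsGrowthRate k s → s ≤ r :=
    fun h s hs => hr.2 s ⟨k, hf, h, hs⟩
  -- The longitudinal amplitudes of the two pairs: the wave direction contracted with the sine
  -- coefficients and, with a minus sign, with the cosine coefficients.
  have hφ₁ := ((hs 0).const_mul n₀).add ((hs 1).const_mul n₁)
  have hφ₂ := ((hc 0).const_mul (-n₀)).add ((hc 1).const_mul (-n₁))
  have e1 := energy_add_nonneg hk0 hr.1 hmax hφ₁ (hc 2)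
  have e2 := energy_add_nonneg hk0 hr.1 hmax hφ₂ (hs 2)
  have p1 := integral_pairDensity hφ₁ (hc 2) k r
  have p2 := integral_pairDensity hφ₂ (hs 2) k r
  have i1 := integrable_pairDensity hφ₁ (hc 2) k r
  have i2 := integrable_pairDensity hφ₂ (hs 2) k r
  have h3 := integral_mono_ae (i1.add i2) iD (ae_lin_of_forall fun z hz => by
    rw [hD, hw', hw]
    exact density_mode_ge (k := k) hr.1.le hz hnn (fun i => c i z) (fun i => dc i z)
      (fun i => s i z) (fun i => ds i z))
  rw [integral_add' i1 i2] at h3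
  rw [← hk2]
  nlinarith

lemma coeFn_testFlow {φ : Fin 3 → Space → ℝ} (h : ∀ i, F.IsInner H (φ i)) :
    (∀ᵐ p ∂F.vol H, Flow.val (F.testFlow H φ) p = (fun i => φ i p) ∧
      Flow.grad (F.testFlow H φ) p = fun i j => partialD j (φ i) p) ∧
    ∀ j, (F.testFlow H φ 2).2.2 j =ᵐ[H.surf] fun y => partialD (horiz j) (φ 2) (y, 0) := by
  refine ⟨?_, fun j => ?_⟩
  · have h1 := fun i => coeFn_toL2 ((h i).1.memLp F 2)
    have h2 := fun i j => coeFn_toL2 (((h i).1.partialD j).memLp F 2)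
    filter_upwards [ae_all_iff.2 h1, ae_all_iff.2 fun i => ae_all_iff.2 (h2 i)] with p a b
    exact ⟨funext a, funext fun i => funext (b i)⟩
  · change H.toL2 _ =ᵐ[_] _
    rw [toL2_surf_eq ((((h 2).1.partialD (horiz j)).slice 0).memLp 2)]
    exact MemLp.coeFn_toLp _

/-- The lower bound of the potential form. -/
theorem total_nonneg (hH : H.Proper) {r : ℝ} (hr : F.Dominates H r) {x : F.Flow H}
    (hx : x ∈ F.flows H) :
    0 ≤ F.potForm H x x + r ^ 2 * F.massForm H (F.velocity H x) (F.velocity H x) +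
      r * F.viscForm H x x := by
  refine flows_induction hH (p := fun x => 0 ≤ F.potForm H x x +
    r ^ 2 * F.massForm H (F.velocity H x) (F.velocity H x) + r * F.viscForm H x x) ?_ ?_ hx
  · refine isClosed_le continuous_const ?_
    fun_prop
  intro φ h
  -- The components of a test flow fit into one box whose Fourier frequencies are all admissible. In
  -- the plane the box may be any large enough square, because every positive frequency is dominated
  -- by `r`.
  obtain ⟨W, hW⟩ := Window.exists_window hH φ fun i => (h i).1
  have hD := fun i j => ((h i).1.partialD j).memLp F 2
  have hdec := decomposes_density (F := F) r (fun i => (h i).1.memLp F 2) hD (fun i => (hW i).1)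
    (fun i j => (hW i).2 j)
  obtain ⟨h1, h2⟩ := coeFn_testFlow h
  have e1 : ∫ p, F.density r p.2 (Flow.val (F.testFlow H φ) p) (Flow.grad (F.testFlow H φ) p) ∂F.vol H =
      ∫ p, F.density r p.2 (fun i => φ i p) (fun i j => partialD j (φ i) p) ∂F.vol H := by
    refine integral_congr_ae ?_
    filter_upwards [h1] with p hp
    rw [hp.1, hp.2]
  have e2 : ∀ j : Fin 2, ∫ q, (F.testFlow H φ 2).2.2 j q * (F.testFlow H φ 2).2.2 j q ∂H.surf =
      ∫ y, partialD (horiz j) (φ 2) (y, 0) * partialD (horiz j) (φ 2) (y, 0) ∂H.surf := fun j => by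
    refine integral_congr_ae ?_
    filter_upwards [h2 j] with p hp
    rw [hp]
  have s1 := fun j : Fin 2 => Window.hasSum_surf (W := W) ((((h 2).1.partialD (horiz j)).slice 0).memLp 2)
    ((((h 2).1.partialD (horiz j)).slice 0).memLp 2) ((hW 2).2 (horiz j) 0) ((hW 2).2 (horiz j) 0)
  have s := hdec.sum.add (((s1 0).add (s1 1)).mul_left F.σ)
  rw [total_apply, e1, Fin.sum_univ_two, e2, e2]
  have hT : 0 < W.T ^ 2 := pow_pos W.T_pos 2
  refine nonneg_of_mul_nonneg_right (a := W.T ^ 2) ?_ hT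
  refine (s.nonneg fun n => ?_).trans_eq (by ring)
  have hc := fun i => isH10_cosM (h i) ((hW i).2 2) n
  have hs := fun i => isH10_sinM (h i) ((hW i).2 2) n
  have := mode_nonneg (W := W) (n := n) hr hc hs (fun z => ?_) (hdec.int_mode n)
  · refine this.trans_eq ?_
    congr 2
    have c1 := fun j => cosM_horiz hH W (h 2).1 n j 0
    have c2 := fun j => sinM_horiz hH W (h 2).1 n j 0
    simp only [Window.cosM, Window.sinM] at c1 c2 ⊢
    rw [c1, c2, c1, c2]
    ring
  · congr 2
    · ext i j
      fin_cases j
      · exact cosM_horiz hH W (h i).1 n 0 z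
      · exact cosM_horiz hH W (h i).1 n 1 z
      · rfl
    · ext i j
      fin_cases j
      · exact (sinM_horiz hH W (h i).1 n 0 z).trans (neg_mul _ _).symm
      · exact (sinM_horiz hH W (h i).1 n 1 z).trans (neg_mul _ _).symm
      · rfl

/-- The evolution of the velocity is dissipative. -/
theorem isDissipative (hH : H.Proper) {r : ℝ} (hr : F.Dominates H r) :
    IsDissipative (F.flows H) (F.velocity H) (F.massForm H) (F.potForm H) (F.viscForm H) r where
  rate_pos := hr.1
  M_symm := massForm_symm
  M_nonneg := massForm_nonneg
  A_symm x _ y _ := potForm_symm x y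
  B_symm := viscForm_symm
  B_nonneg := viscForm_nonneg
  lower _ hx := total_nonneg hH hr hx

end Setup
end RayleighTaylor
end

/-! ### Korn's inequality and the upper bound of the potential form -/

noncomputable section
namespace RayleighTaylor
open Filter Topology

namespace Setup

variable {F : Setup} {H : Horizontal} {φ ψ : Space → ℝ}

lemma IsInner.mul (h : F.IsInner H φ) (h' : H.IsTest ψ) : F.IsInner H fun x => φ x * ψ x :=
  ⟨h.1.mul h', (closure_mono fun _ hx => left_ne_zero_of_mul hx).trans h.2⟩

/-- The integral of a derivative of an inner test function vanishes. -/
lemma IsInner.integral_partialD (hH : H.Proper) (h : F.IsInner H φ) (j : Fin 3) :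
    ∫ x, partialD j φ x ∂F.vol H = 0 := by
  have hi := memLp_one_iff_integrable.1 ((h.1.partialD j).memLp F 1)
  have hor : ∀ j : Fin 2, ∫ x, partialD (horiz j) φ x ∂F.vol H = 0 := fun j => by
    rw [integral_vol (memLp_one_iff_integrable.1 ((h.1.partialD _).memLp F 1))]
    refine integral_eq_zero_of_ae (Eventually.of_forall fun z => ?_)
    refine Eq.trans ?_ ((h.1.slice z).integral_planeD hH j)
    exact integral_congr_ae (Eventually.of_forall fun y => (planeD_slice h.1.1 j y z).symm)
  fin_cases j
  · exact hor 0
  · exact hor 1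
  · simp only [Fin.reduceFinMk] at hi ⊢
    rw [vol_eq] at hi ⊢
    rw [integral_prod _ hi]
    refine integral_eq_zero_of_ae (Eventually.of_forall fun y => ?_)
    simp only
    rw [← integral_lin, h.integral_vertical y F.ℓ, h.eq_zero_of_le y (by simp)]; rfl

/-- The symmetry that underlies Korn's inequality. -/
lemma integral_grad_swap (hH : H.Proper) (h : F.IsInner H φ) (h' : F.IsInner H ψ) (i j : Fin 3) :
    ∫ x, partialD j φ x * partialD i ψ x ∂F.vol H = ∫ x, partialD i φ x * partialD j ψ x ∂F.vol H := by
  have h1 := (h.mul (h'.1.partialD i)).integral_partialD hH j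
  have h2 := (h.mul (h'.1.partialD j)).integral_partialD hH i
  have m := h.1.memLp F 2
  have i1 : ∀ i j, Integrable (fun x => partialD j φ x * partialD i ψ x) (F.vol H) := fun i j =>
    ((h.1.partialD j).memLp F 2).integrable_mul ((h'.1.partialD i).memLp F 2)
  have i2 : ∀ i j, Integrable (fun x => φ x * partialD j (partialD i ψ) x) (F.vol H) := fun i j =>
    m.integrable_mul (((h'.1.partialD i).partialD j).memLp F 2)
  simp only [partialD_mul h.1.1 (contDiff_partialD h'.1.1 _)] at h1 h2
  rw [integral_add (i1 _ _) (i2 _ _)] at h1 h2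
  simp only [partialD_comm h'.1.1 i j] at h2
  linarith

/-- The square of the `L²` norm of the gradient of a velocity field. -/
def gradSq (x : F.Flow H) : ℝ := ∑ i, ∑ j, ∫ p, Flow.grad x p i j * Flow.grad x p i j ∂F.vol H

lemma continuous_gradSq : Continuous (gradSq : F.Flow H → ℝ) := by
  have h : (gradSq : F.Flow H → ℝ) = fun x => ∑ i, ∑ j, inner ℝ (F.gradL H i j x) (F.gradL H i j x) := by
    ext x
    simp only [gradSq, inner_eq_integral]
    rfl
  rw [h]
  fun_prop

lemma continuous_viscForm : Continuous fun x : F.Flow H => F.viscForm H x x := by fun_prop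

/-- Korn's inequality. -/
theorem exists_korn (F : Setup) : ∃ κ, 0 < κ ∧ ∀ H : Horizontal, H.Proper → ∀ x ∈ F.flows H,
    κ * gradSq x ≤ F.viscForm H x x := by
  obtain ⟨κ, hκ, hε⟩ := F.exists_ε₀_lower
  refine ⟨κ, hκ, fun H hH x hx => ?_⟩
  refine flows_induction hH (p := fun x => κ * gradSq x ≤ F.viscForm H x x) ?_ ?_ hx
  · exact isClosed_le (continuous_const.mul continuous_gradSq) continuous_viscForm
  intro φ h
  set X := F.testFlow H φ
  have hX := (coeFn_testFlow h).1
  have m := fun i j => memLp_grad X i j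
  have i1 : ∀ i j k l, Integrable (fun p => Flow.grad X p i j * Flow.grad X p k l) (F.vol H) :=
    fun i j k l => (m i j).integrable_mul (m k l)
  have sw : ∀ i j, ∫ p, Flow.grad X p i j * Flow.grad X p j i ∂F.vol H =
      ∫ p, Flow.grad X p i i * Flow.grad X p j j ∂F.vol H := fun i j => by
    have e : ∀ a b c d, ∫ p, Flow.grad X p a b * Flow.grad X p c d ∂F.vol H =
        ∫ p, partialD b (φ a) p * partialD d (φ c) p ∂F.vol H := fun a b c d => by
      refine integral_congr_ae ?_
      filter_upwards [hX] with p hp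
      rw [hp.2]
    rw [e, e, integral_grad_swap hH (h i) (h j)]
  -- Two integrations by parts turn the cross terms `∂ⱼwᵢ ∂ᵢwⱼ` into the squared divergence, so the
  -- right side is the full gradient plus one third of `∫ (div w)²`.
  have key : gradSq X ≤ ∫ p, ∑ i, ∑ j, (Flow.grad X p i j * Flow.grad X p i j +
      Flow.grad X p i j * Flow.grad X p j i - 2 / 3 * (Flow.grad X p i i * Flow.grad X p j j)) ∂F.vol H := by
    have i2 : ∀ i j, Integrable (fun p => Flow.grad X p i j * Flow.grad X p i j +
        Flow.grad X p i j * Flow.grad X p j i) (F.vol H) := fun i j => (i1 i j i j).add (i1 i j j i)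
    have i3 : ∀ i j, Integrable (fun p => Flow.grad X p i j * Flow.grad X p i j +
        Flow.grad X p i j * Flow.grad X p j i - 2 / 3 * (Flow.grad X p i i * Flow.grad X p j j))
        (F.vol H) := fun i j => (i2 i j).sub ((i1 i i j j).const_mul _)
    rw [integral_finsetSum _ fun i _ => integrable_finsetSum _ fun j _ => i3 i j]
    simp only [integral_finsetSum _ fun j _ => i3 _ j, integral_sub (i2 _ _) ((i1 _ _ _ _).const_mul (2 / 3)),
      integral_add (i1 _ _ _ _) (i1 _ _ _ _), integral_const_mul]
    have e : ∫ p, mdiv (Flow.grad X p) * mdiv (Flow.grad X p) ∂F.vol H =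
        ∑ i, ∑ j, ∫ p, Flow.grad X p i i * Flow.grad X p j j ∂F.vol H := by
      simp only [mdiv, Finset.sum_mul_sum]
      rw [integral_finsetSum _ fun i _ => integrable_finsetSum _ fun j _ => i1 i i j j]
      simp only [integral_finsetSum _ fun j _ => i1 _ _ j j]
    have e0 : 0 ≤ ∫ p, mdiv (Flow.grad X p) * mdiv (Flow.grad X p) ∂F.vol H :=
      integral_nonneg fun p => mul_self_nonneg _
    simp only [Finset.sum_sub_distrib, Finset.sum_add_distrib, ← Finset.mul_sum]
    have e1 : ∑ i, ∑ j, ∫ p, Flow.grad X p i j * Flow.grad X p j i ∂F.vol H = _ :=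
      Finset.sum_congr rfl fun i _ => Finset.sum_congr rfl fun j _ => sw i j
    rw [e1, ← e, gradSq]
    linarith
  refine (mul_le_mul_of_nonneg_left key hκ.le).trans ?_
  rw [viscForm_apply, ← integral_const_mul]
  refine integral_mono_ae ?_ ?_ ?_
  · refine Integrable.const_mul (integrable_finsetSum _ fun i _ => integrable_finsetSum _ fun j _ => ?_) _
    exact ((i1 i j i j).add (i1 i j j i)).sub ((i1 i i j j).const_mul _)
  · simp only [Finset.mul_sum]
    exact (integrable_finsetSum _ fun i _ => integrable_finsetSum _ fun j _ =>
      integrable_weight memLp_ε (memLp_mdev X i j) (memLp_mdev X i j)).add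
      (integrable_weight F.coef_δ₀.memLp_top (memLp_mdiv X) (memLp_mdiv X))
  · filter_upwards [ae_mem_Icc] with p hp
    have h1 := hε _ hp
    have h2 := mul_nonneg (F.δ₀_nonneg hp) (mul_self_nonneg (mdiv (Flow.grad X p)))
    have h3 : 0 ≤ ∑ i, ∑ j, mdev (Flow.grad X p) i j * mdev (Flow.grad X p) i j :=
      Finset.sum_nonneg fun i _ => Finset.sum_nonneg fun j _ => mul_self_nonneg _
    -- Squaring the tensor gives `2|D|² + 2 D : Dᵀ - (4/3)(tr D)²`, twice the integrand above; the
    -- weight `ε₀ / 2` in the dissipation therefore yields the constant `κ`.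
    have h4 : ∑ i, ∑ j, (Flow.grad X p i j * Flow.grad X p i j +
        Flow.grad X p i j * Flow.grad X p j i - 2 / 3 * (Flow.grad X p i i * Flow.grad X p j j)) =
        1 / 2 * ∑ i, ∑ j, mdev (Flow.grad X p) i j * mdev (Flow.grad X p) i j := by
      simp only [Fin.sum_univ_three, mdev, mdiv, kron]
      simp
      ring
    rw [h4]
    nlinarith

/-- The potential form is controlled by the other forms and the surface tension. -/
theorem exists_potForm_le (F : Setup) : ∃ C, 0 ≤ C ∧ ∀ H : Horizontal, H.Proper → ∀ x ∈ F.flows H,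
    F.potForm H x x ≤ C * (F.massForm H (F.velocity H x) (F.velocity H x) + F.viscForm H x x) +
      F.σ * ∑ j, ∫ q, (x 2).2.2 j q * (x 2).2.2 j q ∂H.surf := by
  obtain ⟨κ, hκ, hK⟩ := F.exists_korn
  obtain ⟨K₁, h1, hK₁⟩ := (coef_dPρ (F := F)).bounded
  obtain ⟨K₂, h2, hK₂⟩ := (F.coef_ρ₀.const_mul F.g).bounded
  have hg := F.g_pos
  -- The squared divergence is at most three times the squared gradient, and the buoyancy products
  -- are split evenly: the velocity half gives `g M` and the gradient half enters `K₂`. Korn's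
  -- inequality then trades the gradient for the dissipation at the price `1 / κ`.
  refine ⟨F.g + (3 * |K₁| + |K₂|) / κ, by positivity, fun H hH x hx => ?_⟩
  have hk := hK H hH x hx
  rw [potForm_apply]
  refine add_le_add_left ?_ _
  have hM := massForm_nonneg (F.velocity H x)
  have hB := viscForm_nonneg x
  have key : ∫ p, (F.dP p.2 * F.ρ₀ p.2 * (mdiv (Flow.grad x p) * mdiv (Flow.grad x p)) +
      ∑ j : Fin 2, (F.g * F.ρ₀ p.2 * (Flow.val x p (horiz j) * Flow.grad x p 2 (horiz j)) +
        F.g * F.ρ₀ p.2 * (Flow.val x p (horiz j) * Flow.grad x p 2 (horiz j)))) ∂F.vol H ≤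
      F.g * F.massForm H (F.velocity H x) (F.velocity H x) + (3 * |K₁| + |K₂|) * gradSq x := by
    have i1 := integrable_weight memLp_dPρ (memLp_mdiv x) (memLp_mdiv x)
    have i2 := fun j : Fin 2 => integrable_weight memLp_gρ (memLp_val x (horiz j))
      (memLp_grad x 2 (horiz j))
    have i3 : ∀ i j, Integrable (fun p => Flow.grad x p i j * Flow.grad x p i j) (F.vol H) :=
      fun i j => (memLp_grad x i j).integrable_mul (memLp_grad x i j)
    have i5 := fun i => integrable_weight F.coef_ρ₀.memLp_top (memLp_val x i) (memLp_val x i)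
    have j2 : Integrable (fun p => F.ρ₀ p.2 * ∑ i, Flow.val x p i * Flow.val x p i) (F.vol H) := by
      simp only [Finset.mul_sum]
      exact integrable_finsetSum _ fun i _ => i5 i
    have j3 : Integrable (fun p => ∑ i, ∑ j, Flow.grad x p i j * Flow.grad x p i j) (F.vol H) :=
      integrable_finsetSum _ fun i _ => integrable_finsetSum _ fun j _ => i3 i j
    have e : gradSq x = ∫ p, ∑ i, ∑ j, Flow.grad x p i j * Flow.grad x p i j ∂F.vol H := by
      rw [integral_finsetSum _ fun i _ => integrable_finsetSum _ fun j _ => i3 i j]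
      simp only [integral_finsetSum _ fun j _ => i3 _ j]
      rfl
    rw [massForm_apply, e, ← integral_const_mul, ← integral_const_mul,
      ← integral_add (j2.const_mul _) (j3.const_mul _)]
    refine integral_mono_ae (i1.add (integrable_finsetSum _ fun j _ => (i2 j).add (i2 j)))
      ((j2.const_mul _).add (j3.const_mul _)) ?_
    filter_upwards [ae_mem_Icc] with p hp
    have hρ := (F.ρ₀_pos hp).le
    have b1 := (le_abs_self _).trans ((hK₁ _ hp).trans (le_abs_self K₁))
    have b2 := (le_abs_self _).trans ((hK₂ _ hp).trans (le_abs_self K₂))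
    have b3 := mul_nonneg hg.le hρ
    have b4 := abs_nonneg K₁
    have b5 := abs_nonneg K₂
    simp only [Fin.sum_univ_three, Fin.sum_univ_two, mdiv, show horiz 0 = 0 from rfl,
      show horiz 1 = 1 from rfl]
    set D := Flow.grad x p
    set w := Flow.val x p
    have c1 : (D 0 0 + D 1 1 + D 2 2) * (D 0 0 + D 1 1 + D 2 2) ≤
        3 * (D 0 0 * D 0 0 + D 1 1 * D 1 1 + D 2 2 * D 2 2) := by
      nlinarith [sq_nonneg (D 0 0 - D 1 1), sq_nonneg (D 0 0 - D 2 2), sq_nonneg (D 1 1 - D 2 2)]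
    have c2 := mul_le_mul b1 c1 (mul_self_nonneg _) b4
    have c3 := mul_nonneg b3 (sq_nonneg (w 0 - D 2 0))
    have c4 := mul_nonneg b3 (sq_nonneg (w 1 - D 2 1))
    have c5 := mul_le_mul_of_nonneg_right b2 (add_nonneg (mul_self_nonneg (D 2 0)) (mul_self_nonneg (D 2 1)))
    have c6 := mul_nonneg b3 (mul_self_nonneg (w 2))
    have c7 : 0 ≤ |K₂| * (D 0 0 * D 0 0 + D 0 1 * D 0 1 + D 0 2 * D 0 2 + (D 1 0 * D 1 0 +
      D 1 1 * D 1 1 + D 1 2 * D 1 2) + D 2 2 * D 2 2) := mul_nonneg b5 (by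
        have := fun i j => mul_self_nonneg (D i j)
        linarith [this 0 0, this 0 1, this 0 2, this 1 0, this 1 1, this 1 2, this 2 2])
    have c8 : 0 ≤ 3 * |K₁| * (D 0 1 * D 0 1 + D 0 2 * D 0 2 + (D 1 0 * D 1 0 +
      D 1 2 * D 1 2) + (D 2 0 * D 2 0 + D 2 1 * D 2 1)) := mul_nonneg (by positivity) (by
        have := fun i j => mul_self_nonneg (D i j)
        linarith [this 0 1, this 0 2, this 1 0, this 1 2, this 2 0, this 2 1])
    linarith
  have h5 : (3 * |K₁| + |K₂|) * gradSq x ≤ (3 * |K₁| + |K₂|) / κ * F.viscForm H x x := by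
    rw [div_mul_eq_mul_div, le_div_iff₀ hκ]
    nlinarith [abs_nonneg K₁, abs_nonneg K₂]
  have h6 : 0 ≤ (3 * |K₁| + |K₂|) / κ * F.massForm H (F.velocity H x) (F.velocity H x) := by positivity
  nlinarith

end Setup
end RayleighTaylor
end

/-! ### Traces and the jet of an `H²` function -/

noncomputable section
namespace RayleighTaylor
open Filter Topology

namespace Setup

variable {F : Setup} {H : Horizontal} {f : Space → ℝ}

/-- A test function of height that equals one on a given interval around zero. -/
lemma exists_height_cutoff {a b : ℝ} (ha : 0 < a) (hab : a < b) :
    ∃ τ : ℝ → ℝ, ContDiff ℝ ∞ τ ∧ HasCompactSupport τ ∧ (∀ z, |z| ≤ a → τ z = 1) ∧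
      ∀ z, b ≤ |z| → τ z = 0 := by
  let β : ContDiffBump (0 : ℝ) := ⟨a, b, ha, hab⟩
  refine ⟨β, β.contDiff, β.hasCompactSupport, fun z hz => ?_, fun z hz => ?_⟩
  · exact β.one_of_mem_closedBall (by simpa using hz)
  · exact β.zero_of_le_dist (by simpa using hz)

variable (F) in
lemma exists_height_one : ∃ τ : ℝ → ℝ, ContDiff ℝ ∞ τ ∧ HasCompactSupport τ ∧
    (∀ z ∈ Icc (-F.m) F.ℓ, τ z = 1) ∧ ∀ z ∈ Ioo (-F.m) F.ℓ, deriv τ z = 0 := by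
  have h1 := F.m_pos
  have h2 := F.ℓ_pos
  obtain ⟨τ, t1, t2, t3, -⟩ := exists_height_cutoff (a := F.m + F.ℓ) (b := F.m + F.ℓ + 1)
    (by linarith) (by linarith)
  have t4 : ∀ z ∈ Icc (-F.m) F.ℓ, τ z = 1 := fun z hz =>
    t3 z (abs_le.2 ⟨by linarith [hz.1], by linarith [hz.2]⟩)
  refine ⟨τ, t1, t2, t4, fun z hz => ?_⟩
  have : τ =ᶠ[𝓝 z] fun _ => 1 := by
    filter_upwards [isOpen_Ioo.mem_nhds hz] with w hw
    exact t4 w (Ioo_subset_Icc_self hw)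
  rw [this.deriv_eq, deriv_const]

lemma integral_upper (f : Space → ℝ) :
    ∫ x, f x ∂(volume.restrict (H.cell ×ˢ Ioo 0 F.ℓ)) = ∫ x, above x.2 * f x ∂F.vol H := by
  have h1 : ∀ x : Space, above x.2 * f x = {x : Space | 0 < x.2}.indicator f x := fun x => by
    by_cases h : 0 < x.2 <;> simp [above, h]
  have hm : MeasurableSet {x : Space | 0 < x.2} := measurableSet_lt measurable_const measurable_snd
  simp only [h1]
  rw [integral_indicator hm, vol, Measure.restrict_restrict hm]
  congr 2
  ext x
  simp only [heights, mem_prod, mem_inter_iff, mem_union, mem_Ioo, mem_ofPred_eq]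
  constructor
  · rintro ⟨a, b, c⟩; exact ⟨b, a, Or.inr ⟨b, c⟩⟩
  · rintro ⟨a, b, c | c⟩
    · exact absurd c.2 (not_lt.2 a.le)
    · exact ⟨b, c⟩

lemma integral_lower (f : Space → ℝ) :
    ∫ x, f x ∂(volume.restrict (H.cell ×ˢ Ioo (-F.m) 0)) = ∫ x, (1 - above x.2) * f x ∂F.vol H := by
  have h1 : ∀ x : Space, (1 - above x.2) * f x = {x : Space | x.2 ≤ 0}.indicator f x := fun x => by
    by_cases h : 0 < x.2
    · simp [above, h]
    · simp [above, h, not_lt.1 h]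
  have hm : MeasurableSet {x : Space | x.2 ≤ 0} := measurableSet_le measurable_snd measurable_const
  simp only [h1]
  rw [integral_indicator hm, vol, Measure.restrict_restrict hm]
  congr 2
  ext x
  simp only [heights, mem_prod, mem_inter_iff, mem_union, mem_Ioo, mem_ofPred_eq]
  constructor
  · rintro ⟨a, b, c⟩; exact ⟨c.le, a, Or.inl ⟨b, c⟩⟩
  · rintro ⟨a, b, c | c⟩
    · exact ⟨b, c⟩
    · exact absurd c.1 (not_lt.2 a)

lemma integrable_above_mul (hf : Integrable f (F.vol H)) :
    Integrable (fun x => above x.2 * f x) (F.vol H) :=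
  hf.mul_of_top_right (memLp_top_height memLp_above)

lemma integral_layers (hf : Integrable f (F.vol H)) :
    ∫ x, f x ∂F.vol H = ∫ x, f x ∂(volume.restrict (H.cell ×ˢ Ioo 0 F.ℓ)) +
      ∫ x, f x ∂(volume.restrict (H.cell ×ˢ Ioo (-F.m) 0)) := by
  have i := integrable_above_mul hf
  rw [integral_upper (F := F), integral_lower]
  simp only [sub_mul, one_mul]
  rw [integral_sub hf i]
  ring

/-- Green's formula in both layers for a function whose traces on the interface may differ. -/
lemma HasTraces.integral_inner {φ : Space → ℝ} (hf : F.MemH1 H f) {bot₁ top₁ bot₂ top₂ : Plane → ℝ}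
    (h₁ : F.HasTraces H 0 F.ℓ f bot₁ top₁) (h₂ : F.HasTraces H (-F.m) 0 f bot₂ top₂)
    (hφ : H.IsTest φ) (hℓ : ∀ y, top₁ y * φ (y, F.ℓ) = 0) (hm : ∀ y, bot₂ y * φ (y, -F.m) = 0) :
    ∫ x, f x * partialD 2 φ x ∂F.vol H + ∫ x, F.weakDeriv H 2 f x * φ x ∂F.vol H =
      -∫ y, (bot₁ y - top₂ y) * φ (y, 0) ∂H.surf := by
  have hw := hf.hasWeakDeriv 2
  have i1 : Integrable (fun x => f x * partialD 2 φ x) (F.vol H) :=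
    hf.1.integrable_mul ((hφ.partialD 2).memLp F 2)
  have i2 : Integrable (fun x => F.weakDeriv H 2 f x * φ x) (F.vol H) :=
    hw.1.integrable_mul (hφ.memLp F 2)
  have m := (hφ.slice 0).memLp 2
  have i3 : Integrable (fun y => bot₁ y * φ (y, 0)) H.surf := h₁.1.integrable_mul m
  have i4 : Integrable (fun y => top₂ y * φ (y, 0)) H.surf := h₂.2.1.integrable_mul m
  have i12 : Integrable (fun x => f x * partialD 2 φ x + F.weakDeriv H 2 f x * φ x) (F.vol H) :=
    i1.add i2
  rw [← integral_add i1 i2, integral_layers i12]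
  have a := h₁.2.2 φ hφ
  have b := h₂.2.2 φ hφ
  simp only [hℓ, hm, zero_sub, sub_zero, integral_neg] at a b
  simp only [sub_mul]
  rw [a, b, integral_sub i3 i4]
  ring

/-- A vertical cutoff equal to one at the interface and zero at the top isolates the lower trace in
Green's formula. The trace selected by choice is thereby determined almost everywhere. -/
lemma HasTraces.bot_unique (hH : H.Proper) {bot top bot' top' : Plane → ℝ}
    (h : F.HasTraces H 0 F.ℓ f bot top) (h' : F.HasTraces H 0 F.ℓ f bot' top') :
    bot =ᵐ[H.surf] bot' := by
  obtain ⟨τ, t1, t2, t3, t4⟩ := exists_height_cutoff (half_pos F.ℓ_pos) (half_lt_self F.ℓ_pos)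
  refine sub_ae_eq_zero _ _ |>.1 (ae_eq_zero_of_planeTests hH (h.1.sub h'.1) fun χ hχ => ?_)
  have e := (h.2.2 _ (hχ.prod t1 t2)).symm.trans (h'.2.2 _ (hχ.prod t1 t2))
  have t0 : τ 0 = 1 := t3 0 (by rw [abs_zero]; exact (half_pos F.ℓ_pos).le)
  simp only [t0, t4 F.ℓ (le_abs_self _), mul_zero, zero_sub, mul_one,
    integral_neg] at e
  have i1 : Integrable (fun y => bot y * χ y) H.surf := h.1.integrable_mul (hχ.memLp 2)
  have i2 : Integrable (fun y => bot' y * χ y) H.surf := h'.1.integrable_mul (hχ.memLp 2)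
  simp only [Pi.sub_apply, sub_mul]
  rw [integral_sub i1 i2]
  linarith

lemma HasTraces.interfaceTrace_ae (hH : H.Proper) {bot top : Plane → ℝ}
    (h : F.HasTraces H 0 F.ℓ f bot top) : F.interfaceTrace H f =ᵐ[H.surf] bot := by
  have hex : ∃ bot top, F.HasTraces H 0 F.ℓ f bot top := ⟨bot, top, h⟩
  unfold interfaceTrace
  rw [dif_pos hex]
  obtain ⟨top', h'⟩ := hex.choose_spec
  exact h'.bot_unique hH h

lemma hasWeakDeriv_of_mem_jets {x : F.Jet H} (hx : x ∈ F.jets H) (j : Fin 3) :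
    F.HasWeakDeriv H j x.1 (x.2.1 j) :=
  ⟨Lp.memLp _, fun φ h _ => (mem_jets.1 hx).1 φ h j⟩

/-- Green's formula in the upper layer. -/
lemma integral_above_of_mem_jets (hH : H.Proper) {x : F.Jet H} (hx : x ∈ F.jets H) {φ : Space → ℝ}
    (hφ : H.IsTest φ) :
    ∫ p, above p.2 * (x.1 p * partialD 2 φ p + x.2.1 2 p * φ p) ∂F.vol H =
      ∫ y, F.column H (x.2.1 2) y * φ (y, 0) ∂H.surf := by
  have m1 := memL2_mul memLp_above ((hφ.partialD 2).memLp F 2)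
  have m2 := memL2_mul memLp_above (hφ.memLp F 2)
  have m3 := (hφ.slice 0).memLp 2
  have e1 : ∀ x : F.Jet H, ∫ p, above p.2 * (x.1 p * partialD 2 φ p + x.2.1 2 p * φ p) ∂F.vol H =
      inner ℝ x.1 (F.toL2 H fun p => above p.2 * partialD 2 φ p) +
        inner ℝ (x.2.1 2) (F.toL2 H fun p => above p.2 * φ p) := fun x => by
    rw [toL2_eq m1, toL2_eq m2, inner_toLp_right _ m1, inner_toLp_right _ m2]
    refine Eq.trans ?_ (integral_add ((Lp.memLp x.1).integrable_mul m1)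
      ((Lp.memLp (x.2.1 2)).integrable_mul m2))
    exact integral_congr_ae (Eventually.of_forall fun p => by simp only; ring)
  have e2 : ∀ x : F.Jet H, ∫ y, F.column H (x.2.1 2) y * φ (y, 0) ∂H.surf =
      inner ℝ (F.column H (x.2.1 2)) (H.toL2 fun y => φ (y, 0)) := fun x => by
    rw [toL2_surf_eq m3, inner_toLp_right _ m3]
  rw [e1, e2]
  -- Both sides are continuous in the jet, so by density the identity need only be checked for inner
  -- test functions.
  have hs : closure (F.innerJets H : Set (F.Jet H)) ⊆ {x : F.Jet H |
      inner ℝ x.1 (F.toL2 H fun p => above p.2 * partialD 2 φ p) +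
        inner ℝ (x.2.1 2) (F.toL2 H fun p => above p.2 * φ p) =
      inner ℝ (F.column H (x.2.1 2)) (H.toL2 fun y => φ (y, 0))} := ?_
  · exact hs (jets_subset_closure hH hx)
  refine closure_minimal ?_ (isClosed_eq ?_ ?_)
  · rintro _ ⟨ψ, hψ, rfl⟩
    rw [mem_ofPred_eq, ← e1, ← e2, integral_column _ m3]
    have a1 := coeFn_toL2 (hψ.1.memLp F 2)
    have a2 := coeFn_toL2 ((hψ.1.partialD 2).memLp F 2)
    have key : ∀ {θ : Space → ℝ}, F.IsInner H θ → ∫ p, above p.2 * partialD 2 θ p ∂F.vol H =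
        -∫ y, θ (y, 0) ∂H.surf := fun {θ} hθ => by
      have i := integrable_above_mul (memLp_one_iff_integrable.1 ((hθ.1.partialD 2).memLp F 1))
      rw [vol_eq] at i ⊢
      rw [integral_prod _ i, ← integral_neg]
      refine integral_congr_ae (Eventually.of_forall fun y => ?_)
      have hc : Continuous fun t => partialD 2 θ (y, t) :=
        (contDiff_partialD hθ.1.1 2).continuous.comp (by fun_prop)
      have hI : Integrable (fun t => partialD 2 θ (y, t)) F.lin :=
        (hc.continuousOn.integrableOn_compact isCompact_Icc).mono_set Ioo_subset_Icc_self
      have h0 : ∀ t, above t * partialD 2 θ (y, t) = partialD 2 θ (y, t) -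
          partialD 2 θ (y, t) * (Iic 0).indicator 1 t := fun t => by
        by_cases h : 0 < t
        · simp [above, h]
        · simp [above, h, not_lt.1 h]
      have hI' : Integrable (fun t => partialD 2 θ (y, t) * (Iic 0).indicator 1 t) F.lin := by
        have : (fun t => partialD 2 θ (y, t) * (Iic 0).indicator 1 t) =
            (Iic 0).indicator fun t => partialD 2 θ (y, t) := by
          ext t; by_cases h : t ∈ Iic (0 : ℝ) <;> simp [h]
        rw [this]
        exact hI.indicator measurableSet_Iic
      simp only [h0]
      rw [integral_sub hI hI', integral_indicator_Iic F.zero_mem, ← integral_lin,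
        hθ.integral_vertical, hθ.integral_vertical, hθ.eq_zero_of_le y (z := F.ℓ) (by simp), zero_sub]
    obtain ⟨τ, t1, t2, t3, t4⟩ := F.exists_height_one
    -- The basic identity is applied to `ψφ` and to `ψ` times the interface values of `φ`. These two
    -- products agree at height `0`, so their integrals over the upper fluid agree as well.
    have k1 := key (hψ.mul hφ)
    have k2 := key (hψ.mul ((hφ.slice 0).prod t1 t2))
    simp only [t3 0 F.zero_mem, mul_one] at k2
    refine Eq.trans ?_ (k1.trans (k2.symm.trans ?_))
    · refine integral_congr_ae ?_
      filter_upwards [a1, a2] with p b1 b2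
      simp only [jet, b1, b2]
      rw [partialD_mul hψ.1.1 hφ.1]
      ring
    · refine integral_congr_ae ?_
      have hh : ∀ᵐ p ∂F.vol H, p.2 ∈ Ioo (-F.m) F.ℓ :=
        (ae_restrict_iff' (H.measurableSet_cell.prod F.isOpen_heights.measurableSet)).2
          (Eventually.of_forall fun _ hx => F.heights_subset hx.2)
      filter_upwards [a2, hh] with p b2 b3
      simp only [jet, b2]
      rw [partialD_mul hψ.1.1 (hφ.slice 0 |>.prod t1 t2).1, partialD_two_prod (hφ.slice 0).1 t1,
        t4 _ b3, t3 _ (Ioo_subset_Icc_self b3)]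
      ring
  · fun_prop
  · fun_prop

variable (F H) in
/-- The jet of a function in `H²`. -/
def jetOf (f : Space → ℝ) : F.Jet H :=
  (F.toL2 H f, fun j => F.toL2 H (F.weakDeriv H j f),
    fun j => -F.column H (F.toL2 H (F.weakDeriv H (horiz j) (F.weakDeriv H 2 f))))

/-- Zero outer traces and equal traces at the interface make all boundary terms in Green's formula
cancel. The gradient of the trace is minus the column integral of the mixed derivatives `∂ⱼ∂₃f`, the
place where `H²` regularity enters. -/
lemma jetOf_mem (hf : F.MemH2 H f) {h : Plane → ℝ}
    (h₁ : F.HasTraces H 0 F.ℓ f h 0) (h₂ : F.HasTraces H (-F.m) 0 f 0 h) : F.jetOf H f ∈ F.jets H := by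
  have a0 := coeFn_toL2 hf.1.1
  have a1 := fun j => coeFn_toL2 (hf.1.hasWeakDeriv j).1
  have m1 : MemLp (fun _ : ℝ => (1 : ℝ)) ⊤ F.lin := memLp_top_of_continuous continuous_const
  rw [mem_jets]
  refine ⟨fun φ hφ j => ?_, fun χ hχ j => ?_⟩
  · have e1 : ∫ p, (F.jetOf H f).1 p * partialD j φ p ∂F.vol H = ∫ p, f p * partialD j φ p ∂F.vol H :=
      integral_congr_ae (a0.mono fun p hp => congrArg (· * _) hp)
    have e2 : ∫ p, (F.jetOf H f).2.1 j p * φ p ∂F.vol H = ∫ p, F.weakDeriv H j f p * φ p ∂F.vol H :=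
      integral_congr_ae ((a1 j).mono fun p hp => congrArg (· * _) hp)
    rw [e1, e2]
    have hor := fun k : Fin 2 => (hf.1.hasWeakDeriv (horiz k)).integral_horiz hf.1.1 hφ m1
    simp only [one_mul] at hor
    fin_cases j
    · exact hor 0
    · exact hor 1
    · have := h₁.integral_inner hf.1 h₂ hφ (fun y => by simp) (fun y => by simp)
      simp only [sub_self, zero_mul, integral_zero, neg_zero] at this
      exact eq_neg_of_add_eq_zero_left this
  · obtain ⟨τ, t1, t2, t3, -⟩ := F.exists_height_one
    have hw := (hf.2 2).hasWeakDeriv (horiz j)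
    have key := hw.integral_horiz (hf.2 2).1 (hχ.prod t1 t2) memLp_above
    have c : ∫ y, (F.jetOf H f).2.2 j y * χ y ∂H.surf =
        -∫ y, F.column H (F.toL2 H (F.weakDeriv H (horiz j) (F.weakDeriv H 2 f))) y * χ y ∂H.surf := by
      rw [← integral_neg]
      refine integral_congr_ae ?_
      filter_upwards [Lp.coeFn_neg (F.column H (F.toL2 H (F.weakDeriv H (horiz j)
        (F.weakDeriv H 2 f))))] with y hy
      simp only [jetOf, hy, Pi.neg_apply, neg_mul]
    rw [c, integral_column _ (hχ.memLp 2)]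
    refine Eq.trans ?_ (key.symm.trans ?_)
    · congr 1
      refine integral_congr_ae ?_
      filter_upwards [coeFn_toL2 hw.1, ae_mem_Icc] with p h1 h2
      simp only [h1, t3 _ h2]
      ring
    · refine integral_congr_ae ?_
      filter_upwards [a1 2, ae_mem_Icc] with p h1 h2
      rw [partialD_horiz_prod hχ.1 t1, t3 _ h2]
      simp only [jetOf, h1]
      ring

end Setup
end RayleighTaylor
end

/-! ### Strong solutions as curves of flows; the displacement `∫v` -/

noncomputable section
namespace RayleighTaylor
open Filter Topology

lemma integral_eq_sub_of_hasDerivWithinAt_Ici {E : Type*} [NormedAddCommGroup E] [NormedSpace ℝ E]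
    [CompleteSpace E] {f f' : ℝ → E} (h : ∀ t, 0 ≤ t → HasDerivWithinAt f (f' t) (Ici 0) t)
    (hc : ContinuousOn f' (Ici 0)) {t : ℝ} (ht : 0 ≤ t) : ∫ s in (0)..t, f' s = f t - f 0 := by
  have hsub : Icc 0 t ⊆ Ici 0 := Icc_subset_Ici_self
  refine intervalIntegral.integral_eq_sub_of_hasDeriv_right_of_le ht
    (fun s hs => (h s hs.1).continuousWithinAt.mono hsub)
    (fun s hs => (h s hs.1.le).mono fun r hr => hs.1.le.trans (le_of_lt hr)) ?_
  refine (hc.mono ?_).intervalIntegrable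
  rw [uIcc_of_le ht]
  exact hsub

namespace Setup

variable {F : Setup} {H : Horizontal} {f g : Space → ℝ}

lemma MemH1.add (hf : F.MemH1 H f) (hg : F.MemH1 H g) : F.MemH1 H fun x => f x + g x :=
  ⟨hf.1.add hg.1, fun j => ⟨_, (hf.hasWeakDeriv j).add hf.1 hg.1 (hg.hasWeakDeriv j)⟩⟩

lemma MemH1.const_mul (hf : F.MemH1 H f) (c : ℝ) : F.MemH1 H fun x => c * f x :=
  ⟨hf.1.const_mul c, fun j => ⟨_, (hf.hasWeakDeriv j).const_mul c⟩⟩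

lemma MemH1.coef_mul (hf : F.MemH1 H f) {c : ℝ → ℝ} (hc : F.Coef c) :
    F.MemH1 H fun x => c x.2 * f x := by
  obtain ⟨c', hc', hd⟩ := hc.exists_deriv
  exact ⟨memL2_mul hc.memLp_top hf.1, fun j => ⟨_, (hf.hasWeakDeriv j).coef_mul hf.1 hc hc' hd⟩⟩

lemma MemH1.congr (hf : F.MemH1 H f) (h : ∀ x, g x = f x) : F.MemH1 H g := by
  rwa [show g = f from funext h]

variable {w : Fin 3 → Space → ℝ}

lemma memH1_dvg (hw : ∀ i, F.MemH2 H (w i)) : F.MemH1 H (F.dvg H w) := by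
  refine ((((hw 0).2 0).add ((hw 1).2 1)).add ((hw 2).2 2)).congr fun x => ?_
  rw [dvg, Fin.sum_univ_three]

lemma memH1_dev (hw : ∀ i, F.MemH2 H (w i)) (i j : Fin 3) : F.MemH1 H (F.dev H w i j) := by
  refine ((((hw i).2 j).add ((hw j).2 i)).add
    ((memH1_dvg hw).const_mul (-(2 / 3 * kron i j)))).congr fun x => ?_
  rw [dev]; ring

lemma memH1_viscous (hw : ∀ i, F.MemH2 H (w i)) (i j : Fin 3) : F.MemH1 H (F.viscous H w i j) := by
  refine (((memH1_dev hw i j).coef_mul F.coef_ε₀).add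
    (((memH1_dvg hw).coef_mul F.coef_δ₀).const_mul (kron i j))).congr fun x => ?_
  rw [viscous]; ring

variable {q : Space → ℝ}

lemma memH1_stress (hq : F.MemH1 H q) (hw : ∀ i, F.MemH2 H (w i)) (i j : Fin 3) :
    F.MemH1 H (F.stress H q w i j) := by
  refine (((hq.coef_mul F.coef_dP).const_mul (kron i j)).add
    ((memH1_viscous hw i j).const_mul (-1))).congr fun x => ?_
  rw [stress]; ring

lemma weakDeriv_stress (hH : H.Proper) (hq : F.MemH1 H q) (hw : ∀ i, F.MemH2 H (w i)) (i j : Fin 3) :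
    F.weakDeriv H j (F.stress H q w i j) =ᵐ[F.vol H] fun x =>
      kron i j * F.weakDeriv H j (fun y => F.dP y.2 * q y) x - F.weakDeriv H j (F.viscous H w i j) x := by
  have h1 := hq.coef_mul F.coef_dP
  have h2 := memH1_viscous hw i j
  have h := ((h1.hasWeakDeriv j).const_mul (kron i j)).add (h1.const_mul (kron i j)).1 (h2.const_mul (-1)).1
    ((h2.hasWeakDeriv j).const_mul (-1))
  have e : (fun x => kron i j * (F.dP x.2 * q x) + -1 * F.viscous H w i j x) = F.stress H q w i j := by
    ext x; rw [stress]; ring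
  rw [e] at h
  refine (h.weakDeriv_ae hH).trans (Eventually.of_forall fun x => ?_)
  simp only
  ring

variable (F H) in
/-- The jets of the components of a velocity field in `H²`. -/
def flowOf (w : Fin 3 → Space → ℝ) : F.Flow H := fun i => F.jetOf H (w i)

lemma coeFn_flowOf (hw : ∀ i, F.MemH2 H (w i)) : ∀ᵐ p ∂F.vol H,
    Flow.val (F.flowOf H w) p = (fun i => w i p) ∧
      Flow.grad (F.flowOf H w) p = fun i j => F.weakDeriv H j (w i) p := by
  filter_upwards [ae_all_iff.2 fun i => coeFn_toL2 (hw i).1.1,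
    ae_all_iff.2 fun i => ae_all_iff.2 fun j => coeFn_toL2 ((hw i).1.hasWeakDeriv j).1] with p a b
  exact ⟨funext a, funext fun i => funext (b i)⟩

namespace IsSolution

variable {η v vt : ℝ → Fin 3 → Space → ℝ} {q : ℝ → Space → ℝ}

lemma v_memH2 (hs : F.IsSolution H η v vt q) {t : ℝ} (ht : 0 ≤ t) (i : Fin 3) : F.MemH2 H (v t i) :=
  (hs.v_mem i).1 t ht

lemma flow_mem (hs : F.IsSolution H η v vt q) {t : ℝ} (ht : 0 ≤ t) : F.flowOf H (v t) ∈ F.flows H := by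
  refine Submodule.mem_pi.2 fun i _ => ?_
  obtain ⟨h, h1, h2⟩ := hs.v_jump t ht i
  exact jetOf_mem (hs.v_memH2 ht i) h1 h2

/-- Continuity with values in `H²` is required, not merely `H¹`: the surface gradient slot of the
jet is read off from second derivatives. -/
lemma continuousOn_flow (hs : F.IsSolution H η v vt q) :
    ContinuousOn (fun t => F.flowOf H (v t)) (Ici 0) := by
  refine continuousOn_pi.2 fun i => ?_
  refine (hs.v_mem i).2.1.prodMk (ContinuousOn.prodMk (continuousOn_pi.2 fun j => (hs.v_mem i).2.2.1 j)
    (continuousOn_pi.2 fun j => ?_))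
  exact ((F.column H).continuous.comp_continuousOn ((hs.v_mem i).2.2.2 2 (horiz j))).neg

variable (F H) in
/-- The classes of the components of a vector field. -/
def _root_.RayleighTaylor.Setup.classes (w : Fin 3 → Space → ℝ) : Fin 3 → Lp ℝ 2 (F.vol H) :=
  fun i => F.toL2 H (w i)

lemma hasDeriv_velocity (hs : F.IsSolution H η v vt q) {t : ℝ} (ht : 0 ≤ t) :
    HasDerivWithinAt (fun s => F.velocity H (F.flowOf H (v s))) (F.classes H (vt t)) (Ici 0) t :=
  hasDerivWithinAt_pi.2 fun i => (hs.v_deriv i t ht).2.2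

variable (F H) in
/-- The time integral of the velocity. -/
def _root_.RayleighTaylor.Setup.displacement (v : ℝ → Fin 3 → Space → ℝ) (t : ℝ) : F.Flow H :=
  ∫ s in (0)..t, F.flowOf H (v s)

lemma intervalIntegrable_flow (hs : F.IsSolution H η v vt q) {t : ℝ} (ht : 0 ≤ t) :
    IntervalIntegrable (fun s => F.flowOf H (v s)) volume 0 t := by
  refine (hs.continuousOn_flow.mono ?_).intervalIntegrable
  rw [uIcc_of_le ht]
  exact Icc_subset_Ici_self

lemma displacement_mem (hs : F.IsSolution H η v vt q) {t : ℝ} (ht : 0 ≤ t) :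
    F.displacement H v t ∈ F.flows H :=
  intervalIntegral_mem isClosed_flows ht (fun _ h => hs.flow_mem h.1.le) (hs.intervalIntegrable_flow ht).1

lemma clm_displacement (hs : F.IsSolution H η v vt q) {t : ℝ} (ht : 0 ≤ t) {E : Type*}
    [NormedAddCommGroup E] [NormedSpace ℝ E] [CompleteSpace E] (l : F.Flow H →L[ℝ] E) :
    l (F.displacement H v t) = ∫ s in (0)..t, l (F.flowOf H (v s)) :=
  (l.intervalIntegral_comp_comm (hs.intervalIntegrable_flow ht)).symm

/-- Integrating `∂ₜη = v` in time; only the initial flow map and the displacement remain. -/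
lemma η_displacement (hs : F.IsSolution H η v vt q) {t : ℝ} (ht : 0 ≤ t) (i : Fin 3) :
    F.toL2 H (η t i) = F.toL2 H (η 0 i) + (F.displacement H v t i).1 := by
  have h1 := integral_eq_sub_of_hasDerivWithinAt_Ici (fun s hs' => (hs.η_eq i s hs').2.2)
    (hs.v_mem i).2.1 ht
  have h2 := hs.clm_displacement ht (ContinuousLinearMap.proj i ∘L F.velocity H)
  have h3 : (F.displacement H v t i).1 = _ := h2.trans h1
  rw [h3]
  abel

/-- The continuity equation integrated in time, `q(t) = q(0) - ρ₀ div ∫v`, stated after pairing with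
a fixed function so that the time integral passes through a bounded linear functional of the flow.
-/
lemma q_displacement (hs : F.IsSolution H η v vt q) {t : ℝ} (ht : 0 ≤ t) (g : Lp ℝ 2 (F.vol H)) :
    inner ℝ (F.toL2 H (q t)) g = inner ℝ (F.toL2 H (q 0)) g -
      F.mulForm H F.ρ₀ (F.divL H (F.displacement H v t)) g := by
  let l : F.Flow H →L[ℝ] ℝ := -((F.mulForm H F.ρ₀).flip g ∘L F.divL H)
  have hl : ∀ s, 0 ≤ s → inner ℝ (F.toL2 H fun x => -(F.ρ₀ x.2 * F.dvg H (v s) x)) g =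
      l (F.flowOf H (v s)) := fun s h => by
    have m := (memL2_mul F.coef_ρ₀.memLp_top (memH1_dvg fun i => hs.v_memH2 h i).1).neg
    change _ = -F.mulForm H F.ρ₀ (F.divL H (F.flowOf H (v s))) g
    rw [mulForm_apply F.coef_ρ₀.memLp_top, inner_eq_integral, ← integral_neg]
    refine integral_congr_ae ?_
    filter_upwards [coeFn_toL2 (f := fun x => -(F.ρ₀ x.2 * F.dvg H (v s) x)) m,
      coeFn_divL (F.flowOf H (v s)), coeFn_flowOf fun i => hs.v_memH2 h i] with p a b c
    rw [a, b, c.2, mdiv, dvg]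
    ring
  have hd : ∀ s, 0 ≤ s → HasDerivWithinAt (fun s => inner ℝ (F.toL2 H (q s)) g)
      (l (F.flowOf H (v s))) (Ici 0) s := fun s h => by
    rw [← hl s h]
    simpa using (hs.q_eq s h).2.2.inner ℝ (hasDerivWithinAt_const s (Ici 0) g)
  have h1 := integral_eq_sub_of_hasDerivWithinAt_Ici hd
    (l.continuous.comp_continuousOn hs.continuousOn_flow) ht
  rw [← hs.clm_displacement ht l] at h1
  change -F.mulForm H F.ρ₀ (F.divL H (F.displacement H v t)) g = _ at h1
  linarith

lemma coeFn_η (hs : F.IsSolution H η v vt q) {t : ℝ} (ht : 0 ≤ t) (i : Fin 3) :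
    η t i =ᵐ[F.vol H] fun x => η 0 i x + (F.displacement H v t i).1 x := by
  filter_upwards [coeFn_toL2 (hs.η_mem t ht i).1.1, coeFn_toL2 (hs.η_mem 0 le_rfl i).1.1,
    Lp.coeFn_add (F.toL2 H (η 0 i)) (F.displacement H v t i).1] with x h1 h2 h3
  rw [← h1, hs.η_displacement ht, h3, Pi.add_apply, h2]

lemma coeFn_grad_η (hH : H.Proper) (hs : F.IsSolution H η v vt q) {t : ℝ} (ht : 0 ≤ t) (i j : Fin 3) :
    F.weakDeriv H j (η t i) =ᵐ[F.vol H] fun x =>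
      F.weakDeriv H j (η 0 i) x + (F.displacement H v t i).2.1 j x := by
  have hI := hasWeakDeriv_of_mem_jets (Submodule.mem_pi.1 (hs.displacement_mem ht) i (mem_univ i)) j
  have h := ((hs.η_mem 0 le_rfl i).1.hasWeakDeriv j).add (hs.η_mem 0 le_rfl i).1.1 (Lp.memLp _) hI
  exact ((hs.η_mem t ht i).1.hasWeakDeriv j).ae_eq hH h (hs.coeFn_η ht i)

/-- Linearity of Green's formula: the displacement is a jet, whose trace is minus its column
integral, and adding it to the initial trace gives a trace at time `t`. Uniqueness identifies it
with the chosen one. -/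
lemma interfaceTrace_η (hH : H.Proper) (hs : F.IsSolution H η v vt q) {t : ℝ} (ht : 0 ≤ t)
    (i : Fin 3) :
    MemLp (F.interfaceTrace H (η 0 i)) 2 H.surf ∧ F.interfaceTrace H (η t i) =ᵐ[H.surf] fun y =>
      F.interfaceTrace H (η 0 i) y - F.column H ((F.displacement H v t i).2.1 2) y := by
  obtain ⟨bot, -, top, h, -⟩ := hs.η_jump i
  have h0 := h.interfaceTrace_ae hH
  refine ⟨h.1.ae_eq h0.symm, ?_⟩
  set X := F.displacement H v t i
  have hX : X ∈ F.jets H := Submodule.mem_pi.1 (hs.displacement_mem ht) i (mem_univ i)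
  have ht' : F.HasTraces H 0 F.ℓ (η t i) (fun y => bot y - F.column H (X.2.1 2) y) top := by
    refine ⟨h.1.sub (Lp.memLp _), h.2.1, fun φ hφ => ?_⟩
    have k1 := h.2.2 φ hφ
    have k2 := integral_above_of_mem_jets hH hX hφ
    rw [integral_upper] at k1 ⊢
    have m1 := (hφ.partialD 2).memLp F 2
    have m2 := hφ.memLp F 2
    have i1 : Integrable (fun x => η 0 i x * partialD 2 φ x + F.weakDeriv H 2 (η 0 i) x * φ x) (F.vol H) :=
      ((hs.η_mem 0 le_rfl i).1.1.integrable_mul m1).add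
        (((hs.η_mem 0 le_rfl i).1.hasWeakDeriv 2).1.integrable_mul m2)
    have i2 : Integrable (fun x => X.1 x * partialD 2 φ x + X.2.1 2 x * φ x) (F.vol H) :=
      ((Lp.memLp X.1).integrable_mul m1).add ((Lp.memLp (X.2.1 2)).integrable_mul m2)
    have e : ∫ x, above x.2 * (η t i x * partialD 2 φ x + F.weakDeriv H 2 (η t i) x * φ x) ∂F.vol H =
        ∫ x, (above x.2 * (η 0 i x * partialD 2 φ x + F.weakDeriv H 2 (η 0 i) x * φ x) +
          above x.2 * (X.1 x * partialD 2 φ x + X.2.1 2 x * φ x)) ∂F.vol H := by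
      refine integral_congr_ae ?_
      filter_upwards [hs.coeFn_η ht i, hs.coeFn_grad_η hH ht i 2] with x a b
      rw [a, b]
      ring
    have m3 := (hφ.slice 0).memLp 2
    have j1 : Integrable (fun y => top y * φ (y, F.ℓ) - bot y * φ (y, 0)) H.surf :=
      (h.2.1.integrable_mul ((hφ.slice F.ℓ).memLp 2)).sub (h.1.integrable_mul m3)
    have j2 : Integrable (fun y => F.column H (X.2.1 2) y * φ (y, 0)) H.surf :=
      (Lp.memLp (F.column H (X.2.1 2))).integrable_mul m3
    rw [e, integral_add (integrable_above_mul i1) (integrable_above_mul i2), k1, k2, ← integral_add j1 j2]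
    exact integral_congr_ae (Eventually.of_forall fun y => by simp only; ring)
  filter_upwards [h0, ht'.interfaceTrace_ae hH] with y a b
  rw [a, b]

end IsSolution

end Setup
end RayleighTaylor
end

/-! ### Weak form of the momentum equation -/

noncomputable section
namespace RayleighTaylor
open Filter Topology

namespace Setup

variable {F : Setup} {H : Horizontal} {φ : Space → ℝ}

/-- The horizontal Laplacian of the values of a function on the interface. -/
def surfLap (φ : Space → ℝ) (y : Plane) : ℝ := ∑ j, planeD j (planeD j fun y => φ (y, 0)) y

namespace IsSolution

variable {η v vt : ℝ → Fin 3 → Space → ℝ} {q : ℝ → Space → ℝ} {t : ℝ}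

/-- Green's formula for the stress. -/
lemma integral_stress (hs : F.IsSolution H η v vt q) (ht : 0 ≤ t) (hφ : F.IsInner H φ) (i j : Fin 3) :
    ∫ x, F.stress H (q t) (v t) i j x * partialD j φ x ∂F.vol H +
      ∫ x, F.weakDeriv H j (F.stress H (q t) (v t) i j) x * φ x ∂F.vol H =
    -(kron j 2 * (F.σ * kron i 2 * ∫ y, F.interfaceTrace H (η t 2) y * surfLap φ y ∂H.surf)) := by
  have hS := memH1_stress (hs.q_mem t ht) (fun k => hs.v_memH2 ht k) i j
  have m1 : MemLp (fun _ : ℝ => (1 : ℝ)) ⊤ F.lin := memLp_top_of_continuous continuous_const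
  -- Horizontal derivatives produce no interface term; only the vertical direction sees the jump of
  -- the stress.
  have hor : ∀ k : Fin 2, j = horiz k → ∫ x, F.stress H (q t) (v t) i j x * partialD j φ x ∂F.vol H +
      ∫ x, F.weakDeriv H j (F.stress H (q t) (v t) i j) x * φ x ∂F.vol H = 0 := by
    rintro k rfl
    have := (hS.hasWeakDeriv (horiz k)).integral_horiz hS.1 hφ.1 m1
    simp only [one_mul] at this
    exact add_eq_zero_iff_eq_neg.2 this
  fin_cases j
  · exact (hor 0 rfl).trans (by simp [kron])
  · exact (hor 1 rfl).trans (by simp [kron])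
  · obtain ⟨b₁, t₁, b₂, t₂, h1, h2, h3⟩ := hs.stress_jump t ht i
    have h4 := h1.integral_inner hS h2 hφ.1 (fun y => by rw [hφ.eq_zero_of_le y (by simp), mul_zero])
      (fun y => by rw [hφ.eq_zero_of_le y (by simp), mul_zero])
    have h5 := h3 _ (hφ.1.slice 0)
    refine h4.trans ?_
    rw [h5]
    simp [kron, surfLap]

/-- The weak form of the momentum equation. -/
theorem momentum (hH : H.Proper) (hs : F.IsSolution H η v vt q) (ht : 0 ≤ t) (hφ : F.IsInner H φ)
    (i : Fin 3) :
    ∫ x, F.ρ₀ x.2 * (vt t i x * φ x) ∂F.vol H +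
      ∑ j, ∫ x, F.viscous H (v t) i j x * partialD j φ x ∂F.vol H =
    ∫ x, F.dP x.2 * (q t x * partialD i φ x) ∂F.vol H - F.g * kron i 2 * ∫ x, q t x * φ x ∂F.vol H -
      F.g * ∫ x, F.ρ₀ x.2 * (F.weakDeriv H i (η t 2) x * φ x) ∂F.vol H +
      F.σ * kron i 2 * ∫ y, F.interfaceTrace H (η t 2) y * surfLap φ y ∂H.surf := by
  have hv := fun k => hs.v_memH2 ht k
  have hq := hs.q_mem t ht
  have mφ := hφ.1.memLp F 2
  have mD := fun j => (hφ.1.partialD j).memLp F 2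
  have hV := fun j => memH1_viscous hv i j
  have hη := ((hs.η_mem t ht 2).1.hasWeakDeriv i).1
  have i1 := integrable_weight F.coef_ρ₀.memLp_top (hs.v_deriv i t ht).2.1 mφ
  have i2 : ∀ j, Integrable (fun x => F.weakDeriv H j (F.stress H (q t) (v t) i j) x * φ x) (F.vol H) :=
    fun j => ((memH1_stress hq hv i j).hasWeakDeriv j).1.integrable_mul mφ
  have i3 : Integrable (fun x => q t x * φ x) (F.vol H) := hq.1.integrable_mul mφ
  have i4 := integrable_weight F.coef_ρ₀.memLp_top hη mφ
  have i5 : ∀ j, Integrable (fun x => F.viscous H (v t) i j x * partialD j φ x) (F.vol H) :=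
    fun j => (hV j).1.integrable_mul (mD j)
  have i6 := fun j => integrable_weight F.coef_dP.memLp_top hq.1 (mD j)
  -- The pointwise equation times the test function, with the pressure gradient and the viscous term
  -- gathered into the divergence of the stress, so that Green's formula can be used with the stress
  -- jump.
  have key : ∫ x, F.ρ₀ x.2 * (vt t i x * φ x) ∂F.vol H +
      (∑ j, ∫ x, F.weakDeriv H j (F.stress H (q t) (v t) i j) x * φ x ∂F.vol H +
      (F.g * kron i 2 * ∫ x, q t x * φ x ∂F.vol H +
      F.g * ∫ x, F.ρ₀ x.2 * (F.weakDeriv H i (η t 2) x * φ x) ∂F.vol H)) = 0 := by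
    have i34 : Integrable (fun x => F.g * kron i 2 * (q t x * φ x) +
        F.g * (F.ρ₀ x.2 * (F.weakDeriv H i (η t 2) x * φ x))) (F.vol H) :=
      (i3.const_mul _).add (i4.const_mul _)
    have i234 : Integrable (fun x => ∑ j, F.weakDeriv H j (F.stress H (q t) (v t) i j) x * φ x +
        (F.g * kron i 2 * (q t x * φ x) +
        F.g * (F.ρ₀ x.2 * (F.weakDeriv H i (η t 2) x * φ x)))) (F.vol H) :=
      (integrable_finsetSum _ fun j _ => i2 j).add i34
    rw [← integral_finsetSum _ fun j _ => i2 j, ← integral_const_mul, ← integral_const_mul,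
      ← integral_add (i3.const_mul _) (i4.const_mul _),
      ← integral_add (integrable_finsetSum _ fun j _ => i2 j) i34, ← integral_add i1 i234]
    refine integral_eq_zero_of_ae ?_
    filter_upwards [hs.v_eq t ht i, ae_all_iff.2 fun j => weakDeriv_stress hH hq hv i j] with x a b
    simp only [b, Pi.zero_apply, ← Finset.sum_mul, Finset.sum_sub_distrib, ← a]
    have : ∑ j, kron i j * F.weakDeriv H j (fun y => F.dP y.2 * q t y) x =
        F.weakDeriv H i (fun y => F.dP y.2 * q t y) x := by
      simp [kron]
    rw [this]
    ring
  have green := fun j => hs.integral_stress ht hφ i j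
  have split : ∀ j, ∫ x, F.stress H (q t) (v t) i j x * partialD j φ x ∂F.vol H =
      kron i j * ∫ x, F.dP x.2 * (q t x * partialD j φ x) ∂F.vol H -
        ∫ x, F.viscous H (v t) i j x * partialD j φ x ∂F.vol H := fun j => by
    rw [← integral_const_mul, ← integral_sub ((i6 j).const_mul _) (i5 j)]
    exact integral_congr_ae (Eventually.of_forall fun x => by simp only [stress]; ring)
  simp only [split] at green
  have e : ∑ j, kron i j * ∫ x, F.dP x.2 * (q t x * partialD j φ x) ∂F.vol H =
      ∫ x, F.dP x.2 * (q t x * partialD i φ x) ∂F.vol H := by simp [kron]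
  have sumgreen := Finset.sum_congr (s₁ := Finset.univ) rfl fun j _ => green j
  simp only [Finset.sum_add_distrib, Finset.sum_sub_distrib, Finset.sum_neg_distrib, e,
    ← Finset.sum_mul] at sumgreen
  have k : ∑ j, kron j 2 = 1 := by simp [kron]
  rw [k] at sumgreen
  linarith

end IsSolution

/-- The viscous form against a test flow. -/
lemma viscForm_flowOf {w : Fin 3 → Space → ℝ} (hw : ∀ i, F.MemH2 H (w i)) {φ : Fin 3 → Space → ℝ}
    (hφ : ∀ i, F.IsInner H (φ i)) :
    F.viscForm H (F.flowOf H w) (F.testFlow H φ) =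
      ∑ i, ∑ j, ∫ x, F.viscous H w i j x * partialD j (φ i) x ∂F.vol H := by
  have i5 : ∀ i j, Integrable (fun x => F.viscous H w i j x * partialD j (φ i) x) (F.vol H) :=
    fun i j => (memH1_viscous hw i j).1.integrable_mul (((hφ i).1.partialD j).memLp F 2)
  have e : ∑ i, ∑ j, ∫ x, F.viscous H w i j x * partialD j (φ i) x ∂F.vol H =
      ∫ x, ∑ i, ∑ j, F.viscous H w i j x * partialD j (φ i) x ∂F.vol H := by
    rw [integral_finsetSum _ fun i _ => integrable_finsetSum _ fun j _ => i5 i j]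
    simp only [integral_finsetSum _ fun j _ => i5 _ j]
  rw [viscForm_apply, e]
  -- Pointwise algebra: the viscous tensor is symmetric, so contracting it with the test gradient
  -- gives half the contraction with the symmetric trace-free part, plus the bulk term.
  refine integral_congr_ae ?_
  filter_upwards [coeFn_flowOf hw, (coeFn_testFlow hφ).1] with x a b
  rw [a.2, b.2]
  simp only [viscous, dev, dvg, mdev, mdiv, Fin.sum_univ_three, kron]
  simp
  ring

end Setup
end RayleighTaylor
end

/-! ### The evolution equation for the velocity, integrated in time -/

noncomputable section
namespace RayleighTaylor
open Filter Topology

namespace Setup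

variable {F : Setup} {H : Horizontal} {φ : Space → ℝ}

lemma mulForm_toL2 {a : ℝ → ℝ} (ha : MemLp a ⊤ F.lin) {f g : Space → ℝ} (hf : MemLp f 2 (F.vol H))
    (hg : MemLp g 2 (F.vol H)) :
    F.mulForm H a (F.toL2 H f) (F.toL2 H g) = ∫ x, a x.2 * (f x * g x) ∂F.vol H :=
  mulForm_congr ha (coeFn_toL2 hf) (coeFn_toL2 hg)

lemma mulForm_symm {a : ℝ → ℝ} (ha : MemLp a ⊤ F.lin) (f g : Lp ℝ 2 (F.vol H)) :
    F.mulForm H a f g = F.mulForm H a g f := by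
  rw [mulForm_apply ha, mulForm_apply ha]
  exact integral_congr_ae (Eventually.of_forall fun x => by simp only; ring)

lemma mulForm_gρ (f g : Lp ℝ 2 (F.vol H)) :
    F.mulForm H (fun z => F.g * F.ρ₀ z) f g = F.g * F.mulForm H F.ρ₀ f g := by
  rw [mulForm_apply memLp_gρ, mulForm_apply F.coef_ρ₀.memLp_top, ← integral_const_mul]
  exact integral_congr_ae (Eventually.of_forall fun x => by simp only; ring)

/-- Horizontal integration by parts against a test function. -/
lemma mulForm_horiz {x : F.Flow H} (hx : x ∈ F.flows H) (hφ : H.IsTest φ) (i : Fin 3) (j : Fin 2) :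
    F.mulForm H F.ρ₀ (x i).1 (F.toL2 H (partialD (horiz j) φ)) =
      -F.mulForm H F.ρ₀ (F.gradL H i (horiz j) x) (F.toL2 H φ) := by
  have h := (hasWeakDeriv_of_mem_jets (Submodule.mem_pi.1 hx i (mem_univ i)) (horiz j)).integral_horiz
    (Lp.memLp _) hφ F.coef_ρ₀.memLp_top
  rw [mulForm_congr F.coef_ρ₀.memLp_top (ae_eq_refl _) (coeFn_toL2 ((hφ.partialD _).memLp F 2)),
    mulForm_congr F.coef_ρ₀.memLp_top (ae_eq_refl _) (coeFn_toL2 (hφ.memLp F 2))]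
  simp only [mul_assoc] at h
  exact h

/-- The column integral is minus the trace, so one integration by parts on the interface turns the
pairing with the Laplacian into the product of surface gradients, the surface tension part of the
potential form. -/
lemma integral_column_surfLap {x : F.Flow H} (hx : x ∈ F.flows H) {φ : Fin 3 → Space → ℝ}
    (hφ : ∀ i, F.IsInner H (φ i)) :
    ∫ y, F.column H ((x 2).2.1 2) y * surfLap (φ 2) y ∂H.surf =
      ∑ j, surfForm H (F.surfL H j x) (F.surfL H j (F.testFlow H φ)) := by
  have ht := fun j => ((hφ 2).1.slice 0).planeD j
  have i1 : ∀ j, Integrable (fun y => F.column H ((x 2).2.1 2) y *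
      planeD j (planeD j fun y => φ 2 (y, 0)) y) H.surf := fun j =>
    (Lp.memLp (F.column H ((x 2).2.1 2))).integrable_mul (((ht j).planeD j).memLp 2)
  simp only [surfLap, Finset.mul_sum]
  rw [integral_finsetSum _ fun j _ => i1 j]
  refine Finset.sum_congr rfl fun j _ => ?_
  rw [integral_column _ (((ht j).planeD j).memLp 2),
    ← (mem_jets.1 (Submodule.mem_pi.1 hx 2 (mem_univ 2))).2 _ (ht j) j, surfForm_apply]
  refine integral_congr_ae ?_
  filter_upwards [(coeFn_testFlow hφ).2 j] with y hy
  rw [planeD_slice (hφ 2).1.1]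
  exact congrArg (_ * ·) hy.symm

namespace IsSolution

variable {η v vt : ℝ → Fin 3 → Space → ℝ} {q : ℝ → Space → ℝ} {t : ℝ}

/-- The increment of the momentum equation between the times `0` and `t`. -/
lemma momentum_increment (hH : H.Proper) (hs : F.IsSolution H η v vt q) (ht : 0 ≤ t)
    (hφ : F.IsInner H φ) (i : Fin 3) :
    F.mulForm H F.ρ₀ (F.classes H (vt t) i - F.classes H (vt 0) i) (F.toL2 H φ) +
      (∑ j, ∫ x, F.viscous H (v t) i j x * partialD j φ x ∂F.vol H -
        ∑ j, ∫ x, F.viscous H (v 0) i j x * partialD j φ x ∂F.vol H) =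
    -F.mulForm H (fun z => F.dP z * F.ρ₀ z) (F.divL H (F.displacement H v t))
        (F.toL2 H (partialD i φ)) +
      F.g * kron i 2 * F.mulForm H F.ρ₀ (F.divL H (F.displacement H v t)) (F.toL2 H φ) -
      F.g * F.mulForm H F.ρ₀ (F.gradL H 2 i (F.displacement H v t)) (F.toL2 H φ) -
      F.σ * kron i 2 * ∫ y, F.column H ((F.displacement H v t 2).2.1 2) y * surfLap φ y ∂H.surf := by
  have mφ := hφ.1.memLp F 2
  have mD := (hφ.1.partialD i).memLp F 2
  have cρ := F.coef_ρ₀.memLp_top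
  have m1 := hs.momentum hH ht hφ i
  have m0 := hs.momentum hH le_rfl hφ i
  have mη := fun {s} (h : 0 ≤ s) => ((hs.η_mem s h 2).1.hasWeakDeriv i).1
  -- In each of the following four identities the value at time `0` separates off, and the remainder
  -- depends linearly on the displacement. Subtracting the momentum equation at time `0` therefore
  -- removes the initial pressure and flow map.
  have d1 : ∫ x, F.dP x.2 * (q t x * partialD i φ x) ∂F.vol H =
      ∫ x, F.dP x.2 * (q 0 x * partialD i φ x) ∂F.vol H -
        F.mulForm H (fun z => F.dP z * F.ρ₀ z) (F.divL H (F.displacement H v t))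
        (F.toL2 H (partialD i φ)) := by
    have m := memL2_mul F.coef_dP.memLp_top mD
    have e : ∀ s, 0 ≤ s → ∫ x, F.dP x.2 * (q s x * partialD i φ x) ∂F.vol H =
        inner ℝ (F.toL2 H (q s)) (F.toL2 H fun x => F.dP x.2 * partialD i φ x) := fun s h => by
      rw [inner_eq_integral]
      refine integral_congr_ae ?_
      filter_upwards [coeFn_toL2 (hs.q_mem s h).1, coeFn_toL2 m] with x a b
      rw [a, b]; ring
    rw [e t ht, e 0 le_rfl, hs.q_displacement ht, mulForm_congr cρ (ae_eq_refl _) (coeFn_toL2 m),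
      mulForm_congr memLp_dPρ (ae_eq_refl _) (coeFn_toL2 mD)]
    congr 1
    exact integral_congr_ae (Eventually.of_forall fun x => by simp only; ring)
  have d2 : ∫ x, q t x * φ x ∂F.vol H = ∫ x, q 0 x * φ x ∂F.vol H -
      F.mulForm H F.ρ₀ (F.divL H (F.displacement H v t)) (F.toL2 H φ) := by
    have e : ∀ s, 0 ≤ s → ∫ x, q s x * φ x ∂F.vol H =
        inner ℝ (F.toL2 H (q s)) (F.toL2 H φ) := fun s h => by
      rw [inner_eq_integral]
      refine integral_congr_ae ?_
      filter_upwards [coeFn_toL2 (hs.q_mem s h).1, coeFn_toL2 mφ] with x a b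
      rw [a, b]
    rw [e t ht, e 0 le_rfl, hs.q_displacement ht]
  have d3 : ∫ x, F.ρ₀ x.2 * (F.weakDeriv H i (η t 2) x * φ x) ∂F.vol H =
      ∫ x, F.ρ₀ x.2 * (F.weakDeriv H i (η 0 2) x * φ x) ∂F.vol H +
        F.mulForm H F.ρ₀ (F.gradL H 2 i (F.displacement H v t)) (F.toL2 H φ) := by
    rw [mulForm_congr cρ (ae_eq_refl _) (coeFn_toL2 mφ), ← integral_add
      (integrable_weight cρ (mη le_rfl) mφ) (integrable_weight cρ (Lp.memLp _) mφ)]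
    refine integral_congr_ae ?_
    filter_upwards [hs.coeFn_grad_η hH ht 2 i] with x a
    rw [a]
    change _ = _ + F.ρ₀ x.2 * ((F.displacement H v t 2).2.1 i x * φ x)
    ring
  have d4 : ∫ y, F.interfaceTrace H (η t 2) y * surfLap φ y ∂H.surf =
      ∫ y, F.interfaceTrace H (η 0 2) y * surfLap φ y ∂H.surf -
        ∫ y, F.column H ((F.displacement H v t 2).2.1 2) y * surfLap φ y ∂H.surf := by
    obtain ⟨h1, h2⟩ := hs.interfaceTrace_η hH ht 2
    have mL : MemLp (surfLap φ) 2 H.surf :=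
      memLp_finsetSum _ fun j _ => (((hφ.1.slice 0).planeD j).planeD j).memLp 2
    have i1 : Integrable (fun y => F.interfaceTrace H (η 0 2) y * surfLap φ y) H.surf :=
      h1.integrable_mul mL
    have i2 : Integrable (fun y => F.column H ((F.displacement H v t 2).2.1 2) y * surfLap φ y)
      H.surf := (Lp.memLp _).integrable_mul mL
    rw [← integral_sub i1 i2]
    refine integral_congr_ae ?_
    filter_upwards [h2] with y a
    rw [a]
    ring
  have e1 : ∀ s, 0 ≤ s → F.mulForm H F.ρ₀ (F.classes H (vt s) i) (F.toL2 H φ) =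
      ∫ x, F.ρ₀ x.2 * (vt s i x * φ x) ∂F.vol H := fun s h =>
    mulForm_toL2 cρ (hs.v_deriv i s h).2.1 mφ
  rw [map_sub, _root_.sub_apply, e1 t ht, e1 0 le_rfl]
  rw [d1, d2, d3, d4] at m1
  linear_combination m1 - m0

/-- The velocity of a solution solves the evolution equation, integrated in time, weakly. -/
theorem weak_eq (hH : H.Proper) (hs : F.IsSolution H η v vt q) (ht : 0 ≤ t) {y : F.Flow H}
    (hy : y ∈ F.flows H) :
    F.massForm H (F.classes H (vt t) - F.classes H (vt 0)) (F.velocity H y) +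
      F.viscForm H (F.flowOf H (v t) - F.flowOf H (v 0)) y + F.potForm H (F.displacement H v t) y = 0 := by
  refine flows_induction hH (p := fun y =>
    F.massForm H (F.classes H (vt t) - F.classes H (vt 0)) (F.velocity H y) +
      F.viscForm H (F.flowOf H (v t) - F.flowOf H (v 0)) y + F.potForm H (F.displacement H v t) y = 0)
    (isClosed_eq (by fun_prop) continuous_const) (fun φ hφ => ?_) hy
  set X := F.displacement H v t
  have hX : X ∈ F.flows H := hs.displacement_mem ht
  have inc := fun i => hs.momentum_increment hH ht (hφ i) i
  have c2 := integral_column_surfLap hX hφ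
  -- The gravity terms `gρ₀ div X φ₃ - gρ₀ ∇X₃ · φ` look asymmetric. Their vertical derivatives
  -- cancel, and moving the remaining horizontal derivatives onto `φ₃` yields minus the symmetric
  -- buoyancy part of the potential form.
  have hz := fun j => mulForm_horiz hX (hφ 2).1 (horiz j) j
  have e1 : F.massForm H (F.classes H (vt t) - F.classes H (vt 0)) (F.velocity H (F.testFlow H φ)) =
      ∑ i, F.mulForm H F.ρ₀ (F.classes H (vt t) i - F.classes H (vt 0) i) (F.toL2 H (φ i)) := by
    simp only [massForm, FunLike.coe_sum, Finset.sum_apply, ContinuousLinearMap.bilinearComp_apply,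
      ContinuousLinearMap.proj_apply]
    rfl
  have e2 : F.potForm H X (F.testFlow H φ) =
      ∑ i, F.mulForm H (fun z => F.dP z * F.ρ₀ z) (F.divL H X) (F.toL2 H (partialD i (φ i))) +
      F.g * ∑ j : Fin 2, (F.mulForm H F.ρ₀ (X (horiz j)).1 (F.toL2 H (partialD (horiz j) (φ 2))) +
        F.mulForm H F.ρ₀ (F.gradL H 2 (horiz j) X) (F.toL2 H (φ (horiz j)))) +
      F.σ * ∑ j, surfForm H (F.surfL H j X) (F.surfL H j (F.testFlow H φ)) := by
    have d : F.divL H (F.testFlow H φ) = F.toL2 H (partialD 0 (φ 0)) + F.toL2 H (partialD 1 (φ 1)) +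
        F.toL2 H (partialD 2 (φ 2)) := rfl
    simp only [potForm, FunLike.coe_sum, Finset.sum_apply, _root_.add_apply,
      ContinuousLinearMap.bilinearComp_apply, ContinuousLinearMap.flip_apply,
      ContinuousLinearMap.coe_comp, Function.comp_apply, ContinuousLinearMap.proj_apply,
      _root_.smul_apply, smul_eq_mul, d, map_add, mulForm_gρ, Finset.mul_sum, Fin.sum_univ_three,
      mul_add, mulForm_symm F.coef_ρ₀.memLp_top (F.gradL H 2 _ X)]
    rfl
  have e3 : F.divL H X = F.gradL H 0 0 X + F.gradL H 1 1 X + F.gradL H 2 2 X := rfl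
  have k : kron (0 : Fin 3) 2 = 0 ∧ kron (1 : Fin 3) 2 = 0 ∧ kron (2 : Fin 3) 2 = 1 := by simp [kron]
  have s := (congrArg₂ (· + ·) (congrArg₂ (· + ·) (inc 0) (inc 1)) (inc 2))
  simp only [k.1, k.2.1, k.2.2] at s
  rw [c2] at s
  have h0 := hz 0
  have h1 := hz 1
  rw [e1, e2, map_sub (F.viscForm H), _root_.sub_apply, viscForm_flowOf (fun i => hs.v_memH2 ht i) hφ,
    viscForm_flowOf (fun i => hs.v_memH2 le_rfl i) hφ]
  have e4 : F.mulForm H F.ρ₀ (F.divL H X) (F.toL2 H (φ 2)) =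
      F.mulForm H F.ρ₀ (F.gradL H 0 0 X) (F.toL2 H (φ 2)) +
      F.mulForm H F.ρ₀ (F.gradL H 1 1 X) (F.toL2 H (φ 2)) +
      F.mulForm H F.ρ₀ (F.gradL H 2 2 X) (F.toL2 H (φ 2)) := by
    rw [e3, map_add, map_add]; rfl
  rw [e4] at s
  simp only [Fin.sum_univ_three, Fin.sum_univ_two] at s ⊢
  change F.mulForm H F.ρ₀ (X 0).1 (F.toL2 H (partialD 0 (φ 2))) = 
    -F.mulForm H F.ρ₀ (F.gradL H 0 0 X) (F.toL2 H (φ 2)) at h0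
  change F.mulForm H F.ρ₀ (X 1).1 (F.toL2 H (partialD 1 (φ 2))) = 
    -F.mulForm H F.ρ₀ (F.gradL H 1 1 X) (F.toL2 H (φ 2)) at h1
  simp only [show horiz 0 = 0 from rfl, show horiz 1 = 1 from rfl]
  rw [h0, h1]
  linear_combination s

end IsSolution

end Setup
end RayleighTaylor
end

/-! ### Identification of the norms and the growth estimate -/

noncomputable section
namespace RayleighTaylor
open Filter Topology

lemma Horizontal.HasPlaneWeakDeriv.planeWeakDeriv_ae {H : Horizontal} (hH : H.Proper) {j : Fin 2}
    {h d : Plane → ℝ} (hd : H.HasPlaneWeakDeriv j h d) : H.planeWeakDeriv j h =ᵐ[H.surf] d := by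
  have hex : ∃ d, H.HasPlaneWeakDeriv j h d := ⟨d, hd⟩
  have hc : H.HasPlaneWeakDeriv j h (H.planeWeakDeriv j h) := by
    unfold Horizontal.planeWeakDeriv
    rw [dif_pos hex]
    exact hex.choose_spec
  refine sub_ae_eq_zero _ _ |>.1 (Setup.ae_eq_zero_of_planeTests hH (hc.1.sub hd.1) fun χ hχ => ?_)
  have i1 : Integrable (fun y => H.planeWeakDeriv j h y * χ y) H.surf := hc.1.integrable_mul (hχ.memLp 2)
  have i2 : Integrable (fun y => d y * χ y) H.surf := hd.1.integrable_mul (hχ.memLp 2)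
  simp only [Pi.sub_apply, sub_mul]
  rw [integral_sub i1 i2, sub_eq_zero, ← neg_inj, ← hc.2 χ hχ, ← hd.2 χ hχ]

namespace Setup

variable {F : Setup} {H : Horizontal} {w : Fin 3 → Space → ℝ}

lemma massForm_classes (hw : ∀ i, F.MemL2 H (w i)) :
    F.massForm H (F.classes H w) (F.classes H w) = F.normSq₁ H w := by
  have e := massForm_apply (F := F) (H := H) (fun i => (F.classes H w i, 0)) (fun i => (F.classes H w i, 0))
  refine Eq.trans e ?_
  rw [normSq₁]
  refine integral_congr_ae ?_
  filter_upwards [ae_all_iff.2 fun i => coeFn_toL2 (hw i)] with x a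
  congr 1
  refine Finset.sum_congr rfl fun i _ => ?_
  rw [sq, ← a i]
  rfl

lemma viscForm_normSq₂ (hw : ∀ i, F.MemH2 H (w i)) :
    F.viscForm H (F.flowOf H w) (F.flowOf H w) = F.normSq₂ H w := by
  rw [viscForm_apply, normSq₂]
  refine integral_congr_ae ?_
  filter_upwards [coeFn_flowOf hw] with x a
  simp only [a.2, mdev, mdiv, dev, dvg, sq]

/-- Trace and weak surface gradient in the statement are selected by choice. Uniqueness of both
identifies them with the column integral and the last slot of the jet, on which the potential form
is defined. -/
lemma surfaceDirichlet_eq (hH : H.Proper) {f : Space → ℝ} (hf : F.MemH2 H f)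
    (hm : F.jetOf H f ∈ F.jets H) :
    F.surfaceDirichlet H f = ∑ j, ∫ y, (F.jetOf H f).2.2 j y * (F.jetOf H f).2.2 j y ∂H.surf := by
  set X := F.jetOf H f
  have ht : F.HasTraces H 0 F.ℓ f (fun y => -F.column H (X.2.1 2) y) 0 := by
    refine ⟨(Lp.memLp _).neg, MemLp.zero, fun φ hφ => ?_⟩
    rw [integral_upper]
    refine Eq.trans ?_ ((integral_above_of_mem_jets hH hm hφ).trans ?_)
    · refine integral_congr_ae ?_
      filter_upwards [coeFn_toL2 hf.1.1, coeFn_toL2 (hf.1.hasWeakDeriv 2).1] with x a b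
      simp only [X, jetOf, a, b]
    · simp
  have hd : ∀ j, H.HasPlaneWeakDeriv j (F.interfaceTrace H f) (X.2.2 j) := fun j => by
    refine ⟨Lp.memLp _, fun χ hχ => ?_⟩
    rw [(mem_jets.1 hm).2 χ hχ j, ← integral_column _ ((hχ.planeD j).memLp 2), ← integral_neg]
    refine integral_congr_ae ?_
    filter_upwards [ht.interfaceTrace_ae hH] with y a
    rw [a, neg_mul]
  have i : ∀ j, Integrable (fun y => X.2.2 j y * X.2.2 j y) H.surf := fun j =>
    (Lp.memLp (X.2.2 j)).integrable_mul (Lp.memLp (X.2.2 j))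
  rw [← integral_finsetSum _ fun j _ => i j, surfaceDirichlet]
  refine integral_congr_ae ?_
  filter_upwards [ae_all_iff.2 fun j => (hd j).planeWeakDeriv_ae hH] with y a
  simp only [a, sq]

/-- The constant of the growth estimate, in terms of that of `exists_potForm_le`. -/
def growthConst (c r : ℝ) : ℝ :=
  (1 + 2 * |r| + 2 * r ^ 2) * (1 + (2 + |r|⁻¹ * (1 + c)) / (2 * |r|))

/-- The constant must be positive for every real argument, not only at a growth rate; the absolute
values achieve this, also at `0`, where the inverse is `0`. -/
lemma growthConst_pos {c : ℝ} (hc : 0 ≤ c) (r : ℝ) : 0 < growthConst c r := by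
  unfold growthConst
  positivity

/-- The growth estimate for solutions, with any rate that dominates the growth rates. -/
theorem growthBound (hH : H.Proper) {r : ℝ} (hr : F.Dominates H r) {c : ℝ} (hc : 0 ≤ c)
    (hA : ∀ x ∈ F.flows H,
      F.potForm H x x ≤ c * (F.massForm H (F.velocity H x) (F.velocity H x) + F.viscForm H x x) +
        F.σ * ∑ j, ∫ q, (x 2).2.2 j q * (x 2).2.2 j q ∂H.surf) :
    F.GrowthBound H r (growthConst c r) := by
  intro η v vt q hs t ht
  have hr0 := hr.1
  have mass : ∀ s, 0 ≤ s → F.massForm H (F.velocity H (F.flowOf H (v s)))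
      (F.velocity H (F.flowOf H (v s))) = F.normSq₁ H (v s) := fun s h =>
    massForm_classes fun i => (hs.v_memH2 h i).1.1
  have mass' : ∀ s, 0 ≤ s → F.massForm H (F.classes H (vt s)) (F.classes H (vt s)) =
      F.normSq₁ H (vt s) := fun s h => massForm_classes fun i => (hs.v_deriv i s h).2.1
  have visc : ∀ s, 0 ≤ s → F.viscForm H (F.flowOf H (v s)) (F.flowOf H (v s)) = F.normSq₂ H (v s) :=
    fun s h => viscForm_normSq₂ fun i => hs.v_memH2 h i
  have pot := hA _ (hs.flow_mem le_rfl)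
  have surf := surfaceDirichlet_eq hH (hs.v_memH2 le_rfl 2)
    (Submodule.mem_pi.1 (hs.flow_mem le_rfl) 2 (mem_univ 2))
  rw [mass 0 le_rfl, visc 0 le_rfl] at pot
  have hm0 : 0 ≤ F.normSq₁ H (v 0) := mass 0 le_rfl ▸ massForm_nonneg _
  have hb0 : 0 ≤ F.normSq₂ H (v 0) := visc 0 le_rfl ▸ viscForm_nonneg _
  have hn0 : 0 ≤ F.normSq₁ H (vt 0) := mass' 0 le_rfl ▸ massForm_nonneg _
  have hs0 : 0 ≤ F.σ * F.surfaceDirichlet H (v 0 2) :=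
    mul_nonneg F.σ_nonneg (integral_nonneg fun y => Finset.sum_nonneg fun j _ => sq_nonneg _)
  have hbt : 0 ≤ F.normSq₂ H (v t) := visc t ht ▸ viscForm_nonneg _
  have hnt : 0 ≤ F.normSq₁ H (vt t) := mass' t ht ▸ massForm_nonneg _
  replace pot : F.potForm H (F.flowOf H (v 0)) (F.flowOf H (v 0)) ≤
      c * (F.normSq₁ H (v 0) + F.normSq₂ H (v 0)) + F.σ * F.surfaceDirichlet H (v 0 2) := by
    rw [surf]; exact pot
  set E := F.normSq₁ H (vt 0) + F.normSq₁ H (v 0) + F.normSq₂ H (v 0) +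
    F.σ * F.surfaceDirichlet H (v 0 2) with hE
  have hE0 : 0 ≤ E := by positivity
  set e := Real.exp (2 * r * t)
  have he : 0 < e := Real.exp_pos _
  have hri : 0 < r⁻¹ := inv_pos.2 hr0
  set c₁ := 2 + r⁻¹ * (1 + c) with hc₁
  set c₂ := 1 + 2 * r + 2 * r ^ 2 with hc₂
  have hc₁0 : 0 < c₁ := by positivity
  have hc₂0 : 0 < c₂ := by positivity
  -- The initial quantity of the abstract theorem is bounded by the data: the potential at time zero
  -- is at most `c` times mass plus dissipation, plus the surface term.
  have hK : 2 * F.normSq₂ H (v 0) + r⁻¹ * (F.normSq₁ H (vt 0) +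
      F.potForm H (F.flowOf H (v 0)) (F.flowOf H (v 0))) ≤ c₁ * E := by
    have h1 : F.normSq₁ H (vt 0) + F.potForm H (F.flowOf H (v 0)) (F.flowOf H (v 0)) ≤ (1 + c) * E := by
      have := mul_nonneg hc (add_nonneg hn0 hs0)
      nlinarith
    have h2 := mul_le_mul_of_nonneg_left h1 hri.le
    rw [hc₁]
    nlinarith
  -- The abstract bound asks for a strict inequality on the initial data; the excess `δ` provides it
  -- and tends to zero at the end.
  have bound : ∀ δ, 0 < δ → F.normSq₁ H (v t) + F.normSq₂ H (v t) + F.normSq₁ H (vt t) ≤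
      c₂ * ((E + (c₁ * E + δ) / (2 * r)) * e) := fun δ hδ => by
    obtain ⟨h1, h2⟩ := (isDissipative hH hr).weak_bound isClosed_flows hs.continuousOn_flow
      (fun s h => hs.flow_mem h) (fun s h => hs.hasDeriv_velocity h)
      (fun s h y hy => hs.weak_eq hH h hy) (K := c₁ * E + δ)
      (by rw [visc 0 le_rfl, mass' 0 le_rfl]; linarith) ht
    rw [mass t ht, mass 0 le_rfl] at h1
    rw [visc t ht, mass' t ht, mass 0 le_rfl] at h2
    have hKr : 0 ≤ (c₁ * E + δ) / (2 * r) := by positivity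
    have h3 : (F.normSq₁ H (v 0) + (c₁ * E + δ) / (2 * r)) * e ≤ (E + (c₁ * E + δ) / (2 * r)) * e := by
      gcongr
      linarith
    set G := (E + (c₁ * E + δ) / (2 * r)) * e
    have h4 : F.normSq₂ H (v t) + r⁻¹ * F.normSq₁ H (vt t) ≤ 2 * r * G :=
      h2.trans (mul_le_mul_of_nonneg_left h3 (by positivity))
    have h5 := mul_nonneg hri.le hnt
    have h6 : r * (F.normSq₂ H (v t) + r⁻¹ * F.normSq₁ H (vt t)) =
        r * F.normSq₂ H (v t) + F.normSq₁ H (vt t) := by field_simp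
    -- Multiplying by `r` gives `∂ₜv` weight one. With `G` the common majorant, the three norms are
    -- at most `G`, `2 r G` and `2 r² G`, the summands of `c₂`.
    have h7 := mul_le_mul_of_nonneg_left h4 hr0.le
    rw [h6] at h7
    have h8 := mul_nonneg hr0.le hbt
    rw [hc₂]
    linarith
  have hconst : growthConst c r = c₂ * (1 + c₁ / (2 * r)) := by
    rw [growthConst, abs_of_pos hr0]
  rw [hconst]
  refine le_of_forall_pos_le_add fun ε hε => ?_
  -- The excess is chosen so that its contribution to the bound is exactly `ε`.
  refine (bound (ε * (2 * r) / (c₂ * e)) (by positivity)).trans_eq ?_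
  field_simp
  ring

end Setup
end RayleighTaylor
end


theorem mainTheorem6 (F : RayleighTaylor.Setup) :
    ∃ C : ℝ → ℝ, (∀ r, 0 < C r) ∧
      (0 < F.maxRate .plane ∧ IsLUB (F.growthRates .plane) (F.maxRate .plane) ∧
        F.GrowthBound .plane (F.maxRate .plane) (C (F.maxRate .plane))) ∧
      ∀ L : ℝ, Real.sqrt (F.σ / (F.g * F.jumpρ)) < L →
        (0 < F.maxRate (.torus L) ∧ IsLUB (F.growthRates (.torus L)) (F.maxRate (.torus L)) ∧
          F.GrowthBound (.torus L) (F.maxRate (.torus L)) (C (F.maxRate (.torus L)))) := by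
  -- The constant `c` depends only on the fluids and not on the horizontal setting, so one function
  -- `C` serves the plane and all tori.
  obtain ⟨c, hc, hA⟩ := F.exists_potForm_le
  have main : ∀ H : RayleighTaylor.Horizontal, H.Proper →
      0 < F.maxRate H ∧ IsLUB (F.growthRates H) (F.maxRate H) →
      0 < F.maxRate H ∧ IsLUB (F.growthRates H) (F.maxRate H) ∧
        F.GrowthBound H (F.maxRate H) (RayleighTaylor.Setup.growthConst c (F.maxRate H)) :=
    fun H hH h => ⟨h.1, h.2, RayleighTaylor.Setup.growthBound hH ⟨h.1, fun _ hs => h.2.1 hs⟩ hc (hA H hH)⟩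
  exact ⟨_, RayleighTaylor.Setup.growthConst_pos hc,
    main _ trivial RayleighTaylor.Setup.growthRates_plane, fun L hL =>
      main _ ((Real.sqrt_nonneg _).trans_lt hL) (RayleighTaylor.Setup.growthRates_torus hL)⟩
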